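/- Let $m\ge 0$, let $z_1,\dots,z_m$ be pairwise $\mathrm{SL}(2,\mathbb Z)$-inequivalent points of the upper half-plane $\mathbb H$, none equivalent to $i$ or $\rho=(-1+\sqrt3\,i)/2$. For $z\in\{z_1,\dots,z_m,i,\rho\}$ let $\kappa_z^{(1)}<\kappa_z^{(2)}<\kappa_z^{(3)}$ be numbers in $\frac13\mathbb Z$ with sum $3$ and integral differences, such that $\{3\kappa_i^{(k)}\}_k\equiv\{0,0,1\}\bmod 2$, and $\kappa_\rho^{(k)}\in\mathbb Z$ with $\{\kappa_\rho^{(k)}\}_k\equiv\{0,1,2\}\bmod 3$. Let $\kappa_\infty^{(1)}\le\kappa_\infty^{(2)}\le\kappa_\infty^{(3)}$ be numbers in $\frac13\mathbb Z$ with sum $0$ and integral differences. For $z\in\{z_1,\dots,z_m,i,\rho,\infty\}$ write $\epsilon_2(z)$, $\epsilon_3(z)$ for the second and third elementary symmetric functions of $\kappa_z^{(1)},\kappa_z^{(2)},\kappa_z^{(3)}$. For meromorphic modular forms $Q,R$ of weight $4,6$ on $\mathrm{SL}(2,\mathbb Z)$ consider $$y'''+Q_2y'+Q_3y=0,\qquad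 Q_2=(2\pi i)^2Q,\quad Q_3=(2\pi i)^3R+\tfrac12Q_2'.\tag{$*$}$$ Say that $(Q,R)$ has the prescribed exponents if $(*)$ is Fuchsian on $\mathbb H\cup\{\infty\}$, its singular points in $\mathbb H$ are equivalent to points of $\{i,\rho,z_1,\dots,z_m\}$, and its local exponents at $z_j,i,\rho,\infty$ are the given ones. Call $(*)$ apparent at $z_0$ if no solution has a logarithmic singularity there. Put $\Delta_0=E_4^3-E_6^2$, $t_j=E_4(z_j)^3/E_6(z_j)^2$, $F_j=E_4^3-t_jE_6^2$ and $$Q=r_\infty E_4+r_i^{(2)}\frac{E_4\Delta_0}{E_6^2}+r_\rho^{(2)}\frac{\Delta_0}{E_4^2}+\sum_{j=1}^m\Big(r_{z_j}^{(2)}\frac{E_4\Delta_0^2}{F_j^2}+r_{z_j}^{(1)}\frac{E_4\Delta_0}{F_j}\Big),$$ $$R=s_\infty E_6+s_i^{(3)}\frac{\Delta_0^2}{E_6^3}+s_i^{(1)}\frac{\Delta_0}{E_6}+s_\rho^{(3)}\frac{E_6\Delta_0}{E_4^3}+\sum_{j=1}^m\sum_{k=1}^3s_{z_j}^{(k)}\frac{E_6\Delta_0^k}{F_j^k},$$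 where the following parameters are fixed by the exponents: $r_\infty=\epsilon_2(\infty)$, $s_\infty=-\epsilon_3(\infty)$, $4r_i^{(2)}=\epsilon_2(i)-2$, $8s_i^{(3)}=\epsilon_3(i)-\epsilon_2(i)+2$, $-9r_\rho^{(2)}=\epsilon_2(\rho)-2$, $27s_\rho^{(3)}=\epsilon_2(\rho)-2-\epsilon_3(\rho)$, $r_{z_j}^{(2)}=t_j(\epsilon_2(z_j)-2)$, $s_{z_j}^{(3)}=t_j^2(\epsilon_2(z_j)-2-\epsilon_3(z_j))$. The free parameters are the $3m+1$ numbers $r_{z_j}^{(1)},s_{z_j}^{(2)},s_{z_j}^{(1)}$ $(1\le j\le m)$ and $s_i^{(1)}$; write $(\mathbf r,\mathbf s)$ for them. For $z_0\in\{z_1,\dots,z_m,i,\rho\}$ let $w=(z-z_0)/(z-\bar z_0)$, $A=\frac{\pi\operatorname{Im}z_0}{3}\big(E_2(z_0)+\frac{6}{\pi i(z_0-\bar z_0)}\big)$, $\tilde w=w/(1+Aw)$, $x=-4\pi(\operatorname{Im}z_0)\tilde w$, and write $Q=(1-(1+A)\tilde w)^4\tilde Q(x)$, $R=(1-(1+A)\tilde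 w)^6\tilde R(x)$, $\tilde Q=\sum_{n\ge-2}a_nx^n$, $\frac12\tilde Q'+\tilde R=\sum_{n\ge-3}b_nx^n$. The $a_n,b_n$ are polynomials of degree at most $1$ in $(\mathbf r,\mathbf s)$. Let $f(x)=\prod_k(x-\kappa_{z_0}^{(k)})$. For $k_1<k_2$ put $\alpha=\kappa_{z_0}^{(k_1)}$, $n'=\kappa_{z_0}^{(k_2)}-\kappa_{z_0}^{(k_1)}$, $c_0=1$ and, for $1\le n<n'$, $c_n=-f(\alpha+n)^{-1}\sum_{k<n}[(\alpha+k)a_{n-k-2}+b_{n-k-3}]c_k$ if $f(\alpha+n)\ne0$ and $c_n=0$ if $f(\alpha+n)=0$. Put $$P_{z_0,k_1,k_2}(\mathbf r,\mathbf s)=\sum_{k=0}^{n'-1}[(\alpha+k)a_{n'-k-2}+b_{n'-k-3}]c_k .$$ Then the following hold. (1) For all values of the free parameters, $Q$ and $R$ are meromorphic modular forms of weight $4$ and $6$. A pair of meromorphic modular forms of weight $4$ and $6$ has the prescribed exponents if and only if it is of the above form for exactly one $(\mathbf r,\mathbf s)$. (2) All $P_{\rho,k_1,k_2}$ vanish identically.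 There is exactly one pair $k_1<k_2$ with $\kappa_i^{(k_2)}-\kappa_i^{(k_1)}$ even; put $P_i=P_{i,k_1,k_2}$ for this pair. For the two other pairs $P_{i,k_1,k_2}$ vanishes identically. (3) For $Q,R$ as above, $(*)$ is apparent at every point of $\mathbb H$ if and only if $(\mathbf r,\mathbf s)$ is a common zero of the $3m+1$ polynomials $P_i$ and $P_{z_j,k_1,k_2}$, $1\le j\le m$, $(k_1,k_2)\in\{(1,2),(1,3),(2,3)\}$. (4) $\deg P_{z_j,k_1,k_2}=\kappa_{z_j}^{(k_2)}-\kappa_{z_j}^{(k_1)}$ for $(k_1,k_2)=(1,2),(2,3)$, and $\deg P_{z_j,1,3}=\kappa_{z_j}^{(3)}-\kappa_{z_j}^{(1)}-1$. Let $\operatorname{LT}(P)$ be the sum of the terms of highest degree of $P$. For each $j$ there are complex numbers $d_1,d_2,d_3,d_4,d_1',\dots,d_m'$ with $d_1,d_2,d_3\ne0$ such that, up to nonzero scalars, $$\operatorname{LT}(P_{z_j,k_1,k_2})=\prod_{k=1}^{\kappa_{z_j}^{(k_2)}-\kappa_{z_j}^{(k_1)}}\big((\kappa_{z_j}^{(k_1)}+k-\tfrac32)d_1r_{z_j}^{(1)}+d_2s_{z_j}^{(2)}\big)\quad\text{for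 }(k_1,k_2)=(1,2),(2,3),$$ $$\operatorname{LT}(P_{z_j,1,3})=\Big(d_3s_{z_j}^{(1)}+d_4s_{z_j}^{(2)}+\sum_{l=1}^md_l'r_{z_l}^{(1)}\Big)\prod_{k}\big((\kappa_{z_j}^{(1)}+k-\tfrac32)d_1r_{z_j}^{(1)}+d_2s_{z_j}^{(2)}\big),$$ where in the last product $1\le k\le\kappa_{z_j}^{(3)}-\kappa_{z_j}^{(1)}$ and $k\ne\kappa_{z_j}^{(2)}-\kappa_{z_j}^{(1)},\ \kappa_{z_j}^{(2)}-\kappa_{z_j}^{(1)}+1$. (5) $\deg P_i=(\kappa_i^{(k_2)}-\kappa_i^{(k_1)})/2$ for the pair in (2), and $\operatorname{LT}(P_i)$ is a product of $(\kappa_i^{(k_2)}-\kappa_i^{(k_1)})/2$ linear forms in $s_i^{(1)},r_{z_1}^{(1)},\dots,r_{z_m}^{(1)}$ in each of which the coefficient of $s_i^{(1)}$ is nonzero. -/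

import Mathlib

open UpperHalfPlane Filter Topology
open scoped MatrixGroups ModularForm LaurentSeries

noncomputable section

namespace ModularODE

/-! ### The third order equation attached to two meromorphic modular forms -/

/-- `f` is a meromorphic modular form of weight `k` on `SL(2,ℤ)`: it is meromorphic on the upper
half-plane (normalised to take the value `0` at its poles and the limit value everywhere else),
it is invariant under the weight `k` slash action, and it is meromorphic at the cusp `∞`. -/
structure IsMeromorphicModularForm (k : ℤ) (f : ℍ → ℂ) : Prop where
  meromorphic : MeromorphicNFOn (fun z : ℂ => f (ofComplex z)) {z : ℂ | 0 < z.im}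
  slash_eq : ∀ γ : SL(2, ℤ), f ∣[k] γ = f
  meromorphic_at_infty : ∃ n : ℕ,
    IsBoundedAtImInfty (fun z : ℍ => Complex.exp (2 * Real.pi * Complex.I * n * z) * f z)

/-- The coefficient `Q₂ = (2πi)² Q` of `y'`. -/
def coeffTwo (Q : ℍ → ℂ) (z : ℂ) : ℂ :=
  (2 * Real.pi * Complex.I) ^ 2 * Q (ofComplex z)

/-- The coefficient `Q₃` of `y`, determined by `Q₃ - Q₂' / 2 = (2πi)³ R`. -/
def coeffThree (Q R : ℍ → ℂ) (z : ℂ) : ℂ :=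
  (2 * Real.pi * Complex.I) ^ 3 * R (ofComplex z) + (1 / 2) * deriv (coeffTwo Q) z

/-- The equation `y''' + Q₂ y' + Q₃ y = 0` is Fuchsian at `z₀`: the pole of `Q_j` at `z₀` has order
at most `j`. -/
def IsFuchsianAt (Q₂ Q₃ : ℂ → ℂ) (z₀ : ℂ) : Prop :=
  MeromorphicAt Q₂ z₀ ∧ MeromorphicAt Q₃ z₀ ∧
    (-2 : ℤ) ≤ meromorphicOrderAt Q₂ z₀ ∧ (-3 : ℤ) ≤ meromorphicOrderAt Q₃ z₀

/-- The local exponents at `z₀`, that is, the roots with multiplicity of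
`x (x - 1) (x - 2) + A₂ x + A₃` where `Q_j = A_j (z - z₀)^(-j) + ⋯`, are `κ 0`, `κ 1`, `κ 2`. -/
def HasLocalExponentsAt (Q₂ Q₃ : ℂ → ℂ) (z₀ : ℂ) (κ : Fin 3 → ℚ) : Prop :=
  ∃ A₂ A₃ : ℂ,
    Tendsto (fun z => (z - z₀) ^ 2 * Q₂ z) (𝓝[≠] z₀) (𝓝 A₂) ∧
    Tendsto (fun z => (z - z₀) ^ 3 * Q₃ z) (𝓝[≠] z₀) (𝓝 A₃) ∧
    ∀ x : ℂ, x * (x - 1) * (x - 2) + A₂ * x + A₃ = ∏ k, (x - (κ k : ℂ))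

/-- The local exponents at the cusp `∞` (of width one), that is, the roots with multiplicity of
`x³ + Q₂(∞) / (2πi)² x + Q₃(∞) / (2πi)³`, are `κ 0`, `κ 1`, `κ 2`. -/
def HasLocalExponentsAtInfty (Q₂ Q₃ : ℂ → ℂ) (κ : Fin 3 → ℚ) : Prop :=
  ∃ A₂ A₃ : ℂ,
    Tendsto (fun z : ℍ => Q₂ z) atImInfty (𝓝 A₂) ∧
    Tendsto (fun z : ℍ => Q₃ z) atImInfty (𝓝 A₃) ∧
    ∀ x : ℂ, x ^ 3 + A₂ / (2 * Real.pi * Complex.I) ^ 2 * x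
      + A₃ / (2 * Real.pi * Complex.I) ^ 3 = ∏ k, (x - (κ k : ℂ))

/-- `y` is a holomorphic solution on `U` of `y''' + Q₂ y' + Q₃ y = 0`. -/
def IsSolutionOn (Q₂ Q₃ : ℂ → ℂ) (U : Set ℂ) (y : ℂ → ℂ) : Prop :=
  DifferentiableOn ℂ y U ∧ ∀ z ∈ U, iteratedDeriv 3 y z + Q₂ z * deriv y z + Q₃ z * y z = 0

/-- The equation is apparent at `z₀`: no solution has a logarithmic singularity there. In a
punctured neighbourhood of `z₀`, every solution on a domain `U` carrying a branch `L` of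
`log (z - z₀)` is a finite sum of terms `(z - z₀)^κ h(z)` with `h` holomorphic near `z₀`,
where `(z - z₀)^κ = exp (κ L(z))`; no powers of `log (z - z₀)` occur. -/
def IsApparentAt (Q₂ Q₃ : ℂ → ℂ) (z₀ : ℂ) : Prop :=
  ∃ ε > 0, ∀ U : Set ℂ, IsOpen U → IsConnected U → U ⊆ Metric.ball z₀ ε \ {z₀} →
    ∀ L : ℂ → ℂ, ContinuousOn L U → (∀ z ∈ U, Complex.exp (L z) = z - z₀) →
    ∀ y : ℂ → ℂ, IsSolutionOn Q₂ Q₃ U y →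
      ∃ (S : Finset ℂ) (h : ℂ → ℂ → ℂ),
        (∀ κ ∈ S, AnalyticOnNhd ℂ (h κ) (Metric.ball z₀ ε)) ∧
        ∀ z ∈ U, y z = ∑ κ ∈ S, Complex.exp (κ * L z) * h κ z

/-! ### Prescribed singular points and exponents -/

/-- The elliptic point `ρ = (-1 + √3 i) / 2` of order three. -/
def rho : ℍ := ⟨⟨-1 / 2, Real.sqrt 3 / 2⟩, by positivity⟩

/-- Singular points `z_j`, and three exponents at each of `z_j`, `i`, `ρ` and `∞`. -/
structure SingularData (m : ℕ) where
  pt : Fin m → ℍ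
  expPt : Fin m → Fin 3 → ℚ
  expI : Fin 3 → ℚ
  expRho : Fin 3 → ℚ
  expInf : Fin 3 → ℚ

/-- Exponents at a point of the upper half-plane: distinct and increasing, in `(1/3) ℤ`, with sum
`3` and integral differences. -/
def IsExponentTriple (κ : Fin 3 → ℚ) : Prop :=
  StrictMono κ ∧ (∀ k, ∃ n : ℤ, κ k = n / 3) ∧ κ 0 + κ 1 + κ 2 = 3 ∧ ∃ n : ℤ, κ 1 - κ 0 = n

/-- Exponents at the cusp: weakly increasing, in `(1/3) ℤ`, with sum `0` and integral
differences. -/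
def IsCuspExponentTriple (κ : Fin 3 → ℚ) : Prop :=
  Monotone κ ∧ (∀ k, ∃ n : ℤ, κ k = n / 3) ∧ κ 0 + κ 1 + κ 2 = 0 ∧
    (∃ n : ℤ, κ 1 - κ 0 = n) ∧ ∃ n : ℤ, κ 2 - κ 1 = n

/-- Pairs `(k₁, k₂)` with `k₁ < k₂`; the exponents are numbered from `0` to `2`. -/
abbrev ExponentPair : Type := {p : Fin 3 × Fin 3 // p.1 < p.2}

/-- The exponent difference `κ^(k₂) - κ^(k₁)`. -/
def expDiff (κ : Fin 3 → ℚ) (p : ExponentPair) : ℚ := κ p.1.2 - κ p.1.1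

/-- Names of the `3m + 1` parameters which the exponents leave free:
`r_{z_j}^{(1)}`, `s_{z_j}^{(2)}`, `s_{z_j}^{(1)}` and `s_i^{(1)}`. -/
inductive FreeParam (m : ℕ) : Type
  | r1 (j : Fin m)
  | s2 (j : Fin m)
  | s1 (j : Fin m)
  | sI

/-- Names of the equations: one for each `z_j` and each pair `(k₁, k₂)`, and one for `i`. -/
inductive EquationIndex (m : ℕ) : Type
  | atPt (j : Fin m) (p : ExponentPair)
  | atI

/-- The second elementary symmetric function of the exponents. -/
def esymmTwo (κ : Fin 3 → ℚ) : ℂ := κ 0 * κ 1 + κ 0 * κ 2 + κ 1 * κ 2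

/-- The third elementary symmetric function of the exponents. -/
def esymmThree (κ : Fin 3 → ℚ) : ℂ := κ 0 * κ 1 * κ 2

/-- For a weight `k` function `f`, the power series `f̃(x)` with
`f(z) = (1 - (1 + A) w̃)^k f̃(x)`, where `x = -4π (Im z₀) w̃`, `w̃ = w / (1 + A w)`,
`w = (z - z₀) / (z - conj z₀)` and `A = 4π E₂*(z₀) (Im z₀) / 12` with
`E₂*(z) = E₂(z) + 6 / (πi (z - conj z))`. -/
def localSeries (k : ℕ) (f : ℍ → ℂ) (z₀ : ℍ) : PowerSeries ℂ :=
  let A : ℂ := 4 * Real.pi * z₀.im / 12 * (EisensteinSeries.E2 z₀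
    + 6 / (Real.pi * Complex.I * ((z₀ : ℂ) - (starRingEnd ℂ) (z₀ : ℂ))))
  let wt : ℂ → ℂ := fun x => -x / (4 * Real.pi * z₀.im)
  let w : ℂ → ℂ := fun x => wt x / (1 - A * wt x)
  let z : ℂ → ℂ := fun x => ((z₀ : ℂ) - (starRingEnd ℂ) (z₀ : ℂ) * w x) / (1 - w x)
  let g : ℂ → ℂ := fun x => f (ofComplex (z x)) / (1 - (1 + A) * wt x) ^ k
  PowerSeries.mk fun n => iteratedDeriv n g 0 / (n.factorial : ℂ)

/-- `Ẽ₄(x)` at `z₀`, as a Laurent series. -/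
def e4Series (z₀ : ℍ) : ℂ⸨X⸩ := HahnSeries.ofPowerSeries ℤ ℂ (localSeries 4 ModularForm.E₄ z₀)

/-- `Ẽ₆(x)` at `z₀`, as a Laurent series. -/
def e6Series (z₀ : ℍ) : ℂ⸨X⸩ := HahnSeries.ofPowerSeries ℤ ℂ (localSeries 6 ModularForm.E₆ z₀)

/-- The coefficients `c_n(α)` of the Frobenius solution `∑ c_n x^(n+α)`, `c_0 = 1`, of
`y''' + (∑ a_n x^n) y' + (∑ b_n x^n) y = 0` with indicial polynomial `f`:
`f(α+n) c_n + ∑_{k<n} [(α+k) a_{n-k-2} + b_{n-k-3}] c_k = 0` if `f(α+n) ≠ 0`, and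
`c_n = 0` if `f(α+n) = 0`. -/
def frobeniusCoeff {A : Type*} [CommRing A] [Algebra ℂ A] (a b : ℤ → A) (f : ℂ → ℂ) (α : ℂ) :
    ℕ → A
  | 0 => 1
  | n + 1 =>
    open Classical in
    if f (α + (n + 1 : ℕ)) = 0 then 0
    else -((f (α + (n + 1 : ℕ)))⁻¹ •
      ∑ k : Fin (n + 1), ((α + (k : ℕ)) • a ((n + 1 : ℕ) - (k : ℕ) - 2)
        + b ((n + 1 : ℕ) - (k : ℕ) - 3)) * frobeniusCoeff a b f α k)
  termination_by n => n
  decreasing_by exact k.2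

/-- The obstruction `∑_{k<n} [(α+k) a_{n-k-2} + b_{n-k-3}] c_k(α)` in degree `n`. -/
def frobeniusObstruction {A : Type*} [CommRing A] [Algebra ℂ A] (a b : ℤ → A) (f : ℂ → ℂ) (α : ℂ)
    (n : ℕ) : A :=
  ∑ k ∈ Finset.range n, ((α + (k : ℕ)) • a ((n : ℤ) - k - 2) + b ((n : ℤ) - k - 3))
    * frobeniusCoeff a b f α k

namespace SingularData

variable {m : ℕ} (D : SingularData m)

/-- The hypotheses on the prescribed data: the `z_j` are pairwise inequivalent non-elliptic points,
the exponents are as above, `{3 κ_i} ≡ {0, 0, 1} mod 2`, and the `κ_ρ` are integers with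
`{κ_ρ} ≡ {0, 1, 2} mod 3`. -/
structure IsAdmissible : Prop where
  inequivalent : ∀ j k, j ≠ k → D.pt j ∉ MulAction.orbit SL(2, ℤ) (D.pt k)
  ne_I : ∀ j, D.pt j ∉ MulAction.orbit SL(2, ℤ) UpperHalfPlane.I
  ne_rho : ∀ j, D.pt j ∉ MulAction.orbit SL(2, ℤ) rho
  expPt : ∀ j, IsExponentTriple (D.expPt j)
  expI : IsExponentTriple D.expI
  expRho : IsExponentTriple D.expRho
  expInf : IsCuspExponentTriple D.expInf
  parity_I : ∃ n : Fin 3 → ℤ, (∀ k, 3 * D.expI k = n k) ∧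
    ({(n 0 : ZMod 2), (n 1 : ZMod 2), (n 2 : ZMod 2)} : Multiset (ZMod 2)) = {0, 0, 1}
  residues_rho : ∃ n : Fin 3 → ℤ, (∀ k, D.expRho k = n k) ∧
    ({(n 0 : ZMod 3), (n 1 : ZMod 3), (n 2 : ZMod 3)} : Multiset (ZMod 3)) = {0, 1, 2}

/-- All points equivalent to `i`, `ρ` or one of the `z_j`. -/
def singularSet : Set ℍ :=
  MulAction.orbit SL(2, ℤ) UpperHalfPlane.I ∪ MulAction.orbit SL(2, ℤ) rho ∪
    ⋃ j, MulAction.orbit SL(2, ℤ) (D.pt j)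

/-- The equation attached to `Q`, `R` is Fuchsian on the upper half-plane and at `∞`, all its
singular points are equivalent to `i`, `ρ` or one of the `z_j`, and the local exponents are the
prescribed ones. -/
structure HasPrescribedExponents (Q R : ℍ → ℂ) : Prop where
  fuchsian : ∀ z : ℍ, IsFuchsianAt (coeffTwo Q) (coeffThree Q R) z
  fuchsian_infty : IsBoundedAtImInfty (fun z : ℍ => coeffTwo Q z) ∧
    IsBoundedAtImInfty (fun z : ℍ => coeffThree Q R z)
  regular : ∀ z : ℍ, z ∉ D.singularSet →
    AnalyticAt ℂ (coeffTwo Q) z ∧ AnalyticAt ℂ (coeffThree Q R) z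
  exponents_pt : ∀ j, HasLocalExponentsAt (coeffTwo Q) (coeffThree Q R) (D.pt j) (D.expPt j)
  exponents_I : HasLocalExponentsAt (coeffTwo Q) (coeffThree Q R) UpperHalfPlane.I D.expI
  exponents_rho : HasLocalExponentsAt (coeffTwo Q) (coeffThree Q R) rho D.expRho
  exponents_infty : HasLocalExponentsAtInfty (coeffTwo Q) (coeffThree Q R) D.expInf

/-! ### The general form of `Q` and `R` -/

/-- `t_j = E₄(z_j)³ / E₆(z_j)²`. -/
def t (j : Fin m) : ℂ := ModularForm.E₄ (D.pt j) ^ 3 / ModularForm.E₆ (D.pt j) ^ 2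

/-- `r_∞`. -/
def rInf : ℂ := esymmTwo D.expInf
/-- `s_∞`. -/
def sInf : ℂ := -esymmThree D.expInf
/-- `r_i^{(2)}`. -/
def rI : ℂ := (esymmTwo D.expI - 2) / 4
/-- `s_i^{(3)}`. -/
def sI : ℂ := (esymmThree D.expI - (esymmTwo D.expI - 2)) / 8
/-- `r_ρ^{(2)}`. -/
def rRho : ℂ := -(esymmTwo D.expRho - 2) / 9
/-- `s_ρ^{(3)}`. -/
def sRho : ℂ := (esymmTwo D.expRho - 2 - esymmThree D.expRho) / 27
/-- `r_{z_j}^{(2)}`. -/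
def rPt (j : Fin m) : ℂ := D.t j * (esymmTwo (D.expPt j) - 2)
/-- `s_{z_j}^{(3)}`. -/
def sPt (j : Fin m) : ℂ := D.t j ^ 2 * (esymmTwo (D.expPt j) - 2 - esymmThree (D.expPt j))

section GeneralForm

/-! The formulas are used both for the values of `E₄`, `E₆` at a point (`K = ℂ`) and for their
expansions (`K = ℂ⸨X⸩`). Here `Δ₀ = E₄³ - E₆²` and `F_j = E₄³ - t_j E₆²`. -/

variable {K : Type*} [Field K] [Algebra ℂ K] (e4 e6 : K)

/-- `F_j = E₄³ - t_j E₆²`. -/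
def F (j : Fin m) : K := e4 ^ 3 - D.t j • e6 ^ 2

/-- The part of `Q` determined by the exponents. -/
def qFixed : K :=
  D.rInf • e4 + D.rI • (e4 * (e4 ^ 3 - e6 ^ 2) / e6 ^ 2) + D.rRho • ((e4 ^ 3 - e6 ^ 2) / e4 ^ 2)
    + ∑ j, D.rPt j • (e4 * (e4 ^ 3 - e6 ^ 2) ^ 2 / D.F e4 e6 j ^ 2)

/-- The coefficient of `r_{z_j}^{(1)}` in `Q`. -/
def qR1 (j : Fin m) : K := e4 * (e4 ^ 3 - e6 ^ 2) / D.F e4 e6 j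

/-- The part of `R` determined by the exponents. -/
def rFixed : K :=
  D.sInf • e6 + D.sI • ((e4 ^ 3 - e6 ^ 2) ^ 2 / e6 ^ 3)
    + D.sRho • (e6 * (e4 ^ 3 - e6 ^ 2) / e4 ^ 3)
    + ∑ j, D.sPt j • (e6 * (e4 ^ 3 - e6 ^ 2) ^ 3 / D.F e4 e6 j ^ 3)

/-- The coefficient of `s_i^{(1)}` in `R`. -/
def rSI : K := (e4 ^ 3 - e6 ^ 2) / e6

/-- The coefficient of `s_{z_j}^{(k)}` in `R`. -/
def rS (k : ℕ) (j : Fin m) : K := e6 * (e4 ^ 3 - e6 ^ 2) ^ k / D.F e4 e6 j ^ k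

end GeneralForm

/-- The function `Q` with free parameters `v`. -/
def qForm (v : FreeParam m → ℂ) (z : ℍ) : ℂ :=
  let e4 := ModularForm.E₄ z
  let e6 := ModularForm.E₆ z
  D.qFixed e4 e6 + ∑ j, v (.r1 j) * D.qR1 e4 e6 j

/-- The function `R` with free parameters `v`. -/
def rForm (v : FreeParam m → ℂ) (z : ℍ) : ℂ :=
  let e4 := ModularForm.E₄ z
  let e6 := ModularForm.E₆ z
  D.rFixed e4 e6 + v .sI * rSI e4 e6
    + ∑ j, (v (.s2 j) * D.rS e4 e6 2 j + v (.s1 j) * D.rS e4 e6 1 j)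

/-- `Q` and `R` are given by the general form with free parameters `v`. -/
def IsGivenBy (v : FreeParam m → ℂ) (Q R : ℍ → ℂ) : Prop :=
  ∀ z ∉ D.singularSet, Q z = D.qForm v z ∧ R z = D.rForm v z

/-! ### The polynomials -/

/-- The coefficient `a_n` of `Q̃(x) = ∑ a_n x^n` at `z₀`, a polynomial in the free parameters. -/
def aCoeff (z₀ : ℍ) (n : ℤ) : MvPolynomial (FreeParam m) ℂ :=
  let e4 := e4Series z₀
  let e6 := e6Series z₀
  MvPolynomial.C ((D.qFixed e4 e6).coeff n)
    + ∑ j, MvPolynomial.C ((D.qR1 e4 e6 j).coeff n) * MvPolynomial.X (.r1 j)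

/-- The coefficient of `x^n` in `R̃(x)` at `z₀`, a polynomial in the free parameters. -/
def rCoeff (z₀ : ℍ) (n : ℤ) : MvPolynomial (FreeParam m) ℂ :=
  let e4 := e4Series z₀
  let e6 := e6Series z₀
  MvPolynomial.C ((D.rFixed e4 e6).coeff n)
    + MvPolynomial.C ((rSI e4 e6).coeff n) * MvPolynomial.X .sI
    + ∑ j, (MvPolynomial.C ((D.rS e4 e6 2 j).coeff n) * MvPolynomial.X (.s2 j)
      + MvPolynomial.C ((D.rS e4 e6 1 j).coeff n) * MvPolynomial.X (.s1 j))

/-- The coefficient `b_n` of `(1/2) Q̃'(x) + R̃(x) = ∑ b_n x^n` at `z₀`. -/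
def bCoeff (z₀ : ℍ) (n : ℤ) : MvPolynomial (FreeParam m) ℂ :=
  MvPolynomial.C (((n : ℂ) + 1) / 2) * D.aCoeff z₀ (n + 1) + D.rCoeff z₀ n

/-- The polynomial `P_{z₀,k₁,k₂}` at a point `z₀` with exponents `κ`: the obstruction for
`α = κ^(k₁)` in degree `κ^(k₂) - κ^(k₁)`. The indicial polynomial is `∏ (x - κ^(k))`. -/
def poly (z₀ : ℍ) (κ : Fin 3 → ℚ) (p : ExponentPair) : MvPolynomial (FreeParam m) ℂ :=
  frobeniusObstruction (D.aCoeff z₀) (D.bCoeff z₀) (fun x => ∏ k, (x - (κ k : ℂ)))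
    (κ p.1.1 : ℂ) ⌊expDiff κ p⌋₊

/-- The polynomial `P_{z_j,k₁,k₂}`. -/
def polyPt (j : Fin m) (p : ExponentPair) : MvPolynomial (FreeParam m) ℂ :=
  D.poly (D.pt j) (D.expPt j) p

/-- The polynomial `P_{i,k₁,k₂}`. -/
def polyI (p : ExponentPair) : MvPolynomial (FreeParam m) ℂ := D.poly UpperHalfPlane.I D.expI p

/-- The polynomial `P_{ρ,k₁,k₂}`. -/
def polyRho (p : ExponentPair) : MvPolynomial (FreeParam m) ℂ := D.poly rho D.expRho p

/-- The polynomial system, where `p₀` is the pair used at `i`. -/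
def system (p₀ : ExponentPair) : EquationIndex m → MvPolynomial (FreeParam m) ℂ
  | .atPt j p => D.polyPt j p
  | .atI => D.polyI p₀

end SingularData

/-- The sum of the terms of highest degree of a polynomial. -/
def leadingTerm {σ : Type*} (P : MvPolynomial σ ℂ) : MvPolynomial σ ℂ :=
  MvPolynomial.homogeneousComponent P.totalDegree P

/-- The linear form `(κ^(k₁) + k - 3/2) d₁ r_{z_j}^{(1)} + d₂ s_{z_j}^{(2)}`. -/
def linearFactor {m : ℕ} (j : Fin m) (κ : ℚ) (d₁ d₂ : ℂ) (k : ℕ) :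
    MvPolynomial (FreeParam m) ℂ :=
  MvPolynomial.C (((κ : ℂ) + k - 3 / 2) * d₁) * MvPolynomial.X (.r1 j)
    + MvPolynomial.C d₂ * MvPolynomial.X (.s2 j)

/-- `(k₁, k₂) = (1, 2)` in the usual numbering of the exponents from `1` to `3`. -/
def pair12 : ExponentPair := ⟨(0, 1), by decide⟩
/-- `(k₁, k₂) = (2, 3)` in the usual numbering of the exponents from `1` to `3`. -/
def pair23 : ExponentPair := ⟨(1, 2), by decide⟩
/-- `(k₁, k₂) = (1, 3)` in the usual numbering of the exponents from `1` to `3`. -/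
def pair13 : ExponentPair := ⟨(0, 2), by decide⟩

end ModularODE

end

noncomputable section

namespace ModularODE

/-! ### Taylor coefficients at the origin -/

/-! The proof rests on three mechanisms.

The general form. The function E₄³/E₆² separates the orbits of SL(2,ℤ) (`mem_orbit_of_cross_eq`,
deduced from the fact that a lattice is determined by g₂ and g₃), so E₆, E₄ and F_j vanish exactly
on the orbits of i, ρ and z_j. Ramanujan's formulas (`hasDerivAt_cE4`, `hasDerivAt_cE6`) show that
these zeros are simple and yield the leading coefficients of Q and R there
(`PointType.tendsto_qVal`, `PointType.tendsto_rVal`); the fixed parameters are those producing the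
given exponents, and the free parameters only affect poles of lower order. Conversely, if (Q, R) has
the prescribed exponents, the free parameters can be chosen so that the difference with the general
form has no poles at the z_j, and none of those poles at i that its stabiliser allows. The
stabilisers of i and ρ exclude the remaining pole orders (`IsForm.tendsto_of_fixed`). What is left
is a holomorphic form of weight 4 or 6 vanishing at the cusp, hence zero (`IsForm.eq_zero`). The
free parameters are limits of Q and R, so they are unique.

Apparentness. The equation is covariant under Möbius changes of variable when solutions are given
weight -2 (`IsPullback.isApparentAt`). Hence one point per orbit suffices, and the canonical
coordinate x, which is Möbius in z, may be used. There the exponents differ by integers, and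
Frobenius' method shows that logarithms are absent exactly when all obstructions vanish
(`IsExponents.isApparentAt`, `IsExponents.obstruction_of_isApparentAt`). At i and ρ the stabiliser
acts linearly on x, so the coefficients entering the recursion across n steps vanish unless j^(2n) =
1, where j is the automorphy factor (`SingularData.coeff_eq_zero`). This kills the obstructions at ρ
and those at i with odd exponent difference. The formulas for Q and R are used both for functions
and for formal Laurent series; `Rep` relates the two.

Leading terms. The Frobenius recursion has coefficients of degree at most 1 in the parameters, so
the n-th coefficient has degree n and its leading term is the product of the linear parts of the
one-step coefficients (`top_recursion`). At z_j these linear parts come from the simple pole of Q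
and the double pole of R, where only r_{z_j}^{(1)} and s_{z_j}^{(2)} enter. For the pair (1,3) the
coefficient at the middle exponent is set to zero; two factors drop out and are replaced by one
two-step linear form (`top_recursion_skip`). At i only even degrees occur and the recursion runs in
steps of two. -/

/-- The `n`-th Taylor coefficient at `0`. -/
def tc (h : ℂ → ℂ) (n : ℕ) : ℂ := iteratedDeriv n h 0 / (n.factorial : ℂ)

/-- The Taylor series at `0`. -/
def taylor (h : ℂ → ℂ) : PowerSeries ℂ := PowerSeries.mk (tc h)

@[simp] lemma coeff_taylor (h : ℂ → ℂ) (n : ℕ) : PowerSeries.coeff n (taylor h) = tc h n := by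
  simp [taylor]

lemma tc_zero (h : ℂ → ℂ) : tc h 0 = h 0 := by simp [tc]


lemma tc_congr {f g : ℂ → ℂ} (h : f =ᶠ[𝓝 0] g) : tc f = tc g := by
  ext n; simp only [tc]; rw [h.iteratedDeriv_eq n]

lemma taylor_congr {f g : ℂ → ℂ} (h : f =ᶠ[𝓝 0] g) : taylor f = taylor g := by
  rw [taylor, taylor, tc_congr h]

lemma hasFPowerSeriesAt_tc {h : ℂ → ℂ} (hh : AnalyticAt ℂ h 0) :
    HasFPowerSeriesAt h (FormalMultilinearSeries.ofScalars ℂ (tc h)) 0 :=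
  hh.hasFPowerSeriesAt

lemma tc_eq_of_hasFPowerSeriesAt {h : ℂ → ℂ} {c : ℕ → ℂ}
    (hh : HasFPowerSeriesAt h (FormalMultilinearSeries.ofScalars ℂ c) 0) : tc h = c := by
  have h1 := hasFPowerSeriesAt_tc hh.analyticAt
  have h2 := h1.eq_formalMultilinearSeries hh
  exact FormalMultilinearSeries.ofScalars_series_injective ℂ ℂ h2

lemma eventuallyEq_of_tc_eq {f g : ℂ → ℂ} (hf : AnalyticAt ℂ f 0) (hg : AnalyticAt ℂ g 0)
    (h : ∀ n, tc f n = tc g n) : f =ᶠ[𝓝 0] g := by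
  have h1 := hasFPowerSeriesAt_tc hf
  have h2 := hasFPowerSeriesAt_tc hg
  rw [← funext h] at h2
  obtain ⟨r, hr⟩ := h1
  obtain ⟨s, hs⟩ := h2
  have := (hr.mono (lt_min hr.r_pos hs.r_pos) (min_le_left _ _)).unique
    (hs.mono (lt_min hr.r_pos hs.r_pos) (min_le_right _ _))
  exact this.eventuallyEq_of_mem (Metric.eball_mem_nhds _ (lt_min hr.r_pos hs.r_pos))

lemma tc_add {f g : ℂ → ℂ} (hf : AnalyticAt ℂ f 0) (hg : AnalyticAt ℂ g 0) (n : ℕ) :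
    tc (fun x => f x + g x) n = tc f n + tc g n := by
  simp only [tc]
  rw [iteratedDeriv_fun_add hf.contDiffAt hg.contDiffAt, add_div]

lemma tc_const_mul {f : ℂ → ℂ} (c : ℂ) (n : ℕ) :
    tc (fun x => c * f x) n = c * tc f n := by
  simp only [tc]
  rw [iteratedDeriv_const_mul_field, mul_div_assoc]

lemma taylor_add {f g : ℂ → ℂ} (hf : AnalyticAt ℂ f 0) (hg : AnalyticAt ℂ g 0) :
    taylor (fun x => f x + g x) = taylor f + taylor g := by
  ext n; simp [tc_add hf hg]

lemma taylor_mul {f g : ℂ → ℂ} (hf : AnalyticAt ℂ f 0) (hg : AnalyticAt ℂ g 0) :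
    taylor (fun x => f x * g x) = taylor f * taylor g := by
  ext n
  rw [PowerSeries.coeff_mul, coeff_taylor, Finset.Nat.sum_antidiagonal_eq_sum_range_succ
    (fun i j => PowerSeries.coeff i (taylor f) * PowerSeries.coeff j (taylor g))]
  simp only [tc, coeff_taylor]
  rw [iteratedDeriv_fun_mul hf.contDiffAt hg.contDiffAt, Finset.sum_div]
  refine Finset.sum_congr rfl fun i hi => ?_
  have hi' : i ≤ n := by simpa [Nat.lt_succ_iff] using hi
  rw [Nat.cast_choose ℂ hi']
  have h1 : (n.factorial : ℂ) ≠ 0 := by exact_mod_cast n.factorial_ne_zero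
  have h2 : (i.factorial : ℂ) ≠ 0 := by exact_mod_cast i.factorial_ne_zero
  have h3 : ((n - i).factorial : ℂ) ≠ 0 := by exact_mod_cast (n - i).factorial_ne_zero
  field_simp

lemma tc_mul {f g : ℂ → ℂ} (hf : AnalyticAt ℂ f 0) (hg : AnalyticAt ℂ g 0) (n : ℕ) :
    tc (fun x => f x * g x) n = ∑ k ∈ Finset.range (n + 1), tc f k * tc g (n - k) := by
  rw [← coeff_taylor, taylor_mul hf hg, PowerSeries.coeff_mul,
    Finset.Nat.sum_antidiagonal_eq_sum_range_succ
    (fun i j => PowerSeries.coeff i (taylor f) * PowerSeries.coeff j (taylor g))]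
  simp

lemma taylor_const (c : ℂ) : taylor (fun _ => c) = PowerSeries.C c := by
  ext n
  rw [coeff_taylor, PowerSeries.coeff_C, tc, iteratedDeriv_const]
  split_ifs with h <;> simp [h]

lemma tc_deriv (h : ℂ → ℂ) (n : ℕ) : tc (deriv h) n = (n + 1) * tc h (n + 1) := by
  have h1 : (n.factorial : ℂ) ≠ 0 := by exact_mod_cast n.factorial_ne_zero
  have h2 : (n : ℂ) + 1 ≠ 0 := by exact_mod_cast n.succ_ne_zero
  simp only [tc]
  rw [iteratedDeriv_succ', Nat.factorial_succ]
  push_cast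
  field_simp

lemma taylor_id : taylor (fun x => x) = PowerSeries.X := by
  ext n
  rw [coeff_taylor, PowerSeries.coeff_X]
  rcases n with _ | _ | n
  · simp [tc]
  · simp [tc]
  · have : deriv (fun x : ℂ => x) = fun _ => 1 := by ext; simp
    rw [tc, iteratedDeriv_succ', this, iteratedDeriv_const]; simp

lemma taylor_pow_mul {f : ℂ → ℂ} (hf : AnalyticAt ℂ f 0) (k : ℕ) :
    taylor (fun x => x ^ k * f x) = PowerSeries.X ^ k * taylor f := by
  induction k with
  | zero => simp
  | succ k ih =>
    have : (fun x => x ^ (k + 1) * f x) = fun x => x * (x ^ k * f x) := by ext; ring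
    rw [this, taylor_mul (f := fun x => x) analyticAt_id (by fun_prop), ih, pow_succ', mul_assoc,
      taylor_id]

lemma tc_scale {f : ℂ → ℂ} (hf : AnalyticAt ℂ f 0) (c : ℂ) (n : ℕ) :
    tc (fun x => f (c * x)) n = c ^ n * tc f n := by
  by_cases hc : c = 0
  · subst hc
    have : tc (fun _ => f 0) n = 0 ^ n * tc f n := by
      rw [← coeff_taylor, taylor_const, PowerSeries.coeff_C]
      rcases n with _ | n <;> simp [tc_zero]
    simpa using this
  · have h1 := hasFPowerSeriesAt_tc hf
    have h2 : HasFPowerSeriesAt (fun x => f (c * x))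
        (FormalMultilinearSeries.ofScalars ℂ fun n => c ^ n * tc f n) 0 := by
      rw [hasFPowerSeriesAt_iff] at h1 ⊢
      have h3 : Tendsto (fun z : ℂ => c * z) (𝓝 0) (𝓝 0) := by
        have : ContinuousAt (fun z : ℂ => c * z) 0 := by fun_prop
        simpa [ContinuousAt] using this
      filter_upwards [h3.eventually h1] with z hz
      simp only [FormalMultilinearSeries.coeff_ofScalars, zero_add, smul_eq_mul] at hz ⊢
      convert! hz using 2
      ring
    rw [tc_eq_of_hasFPowerSeriesAt h2]

/-- Each vanishing coefficient permits one division by x, carried out by `dslope`, which shifts the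
Taylor coefficients by one. -/
lemma tc_eq_zero_of_forall_lt {f : ℂ → ℂ} (hf : AnalyticAt ℂ f 0) (N : ℕ)
    (h : ∀ n < N, tc f n = 0) :
    ∃ g : ℂ → ℂ, AnalyticAt ℂ g 0 ∧ (∀ᶠ x in 𝓝 0, f x = x ^ N * g x) ∧
      ∀ n, tc g n = tc f (n + N) := by
  induction N with
  | zero => exact ⟨f, hf, by simp, fun n => rfl⟩
  | succ N ih =>
    obtain ⟨g, hg, hfg, hc⟩ := ih fun n hn => h n (hn.trans (Nat.lt_succ_self _))
    have hg0 : g 0 = 0 := by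
      rw [← tc_zero g, hc 0, zero_add]; exact h N (Nat.lt_succ_self _)
    refine ⟨dslope g 0, ?_, ?_, fun n => ?_⟩
    · obtain ⟨p, hp⟩ := hg
      exact ⟨p.fslope, hp.has_fpower_series_dslope_fslope⟩
    · filter_upwards [hfg] with x hx
      have := sub_smul_dslope g 0 x
      rw [hx, pow_succ, mul_assoc]
      simp only [sub_zero, smul_eq_mul, hg0] at this
      rw [this]
    · have ha : AnalyticAt ℂ (dslope g 0) 0 := by
        obtain ⟨p, hp⟩ := hg
        exact ⟨p.fslope, hp.has_fpower_series_dslope_fslope⟩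
      have h1 : g = fun x => x ^ 1 * dslope g 0 x := by
        ext x
        have := sub_smul_dslope g 0 x
        simp only [sub_zero, smul_eq_mul, hg0] at this
        rw [pow_one, this]
      have h2 := congrArg (PowerSeries.coeff (n + 1)) (taylor_pow_mul ha 1)
      rw [← h1, pow_one, PowerSeries.coeff_succ_X_mul, coeff_taylor, coeff_taylor, hc] at h2
      rw [← h2]; ring_nf

lemma eventually_eq_zero_of_taylor {f : ℂ → ℂ} (hf : AnalyticAt ℂ f 0) (h : taylor f = 0) :
    ∀ᶠ x in 𝓝 0, f x = 0 :=
  eventuallyEq_of_tc_eq hf analyticAt_const fun n => by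
    rw [← coeff_taylor, h, ← coeff_taylor, taylor_const]; simp

/-! ### Laurent expansions -/

/-- The germ of `g` at `0` has the Laurent expansion `S`. -/
def Rep (g : ℂ → ℂ) (S : ℂ⸨X⸩) : Prop :=
  ∃ (N : ℕ) (G : ℂ → ℂ), AnalyticAt ℂ G 0 ∧ (∀ᶠ x in 𝓝[≠] 0, x ^ N * g x = G x) ∧
    HahnSeries.ofPowerSeries ℤ ℂ (PowerSeries.X ^ N) * S = HahnSeries.ofPowerSeries ℤ ℂ (taylor G)

local notation "oPS" => HahnSeries.ofPowerSeries ℤ ℂ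

lemma ofPowerSeries_X_pow_ne_zero (N : ℕ) : oPS (PowerSeries.X ^ N) ≠ 0 := by
  rw [Ne, map_eq_zero_iff _ HahnSeries.ofPowerSeries_injective]
  exact pow_ne_zero _ PowerSeries.X_ne_zero

lemma coeff_X_pow_mul (N : ℕ) (S : ℂ⸨X⸩) (n : ℤ) :
    (oPS (PowerSeries.X ^ N) * S).coeff n = S.coeff (n - N) := by
  rw [HahnSeries.ofPowerSeries_X_pow]
  have := HahnSeries.coeff_single_mul_add (r := (1 : ℂ)) (x := S) (a := n - N) (b := (N : ℤ))
  simpa using this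

lemma ofPowerSeries_coeff (p : PowerSeries ℂ) (n : ℤ) :
    (oPS p).coeff n = if 0 ≤ n then PowerSeries.coeff n.toNat p else 0 := by
  split_ifs with h
  · obtain ⟨k, rfl⟩ := Int.eq_ofNat_of_zero_le h
    simp [HahnSeries.ofPowerSeries_apply_coeff]
  · rw [HahnSeries.ofPowerSeries_apply]
    apply HahnSeries.embDomain_of_notMem_range
    rintro ⟨k, hk⟩
    simp at hk
    omega

lemma Rep.congr {f g : ℂ → ℂ} {S : ℂ⸨X⸩} (h : Rep f S) (hfg : ∀ᶠ x in 𝓝[≠] 0, f x = g x) :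
    Rep g S := by
  obtain ⟨N, G, hG, h1, h2⟩ := h
  exact ⟨N, G, hG, by filter_upwards [h1, hfg] with x hx hx'; rw [← hx', hx], h2⟩

lemma rep_taylor {f : ℂ → ℂ} (hf : AnalyticAt ℂ f 0) : Rep f (oPS (taylor f)) :=
  ⟨0, f, hf, by simp, by simp⟩

lemma Rep.add {f g : ℂ → ℂ} {S T : ℂ⸨X⸩} (hf : Rep f S) (hg : Rep g T) :
    Rep (fun x => f x + g x) (S + T) := by
  obtain ⟨N, F, hF, h1, h2⟩ := hf
  obtain ⟨M, G, hG, h3, h4⟩ := hg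
  refine ⟨N + M, fun x => x ^ M * F x + x ^ N * G x, by fun_prop, ?_, ?_⟩
  · filter_upwards [h1, h3] with x hx hx'
    rw [← hx, ← hx']; ring
  · rw [taylor_add (by fun_prop) (by fun_prop), taylor_pow_mul hF, taylor_pow_mul hG, map_add,
      map_mul, map_mul, ← h2, ← h4, pow_add, map_mul]
    ring

lemma Rep.mul {f g : ℂ → ℂ} {S T : ℂ⸨X⸩} (hf : Rep f S) (hg : Rep g T) :
    Rep (fun x => f x * g x) (S * T) := by
  obtain ⟨N, F, hF, h1, h2⟩ := hf
  obtain ⟨M, G, hG, h3, h4⟩ := hg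
  refine ⟨N + M, fun x => F x * G x, by fun_prop, ?_, ?_⟩
  · filter_upwards [h1, h3] with x hx hx'
    rw [← hx, ← hx']; ring
  · rw [taylor_mul hF hG, map_mul, ← h2, ← h4, pow_add, map_mul]
    ring

lemma rep_const (c : ℂ) : Rep (fun _ => c) (algebraMap ℂ ℂ⸨X⸩ c) := by
  have := rep_taylor (f := fun _ => c) analyticAt_const
  rw [taylor_const] at this
  convert! this

lemma Rep.const_mul {f : ℂ → ℂ} {S : ℂ⸨X⸩} (c : ℂ) (hf : Rep f S) :
    Rep (fun x => c * f x) (algebraMap ℂ ℂ⸨X⸩ c * S) :=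
  (rep_const c).mul hf

lemma Rep.smul {f : ℂ → ℂ} {S : ℂ⸨X⸩} (c : ℂ) (hf : Rep f S) :
    Rep (fun x => c • f x) (Algebra.toSMul.smul c S) := by
  have h : Algebra.toSMul.smul c S = algebraMap ℂ ℂ⸨X⸩ c * S := Algebra.smul_def c S
  rw [h]
  exact hf.const_mul c

lemma Rep.sub {f g : ℂ → ℂ} {S T : ℂ⸨X⸩} (hf : Rep f S) (hg : Rep g T) :
    Rep (fun x => f x - g x) (S - T) := by
  have h1 := hf.add (hg.const_mul (-1))
  have h2 : S - T = S + algebraMap ℂ ℂ⸨X⸩ (-1) * T := by rw [map_neg, map_one]; ring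
  rw [h2]
  exact h1.congr (.of_forall fun x => by ring)

lemma Rep.pow {f : ℂ → ℂ} {S : ℂ⸨X⸩} (hf : Rep f S) (n : ℕ) : Rep (fun x => f x ^ n) (S ^ n) := by
  induction n with
  | zero => simpa using rep_const 1
  | succ n ih => simpa [pow_succ] using ih.mul hf

lemma Rep.sum {ι : Type*} (s : Finset ι) {f : ι → ℂ → ℂ} {S : ι → ℂ⸨X⸩}
    (hf : ∀ i ∈ s, Rep (f i) (S i)) : Rep (fun x => ∑ i ∈ s, f i x) (∑ i ∈ s, S i) := by
  classical
  induction s using Finset.induction_on with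
  | empty => simpa using rep_const 0
  | insert a s ha ih =>
    simp only [Finset.sum_insert ha]
    exact (hf a (by simp)).add (ih fun i hi => hf i (by simp [hi]))

/-- Writing G = x^k U with U(0) ≠ 0, the reciprocal is x^N U⁻¹ / x^k on both sides; the zero germ
and the zero series are both inverted to zero. With this `Rep` respects all field operations, so a
rational formula in E₄ and E₆ has the same formula in their series as its Laurent expansion. -/
lemma Rep.inv {f : ℂ → ℂ} {S : ℂ⸨X⸩} (hf : Rep f S) : Rep (fun x => (f x)⁻¹) S⁻¹ := by
  obtain ⟨N, G, hG, h1, h2⟩ := hf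
  have hx0 : ∀ᶠ x : ℂ in 𝓝[≠] 0, x ≠ 0 := eventually_mem_nhdsWithin
  by_cases hG0 : ∀ᶠ x in 𝓝 0, G x = 0
  · have hT : taylor G = 0 := by
      have : G =ᶠ[𝓝 0] fun _ => 0 := hG0
      rw [taylor_congr this, taylor_const, map_zero]
    have hS : S = 0 := by
      rw [hT, map_zero] at h2
      exact (mul_eq_zero.mp h2).resolve_left (ofPowerSeries_X_pow_ne_zero N)
    have : Rep (fun _ => 0) (0 : ℂ⸨X⸩) := by simpa using rep_const 0
    rw [hS, inv_zero]
    refine this.congr ?_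
    filter_upwards [h1, hG0.filter_mono nhdsWithin_le_nhds, hx0] with x hx hx' hx0
    rw [hx'] at hx
    rw [(mul_eq_zero.mp hx).resolve_left (pow_ne_zero _ hx0), inv_zero]
  · obtain ⟨k, U, hU, hU0, hGU⟩ := (hG.exists_eventuallyEq_pow_smul_nonzero_iff).mpr hG0
    simp only [sub_zero, smul_eq_mul] at hGU
    have hUi : AnalyticAt ℂ (fun x => (U x)⁻¹) 0 := hU.inv hU0
    have hUne : ∀ᶠ x in 𝓝 0, U x ≠ 0 := hU.continuousAt.eventually_ne hU0
    refine ⟨k, fun x => x ^ N * (U x)⁻¹, by fun_prop, ?_, ?_⟩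
    · filter_upwards [h1, hGU.filter_mono nhdsWithin_le_nhds, hx0,
        hUne.filter_mono nhdsWithin_le_nhds] with x hx hx' hx0 hxU
      rw [hx'] at hx
      have hN := pow_ne_zero N hx0
      have hk := pow_ne_zero k hx0
      have : f x = x ^ k * U x / x ^ N := by rw [← hx]; field_simp
      rw [this]; field_simp
    · have hTU : oPS (taylor U) * oPS (taylor fun x => (U x)⁻¹) = 1 := by
        rw [← map_mul, ← taylor_mul hU hUi]
        have : (fun x => U x * (U x)⁻¹) =ᶠ[𝓝 0] fun _ => 1 := by
          filter_upwards [hUne] with x hx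
          exact mul_inv_cancel₀ hx
        rw [taylor_congr this, taylor_const, map_one, map_one]
      rw [taylor_pow_mul hUi, map_mul]
      rw [taylor_congr hGU, taylor_pow_mul hU, map_mul] at h2
      have hS : S ≠ 0 := by
        rintro rfl
        rw [mul_zero] at h2
        rcases mul_eq_zero.mp h2.symm with h | h
        · exact ofPowerSeries_X_pow_ne_zero k h
        · rw [h, zero_mul] at hTU; exact zero_ne_one hTU
      have hU' := left_ne_zero_of_mul_eq_one hTU
      rw [eq_inv_of_mul_eq_one_right hTU]
      field_simp
      rw [mul_comm S, h2]

lemma Rep.div {f g : ℂ → ℂ} {S T : ℂ⸨X⸩} (hf : Rep f S) (hg : Rep g T) :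
    Rep (fun x => f x / g x) (S / T) := by
  simpa [div_eq_mul_inv] using hf.mul hg.inv

lemma Rep.unique {f : ℂ → ℂ} {S T : ℂ⸨X⸩} (hS : Rep f S) (hT : Rep f T) : S = T := by
  have h := hS.sub hT
  obtain ⟨N, G, hG, h1, h2⟩ := h
  have hG0 : ∀ᶠ x in 𝓝[≠] 0, G x = 0 := by
    filter_upwards [h1] with x hx
    rw [← hx]; ring
  have h3 : ∀ᶠ x in 𝓝 0, G x = 0 := hG.frequently_zero_iff_eventually_zero.mp hG0.frequently
  have h4 : taylor G = 0 := by
    have : G =ᶠ[𝓝 0] fun _ => 0 := h3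
    rw [taylor_congr this, taylor_const, map_zero]
  rw [h4, map_zero] at h2
  exact sub_eq_zero.mp ((mul_eq_zero.mp h2).resolve_left (ofPowerSeries_X_pow_ne_zero N))

/-- A germ `g` with `x^N g(x) → c` has a Laurent expansion without terms of order below `-N`,
and `c` is the coefficient of `x^(-N)`. -/
lemma Rep.lead {g : ℂ → ℂ} {S : ℂ⸨X⸩} (h : Rep g S) {N : ℕ} {c : ℂ}
    (hc : Tendsto (fun x => x ^ N * g x) (𝓝[≠] 0) (𝓝 c)) :
    ∃ G : ℂ → ℂ, AnalyticAt ℂ G 0 ∧ G 0 = c ∧ (∀ᶠ x in 𝓝[≠] 0, x ^ N * g x = G x) ∧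
      (∀ n : ℤ, S.coeff n = if 0 ≤ n + N then tc G (n + N).toNat else 0) := by
  obtain ⟨M, F, hF, h1, h2⟩ := h
  have hx0 : ∀ᶠ x : ℂ in 𝓝[≠] 0, x ≠ 0 := eventually_mem_nhdsWithin
  have key : ∃ G : ℂ → ℂ, AnalyticAt ℂ G 0 ∧ (∀ᶠ x in 𝓝[≠] 0, x ^ N * g x = G x) := by
    -- If n < M were the order of the first nonzero coefficient, x^(M-n) · x^N g would have a
    -- nonzero limit, although x^N g → c makes it tend to 0.
    have hlow : ∀ n < M, tc (fun x => x ^ N * F x) n = 0 := by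
      by_contra! hne
      classical
      obtain ⟨hn, hn'⟩ := Nat.find_spec hne
      set n := Nat.find hne
      have hmin : ∀ j < n, tc (fun x => x ^ N * F x) j = 0 := by
        intro j hj
        by_contra hj'
        exact Nat.find_min hne hj ⟨hj.trans hn, hj'⟩
      obtain ⟨G, hG, hFG, hcG⟩ := tc_eq_zero_of_forall_lt (f := fun x => x ^ N * F x)
        (by fun_prop) n hmin
      have hG0 : G 0 ≠ 0 := by rw [← tc_zero G, hcG, zero_add]; exact hn'
      have hlim : Tendsto (fun x => x ^ (M - n) * (x ^ N * g x)) (𝓝[≠] 0) (𝓝 (G 0)) := by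
        refine (hG.continuousAt.tendsto.mono_left nhdsWithin_le_nhds).congr' ?_
        filter_upwards [h1, hFG.filter_mono nhdsWithin_le_nhds, hx0] with x hx hx' hx0
        have hn0 := pow_ne_zero n hx0
        apply mul_left_cancel₀ hn0
        rw [← hx', ← hx]
        have : M = n + (M - n) := by omega
        conv_lhs => rw [this, pow_add]
        ring
      have hlim2 : Tendsto (fun x : ℂ => x ^ (M - n) * (x ^ N * g x)) (𝓝[≠] 0) (𝓝 (0 * c)) := by
        refine Tendsto.mul ?_ hc
        have : ContinuousAt (fun x : ℂ => x ^ (M - n)) 0 := by fun_prop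
        have h := this.tendsto.mono_left (nhdsWithin_le_nhds (s := {0}ᶜ))
        rwa [zero_pow (by omega)] at h
      rw [zero_mul] at hlim2
      exact hG0 (tendsto_nhds_unique hlim hlim2)
    obtain ⟨G, hG, hFG, hcG⟩ := tc_eq_zero_of_forall_lt (f := fun x => x ^ N * F x)
        (by fun_prop) M hlow
    refine ⟨G, hG, ?_⟩
    filter_upwards [h1, hFG.filter_mono nhdsWithin_le_nhds, hx0] with x hx hx' hx0
    apply mul_left_cancel₀ (pow_ne_zero M hx0)
    rw [← hx', ← hx]; ring
  obtain ⟨G, hG, hgG⟩ := key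
  refine ⟨G, hG, ?_, hgG, fun n => ?_⟩
  · refine tendsto_nhds_unique ?_ hc
    exact (hG.continuousAt.tendsto.mono_left nhdsWithin_le_nhds).congr'
      (hgG.mono fun x hx => hx.symm)
  · have hr : Rep (fun x => x ^ N * g x) (oPS (PowerSeries.X ^ N) * S) := by
      have h5 := (rep_taylor (f := fun x : ℂ => x ^ N * 1) (by fun_prop)).mul
        (⟨M, F, hF, h1, h2⟩ : Rep g S)
      rw [taylor_pow_mul analyticAt_const, taylor_const, map_one, mul_one] at h5
      simpa using h5
    have h6 : oPS (PowerSeries.X ^ N) * S = oPS (taylor G) :=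
      (hr.congr hgG).unique (rep_taylor hG)
    have h7 := congrArg (fun T => HahnSeries.coeff T (n + N)) h6
    simp only [coeff_X_pow_mul, ofPowerSeries_coeff, add_sub_cancel_right, coeff_taylor] at h7
    exact h7

/-- Laurent coefficients of a homogeneous germ. -/
lemma Rep.coeff_scale {g : ℂ → ℂ} {S : ℂ⸨X⸩} (h : Rep g S) {c u : ℂ} (hc : c ≠ 0)
    (hg : ∀ᶠ x in 𝓝[≠] 0, g (c * x) = u * g x) (n : ℤ) : c ^ n * S.coeff n = u * S.coeff n := by
  obtain ⟨N, G, hG, h1, h2⟩ := h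
  have h3 : Tendsto (fun z : ℂ => c * z) (𝓝[≠] 0) (𝓝[≠] 0) := by
    refine tendsto_nhdsWithin_iff.mpr ⟨?_, ?_⟩
    · have : ContinuousAt (fun z : ℂ => c * z) 0 := by fun_prop
      have h := this.tendsto.mono_left (nhdsWithin_le_nhds (s := {0}ᶜ))
      rwa [mul_zero] at h
    · filter_upwards [eventually_mem_nhdsWithin] with x hx
      exact mul_ne_zero hc hx
  have hGs : AnalyticAt ℂ (fun x => G (c * x)) 0 := by
    apply AnalyticAt.fun_comp (g := G) (by simpa using hG) (by fun_prop)
  have h4 : (fun x => G (c * x)) =ᶠ[𝓝 0] fun x => (c ^ N * u) * G x := by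
    have h5 : ∀ᶠ x in 𝓝[≠] 0, G (c * x) - (c ^ N * u) * G x = 0 := by
      filter_upwards [h3.eventually h1, h1, hg] with x hx hx' hx''
      rw [← hx, ← hx', hx'']; ring
    have h6 : AnalyticAt ℂ (fun x => G (c * x) - (c ^ N * u) * G x) 0 :=
      hGs.sub (analyticAt_const.mul hG)
    filter_upwards [h6.frequently_zero_iff_eventually_zero.mp h5.frequently] with x hx
    exact sub_eq_zero.mp hx
  have h7 := congrFun (tc_congr h4)
  have h8 := congrArg (fun T => HahnSeries.coeff T (n + N)) h2
  simp only [coeff_X_pow_mul, ofPowerSeries_coeff, add_sub_cancel_right, coeff_taylor] at h8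
  rw [h8]
  split_ifs with hn
  · have h9 := h7 (n + N).toNat
    rw [tc_scale hG, tc_const_mul, ← zpow_natCast, Int.toNat_of_nonneg hn, zpow_add₀ hc,
      zpow_natCast] at h9
    have := pow_ne_zero N hc
    apply mul_left_cancel₀ this
    linear_combination h9
  · simp

/-! ### The equation in terms of the Euler operator -/

/-- The shifted Euler operator `h ↦ x h' + α h`. -/
def eul (α : ℂ) (h : ℂ → ℂ) (x : ℂ) : ℂ := x * deriv h x + α * h x

lemma analyticAt_eul {h : ℂ → ℂ} {x : ℂ} (α : ℂ) (hh : AnalyticAt ℂ h x) :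
    AnalyticAt ℂ (eul α h) x :=
  (analyticAt_id.mul hh.deriv).add (analyticAt_const.mul hh)

lemma tc_eul {h : ℂ → ℂ} (α : ℂ) (hh : AnalyticAt ℂ h 0) (n : ℕ) :
    tc (eul α h) n = (α + n) * tc h n := by
  have h1 : tc (fun x => x * deriv h x) n = n * tc h n := by
    have h2 := congrArg (PowerSeries.coeff n) (taylor_pow_mul hh.deriv 1)
    simp only [pow_one, coeff_taylor] at h2
    rw [h2]
    rcases n with _ | n
    · simp
    · rw [PowerSeries.coeff_succ_X_mul, coeff_taylor, tc_deriv]; push_cast; ring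
  have h3 : tc (eul α h) n = tc (fun x => x * deriv h x + α * h x) n := rfl
  rw [h3, tc_add (f := fun x => x * deriv h x) (g := fun x => α * h x)
    (analyticAt_id.mul hh.deriv) (by fun_prop), h1, tc_const_mul]
  ring

lemma eul_congr {f g : ℂ → ℂ} {x : ℂ} (α : ℂ) (h : f =ᶠ[𝓝 x] g) : eul α f =ᶠ[𝓝 x] eul α g := by
  filter_upwards [h.deriv, h] with z hz hz'
  rw [eul, eul, hz, hz']

/-- The operator `x³ ∂³ + A x ∂ + B`, conjugated by `x^α`. -/
def op (A B : ℂ → ℂ) (α : ℂ) (h : ℂ → ℂ) (x : ℂ) : ℂ :=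
  eul α (eul (α - 1) (eul (α - 2) h)) x + eul α h x * A x + h x * B x

lemma analyticAt_op {A B h : ℂ → ℂ} {x : ℂ} (α : ℂ) (hA : AnalyticAt ℂ A x)
    (hB : AnalyticAt ℂ B x) (hh : AnalyticAt ℂ h x) : AnalyticAt ℂ (op A B α h) x :=
  ((analyticAt_eul _ (analyticAt_eul _ (analyticAt_eul _ hh))).add
    ((analyticAt_eul _ hh).mul hA)).add (hh.mul hB)

/-- This is the identity θ(θ - 1)(θ - 2) = x³∂³ for the Euler operator θ = x∂. -/
lemma op_zero_eq {y : ℂ → ℂ} {x : ℂ} (A B : ℂ → ℂ) (hy : AnalyticAt ℂ y x) :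
    op A B 0 y x = x ^ 3 * iteratedDeriv 3 y x + x * A x * deriv y x + B x * y x := by
  have h1 : ∀ᶠ z in 𝓝 x, AnalyticAt ℂ y z := hy.eventually_analyticAt
  have e1 : deriv (eul (0 - 2) y) =ᶠ[𝓝 x] fun z => z * deriv (deriv y) z - deriv y z := by
    filter_upwards [h1] with z hz
    have := ((hasDerivAt_id z).mul hz.deriv.differentiableAt.hasDerivAt).add
      (hz.differentiableAt.hasDerivAt.const_mul (0 - 2 : ℂ))
    refine (HasDerivAt.deriv this).trans ?_
    simp; ring
  have e2 : eul (0 - 1) (eul (0 - 2) y) =ᶠ[𝓝 x]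
      fun z => z ^ 2 * deriv (deriv y) z - 2 * z * deriv y z + 2 * y z := by
    filter_upwards [e1] with z hz
    rw [eul, hz, eul]; ring
  have e3 : deriv (eul (0 - 1) (eul (0 - 2) y)) x = x ^ 2 * deriv (deriv (deriv y)) x := by
    rw [e2.deriv_eq]
    have := ((((hasDerivAt_id x).pow 2).mul hy.deriv.deriv.differentiableAt.hasDerivAt).sub
      (((hasDerivAt_id x).const_mul 2).mul hy.deriv.differentiableAt.hasDerivAt)).add
      (hy.differentiableAt.hasDerivAt.const_mul (2 : ℂ))
    refine (HasDerivAt.deriv this).trans ?_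
    simp; ring
  have e4 : iteratedDeriv 3 y x = deriv (deriv (deriv y)) x := by
    rw [iteratedDeriv_succ, iteratedDeriv_succ, iteratedDeriv_one]
  have e5 : eul 0 y x = x * deriv y x := by rw [eul]; ring
  rw [op, eul, e3, e4, e5]; ring

/-- The recursion satisfied by the coefficients of a solution `x^α ∑ c_n x^n`. -/
def IsRec (a b : ℕ → ℂ) (α : ℂ) (c : ℕ → ℂ) : Prop :=
  ∀ n : ℕ, (α + n) * (α + n - 1) * (α + n - 2) * c n
    + ∑ k ∈ Finset.range (n + 1), ((α + k) * a (n - k) + b (n - k)) * c k = 0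

lemma tc_op {A B h : ℂ → ℂ} (α : ℂ) (hA : AnalyticAt ℂ A 0)
    (hB : AnalyticAt ℂ B 0) (hh : AnalyticAt ℂ h 0) (n : ℕ) :
    tc (op A B α h) n = (α + n) * (α + n - 1) * (α + n - 2) * tc h n
      + ∑ k ∈ Finset.range (n + 1), ((α + k) * tc A (n - k) + tc B (n - k)) * tc h k := by
  have a1 := analyticAt_eul (α - 2) hh
  have a2 := analyticAt_eul (α - 1) a1
  have a3 := analyticAt_eul α a2
  have h0 : tc (op A B α h) n
    = tc (fun x => (eul α (eul (α - 1) (eul (α - 2) h)) x + eul α h x * A x) + h x * B x) n := rfl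
  have b1 : AnalyticAt ℂ (fun x => eul α h x * A x) 0 := (analyticAt_eul _ hh).mul hA
  have b2 : AnalyticAt ℂ (fun x => h x * B x) 0 := hh.mul hB
  have b3 : AnalyticAt ℂ
    (fun x => eul α (eul (α - 1) (eul (α - 2) h)) x + eul α h x * A x) 0 := a3.add b1
  rw [h0, tc_add b3 b2, tc_add a3 b1, tc_mul (analyticAt_eul _ hh) hA, tc_mul hh hB,
    tc_eul _ a2, tc_eul _ a1, tc_eul _ hh, add_assoc, ← Finset.sum_add_distrib]
  congr 1
  · ring
  · refine Finset.sum_congr rfl fun k _ => ?_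
    rw [tc_eul _ hh]; ring

lemma op_eventually_eq_zero_iff {A B h : ℂ → ℂ} (α : ℂ) (hA : AnalyticAt ℂ A 0)
    (hB : AnalyticAt ℂ B 0) (hh : AnalyticAt ℂ h 0) :
    (∀ᶠ x in 𝓝 0, op A B α h x = 0) ↔ IsRec (tc A) (tc B) α (tc h) := by
  constructor
  · intro h0 n
    rw [← tc_op α hA hB hh]
    have : op A B α h =ᶠ[𝓝 0] fun _ => 0 := h0
    rw [tc_congr this, ← coeff_taylor, taylor_const]; simp
  · intro h0
    refine eventually_eq_zero_of_taylor (analyticAt_op α hA hB hh) ?_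
    ext n
    rw [coeff_taylor, tc_op α hA hB hh, h0 n]; simp

lemma exists_bound_tc {h : ℂ → ℂ} (hh : AnalyticAt ℂ h 0) :
    ∃ C > 0, ∃ R > 0, ∀ n, ‖tc h n‖ ≤ C * R ^ n := by
  have h1 := hasFPowerSeriesAt_tc hh
  obtain ⟨C, r, hC, hr, h2⟩ := (FormalMultilinearSeries.ofScalars ℂ (tc h)).le_mul_pow_of_radius_pos
    h1.radius_pos
  refine ⟨C, hC, r, hr, fun n => ?_⟩
  have := h2 n
  rwa [FormalMultilinearSeries.ofScalars_norm] at this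

lemma exists_analyticAt_of_bound {c : ℕ → ℂ} {C R : ℝ} (hR : 0 < R)
    (h : ∀ n, ‖c n‖ ≤ C * R ^ n) : ∃ f : ℂ → ℂ, AnalyticAt ℂ f 0 ∧ tc f = c := by
  set p := FormalMultilinearSeries.ofScalars ℂ (𝕜 := ℂ) c
  have hrad : 0 < p.radius := by
    have h1 : ((Real.toNNReal R⁻¹ : NNReal) : ENNReal) ≤ p.radius := by
      refine p.le_radius_of_bound C fun n => ?_
      rw [FormalMultilinearSeries.ofScalars_norm, Real.coe_toNNReal _ (by positivity)]
      calc ‖c n‖ * R⁻¹ ^ n ≤ C * R ^ n * R⁻¹ ^ n := by gcongr; exact h n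
        _ = C := by rw [mul_assoc, ← mul_pow, mul_inv_cancel₀ hR.ne', one_pow, mul_one]
    refine lt_of_lt_of_le ?_ h1
    simpa using hR
  have h2 := (p.hasFPowerSeriesOnBall hrad).hasFPowerSeriesAt
  exact ⟨p.sum, h2.analyticAt, tc_eq_of_hasFPowerSeriesAt h2⟩

/-- Convergence of the formal solutions. -/
lemma IsRec.exists_analyticAt {A B : ℂ → ℂ} {α : ℂ} {c : ℕ → ℂ} (hA : AnalyticAt ℂ A 0)
    (hB : AnalyticAt ℂ B 0) (hc : IsRec (tc A) (tc B) α c) :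
    ∃ f : ℂ → ℂ, AnalyticAt ℂ f 0 ∧ tc f = c := by
  obtain ⟨M₁, hM₁, R₁, hR₁, h1⟩ := exists_bound_tc hA
  obtain ⟨M₂, hM₂, R₂, hR₂, h2⟩ := exists_bound_tc hB
  set M := max M₁ M₂
  set R := max R₁ R₂
  have hM : 0 < M := lt_max_of_lt_left hM₁
  have hR : 0 < R := lt_max_of_lt_left hR₁
  have hAb : ∀ n, ‖tc A n‖ ≤ M * R ^ n := fun n => (h1 n).trans (by gcongr <;> simp [M, R])
  have hBb : ∀ n, ‖tc B n‖ ≤ M * R ^ n := fun n => (h2 n).trans (by gcongr <;> simp [M, R])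
  set a := ‖α‖
  have ha : 0 ≤ a := norm_nonneg _
  -- growth of the indicial polynomial
  obtain ⟨N, hN⟩ : ∃ N : ℕ, ∀ n : ℕ, N ≤ n → (n + a + 1) * M ≤
      ‖(α + n) * (α + n - 1) * (α + n - 2) + ((α + n) * tc A 0 + tc B 0)‖ := by
    -- With m = n - a - 2 each of the three linear factors has modulus at least m. Since n + a + 1 =
    -- m + 2a + 3 ≤ 2m, the bounds m ≥ 4M and m ≥ 1 give m³ ≥ 2(n + a + 1)M; half of this absorbs
    -- the terms with A(0) and B(0).
    obtain ⟨N, hN⟩ := exists_nat_ge (a + 2 + (2 * a + 3) + 4 * M + 1)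
    refine ⟨N, fun n hn => ?_⟩
    set m : ℝ := n - a - 2
    have hm : (2 * a + 3) + 4 * M + 1 ≤ m := by
      have : (N : ℝ) ≤ n := by exact_mod_cast hn
      simp only [m]; linarith
    have hna : (n : ℝ) = ‖(n : ℂ)‖ := by simp
    have b0 : m ≤ ‖α + n‖ := by
      have := norm_sub_norm_le (n : ℂ) (-α)
      rw [norm_neg, sub_neg_eq_add, add_comm (n : ℂ)] at this
      simp only [m]; linarith
    have b1 : m ≤ ‖α + n - 1‖ := by
      have := norm_sub_norm_le (n : ℂ) (1 - α)
      have h3 : ‖(1 : ℂ) - α‖ ≤ 1 + a := (norm_sub_le _ _).trans (by simp [a])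
      rw [show (n : ℂ) - (1 - α) = α + n - 1 by ring] at this
      simp only [m]; linarith
    have b2 : m ≤ ‖α + n - 2‖ := by
      have := norm_sub_norm_le (n : ℂ) (2 - α)
      have h3 : ‖(2 : ℂ) - α‖ ≤ 2 + a := (norm_sub_le _ _).trans (by simp [a])
      rw [show (n : ℂ) - (2 - α) = α + n - 2 by ring] at this
      simp only [m]; linarith
    have hm0 : 0 ≤ m := by linarith
    have b3 : m * m * m ≤ ‖(α + n) * (α + n - 1) * (α + n - 2)‖ := by
      rw [norm_mul, norm_mul]; gcongr
    have b4 : ‖(α + n) * tc A 0 + tc B 0‖ ≤ (n + a + 1) * M := by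
      refine (norm_add_le _ _).trans ?_
      rw [norm_mul]
      have h3 : ‖α + n‖ ≤ a + n := (norm_add_le _ _).trans (by simp [a])
      have h4 := hAb 0
      have h5 := hBb 0
      rw [pow_zero, mul_one] at h4 h5
      have : ‖α + n‖ * ‖tc A 0‖ ≤ (a + n) * M := by gcongr
      linarith
    have b5 := norm_sub_norm_le ((α + n) * (α + n - 1) * (α + n - 2)) (-((α + n) * tc A 0 + tc B 0))
    rw [norm_neg, sub_neg_eq_add] at b5
    have b6 : 2 * ((n + a + 1) * M) ≤ m * m * m := by
      have e1 : (n : ℝ) + a + 1 = m + (2 * a + 3) := by simp only [m]; ring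
      rw [e1]
      have e2 : m + (2 * a + 3) ≤ 2 * m := by linarith
      have e3 : 4 * M ≤ m := by linarith
      have e4 : 1 ≤ m := by linarith
      calc 2 * ((m + (2 * a + 3)) * M) ≤ 2 * ((2 * m) * M) := by gcongr
        _ = m * (4 * M) * 1 := by ring
        _ ≤ m * m * m := by gcongr
    linarith
  -- The first N coefficients are absorbed into C. From N on the bound C(2R)^n propagates, because
  -- doubling R gives ∑_{k<n} R^(n-k) (2R)^k ≤ (2R)^n, and the factor (n + a + 1)M cancels against
  -- the indicial polynomial.
  obtain ⟨C, hC, hCk⟩ : ∃ C : ℝ, 0 ≤ C ∧ ∀ k < N, ‖c k‖ / (2 * R) ^ k ≤ C :=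
    ⟨∑ k ∈ Finset.range N, ‖c k‖ / (2 * R) ^ k, Finset.sum_nonneg fun k _ => by positivity,
      fun k hk => Finset.single_le_sum (f := fun k => ‖c k‖ / (2 * R) ^ k)
        (fun k _ => by positivity) (Finset.mem_range.mpr hk)⟩
  refine exists_analyticAt_of_bound (C := C) (R := 2 * R) (by positivity) fun n => ?_
  induction n using Nat.strong_induction_on with
  | _ n ih =>
    by_cases hn : n < N
    · have h3 := hCk n hn
      rwa [div_le_iff₀ (by positivity)] at h3
    · have h3 := hc n
      have h4 := hN n (not_lt.mp hn)
      rw [Finset.sum_range_succ, Nat.sub_self] at h3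
      set F := (α + n) * (α + n - 1) * (α + n - 2) + ((α + n) * tc A 0 + tc B 0)
      have h5 : F * c n
          = -∑ k ∈ Finset.range n, ((α + k) * tc A (n - k) + tc B (n - k)) * c k := by
        simp only [F]; linear_combination h3
      have h6 : ‖∑ k ∈ Finset.range n, ((α + k) * tc A (n - k) + tc B (n - k)) * c k‖
          ≤ (n + a + 1) * M * (C * (2 * R) ^ n) := by
        calc _ ≤ ∑ k ∈ Finset.range n, (n + a + 1) * M * C * R ^ n * 2 ^ k := by
              refine norm_sum_le_of_le _ fun k hk => ?_
              have hk' := Finset.mem_range.mp hk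
              have g1 : ‖α + k‖ ≤ n + a := by
                refine (norm_add_le _ _).trans ?_
                have : (k : ℝ) ≤ n := by exact_mod_cast hk'.le
                simp [a]; linarith
              have g2 : ‖(α + k) * tc A (n - k) + tc B (n - k)‖
                  ≤ (n + a + 1) * (M * R ^ (n - k)) := by
                refine (norm_add_le _ _).trans ?_
                rw [norm_mul]
                have : ‖α + k‖ * ‖tc A (n - k)‖ ≤ (n + a) * (M * R ^ (n - k)) := by
                  gcongr; exact hAb _
                linarith [hBb (n - k)]
              rw [norm_mul]
              calc _ ≤ (n + a + 1) * (M * R ^ (n - k)) * (C * (2 * R) ^ k) := by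
                    gcongr; exact ih k hk'
                _ = (n + a + 1) * M * C * (R ^ (n - k) * R ^ k) * 2 ^ k := by
                    rw [mul_pow]; ring
                _ = _ := by rw [← pow_add, Nat.sub_add_cancel hk'.le]
          _ = (n + a + 1) * M * C * R ^ n * ∑ k ∈ Finset.range n, (2 : ℝ) ^ k := by
              rw [Finset.mul_sum]
          _ ≤ (n + a + 1) * M * C * R ^ n * 2 ^ n := by
              have : ∑ k ∈ Finset.range n, (2 : ℝ) ^ k ≤ 2 ^ n := by
                rw [geom_sum_eq (by norm_num)]; norm_num
              gcongr
          _ = _ := by rw [mul_pow]; ring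
      have h7 : ‖F‖ * ‖c n‖ ≤ (n + a + 1) * M * (C * (2 * R) ^ n) := by
        rw [← norm_mul, h5, norm_neg]; exact h6
      have h8 : (0 : ℝ) < (n + a + 1) * M := by positivity
      have h9 : (n + a + 1) * M * ‖c n‖ ≤ (n + a + 1) * M * (C * (2 * R) ^ n) :=
        le_trans (by gcongr) h7
      exact le_of_mul_le_mul_left h9 h8

lemma IsRec.exists_solution {A B : ℂ → ℂ} {α : ℂ} {c : ℕ → ℂ} (hA : AnalyticAt ℂ A 0)
    (hB : AnalyticAt ℂ B 0) (hc : IsRec (tc A) (tc B) α c) :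
    ∃ f : ℂ → ℂ, AnalyticAt ℂ f 0 ∧ tc f = c ∧ ∀ᶠ x in 𝓝 0, op A B α f x = 0 := by
  obtain ⟨f, hf, hfc⟩ := hc.exists_analyticAt hA hB
  exact ⟨f, hf, hfc, (op_eventually_eq_zero_iff α hA hB hf).mpr (hfc ▸ hc)⟩

/-! ### Branches of powers -/

/-- Continuity of a branch of the logarithm suffices: as a local inverse of the exponential it is
automatically differentiable. -/
lemma hasDerivAt_of_exp_eq {U : Set ℂ} {L : ℂ → ℂ} (hU : IsOpen U) (hL : ContinuousOn L U) {z₀ : ℂ}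
    (hexp : ∀ z ∈ U, Complex.exp (L z) = z - z₀) {z : ℂ} (hz : z ∈ U) :
    HasDerivAt L (z - z₀)⁻¹ z := by
  have h1 : HasDerivAt (fun w => Complex.exp w + z₀) (Complex.exp (L z)) (L z) :=
    (Complex.hasDerivAt_exp _).add_const _
  have h2 := h1.of_local_left_inverse (hL.continuousAt (hU.mem_nhds hz)) (Complex.exp_ne_zero _)
    (by filter_upwards [hU.mem_nhds hz] with w hw; rw [hexp w hw]; ring)
  rwa [hexp z hz] at h2

/-- Since x∂ multiplies x^α by α, conjugating with a branch of x^α shifts the parameter of the Euler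
operator by α. -/
lemma eul_exp_mul {U : Set ℂ} {L h : ℂ → ℂ} (hU : IsOpen U) (h0 : (0 : ℂ) ∉ U)
    (hL : ContinuousOn L U) (hexp : ∀ z ∈ U, Complex.exp (L z) = z) (α β : ℂ) {z : ℂ} (hz : z ∈ U)
    (hh : DifferentiableAt ℂ h z) :
    eul β (fun w => Complex.exp (α * L w) * h w) z = Complex.exp (α * L z) * eul (α + β) h z := by
  have hz0 : z ≠ 0 := fun h => h0 (h ▸ hz)
  have h1 : HasDerivAt L z⁻¹ z := by
    have := hasDerivAt_of_exp_eq (z₀ := 0) hU hL (by simpa using hexp) hz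
    simpa using this
  have h2 := ((h1.const_mul α).cexp).mul hh.hasDerivAt
  have h3 : deriv (fun w => Complex.exp (α * L w) * h w) z
      = Complex.exp (α * L z) * (α * z⁻¹) * h z + Complex.exp (α * L z) * deriv h z := h2.deriv
  rw [eul, h3, eul]
  field_simp
  ring

lemma op_exp_mul {U : Set ℂ} {A B L h : ℂ → ℂ} (hU : IsOpen U) (h0 : (0 : ℂ) ∉ U)
    (hL : ContinuousOn L U) (hexp : ∀ z ∈ U, Complex.exp (L z) = z) (α : ℂ)
    (hh : ∀ z ∈ U, AnalyticAt ℂ h z) {z : ℂ} (hz : z ∈ U) :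
    op A B 0 (fun w => Complex.exp (α * L w) * h w) z
      = Complex.exp (α * L z) * op A B α h z := by
  have e (β : ℂ) (g : ℂ → ℂ) (hg : ∀ z ∈ U, AnalyticAt ℂ g z) (w : ℂ) (hw : w ∈ U) :
      eul β (fun w => Complex.exp (α * L w) * g w) =ᶠ[𝓝 w]
        fun w => Complex.exp (α * L w) * eul (α + β) g w := by
    filter_upwards [hU.mem_nhds hw] with v hv
    exact eul_exp_mul hU h0 hL hexp α β hv (hg v hv).differentiableAt
  have a1 : ∀ z ∈ U, AnalyticAt ℂ (eul (α + (0 - 2)) h) z := fun z hz => analyticAt_eul _ (hh z hz)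
  have a2 : ∀ z ∈ U, AnalyticAt ℂ (eul (α + (0 - 1)) (eul (α + (0 - 2)) h)) z :=
    fun z hz => analyticAt_eul _ (a1 z hz)
  have e1 := (eul_congr 0 ((eul_congr (0 - 1) (e (0 - 2) h hh z hz)).trans
    (e (0 - 1) _ a1 z hz))).trans (e 0 _ a2 z hz)
  rw [op, e1.eq_of_nhds, (e 0 h hh z hz).eq_of_nhds, op]
  simp only [add_zero, zero_sub, ← sub_eq_add_neg]
  ring

/-! ### Solutions near an ordinary point -/

/-- Multiplied by x³, the equation at an ordinary point has indicial polynomial n(n - 1)(n - 2),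
which does not vanish for n ≥ 3; each later coefficient is determined by the earlier ones. -/
lemma IsRec.eq_zero_of_ordinary {a b : ℕ → ℂ} {c : ℕ → ℂ} (hc : IsRec a b 0 c)
    (ha : a 0 = 0) (hb : b 0 = 0) (h0 : c 0 = 0) (h1 : c 1 = 0) (h2 : c 2 = 0) (n : ℕ) :
    c n = 0 := by
  induction n using Nat.strong_induction_on with
  | _ n ih =>
    rcases n with _ | _ | _ | n
    · exact h0
    · exact h1
    · exact h2
    · have h3 := hc (n + 3)
      rw [Finset.sum_range_succ, Finset.sum_eq_zero fun k hk => by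
        rw [ih k (Finset.mem_range.mp hk), mul_zero], Nat.sub_self, ha, hb] at h3
      have h4 : ((0 : ℂ) + (n + 3 : ℕ)) * (0 + (n + 3 : ℕ) - 1) * (0 + (n + 3 : ℕ) - 2) ≠ 0 := by
        have e1 : ((0 : ℂ) + (n + 3 : ℕ)) * (0 + (n + 3 : ℕ) - 1) * (0 + (n + 3 : ℕ) - 2)
          = ((n + 3) * (n + 2) * (n + 1) : ℕ) := by push_cast; ring
        rw [e1]; exact Nat.cast_ne_zero.mpr (by positivity)
      change c (n + 3) = 0
      simp only [mul_zero, add_zero, zero_mul, zero_add] at h3 h4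
      exact (mul_eq_zero.mp h3).resolve_left h4

/-- The recursion at an ordinary point, with the first three coefficients prescribed. -/
def ordCoeff (a b : ℕ → ℂ) (i : Fin 3 → ℂ) : ℕ → ℂ
  | 0 => i 0
  | 1 => i 1
  | 2 => i 2
  | n + 3 => -(((n : ℂ) + 3) * (n + 2) * (n + 1))⁻¹ *
      ∑ k : Fin (n + 3), ((k : ℕ) * a (n + 3 - k) + b (n + 3 - k)) * ordCoeff a b i k
  termination_by n => n
  decreasing_by exact k.2

lemma isRec_ordCoeff {a b : ℕ → ℂ} (ha0 : a 0 = 0) (ha1 : a 1 = 0) (hb0 : b 0 = 0) (hb1 : b 1 = 0)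
    (hb2 : b 2 = 0) (i : Fin 3 → ℂ) : IsRec a b 0 (ordCoeff a b i) := by
  intro n
  rcases n with _ | _ | _ | n
  · simp [ha0, hb0]
  · simp [Finset.sum_range_succ, ha0, hb0, hb1]
  · simp [Finset.sum_range_succ, ha0, hb0, hb1, ha1, hb2]
  · rw [Finset.sum_range_succ, Nat.sub_self, ha0, hb0]
    conv_lhs => enter [1, 2]; rw [ordCoeff]
    have h1 : ((n : ℂ) + 3) * (n + 2) * (n + 1) ≠ 0 := by
      have e1 : ((n : ℂ) + 3) * (n + 2) * (n + 1) = ((n + 3) * (n + 2) * (n + 1) : ℕ) := by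
        push_cast; ring
      rw [e1]; exact Nat.cast_ne_zero.mpr (by positivity)
    have h2 : ∑ k ∈ Finset.range (n + 3), ((0 + (k : ℂ)) * a (n + 3 - k) + b (n + 3 - k))
        * ordCoeff a b i k = ∑ k : Fin (n + 3), ((k : ℕ) * a (n + 3 - k) + b (n + 3 - k))
        * ordCoeff a b i k := by
      rw [Finset.sum_range]; simp
    rw [h2]
    have e2 : ((0 : ℂ) + (n + 1 + 1 + 1 : ℕ)) * (0 + (n + 1 + 1 + 1 : ℕ) - 1)
        * (0 + (n + 1 + 1 + 1 : ℕ) - 2) = ((n : ℂ) + 3) * (n + 2) * (n + 1) := by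
      push_cast; ring
    rw [e2, neg_mul, mul_neg, mul_inv_cancel_left₀ h1]
    ring

lemma analyticAt_pow_mul {f : ℂ → ℂ} {z : ℂ} (hf : AnalyticAt ℂ f z) (k : ℕ) :
    AnalyticAt ℂ (fun x => x ^ k * f x) z :=
  (analyticAt_id.pow k).mul hf

section Ordinary

variable {q₂ q₃ : ℂ → ℂ} {p : ℂ}

lemma iteratedDeriv_three_comp_const_add (y : ℂ → ℂ) (p x : ℂ) :
    iteratedDeriv 3 (fun x => y (p + x)) x = iteratedDeriv 3 y (p + x) := by
  rw [iteratedDeriv_comp_const_add]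

lemma op_shift {y : ℂ → ℂ} {x : ℂ} (hy : AnalyticAt ℂ y (p + x)) :
    op (fun x => x ^ 2 * q₂ (p + x)) (fun x => x ^ 3 * q₃ (p + x)) 0 (fun x => y (p + x)) x
      = x ^ 3 * (iteratedDeriv 3 y (p + x) + q₂ (p + x) * deriv y (p + x)
        + q₃ (p + x) * y (p + x)) := by
  have hy' : AnalyticAt ℂ (fun x => y (p + x)) x := by
    apply AnalyticAt.fun_comp (g := y) hy (by fun_prop)
  rw [op_zero_eq _ _ hy', iteratedDeriv_three_comp_const_add, deriv_comp_const_add]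
  ring

lemma analyticAt_shift {f : ℂ → ℂ} (hf : AnalyticAt ℂ f p) :
    AnalyticAt ℂ (fun x => f (p + x)) 0 := by
  apply AnalyticAt.fun_comp (g := f) (by simpa using hf) (by fun_prop)

lemma tendsto_add_left_zero (p : ℂ) : Tendsto (fun x : ℂ => p + x) (𝓝 0) (𝓝 p) := by
  have : ContinuousAt (fun x : ℂ => p + x) 0 := by fun_prop
  simpa [ContinuousAt] using this

lemma tendsto_sub_right_zero (p : ℂ) : Tendsto (fun x : ℂ => x - p) (𝓝 p) (𝓝 0) := by
  have : ContinuousAt (fun x : ℂ => x - p) p := by fun_prop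
  simpa [ContinuousAt] using this

lemma taylor_pow_mul_low {f : ℂ → ℂ} (hf : AnalyticAt ℂ f 0) {k n : ℕ} (hn : n < k) :
    tc (fun x => x ^ k * f x) n = 0 := by
  rw [← coeff_taylor, taylor_pow_mul hf, PowerSeries.coeff_X_pow_mul', if_neg (by omega)]

lemma eventually_eq_zero_of_jet (h₂ : AnalyticAt ℂ q₂ p) (h₃ : AnalyticAt ℂ q₃ p) {y : ℂ → ℂ}
    (hy : AnalyticAt ℂ y p)
    (heq : ∀ᶠ z in 𝓝 p, iteratedDeriv 3 y z + q₂ z * deriv y z + q₃ z * y z = 0)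
    (hj : ∀ i : Fin 3, iteratedDeriv i y p = 0) : ∀ᶠ z in 𝓝 p, y z = 0 := by
  have a2 := analyticAt_shift h₂
  have a3 := analyticAt_shift h₃
  have ay := analyticAt_shift hy
  have hop : ∀ᶠ x in 𝓝 0, op (fun x => x ^ 2 * q₂ (p + x)) (fun x => x ^ 3 * q₃ (p + x)) 0
      (fun x => y (p + x)) x = 0 := by
    filter_upwards [(tendsto_add_left_zero p).eventually heq,
      (tendsto_add_left_zero p).eventually hy.eventually_analyticAt] with x hx hx'
    rw [op_shift hx', hx, mul_zero]
  rw [op_eventually_eq_zero_iff 0 (analyticAt_pow_mul a2 2) (analyticAt_pow_mul a3 3) ay] at hop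
  have htc : ∀ n, iteratedDeriv n y p = 0 → tc (fun x => y (p + x)) n = 0 := by
    intro n hn
    rw [tc, iteratedDeriv_comp_const_add]; simp [hn]
  have hz := hop.eq_zero_of_ordinary (taylor_pow_mul_low a2 (by norm_num))
    (taylor_pow_mul_low a3 (by norm_num)) (htc 0 (hj 0)) (htc 1 (hj 1)) (htc 2 (hj 2))
  have h4 := eventually_eq_zero_of_taylor ay (by ext n; rw [coeff_taylor, hz]; simp)
  filter_upwards [(tendsto_sub_right_zero p).eventually h4] with z hz
  simpa using hz

lemma exists_local_solution (h₂ : AnalyticAt ℂ q₂ p) (h₃ : AnalyticAt ℂ q₃ p) (i : Fin 3 → ℂ) :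
    ∃ y : ℂ → ℂ, AnalyticAt ℂ y p ∧
      (∀ᶠ z in 𝓝 p, iteratedDeriv 3 y z + q₂ z * deriv y z + q₃ z * y z = 0) ∧
      ∀ j : Fin 3, iteratedDeriv j y p = (j : ℕ).factorial * i j := by
  have a2 := analyticAt_shift h₂
  have a3 := analyticAt_shift h₃
  have hrec := isRec_ordCoeff (a := tc fun x => x ^ 2 * q₂ (p + x))
    (b := tc fun x => x ^ 3 * q₃ (p + x)) (taylor_pow_mul_low a2 (by norm_num))
    (taylor_pow_mul_low a2 (by norm_num)) (taylor_pow_mul_low a3 (by norm_num))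
    (taylor_pow_mul_low a3 (by norm_num)) (taylor_pow_mul_low a3 (by norm_num)) i
  obtain ⟨f, hf, hfc, hop⟩ := hrec.exists_solution (analyticAt_pow_mul a2 2)
    (analyticAt_pow_mul a3 3)
  have hy : AnalyticAt ℂ (fun z => f (z - p)) p := by
    apply AnalyticAt.fun_comp (g := f) (by simpa using hf) (by fun_prop)
  refine ⟨fun z => f (z - p), hy, ?_, fun j => ?_⟩
  · set y := fun z => f (z - p)
    have e1 : ∀ x, y (p + x) = f x := fun x => by simp [y]
    have hy3 : AnalyticAt ℂ (iteratedDeriv 3 y) p := by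
      rw [iteratedDeriv_eq_iterate]; exact hy.iterated_deriv 3
    have hE : AnalyticAt ℂ (fun z => iteratedDeriv 3 y z + q₂ z * deriv y z + q₃ z * y z) p :=
      (hy3.add (h₂.mul hy.deriv)).add (h₃.mul hy)
    -- The recursion encodes x³ times the equation, hence the equation only for x ≠ 0; analyticity
    -- extends it to x = 0.
    have h5 : ∀ᶠ x in 𝓝[≠] 0, iteratedDeriv 3 y (p + x) + q₂ (p + x) * deriv y (p + x)
        + q₃ (p + x) * y (p + x) = 0 := by
      filter_upwards [hop.filter_mono nhdsWithin_le_nhds, eventually_mem_nhdsWithin,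
        ((tendsto_add_left_zero p).eventually hy.eventually_analyticAt).filter_mono
          nhdsWithin_le_nhds] with x hx hx0 hxa
      have h6 := op_shift (q₂ := q₂) (q₃ := q₃) hxa
      rw [show (fun x => y (p + x)) = f from funext e1, hx] at h6
      exact (mul_eq_zero.mp h6.symm).resolve_left (pow_ne_zero _ hx0)
    have h7 := (analyticAt_shift hE).frequently_zero_iff_eventually_zero.mp h5.frequently
    filter_upwards [(tendsto_sub_right_zero p).eventually h7] with z hz
    simpa using hz
  · have h6 : iteratedDeriv j (fun z => f (z - p)) p = iteratedDeriv j f 0 := by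
      rw [iteratedDeriv_comp_sub_const]; simp
    rw [h6]
    have h7 : tc f j = i j := by
      rw [hfc]
      fin_cases j <;> simp [ordCoeff]
    have h1 : ((j : ℕ).factorial : ℂ) ≠ 0 := by exact_mod_cast (j : ℕ).factorial_ne_zero
    rw [← h7, tc]; field_simp

end Ordinary

/-- Three solutions with independent germs span the solutions on a connected open set. -/
lemma exists_combination {q₂ q₃ : ℂ → ℂ} {U : Set ℂ} (hU : IsOpen U) (hUc : IsPreconnected U)
    {p : ℂ} (hp : p ∈ U) (h₂ : AnalyticAt ℂ q₂ p) (h₃ : AnalyticAt ℂ q₃ p) {Y : Fin 3 → ℂ → ℂ}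
    (hY : ∀ i, IsSolutionOn q₂ q₃ U (Y i))
    (hind : ∀ c : Fin 3 → ℂ, (∀ᶠ z in 𝓝 p, ∑ i, c i * Y i z = 0) → c = 0)
    {y : ℂ → ℂ} (hy : IsSolutionOn q₂ q₃ U y) :
    ∃ c : Fin 3 → ℂ, ∀ z ∈ U, y z = ∑ i, c i * Y i z := by
  have ha : ∀ f : ℂ → ℂ, DifferentiableOn ℂ f U → ∀ z ∈ U, AnalyticAt ℂ f z :=
    fun f hf z hz => hf.analyticAt (hU.mem_nhds hz)
  have hsum : ∀ (c : Fin 3 → ℂ) (n : ℕ), ∀ z ∈ U,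
      iteratedDeriv n (fun z => ∑ i, c i * Y i z) z = ∑ i, c i * iteratedDeriv n (Y i) z := by
    intro c n z hz
    rw [iteratedDeriv_fun_sum (f := fun i z => c i * Y i z)
      fun i _ => (analyticAt_const.mul (ha _ (hY i).1 z hz)).contDiffAt]
    refine Finset.sum_congr rfl fun i _ => ?_
    rw [iteratedDeriv_const_mul_field]
  have hcomb : ∀ c : Fin 3 → ℂ, IsSolutionOn q₂ q₃ U (fun z => ∑ i, c i * Y i z) := by
    intro c
    refine ⟨DifferentiableOn.fun_sum fun i _ => (hY i).1.const_mul _, fun z hz => ?_⟩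
    have h1 := hsum c 1 z hz
    simp only [iteratedDeriv_one] at h1
    rw [hsum c 3 z hz, h1, Finset.mul_sum, Finset.mul_sum, ← Finset.sum_add_distrib,
      ← Finset.sum_add_distrib]
    refine Finset.sum_eq_zero fun i _ => ?_
    linear_combination (c i) * (hY i).2 z hz
  have hzero : ∀ w : ℂ → ℂ, IsSolutionOn q₂ q₃ U w → (∀ i : Fin 3, iteratedDeriv i w p = 0) →
      ∀ᶠ z in 𝓝 p, w z = 0 := by
    intro w hw hj
    exact eventually_eq_zero_of_jet h₂ h₃ (ha w hw.1 p hp)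
      (by filter_upwards [hU.mem_nhds hp] with z hz; exact hw.2 z hz) hj
  -- This is the Wronskian matrix at p. Independence of the germs and uniqueness for the initial
  -- value problem make it injective, hence surjective, so some combination has the same 2-jet at p
  -- as y.
  let Φ : (Fin 3 → ℂ) →ₗ[ℂ] (Fin 3 → ℂ) :=
    Matrix.toLin' (Matrix.of fun j i : Fin 3 => iteratedDeriv j (Y i) p)
  have hΦ : ∀ c j, Φ c j = iteratedDeriv j (fun z => ∑ i, c i * Y i z) p := by
    intro c j
    rw [hsum c j p hp]
    simp only [Φ, Matrix.toLin'_apply, Matrix.mulVec, dotProduct, Matrix.of_apply]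
    exact Finset.sum_congr rfl fun i _ => mul_comm _ _
  have hinj : Function.Injective Φ := by
    rw [injective_iff_map_eq_zero]
    intro c hc
    exact hind c (hzero _ (hcomb c) fun j => by rw [← hΦ, hc]; rfl)
  obtain ⟨c, hc⟩ := LinearMap.injective_iff_surjective.mp hinj
    (fun j : Fin 3 => iteratedDeriv j y p)
  refine ⟨c, ?_⟩
  have hdiff : IsSolutionOn q₂ q₃ U (fun z => y z - ∑ i, c i * Y i z) := by
    refine ⟨hy.1.sub (hcomb c).1, fun z hz => ?_⟩
    have e : ∀ n, iteratedDeriv n (fun z => y z - ∑ i, c i * Y i z) z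
        = iteratedDeriv n y z - iteratedDeriv n (fun z => ∑ i, c i * Y i z) z := fun n =>
      iteratedDeriv_fun_sub (ha y hy.1 z hz).contDiffAt (ha _ (hcomb c).1 z hz).contDiffAt
    have e1 := e 1
    simp only [iteratedDeriv_one] at e1
    rw [e 3, e1]
    linear_combination hy.2 z hz - (hcomb c).2 z hz
  have h6 := hzero _ hdiff fun j => by
    have e : iteratedDeriv j (fun z => y z - ∑ i, c i * Y i z) p
        = iteratedDeriv j y p - iteratedDeriv j (fun z => ∑ i, c i * Y i z) p :=
      iteratedDeriv_fun_sub (ha y hy.1 p hp).contDiffAt (ha _ (hcomb c).1 p hp).contDiffAt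
    rw [e, ← hΦ, hc, sub_self]
  have h7 : AnalyticOnNhd ℂ (fun z => y z - ∑ i, c i * Y i z) U := ha _ hdiff.1
  intro z hz
  have := h7.eqOn_zero_of_preconnected_of_eventuallyEq_zero hUc hp h6 hz
  exact sub_eq_zero.mp this

/-! ### The formal theory -/

/-- The coefficient sequence, indexed by integers, of a Laurent series with Taylor part `A`
after multiplication by `x^N`. -/
def lau (A : ℂ → ℂ) (N : ℕ) (n : ℤ) : ℂ := if 0 ≤ n + N then tc A (n + N).toNat else 0

lemma lau_sub {A : ℂ → ℂ} {N n k : ℕ} (hk : k ≤ n) :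
    lau A N ((n : ℤ) - k - N) = tc A (n - k) := by
  have h1 : (n : ℤ) - k - N + N = ((n - k : ℕ) : ℤ) := by omega
  rw [lau, h1, if_pos (by positivity), Int.toNat_natCast]

lemma frobeniusObstruction_eq {A B : ℂ → ℂ} (f : ℂ → ℂ) (α : ℂ) (n : ℕ) :
    frobeniusObstruction (lau A 2) (lau B 3) f α n
      = ∑ k ∈ Finset.range n, ((α + k) * tc A (n - k) + tc B (n - k))
        * frobeniusCoeff (lau A 2) (lau B 3) f α k := by
  refine Finset.sum_congr rfl fun k hk => ?_
  have hk' := (Finset.mem_range.mp hk).le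
  rw [← lau_sub (N := 2) hk', ← lau_sub (N := 3) hk']
  rfl

lemma frobeniusCoeff_of_eq_zero {R : Type*} [CommRing R] [Algebra ℂ R] (a b : ℤ → R) (f : ℂ → ℂ)
    (α : ℂ) {n : ℕ} (hn : n ≠ 0) (h : f (α + n) = 0) : frobeniusCoeff a b f α n = 0 := by
  obtain ⟨n, rfl⟩ := Nat.exists_eq_succ_of_ne_zero hn
  rw [Nat.succ_eq_add_one] at h ⊢
  rw [frobeniusCoeff, if_pos h]

lemma frobeniusCoeff_of_ne_zero {R : Type*} [CommRing R] [Algebra ℂ R] (a b : ℤ → R) (f : ℂ → ℂ)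
    (α : ℂ) {n : ℕ} (hn : n ≠ 0) (h : f (α + n) ≠ 0) : frobeniusCoeff a b f α n
      = -((f (α + n))⁻¹ • frobeniusObstruction a b f α n) := by
  obtain ⟨n, rfl⟩ := Nat.exists_eq_succ_of_ne_zero hn
  rw [Nat.succ_eq_add_one] at h ⊢
  rw [frobeniusCoeff, if_neg h, frobeniusObstruction, Finset.sum_range]

lemma frobeniusCoeff_zero {R : Type*} [CommRing R] [Algebra ℂ R] (a b : ℤ → R) (f : ℂ → ℂ)
    (α : ℂ) : frobeniusCoeff a b f α 0 = 1 := by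
  rw [frobeniusCoeff]

section Exponents

variable {A B : ℂ → ℂ} {κ : Fin 3 → ℚ}

/-- The indicial polynomial. -/
def ind (κ : Fin 3 → ℚ) (x : ℂ) : ℂ := ∏ k, (x - (κ k : ℂ))

lemma ind_eq_zero_iff (x : ℂ) : ind κ x = 0 ↔ ∃ k, x = κ k := by
  simp [ind, Finset.prod_eq_zero_iff, sub_eq_zero]

/-- The standing assumptions on the exponents at a singular point. -/
structure IsExponents (A B : ℂ → ℂ) (κ : Fin 3 → ℚ) : Prop where
  anA : AnalyticAt ℂ A 0
  anB : AnalyticAt ℂ B 0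
  mono : StrictMono κ
  int : ∀ i j, ∃ n : ℤ, κ i - κ j = n
  indicial : ∀ x : ℂ, x * (x - 1) * (x - 2) + A 0 * x + B 0 = ind κ x

lemma exists_nat_diff (hint : ∀ i j, ∃ n : ℤ, κ i - κ j = n) (hmono : StrictMono κ) {i j : Fin 3}
    (hij : i < j) : ∃ n : ℕ, 0 < n ∧ ⌊κ j - κ i⌋₊ = n ∧ (κ j : ℂ) = κ i + n := by
  obtain ⟨n, hn⟩ := hint j i
  have h1 : 0 < κ j - κ i := sub_pos.mpr (hmono hij)
  rw [hn] at h1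
  have h2 : 0 < n := by exact_mod_cast h1
  obtain ⟨k, rfl⟩ := Int.eq_ofNat_of_zero_le h2.le
  refine ⟨k, by exact_mod_cast h2, by rw [hn]; simp, ?_⟩
  have h3 : κ j = κ i + k := by rw [← sub_eq_iff_eq_add']; rw [hn]; simp
  rw [h3]; push_cast; ring

lemma ind_exponent (i : Fin 3) : ind κ (κ i) = 0 := (ind_eq_zero_iff _).mpr ⟨i, rfl⟩

variable (h : IsExponents A B κ)
include h

lemma IsExponents.isRec_iff {α : ℂ} {c : ℕ → ℂ} : IsRec (tc A) (tc B) α c ↔ ∀ n : ℕ,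
    ind κ (α + n) * c n
      + ∑ k ∈ Finset.range n, ((α + k) * tc A (n - k) + tc B (n - k)) * c k = 0 := by
  refine forall_congr' fun n => ?_
  rw [Finset.sum_range_succ, Nat.sub_self, tc_zero, tc_zero, ← h.indicial]
  constructor <;> intro h1 <;> linear_combination h1

/-- A formal solution with leading coefficient `1` at an exponent, normalised at the higher
exponents, is the Frobenius solution. -/
lemma IsExponents.eq_frobeniusCoeff {i : Fin 3} {c : ℕ → ℂ} (hc : IsRec (tc A) (tc B) (κ i) c)
    (h0 : c 0 = 1) (hz : ∀ n : ℕ, n ≠ 0 → ind κ (κ i + n) = 0 → c n = 0) (n : ℕ) :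
    c n = frobeniusCoeff (lau A 2) (lau B 3) (ind κ) (κ i) n := by
  induction n using Nat.strong_induction_on with
  | _ n ih =>
    by_cases hn : n = 0
    · rw [hn, h0, frobeniusCoeff_zero]
    by_cases hf : ind κ (κ i + n) = 0
    · rw [hz n hn hf, frobeniusCoeff_of_eq_zero _ _ _ _ hn hf]
    · have h1 := h.isRec_iff.mp hc n
      rw [frobeniusCoeff_of_ne_zero _ _ _ _ hn hf, frobeniusObstruction_eq, smul_eq_mul]
      rw [Finset.sum_congr rfl fun k hk => by rw [ih k (Finset.mem_range.mp hk)]] at h1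
      apply mul_left_cancel₀ hf
      rw [mul_neg, mul_inv_cancel_left₀ hf]
      linear_combination h1

/-- The Frobenius series are formal solutions if the obstructions vanish. -/
lemma IsExponents.isRec_frobeniusCoeff {i : Fin 3}
    (hP : ∀ j, i < j → frobeniusObstruction (lau A 2) (lau B 3) (ind κ) (κ i) ⌊κ j - κ i⌋₊ = 0) :
    IsRec (tc A) (tc B) (κ i) (frobeniusCoeff (lau A 2) (lau B 3) (ind κ) (κ i)) := by
  rw [h.isRec_iff]
  intro n
  rw [← frobeniusObstruction_eq]
  by_cases hn : n = 0
  · subst hn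
    simp [ind_exponent, frobeniusObstruction]
  by_cases hf : ind κ (κ i + n) = 0
  · rw [hf, zero_mul, zero_add]
    obtain ⟨j, hj⟩ := (ind_eq_zero_iff _).mp hf
    have h1 : κ i + n = κ j := by exact_mod_cast hj
    have h2 : (0 : ℚ) < n := by exact_mod_cast Nat.pos_of_ne_zero hn
    have h3 : i < j := h.mono.lt_iff_lt.mp (by linarith)
    rw [← hP j h3, show κ j - κ i = n by linarith, Nat.floor_natCast]
  · rw [frobeniusCoeff_of_ne_zero _ _ _ _ hn hf, smul_eq_mul]
    field_simp
    ring

/-- Three independent formal solutions in `x^α ℂ[[x]]` force the obstructions to vanish. -/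
lemma IsExponents.obstruction_eq_zero {α : ℂ} (hα : ∃ n : ℤ, (κ 0 : ℂ) = α + n)
    {d : Fin 3 → ℕ → ℂ} (hd : ∀ i, IsRec (tc A) (tc B) α (d i))
    (hind : ∀ l : Fin 3 → ℂ, (∀ n, ∑ i, l i * d i n = 0) → l = 0) {i j : Fin 3} (hij : i < j) :
    frobeniusObstruction (lau A 2) (lau B 3) (ind κ) (κ i) ⌊κ j - κ i⌋₊ = 0 := by
  have hN : ∀ i, ∃ n : ℤ, (κ i : ℂ) = α + n := by
    intro i
    obtain ⟨n, hn⟩ := hα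
    obtain ⟨m, hm⟩ := h.int i 0
    refine ⟨n + m, ?_⟩
    have : (κ i : ℂ) = κ 0 + m := by
      rw [← sub_eq_iff_eq_add']; exact_mod_cast hm
    rw [this, hn]; push_cast; ring
  choose N hN using hN
  let ev (c : ℕ → ℂ) (n : ℤ) : ℂ := if 0 ≤ n then c n.toNat else 0
  have hcomb : ∀ l : Fin 3 → ℂ, IsRec (tc A) (tc B) α (fun n => ∑ i, l i * d i n) := by
    intro l n
    have h1 : ∀ k : ℕ, ((α + k) * tc A (n - k) + tc B (n - k)) * ∑ i, l i * d i k
        = ∑ i, l i * (((α + k) * tc A (n - k) + tc B (n - k)) * d i k) := by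
      intro k
      rw [Finset.mul_sum]; exact Finset.sum_congr rfl fun i _ => by ring
    simp only [h1]
    rw [Finset.sum_comm, Finset.mul_sum, ← Finset.sum_add_distrib]
    refine Finset.sum_eq_zero fun i _ => ?_
    rw [← Finset.mul_sum]
    linear_combination l i * hd i n
  -- Φ reads off the coefficients of a combination at the three exponents, an exponent below α
  -- counting as coefficient 0. A formal solution is determined by these coefficients, since
  -- elsewhere the indicial polynomial is nonzero; so Φ is injective, hence bijective.
  let Φ : (Fin 3 → ℂ) →ₗ[ℂ] (Fin 3 → ℂ) :=
    Matrix.toLin' (Matrix.of fun j i : Fin 3 => ev (d i) (N j))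
  have hΦ : ∀ l j, Φ l j = ev (fun n => ∑ i, l i * d i n) (N j) := by
    intro l j
    simp only [Φ, Matrix.toLin'_apply, Matrix.mulVec, dotProduct, Matrix.of_apply, ev]
    split_ifs with h0
    · exact Finset.sum_congr rfl fun i _ => mul_comm _ _
    · simp
  have hroot : ∀ n : ℕ, ind κ (α + n) = 0 → ∃ j, N j = n := by
    intro n hn
    obtain ⟨j, hj⟩ := (ind_eq_zero_iff _).mp hn
    refine ⟨j, ?_⟩
    rw [hN j] at hj
    have := add_left_cancel hj
    exact_mod_cast this.symm
  have hstep : ∀ c : ℕ → ℂ, IsRec (tc A) (tc B) α c → ∀ n : ℕ, (∀ m < n, c m = 0) →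
      ind κ (α + n) ≠ 0 → c n = 0 := by
    intro c hc n hm hn
    have h1 := h.isRec_iff.mp hc n
    rw [Finset.sum_eq_zero fun k hk => by rw [hm k (Finset.mem_range.mp hk), mul_zero],
      add_zero] at h1
    exact (mul_eq_zero.mp h1).resolve_left hn
  have hinj : Function.Injective Φ := by
    rw [injective_iff_map_eq_zero]
    intro l hl
    refine hind l fun n => ?_
    induction n using Nat.strong_induction_on with
    | _ n ih =>
      by_cases hn : ind κ (α + n) = 0
      · obtain ⟨j, hj⟩ := hroot n hn
        have h1 := hΦ l j
        rw [hl, hj] at h1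
        simpa [ev] using h1.symm
      · exact hstep _ (hcomb l) n ih hn
  -- The combination with coefficient 1 at κ i and 0 at the other exponents starts at κ i and is the
  -- normalised Frobenius series there. That it satisfies the recursion in degree κ j - κ i, where
  -- the indicial polynomial vanishes, is the vanishing of the obstruction.
  obtain ⟨l, hl⟩ := LinearMap.injective_iff_surjective.mp hinj (Pi.single i 1)
  set e := fun n => ∑ i, l i * d i n
  have he : IsRec (tc A) (tc B) α e := hcomb l
  have hev : ∀ j, ev e (N j) = (Pi.single i 1 : Fin 3 → ℂ) j := fun j => by rw [← hΦ, hl]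
  have hNi : 0 ≤ N i := by
    by_contra hneg
    have h1 := hev i
    simp [ev, hneg] at h1
  obtain ⟨s, hs⟩ := Int.eq_ofNat_of_zero_le hNi
  have hes : e s = 1 := by
    have h1 := hev i
    rw [hs] at h1
    simpa [ev] using h1
  have hez : ∀ n : ℕ, n ≠ s → ind κ (α + n) = 0 → e n = 0 := by
    intro n hn hn0
    obtain ⟨j, hj⟩ := hroot n hn0
    have h1 := hev j
    have hji : j ≠ i := by
      rintro rfl
      rw [hs] at hj; exact hn (by exact_mod_cast hj.symm)
    rw [hj, Pi.single_eq_of_ne hji] at h1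
    simpa [ev] using h1
  have hlow : ∀ n < s, e n = 0 := by
    intro n
    induction n using Nat.strong_induction_on with
    | _ n ih =>
      intro hns
      by_cases hn : ind κ (α + n) = 0
      · exact hez n hns.ne hn
      · exact hstep e he n (fun m hm => ih m hm (hm.trans hns)) hn
  have hκi : (κ i : ℂ) = α + s := by rw [hN i, hs]; simp
  have hshift : IsRec (tc A) (tc B) (κ i) (fun n => e (s + n)) := by
    rw [h.isRec_iff]
    intro n
    have h1 := h.isRec_iff.mp he (s + n)
    rw [Finset.sum_range_add, Finset.sum_eq_zero fun k hk => by
      rw [hlow k (Finset.mem_range.mp hk), mul_zero], zero_add] at h1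
    rw [hκi, ← h1]
    push_cast
    congr 1
    · ring_nf
    · refine Finset.sum_congr rfl fun k _ => ?_
      rw [Nat.add_sub_add_left]; ring
  have hfro := h.eq_frobeniusCoeff hshift (by simpa using hes) fun n hn hn0 => by
    refine hez _ (by omega) ?_
    rw [← hn0, hκi]; push_cast; ring_nf
  obtain ⟨n, hn, hfl, hκj⟩ := exists_nat_diff h.int h.mono hij
  rw [hfl, frobeniusObstruction_eq]
  have h1 := h.isRec_iff.mp hshift n
  rw [← hκj, ind_exponent, zero_mul, zero_add] at h1
  rw [← h1]
  exact Finset.sum_congr rfl fun k _ => by rw [← hfro]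

end Exponents

/-! ### Independence of powers with exponents distinct modulo `ℤ` -/

/-- Translation by 2πi fixes exp s and multiplies exp(c s) by exp(2πi c). Subtracting exp(2πi a)
times the relation from its translate eliminates the term with exponent a, and the other terms
acquire nonzero factors; this permits induction on the number of terms. -/
lemma eq_zero_of_sum_exp_mul_eq_zero {S : Finset ℂ} {M : ℝ}
    (hS : ∀ c ∈ S, ∀ d ∈ S, Complex.exp (2 * Real.pi * Complex.I * c)
      = Complex.exp (2 * Real.pi * Complex.I * d) → c = d) {g : ℂ → ℂ → ℂ}
    (h : ∀ s : ℂ, s.re < M → ∑ c ∈ S, Complex.exp (c * s) * g c (Complex.exp s) = 0) :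
    ∀ c ∈ S, ∀ s : ℂ, s.re < M → g c (Complex.exp s) = 0 := by
  classical
  induction S using Finset.induction_on generalizing g with
  | empty => simp
  | insert a S ha ih =>
    have h1 : ∀ s : ℂ, s.re < M → ∑ c ∈ S, Complex.exp (c * s) *
        ((Complex.exp (2 * Real.pi * Complex.I * c) - Complex.exp (2 * Real.pi * Complex.I * a))
          * g c (Complex.exp s)) = 0 := by
      intro s hs
      have e1 := h s hs
      have e2 := h (s + 2 * Real.pi * Complex.I) (by simpa using hs)
      rw [Finset.sum_insert ha] at e1 e2
      simp only [Complex.exp_add s, mul_add, Complex.exp_add (_ * s),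
        Complex.exp_two_pi_mul_I, mul_one] at e2
      have e3 : ∑ c ∈ S, Complex.exp (c * s) *
        ((Complex.exp (2 * Real.pi * Complex.I * c) - Complex.exp (2 * Real.pi * Complex.I * a))
          * g c (Complex.exp s)) = ∑ c ∈ S, Complex.exp (c * s) *
            Complex.exp (c * (2 * Real.pi * Complex.I)) * g c (Complex.exp s)
          - Complex.exp (a * (2 * Real.pi * Complex.I)) *
            ∑ c ∈ S, Complex.exp (c * s) * g c (Complex.exp s) := by
        rw [Finset.mul_sum, ← Finset.sum_sub_distrib]
        refine Finset.sum_congr rfl fun c _ => ?_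
        rw [mul_comm c (2 * _ * _), mul_comm a (2 * _ * _)]; ring
      rw [e3]
      linear_combination e2 - Complex.exp (a * (2 * Real.pi * Complex.I)) * e1
    have h2 := ih (g := fun c w => (Complex.exp (2 * Real.pi * Complex.I * c)
      - Complex.exp (2 * Real.pi * Complex.I * a)) * g c w) (fun c hc d hd => hS c (by simp [hc]) d (by simp [hd])) h1
    have h3 : ∀ c ∈ S, ∀ s : ℂ, s.re < M → g c (Complex.exp s) = 0 := by
      intro c hc s hs
      refine (mul_eq_zero.mp (h2 c hc s hs)).resolve_left fun h0 => ?_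
      have := hS c (by simp [hc]) a (by simp) (sub_eq_zero.mp h0)
      exact ha (this ▸ hc)
    intro c hc s hs
    rcases Finset.mem_insert.mp hc with rfl | hc
    · have e1 := h s hs
      rw [Finset.sum_insert ha, Finset.sum_eq_zero fun d hd => by rw [h3 d hd s hs, mul_zero],
        add_zero] at e1
      exact (mul_eq_zero.mp e1).resolve_left (Complex.exp_ne_zero _)
    · exact h3 c hc s hs

lemma eq_of_exp_eq_of_re {t : ℤ} {c d : ℂ} (hc : t ≤ c.re ∧ c.re < t + 1)
    (hd : t ≤ d.re ∧ d.re < t + 1) (n : ℤ) (h : c = d + n) : c = d := by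
  have h1 : c.re = d.re + n := by rw [h]; simp
  have h2 : (n : ℝ) < 1 := by linarith
  have h3 : (-1 : ℝ) < n := by linarith
  have h4 : n < 1 := by exact_mod_cast h2
  have h5 : -1 < n := by exact_mod_cast h3
  have : n = 0 := by omega
  rw [h, this]; simp

/-- The substitution z = exp s turns the relation into one on a small open set of the half-plane Re
s < log ε. The half-plane is connected, so the relation holds throughout and is stable under s ↦ s +
2πi. Distinct exponents with real parts in [t, t + 1) are incongruent modulo ℤ. -/
lemma eq_zero_of_sum_log_eq_zero {S : Finset ℂ} {t : ℤ} {ε : ℝ} {U : Set ℂ}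
    (hS : ∀ c ∈ S, t ≤ c.re ∧ c.re < t + 1) {g : ℂ → ℂ → ℂ}
    (hg : ∀ c ∈ S, AnalyticOnNhd ℂ (g c) (Metric.ball 0 ε)) (hU : IsOpen U) (hne : U.Nonempty)
    (hUs : U ⊆ Metric.ball 0 ε ∩ Complex.slitPlane)
    (h : ∀ z ∈ U, ∑ c ∈ S, Complex.exp (c * Complex.log z) * g c z = 0) :
    ∀ c ∈ S, ∀ᶠ z in 𝓝 0, g c z = 0 := by
  obtain ⟨p, hp⟩ := hne
  have hε : 0 < ε := by
    have := (hUs hp).1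
    rw [Metric.mem_ball] at this
    exact lt_of_le_of_lt dist_nonneg this
  have hball : ∀ s : ℂ, s.re < Real.log ε → Complex.exp s ∈ Metric.ball (0 : ℂ) ε := by
    intro s hs
    rw [mem_ball_zero_iff, Complex.norm_exp]
    calc Real.exp s.re < Real.exp (Real.log ε) := Real.exp_lt_exp.mpr hs
      _ = ε := Real.exp_log hε
  have h1 : AnalyticOnNhd ℂ (fun s => ∑ c ∈ S, Complex.exp (c * s) * g c (Complex.exp s))
      {s | s.re < Real.log ε} := by
    intro s hs
    refine Finset.analyticAt_fun_sum _ fun c hc => ?_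
    have : AnalyticAt ℂ (fun s => g c (Complex.exp s)) s :=
      (hg c hc _ (hball s hs)).fun_comp (by fun_prop)
    exact ((analyticAt_const.mul analyticAt_id).cexp).mul this
  have hp0 : p ≠ 0 := Complex.slitPlane_ne_zero (hUs hp).2
  have hpre : (Complex.log p).re < Real.log ε := by
    rw [Complex.log_re]
    exact Real.log_lt_log (by simpa using hp0) (by simpa using (hUs hp).1)
  have h2 : ∀ᶠ s in 𝓝 (Complex.log p),
      ∑ c ∈ S, Complex.exp (c * s) * g c (Complex.exp s) = 0 := by
    have e1 : ∀ᶠ s in 𝓝 (Complex.log p), Complex.exp s ∈ U :=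
      Complex.continuous_exp.continuousAt.eventually
        (hU.mem_nhds (by rwa [Complex.exp_log hp0]))
    have e2 : ∀ᶠ s in 𝓝 (Complex.log p), s.im < Real.pi :=
      Complex.continuous_im.continuousAt.eventually_lt continuousAt_const (by
        rw [Complex.log_im]
        exact lt_of_le_of_ne (Complex.arg_le_pi _) (Complex.mem_slitPlane_iff_arg.mp (hUs hp).2).1)
    have e3 : ∀ᶠ s in 𝓝 (Complex.log p), -Real.pi < s.im :=
      continuousAt_const.eventually_lt Complex.continuous_im.continuousAt (by
        rw [Complex.log_im]
        exact Complex.neg_pi_lt_arg _)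
    filter_upwards [e1, e2, e3] with s h1 h2 h3
    have := h _ h1
    rwa [Complex.log_exp h3 h2.le] at this
  have hconv : IsPreconnected {s : ℂ | s.re < Real.log ε} :=
    (convex_halfSpace_re_lt _).isPreconnected
  have h3 := h1.eqOn_zero_of_preconnected_of_eventuallyEq_zero hconv hpre h2
  have h4 := eq_zero_of_sum_exp_mul_eq_zero (S := S) (M := Real.log ε) (g := g)
    (fun c hc d hd hcd => by
      rw [Complex.exp_eq_exp_iff_exists_int] at hcd
      obtain ⟨n, hn⟩ := hcd
      refine eq_of_exp_eq_of_re (hS c hc) (hS d hd) n ?_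
      have : (2 * Real.pi * Complex.I : ℂ) ≠ 0 := Complex.two_pi_I_ne_zero
      apply mul_left_cancel₀ this
      rw [hn]; ring) (fun s hs => h3 hs)
  intro c hc
  have h5 : ∀ᶠ z in 𝓝[≠] (0 : ℂ), g c z = 0 := by
    filter_upwards [eventually_mem_nhdsWithin,
      nhdsWithin_le_nhds (Metric.ball_mem_nhds (0 : ℂ) hε)] with z hz hz'
    have hz0 : z ≠ 0 := hz
    rw [← Complex.exp_log hz0]
    refine h4 c hc _ ?_
    rw [Complex.log_re]
    exact Real.log_lt_log (by simpa using hz0) (by simpa using hz')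
  exact (hg c hc 0 (by simpa using hε)).frequently_zero_iff_eventually_zero.mp h5.frequently

/-- Rewriting a sum of powers with exponents in `[t, t + 1)`. -/
lemma exists_regroup {S : Finset ℂ} {h : ℂ → ℂ → ℂ} {V : Set ℂ}
    (hh : ∀ κ ∈ S, AnalyticOnNhd ℂ (h κ) V) {t : ℤ} (ht : ∀ κ ∈ S, t ≤ ⌊κ.re⌋) :
    ∃ (T : Finset ℂ) (g : ℂ → ℂ → ℂ), (∀ c ∈ T, t ≤ c.re ∧ c.re < t + 1) ∧
      (∀ c ∈ T, AnalyticOnNhd ℂ (g c) V) ∧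
      ∀ z L : ℂ, Complex.exp L = z →
        ∑ κ ∈ S, Complex.exp (κ * L) * h κ z = ∑ c ∈ T, Complex.exp (c * L) * g c z := by
  classical
  -- The integral part above t is moved into the coefficient as a power of z, and exponents with the
  -- same remainder are collected.
  let n (κ : ℂ) : ℕ := (⌊κ.re⌋ - t).toNat
  let r (κ : ℂ) : ℂ := κ - n κ
  refine ⟨S.image r, fun c z => ∑ κ ∈ S with r κ = c, z ^ n κ * h κ z, ?_, ?_, ?_⟩
  · intro c hc
    obtain ⟨κ, hκ, rfl⟩ := Finset.mem_image.mp hc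
    have h1 : ((n κ : ℕ) : ℤ) = ⌊κ.re⌋ - t := Int.toNat_of_nonneg (sub_nonneg.mpr (ht κ hκ))
    have h2 : ((n κ : ℕ) : ℝ) = ⌊κ.re⌋ - t := by exact_mod_cast h1
    have h3 : (r κ).re = κ.re - n κ := by simp [r]
    rw [h3, h2]
    constructor
    · linarith [Int.floor_le κ.re]
    · linarith [Int.lt_floor_add_one κ.re]
  · intro c _ z hz
    refine Finset.analyticAt_fun_sum _ fun κ hκ => ?_
    exact (analyticAt_id.pow _).mul (hh κ (Finset.mem_filter.mp hκ).1 z hz)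
  · intro z L hL
    rw [← Finset.sum_fiberwise_of_maps_to (g := r) (t := S.image r)
      (fun κ hκ => Finset.mem_image_of_mem _ hκ)]
    refine Finset.sum_congr rfl fun c _ => ?_
    rw [Finset.mul_sum]
    refine Finset.sum_congr rfl fun κ hκ => ?_
    have h1 : κ = c + n κ := by rw [← (Finset.mem_filter.mp hκ).2]; simp [r]
    conv_lhs => rw [h1]
    rw [add_mul, Complex.exp_add, Complex.exp_nat_mul, hL]
    rw [← h1]; ring

/-! ### Apparent singularities and the obstructions -/

section Core

variable {q₂ q₃ A B : ℂ → ℂ} {κ : Fin 3 → ℚ}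

lemma exists_ball_of_germ (hA : AnalyticAt ℂ A 0) (hB : AnalyticAt ℂ B 0)
    (h2 : ∀ᶠ x in 𝓝[≠] 0, x ^ 2 * q₂ x = A x) (h3 : ∀ᶠ x in 𝓝[≠] 0, x ^ 3 * q₃ x = B x) :
    ∃ ε > 0, AnalyticOnNhd ℂ A (Metric.ball 0 ε) ∧ AnalyticOnNhd ℂ B (Metric.ball 0 ε) ∧
      (∀ x ∈ Metric.ball 0 ε, x ≠ 0 → x ^ 2 * q₂ x = A x) ∧
      ∀ x ∈ Metric.ball 0 ε, x ≠ 0 → x ^ 3 * q₃ x = B x := by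
  rw [eventually_nhdsWithin_iff] at h2 h3
  have h4 := hA.eventually_analyticAt.and (hB.eventually_analyticAt.and (h2.and h3))
  obtain ⟨ε, hε, h⟩ := Metric.eventually_nhds_iff_ball.mp h4
  exact ⟨ε, hε, fun x hx => (h x hx).1, fun x hx => (h x hx).2.1, fun x hx hx0 => (h x hx).2.2.1 hx0,
    fun x hx hx0 => (h x hx).2.2.2 hx0⟩

lemma analyticAt_coeff {ε : ℝ} {x : ℂ} {k : ℕ} {q C : ℂ → ℂ} (hC : AnalyticOnNhd ℂ C (Metric.ball 0 ε))
    (hq : ∀ x ∈ Metric.ball 0 ε, x ≠ 0 → x ^ k * q x = C x) (hx : x ∈ Metric.ball 0 ε)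
    (hx0 : x ≠ 0) : AnalyticAt ℂ q x := by
  have h1 : AnalyticAt ℂ (fun z => C z / z ^ k) x :=
    (hC x hx).div (analyticAt_id.pow k) (pow_ne_zero _ hx0)
  refine h1.congr ?_
  filter_upwards [Metric.isOpen_ball.mem_nhds hx, isOpen_ne.mem_nhds hx0] with z hz hz0
  have := pow_ne_zero k hz0
  rw [← hq z hz hz0]; field_simp

lemma isSolutionOn_iff_op {U : Set ℂ} (hU : IsOpen U) (h0 : (0 : ℂ) ∉ U)
    (h2 : ∀ x ∈ U, x ^ 2 * q₂ x = A x) (h3 : ∀ x ∈ U, x ^ 3 * q₃ x = B x) {y : ℂ → ℂ} :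
    IsSolutionOn q₂ q₃ U y ↔ DifferentiableOn ℂ y U ∧ ∀ x ∈ U, op A B 0 y x = 0 := by
  refine and_congr_right fun hy => forall₂_congr fun x hx => ?_
  have hx0 : x ≠ 0 := fun h => h0 (h ▸ hx)
  rw [op_zero_eq _ _ (hy.analyticAt (hU.mem_nhds hx)), ← h2 x hx, ← h3 x hx]
  have h4 : x ^ 3 * iteratedDeriv 3 y x + x * (x ^ 2 * q₂ x) * deriv y x + x ^ 3 * q₃ x * y x
    = x ^ 3 * (iteratedDeriv 3 y x + q₂ x * deriv y x + q₃ x * y x) := by ring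
  rw [h4, mul_eq_zero, or_iff_right (pow_ne_zero _ hx0)]

lemma isSolutionOn_exp_mul {U : Set ℂ} (hU : IsOpen U) (h0 : (0 : ℂ) ∉ U)
    (h2 : ∀ x ∈ U, x ^ 2 * q₂ x = A x) (h3 : ∀ x ∈ U, x ^ 3 * q₃ x = B x) {L : ℂ → ℂ}
    (hL : ContinuousOn L U) (hexp : ∀ z ∈ U, Complex.exp (L z) = z) {α : ℂ} {f : ℂ → ℂ}
    (hf : ∀ z ∈ U, AnalyticAt ℂ f z) (hop : ∀ z ∈ U, op A B α f z = 0) :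
    IsSolutionOn q₂ q₃ U (fun z => Complex.exp (α * L z) * f z) := by
  rw [isSolutionOn_iff_op hU h0 h2 h3]
  refine ⟨fun z hz => ?_, fun z hz => ?_⟩
  · have h1 := hasDerivAt_of_exp_eq (z₀ := 0) hU hL (by simpa using hexp) hz
    exact ((h1.differentiableAt.const_mul α).cexp.mul
      (hf z hz).differentiableAt).differentiableWithinAt
  · rw [op_exp_mul hU h0 hL hexp α hf hz, hop z hz, mul_zero]

/-- When the obstructions vanish, the three Frobenius series converge and give solutions x^(κ i) f_i
with f_i(0) = 1. Their leading exponents differ, so they are independent and span all solutions on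
any connected domain of the punctured ball. -/
theorem IsExponents.isApparentAt (h : IsExponents A B κ)
    (h2 : ∀ᶠ x in 𝓝[≠] 0, x ^ 2 * q₂ x = A x) (h3 : ∀ᶠ x in 𝓝[≠] 0, x ^ 3 * q₃ x = B x)
    (hP : ∀ i j, i < j →
      frobeniusObstruction (lau A 2) (lau B 3) (ind κ) (κ i) ⌊κ j - κ i⌋₊ = 0) :
    IsApparentAt q₂ q₃ 0 := by
  have hex : ∀ i : Fin 3, ∃ f : ℂ → ℂ, AnalyticAt ℂ f 0 ∧ f 0 = 1 ∧
      ∀ᶠ x in 𝓝 0, op A B (κ i) f x = 0 := by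
    intro i
    obtain ⟨f, hf, hfc, hop⟩ := (h.isRec_frobeniusCoeff (hP i)).exists_solution h.anA h.anB
    exact ⟨f, hf, by rw [← tc_zero f, hfc, frobeniusCoeff_zero], hop⟩
  choose f hf hf0 hop using hex
  obtain ⟨ε₁, hε₁, hA, hB, h2', h3'⟩ := exists_ball_of_germ h.anA h.anB h2 h3
  have hev : ∀ᶠ x in 𝓝 (0 : ℂ), ∀ i, AnalyticAt ℂ (f i) x ∧ op A B (κ i) (f i) x = 0 :=
    eventually_all.mpr fun i => (hf i).eventually_analyticAt.and (hop i)
  obtain ⟨ε₂, hε₂, hb⟩ := Metric.eventually_nhds_iff_ball.mp hev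
  set ε := min ε₁ ε₂
  have hs1 : Metric.ball (0 : ℂ) ε ⊆ Metric.ball 0 ε₁ := Metric.ball_subset_ball (min_le_left _ _)
  have hs2 : Metric.ball (0 : ℂ) ε ⊆ Metric.ball 0 ε₂ := Metric.ball_subset_ball (min_le_right _ _)
  refine ⟨ε, lt_min hε₁ hε₂, fun U hU hUc hUs L hL hexp y hy => ?_⟩
  have h0 : (0 : ℂ) ∉ U := fun h => (hUs h).2 rfl
  have hUb : ∀ z ∈ U, z ∈ Metric.ball (0 : ℂ) ε := fun z hz => (hUs hz).1
  have hexp' : ∀ z ∈ U, Complex.exp (L z) = z := by simpa using hexp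
  have hne : ∀ z ∈ U, z ≠ 0 := fun z hz hz0 => h0 (hz0 ▸ hz)
  obtain ⟨p, hp⟩ := hUc.nonempty
  have hY : ∀ i, IsSolutionOn q₂ q₃ U (fun z => Complex.exp ((κ i : ℂ) * L z) * f i z) := fun i =>
    isSolutionOn_exp_mul hU h0 (fun x hx => h2' x (hs1 (hUb x hx)) (hne x hx))
      (fun x hx => h3' x (hs1 (hUb x hx)) (hne x hx)) hL hexp'
      (fun z hz => (hb z (hs2 (hUb z hz)) i).1) (fun z hz => (hb z (hs2 (hUb z hz)) i).2)
  have hind : ∀ c : Fin 3 → ℂ,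
      (∀ᶠ z in 𝓝 p, ∑ i, c i * (Complex.exp ((κ i : ℂ) * L z) * f i z) = 0) → c = 0 := by
    intro c hc
    obtain ⟨n₁, hn₁, -, hκ₁⟩ := exists_nat_diff h.int h.mono (show (0 : Fin 3) < 1 by decide)
    obtain ⟨n₂, hn₂, -, hκ₂⟩ := exists_nat_diff h.int h.mono (show (1 : Fin 3) < 2 by decide)
    -- Dividing a relation by the power with exponent κ 0 leaves functions analytic on the whole
    -- ball. By the identity theorem the relation can be expanded at 0, and the degrees 0, n₁ and n₁
    -- + n₂ yield the three coefficients in turn.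
    have e1 : ∀ᶠ z in 𝓝 p, c 0 * f 0 z + c 1 * z ^ n₁ * f 1 z + c 2 * z ^ (n₁ + n₂) * f 2 z = 0 := by
      filter_upwards [hc, hU.mem_nhds hp] with z hz hzU
      rw [Fin.sum_univ_three, hκ₂, hκ₁] at hz
      simp only [add_mul, Complex.exp_add, Complex.exp_nat_mul, hexp' z hzU] at hz
      apply mul_left_cancel₀ (Complex.exp_ne_zero ((κ 0 : ℂ) * L z))
      rw [mul_zero, ← hz]; ring
    have han : AnalyticOnNhd ℂ (fun z => c 0 * f 0 z + c 1 * z ^ n₁ * f 1 z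
        + c 2 * z ^ (n₁ + n₂) * f 2 z) (Metric.ball 0 ε) := by
      intro z hz
      have a0 := (hb z (hs2 hz) 0).1
      have a1 := (hb z (hs2 hz) 1).1
      have a2 := (hb z (hs2 hz) 2).1
      exact ((analyticAt_const.mul a0).add ((analyticAt_const.mul (analyticAt_id.pow _)).mul a1)).add
        ((analyticAt_const.mul (analyticAt_id.pow _)).mul a2)
    have e2 := han.eqOn_zero_of_preconnected_of_eventuallyEq_zero
      (convex_ball _ _).isPreconnected (hUb p hp) e1
    have e3 : (fun z => c 0 * f 0 z + z ^ n₁ * (c 1 * f 1 z) + z ^ (n₁ + n₂) * (c 2 * f 2 z))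
        =ᶠ[𝓝 0] fun _ => 0 := by
      filter_upwards [Metric.ball_mem_nhds (0 : ℂ) (lt_min hε₁ hε₂)] with z hz
      have := e2 hz
      simp only [Pi.zero_apply] at this
      rw [← this]; ring
    have a0 : AnalyticAt ℂ (fun z => c 0 * f 0 z) 0 := analyticAt_const.mul (hf 0)
    have a1 : AnalyticAt ℂ (fun z => c 1 * f 1 z) 0 := analyticAt_const.mul (hf 1)
    have a2 : AnalyticAt ℂ (fun z => c 2 * f 2 z) 0 := analyticAt_const.mul (hf 2)
    have a01 : AnalyticAt ℂ (fun z => c 0 * f 0 z + z ^ n₁ * (c 1 * f 1 z)) 0 :=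
      a0.add (analyticAt_pow_mul a1 _)
    have e4 := taylor_congr e3
    rw [taylor_add a01 (analyticAt_pow_mul a2 _), taylor_add a0 (analyticAt_pow_mul a1 _),
      taylor_pow_mul a1, taylor_pow_mul a2, taylor_const, map_zero] at e4
    have co := fun n => congrArg (PowerSeries.coeff n) e4
    simp only [map_add, PowerSeries.coeff_X_pow_mul', coeff_taylor, tc_const_mul, map_zero] at co
    have c0 : c 0 = 0 := by
      have := co 0
      rw [if_neg (by omega), if_neg (by omega), tc_zero, hf0] at this
      simpa using this
    have c1 : c 1 = 0 := by
      have := co n₁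
      rw [if_pos le_rfl, if_neg (by omega), Nat.sub_self, tc_zero, hf0, c0] at this
      simpa using this
    have c2 : c 2 = 0 := by
      have := co (n₁ + n₂)
      rw [if_pos le_rfl, Nat.sub_self, tc_zero (f 2), hf0, c0, c1] at this
      simpa using this
    funext i
    fin_cases i <;> assumption
  obtain ⟨c, hc⟩ := exists_combination hU hUc.isPreconnected hp
    (analyticAt_coeff hA h2' (hs1 (hUb p hp)) (hne p hp))
    (analyticAt_coeff hB h3' (hs1 (hUb p hp)) (hne p hp)) hY hind hy
  have hκinj : Function.Injective fun i => (κ i : ℂ) := fun i j hij => by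
    have h1 : (κ i : ℂ) = κ j := hij
    have : κ i = κ j := by exact_mod_cast h1
    exact h.mono.injective this
  classical
  refine ⟨Finset.univ.image fun i => (κ i : ℂ),
    Function.extend (fun i => (κ i : ℂ)) (fun i z => c i * f i z) 0, ?_, fun z hz => ?_⟩
  · intro k hk
    obtain ⟨i, -, rfl⟩ := Finset.mem_image.mp hk
    rw [hκinj.extend_apply]
    exact fun z hz => analyticAt_const.mul (hb z (hs2 hz) i).1
  · rw [Finset.sum_image fun i _ j _ hij => hκinj hij, hc z hz]
    refine Finset.sum_congr rfl fun i _ => ?_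
    rw [hκinj.extend_apply]; ring

/-- After regrouping, the exponents are pairwise incongruent modulo ℤ. The operator preserves each
class, so by independence of the classes every summand is a solution by itself, and only the class
containing the exponents κ can contribute. -/
lemma IsExponents.exists_single_power (h : IsExponents A B κ) {ε : ℝ} {U : Set ℂ} (hU : IsOpen U)
    (hne : U.Nonempty) (hUs : U ⊆ Metric.ball 0 ε ∩ Complex.slitPlane)
    (hA : AnalyticOnNhd ℂ A (Metric.ball 0 ε)) (hB : AnalyticOnNhd ℂ B (Metric.ball 0 ε))
    (h2 : ∀ x ∈ Metric.ball 0 ε, x ≠ 0 → x ^ 2 * q₂ x = A x)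
    (h3 : ∀ x ∈ Metric.ball 0 ε, x ≠ 0 → x ^ 3 * q₃ x = B x)
    {S : Finset ℂ} {t : ℤ} (ht : ∀ κ ∈ S, t ≤ ⌊κ.re⌋) {f : ℂ → ℂ → ℂ}
    (hf : ∀ κ ∈ S, AnalyticOnNhd ℂ (f κ) (Metric.ball 0 ε)) {α : ℂ} (hα : t ≤ α.re ∧ α.re < t + 1)
    (hκα : ∃ n : ℤ, (κ 0 : ℂ) = α + n) {y : ℂ → ℂ} (hy : IsSolutionOn q₂ q₃ U y)
    (hyf : ∀ z ∈ U, y z = ∑ κ ∈ S, Complex.exp (κ * Complex.log z) * f κ z) :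
    ∃ g : ℂ → ℂ, AnalyticOnNhd ℂ g (Metric.ball 0 ε) ∧ IsRec (tc A) (tc B) α (tc g) ∧
      ∀ z ∈ U, y z = Complex.exp (α * Complex.log z) * g z := by
  have hε : 0 < ε := by
    obtain ⟨p, hp⟩ := hne
    have := (hUs hp).1
    rw [Metric.mem_ball] at this
    exact lt_of_le_of_lt dist_nonneg this
  have hnez : ∀ z ∈ U, z ≠ 0 := fun z hz => Complex.slitPlane_ne_zero (hUs hz).2
  have h0U : (0 : ℂ) ∉ U := fun h => hnez 0 h rfl
  obtain ⟨T, g, hT, hg, hsum⟩ := exists_regroup hf ht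
  have hyT : ∀ z ∈ U, y z = ∑ c ∈ T, Complex.exp (c * Complex.log z) * g c z := fun z hz => by
    rw [hyf z hz, hsum z _ (Complex.exp_log (hnez z hz))]
  have hL : ContinuousOn Complex.log U := fun z hz =>
    (Complex.differentiableAt_log (hUs hz).2).continuousAt.continuousWithinAt
  have hexp : ∀ z ∈ U, Complex.exp (Complex.log z) = z := fun z hz => Complex.exp_log (hnez z hz)
  have hop : ∀ c ∈ T, ∀ᶠ z in 𝓝 0, op A B c (g c) z = 0 := by
    refine eq_zero_of_sum_log_eq_zero (g := fun c => op A B c (g c)) hT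
      (fun c hc z hz => analyticAt_op c (hA z hz) (hB z hz) (hg c hc z hz)) hU hne hUs
      fun z hz => ?_
    have e1 := ((isSolutionOn_iff_op hU h0U (fun x hx => h2 x (hUs hx).1 (hnez x hx))
      (fun x hx => h3 x (hUs hx).1 (hnez x hx))).mp hy).2 z hz
    have ha : ∀ c ∈ T, AnalyticAt ℂ (fun w => Complex.exp (c * Complex.log w) * g c w) z := by
      intro c hc
      have := analyticAt_clog (hUs hz).2
      exact ((analyticAt_const.mul this).cexp).mul (hg c hc z (hUs hz).1)
    have e2 : y =ᶠ[𝓝 z] fun w => ∑ c ∈ T, Complex.exp (c * Complex.log w) * g c w := by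
      filter_upwards [hU.mem_nhds hz] with w hw using hyT w hw
    rw [op_zero_eq _ _ (hy.1.analyticAt (hU.mem_nhds hz)), e2.iteratedDeriv_eq 3, e2.deriv_eq,
      e2.eq_of_nhds, iteratedDeriv_fun_sum fun c hc => (ha c hc).contDiffAt,
      deriv_fun_sum fun c hc => (ha c hc).differentiableAt, Finset.mul_sum, Finset.mul_sum,
      Finset.mul_sum, ← Finset.sum_add_distrib, ← Finset.sum_add_distrib] at e1
    rw [← e1]
    refine Finset.sum_congr rfl fun c hc => ?_
    rw [← op_exp_mul hU h0U hL hexp c (fun w hw => hg c hc w (hUs hw).1) hz,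
      op_zero_eq _ _ (ha c hc)]
  -- The indicial polynomial has no root in c + ℕ when c is not congruent to the exponents, so the
  -- recursion has only the zero solution.
  have hzero : ∀ c ∈ T, c ≠ α → ∀ z ∈ Metric.ball 0 ε, g c z = 0 := by
    intro c hc hcα
    have hgc := hg c hc 0 (by simpa using hε)
    have hrec := (op_eventually_eq_zero_iff c h.anA h.anB hgc).mp (hop c hc)
    have hnon : ∀ n : ℕ, ind κ (c + n) ≠ 0 := by
      intro n hn
      obtain ⟨j, hj⟩ := (ind_eq_zero_iff _).mp hn
      obtain ⟨m, hm⟩ := hκα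
      obtain ⟨l, hl⟩ := h.int j 0
      have hl' : (κ j : ℂ) - κ 0 = l := by exact_mod_cast hl
      refine hcα (eq_of_exp_eq_of_re (hT c hc) hα (l + m - n) ?_)
      push_cast
      linear_combination hj + hl' + hm
    have htc : ∀ n, tc (g c) n = 0 := by
      intro n
      induction n using Nat.strong_induction_on with
      | _ n ih =>
        have h1 := h.isRec_iff.mp hrec n
        rw [Finset.sum_eq_zero fun k hk => by rw [ih k (Finset.mem_range.mp hk), mul_zero],
          add_zero] at h1
        exact (mul_eq_zero.mp h1).resolve_left (hnon n)
    have h1 := eventually_eq_zero_of_taylor hgc (by ext n; rw [coeff_taylor, htc]; simp)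
    exact fun z hz => (hg c hc).eqOn_zero_of_preconnected_of_eventuallyEq_zero
      (convex_ball _ _).isPreconnected (by simpa using hε) h1 hz
  by_cases hαT : α ∈ T
  · refine ⟨g α, hg α hαT, (op_eventually_eq_zero_iff α h.anA h.anB
      (hg α hαT 0 (by simpa using hε))).mp (hop α hαT), fun z hz => ?_⟩
    rw [hyT z hz, Finset.sum_eq_single α (fun c hc hcα => by
      rw [hzero c hc hcα z (hUs hz).1, mul_zero]) (fun h => absurd hαT h)]
  · refine ⟨fun _ => 0, fun z _ => analyticAt_const, ?_, fun z hz => ?_⟩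
    · intro n
      have : ∀ n, tc (fun _ => (0 : ℂ)) n = 0 := fun n => by
        rw [← coeff_taylor, taylor_const]; simp
      simp [this]
    · rw [hyT z hz, mul_zero, Finset.sum_eq_zero fun c hc => by
        rw [hzero c hc (fun h => hαT (h ▸ hc)) z (hUs hz).1, mul_zero]]

/-- A full basis of solutions near a point of the slit disc is, by apparentness, expressed through
powers without logarithms. By `IsExponents.exists_single_power` each member lies in x^α ℂ{x} for one
common α, which provides the three independent formal solutions needed in
`IsExponents.obstruction_eq_zero`. -/
theorem IsExponents.obstruction_of_isApparentAt (h : IsExponents A B κ)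
    (h2 : ∀ᶠ x in 𝓝[≠] 0, x ^ 2 * q₂ x = A x) (h3 : ∀ᶠ x in 𝓝[≠] 0, x ^ 3 * q₃ x = B x)
    (hap : IsApparentAt q₂ q₃ 0) {i j : Fin 3} (hij : i < j) :
    frobeniusObstruction (lau A 2) (lau B 3) (ind κ) (κ i) ⌊κ j - κ i⌋₊ = 0 := by
  obtain ⟨ε₁, hε₁, hA, hB, h2', h3'⟩ := exists_ball_of_germ h.anA h.anB h2 h3
  obtain ⟨ε₂, hε₂, hap⟩ := hap
  set ε := min ε₁ ε₂
  have hε : 0 < ε := lt_min hε₁ hε₂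
  have hs1 : Metric.ball (0 : ℂ) ε ⊆ Metric.ball 0 ε₁ := Metric.ball_subset_ball (min_le_left _ _)
  have hs2 : Metric.ball (0 : ℂ) ε ⊆ Metric.ball 0 ε₂ := Metric.ball_subset_ball (min_le_right _ _)
  set p : ℂ := ((ε / 2 : ℝ) : ℂ)
  have hpb : p ∈ Metric.ball (0 : ℂ) ε := by
    rw [mem_ball_zero_iff, Complex.norm_real, Real.norm_of_nonneg (by positivity)]; linarith
  have hps : p ∈ Complex.slitPlane := Complex.ofReal_mem_slitPlane.mpr (by positivity)
  have hp0 : p ≠ 0 := Complex.slitPlane_ne_zero hps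
  have a2 := analyticAt_coeff hA h2' (hs1 hpb) hp0
  have a3 := analyticAt_coeff hB h3' (hs1 hpb) hp0
  have hex := fun i : Fin 3 => exists_local_solution a2 a3 (Pi.single i 1)
  choose Y hYa hYe hYj using hex
  have hev : ∀ᶠ z in 𝓝 p, (∀ i, AnalyticAt ℂ (Y i) z ∧
      iteratedDeriv 3 (Y i) z + q₂ z * deriv (Y i) z + q₃ z * Y i z = 0) ∧
      z ∈ Metric.ball (0 : ℂ) ε ∩ Complex.slitPlane :=
    (eventually_all.mpr fun i => (hYa i).eventually_analyticAt.and (hYe i)).and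
      ((Metric.isOpen_ball.inter Complex.isOpen_slitPlane).mem_nhds ⟨hpb, hps⟩)
  obtain ⟨r, hr, hb⟩ := Metric.eventually_nhds_iff_ball.mp hev
  set U := Metric.ball p r
  have hpU : p ∈ U := Metric.mem_ball_self hr
  have hUc : IsConnected U := ⟨⟨p, hpU⟩, (convex_ball _ _).isPreconnected⟩
  have hUs : U ⊆ Metric.ball 0 ε ∩ Complex.slitPlane := fun z hz => (hb z hz).2
  have hnez : ∀ z ∈ U, z ≠ 0 := fun z hz => Complex.slitPlane_ne_zero (hUs hz).2
  have hsol : ∀ i, IsSolutionOn q₂ q₃ U (Y i) := fun i =>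
    ⟨fun z hz => ((hb z hz).1 i).1.differentiableAt.differentiableWithinAt,
      fun z hz => ((hb z hz).1 i).2⟩
  have hL : ContinuousOn Complex.log U := fun z hz =>
    (Complex.differentiableAt_log (hUs hz).2).continuousAt.continuousWithinAt
  have hrep := fun i => hap U Metric.isOpen_ball hUc
    (fun z hz => ⟨hs2 (hUs hz).1, hnez z hz⟩) Complex.log hL
    (fun z hz => by rw [sub_zero]; exact Complex.exp_log (hnez z hz)) (Y i) (hsol i)
  choose S f hf hYf using hrep
  classical
  obtain ⟨t, ht⟩ : ∃ t : ℤ, ∀ i, ∀ κ ∈ S i, t ≤ ⌊κ.re⌋ := by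
    obtain ⟨t, ht⟩ := ((Finset.univ.biUnion S).image fun κ => ⌊κ.re⌋).bddBelow
    exact ⟨t, fun i k hk => ht (by
      simp only [Finset.coe_image, Set.mem_image, Finset.mem_coe, Finset.mem_biUnion]
      exact ⟨k, ⟨i, Finset.mem_univ _, hk⟩, rfl⟩)⟩
  -- The integer t lies below the real parts of all exponents that occur; α is the representative of
  -- κ 0 modulo ℤ in [t, t + 1), so every power that occurs in its class is x^α times a nonnegative
  -- power of x.
  set α : ℂ := (κ 0 : ℂ) - ((⌊κ 0⌋ - t : ℤ) : ℂ)
  have hα : t ≤ α.re ∧ α.re < t + 1 := by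
    have e1 : α.re = (κ 0 : ℝ) - (⌊κ 0⌋ - t) := by simp [α]
    have e2 : ((⌊κ 0⌋ : ℤ) : ℝ) ≤ κ 0 := by exact_mod_cast Int.floor_le (κ 0)
    have e3 : (κ 0 : ℝ) < ⌊κ 0⌋ + 1 := by exact_mod_cast Int.lt_floor_add_one (κ 0)
    rw [e1]
    constructor <;> linarith
  have hκα : ∃ n : ℤ, (κ 0 : ℂ) = α + n := ⟨⌊κ 0⌋ - t, by simp [α]⟩
  have hg := fun i => h.exists_single_power Metric.isOpen_ball ⟨p, hpU⟩ hUs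
    (fun z hz => hA z (hs1 hz)) (fun z hz => hB z (hs1 hz)) (fun x hx => h2' x (hs1 hx))
    (fun x hx => h3' x (hs1 hx)) (ht i) (fun k hk z hz => hf i k hk z (hs2 hz)) hα hκα (hsol i)
    (hYf i)
  choose g hga hgrec hYg using hg
  refine h.obstruction_eq_zero hκα (d := fun i => tc (g i)) hgrec (fun l hl => ?_) hij
  have hg0 : ∀ i, AnalyticAt ℂ (g i) 0 := fun i => hga i 0 (by simpa using hε)
  have hsum : AnalyticOnNhd ℂ (fun z => ∑ i, l i * g i z) (Metric.ball 0 ε) := fun z hz =>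
    Finset.analyticAt_fun_sum _ fun i _ => analyticAt_const.mul (hga i z hz)
  have e1 : ∀ᶠ z in 𝓝 0, ∑ i, l i * g i z = 0 := by
    refine eventually_eq_zero_of_taylor (hsum 0 (by simpa using hε)) ?_
    ext n
    have e2 : tc (fun z => ∑ i, l i * g i z) n = ∑ i, l i * tc (g i) n := by
      simp only [Fin.sum_univ_three]
      have b : ∀ i, AnalyticAt ℂ (fun z => l i * g i z) 0 := fun i => analyticAt_const.mul (hg0 i)
      have b01 : AnalyticAt ℂ (fun z => l 0 * g 0 z + l 1 * g 1 z) 0 := (b 0).add (b 1)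
      rw [tc_add b01 (b 2), tc_add (b 0) (b 1)]
      simp only [tc_const_mul]
    rw [coeff_taylor, e2, hl n]; simp
  have e3 := hsum.eqOn_zero_of_preconnected_of_eventuallyEq_zero
    (convex_ball _ _).isPreconnected (by simpa using hε) e1
  have e4 : ∀ z ∈ U, ∑ i, l i * Y i z = 0 := by
    intro z hz
    have e5 : ∑ i, l i * g i z = 0 := e3 (hUs hz).1
    rw [Finset.sum_congr rfl fun i _ => by rw [hYg i z hz, mul_left_comm], ← Finset.mul_sum, e5,
      mul_zero]
  have e6 : (fun z => ∑ i, l i * Y i z) =ᶠ[𝓝 p] fun _ => 0 := by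
    filter_upwards [Metric.ball_mem_nhds p hr] with z hz using e4 z hz
  funext k
  -- The 2-jets of the `Y i` at p are nonzero multiples of the unit vectors, so a relation between
  -- the germs has zero coefficients.
  have e7 := e6.iteratedDeriv_eq k
  rw [iteratedDeriv_fun_sum (f := fun i z => l i * Y i z) fun i _ =>
    (analyticAt_const.mul (hYa i)).contDiffAt] at e7
  simp only [iteratedDeriv_const_mul_field, hYj, iteratedDeriv_const, ite_self] at e7
  rw [Finset.sum_eq_single k (fun i _ hik => by rw [Pi.single_eq_of_ne hik.symm]; ring)
    (fun h => absurd (Finset.mem_univ k) h), Pi.single_eq_same, mul_one] at e7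
  exact (mul_eq_zero.mp e7).resolve_right (by exact_mod_cast (k : ℕ).factorial_ne_zero)

end Core

/-! ### Lattices with the same invariants -/

/-- The only analytic germ `d` with `z d' U = d V`, `U 0 = -4`, `V 0 = 12`, is zero. -/
theorem eventually_eq_zero_of_mul_deriv {d U V : ℂ → ℂ} (hd : AnalyticAt ℂ d 0)
    (hU : ContinuousAt U 0) (hV : ContinuousAt V 0) (hU0 : U 0 = -4) (hV0 : V 0 = 12)
    (h : ∀ᶠ z in 𝓝[≠] (0 : ℂ), z * deriv d z * U z = d z * V z) : ∀ᶠ z in 𝓝 (0 : ℂ), d z = 0 := by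
  by_contra hne
  have htop : analyticOrderAt d 0 ≠ ⊤ := by rwa [Ne, analyticOrderAt_eq_top]
  obtain ⟨g, hg, hg0, hdg⟩ := (hd.analyticOrderAt_ne_top).1 htop
  set n := analyticOrderNatAt d 0
  simp only [sub_zero, smul_eq_mul] at hdg
  have hder : ∀ᶠ z in 𝓝 (0 : ℂ), z * deriv d z = z ^ n * (n * g z + z * deriv g z) := by
    filter_upwards [hdg.eventually_nhds, hg.eventually_analyticAt] with z hz hgz
    rw [Filter.EventuallyEq.deriv_eq (f := fun z => z ^ n * g z) hz,
      deriv_fun_mul (by fun_prop) hgz.differentiableAt, deriv_pow_field]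
    rcases Nat.eq_zero_or_pos n with h0 | h0
    · simp [h0]
    · obtain ⟨k, hk⟩ : ∃ k, n = k + 1 := ⟨n - 1, by omega⟩
      rw [hk]; simp only [Nat.add_sub_cancel]; ring
  have hev : ∀ᶠ z in 𝓝[≠] (0 : ℂ), (n * g z + z * deriv g z) * U z = g z * V z := by
    filter_upwards [h, hder.filter_mono nhdsWithin_le_nhds, hdg.filter_mono nhdsWithin_le_nhds,
      self_mem_nhdsWithin] with z h1 h2 h3 h4
    have hz : z ^ n ≠ 0 := pow_ne_zero _ h4
    apply mul_left_cancel₀ hz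
    rw [h2, h3] at h1
    linear_combination h1
  have hg' : ContinuousAt (deriv g) 0 := hg.deriv.continuousAt
  have hgc : ContinuousAt g 0 := hg.continuousAt
  have hl : Tendsto (fun z => (n * g z + z * deriv g z) * U z) (𝓝[≠] 0)
      (𝓝 ((n * g 0 + 0 * deriv g 0) * U 0)) :=
    (ContinuousAt.tendsto (f := fun z => (n * g z + z * deriv g z) * U z) (by fun_prop)).mono_left
      nhdsWithin_le_nhds
  have hr : Tendsto (fun z => g z * V z) (𝓝[≠] 0) (𝓝 (g 0 * V 0)) :=
    (ContinuousAt.tendsto (f := fun z => g z * V z) (by fun_prop)).mono_left nhdsWithin_le_nhds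
  have := tendsto_nhds_unique (hl.congr' hev) hr
  rw [hU0, hV0] at this
  -- With d = z^n g and g(0) ≠ 0, comparing leading terms gives -4n g(0) = 12 g(0), which is
  -- impossible for n ≥ 0.
  have h3 : (((n + 3 : ℕ)) : ℂ) * g 0 = 0 := by push_cast; linear_combination (-1 / 4) * this
  rcases mul_eq_zero.1 h3 with h | h
  · exact absurd h (Nat.cast_ne_zero.2 (by omega))
  · exact hg0 h

open PeriodPair in
/-- Two lattices with the same `g₂` and `g₃` have the same `℘`-function near `0`. -/
theorem weierstrassP_eventuallyEq {L M : PeriodPair} (h4 : L.G 4 = M.G 4) (h6 : L.G 6 = M.G 6) :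
    ∀ᶠ z in 𝓝[≠] (0 : ℂ), L.weierstrassP z = M.weierstrassP z := by
  have hg2 : L.g₂ = M.g₂ := by simp [PeriodPair.g₂, h4]
  have hg3 : L.g₃ = M.g₃ := by simp [PeriodPair.g₃, h6]
  set f := L.weierstrassPExcept 0
  set g := M.weierstrassPExcept 0
  have hf : AnalyticAt ℂ f 0 := L.analyticAt_weierstrassPExcept 0
  have hg : AnalyticAt ℂ g 0 := M.analyticAt_weierstrassPExcept 0
  have key : ∀ (N : PeriodPair), ∀ᶠ z in 𝓝[≠] (0 : ℂ), z ∉ N.lattice ∧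
      N.weierstrassP z = N.weierstrassPExcept 0 z + 1 / z ^ 2 ∧
      N.derivWeierstrassP z = deriv (N.weierstrassPExcept 0) z - 2 / z ^ 3 := by
    intro N
    have hN := N.compl_lattice_sdiff_singleton_mem_nhds 0
    have hv : ∀ z, N.weierstrassP z = N.weierstrassPExcept 0 z + 1 / z ^ 2 := fun z => by
      have := N.weierstrassPExcept_add 0 z
      simp only [ZeroMemClass.coe_zero, sub_zero] at this
      rw [← this]; simp
    filter_upwards [mem_nhdsWithin_of_mem_nhds hN, self_mem_nhdsWithin,
      ((N.analyticAt_weierstrassPExcept 0).eventually_analyticAt).filter_mono nhdsWithin_le_nhds]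
      with z hz hz0 hz2
    have hz0' : z ≠ 0 := hz0
    refine ⟨fun h => hz ⟨h, hz0⟩, hv z, ?_⟩
    rw [← N.deriv_weierstrassP, show N.weierstrassP = fun z => N.weierstrassPExcept 0 z + 1 / z ^ 2
      from funext hv]
    have hd : HasDerivAt (fun z : ℂ => 1 / z ^ 2) (-2 / z ^ 3) z := by
      have := ((hasDerivAt_pow 2 z).inv (pow_ne_zero 2 hz0'))
      simp only [one_div]
      refine this.congr_deriv ?_
      field_simp
      push_cast
      ring
    rw [(hz2.differentiableAt.hasDerivAt.fun_add hd).deriv]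
    ring
  -- Subtracting the equations ℘'² = 4℘³ - g₂℘ - g₃ of the two lattices and factoring both sides
  -- gives a linear relation between the difference d of the regular parts and d'. Multiplication by
  -- z⁴ clears the poles and produces U and V, with values -4 and 12 at 0.
  have hd := eventually_eq_zero_of_mul_deriv (d := fun z => f z - g z)
    (U := fun z => z ^ 3 * (deriv f z + deriv g z) - 4)
    (V := fun z => 4 * ((1 + z ^ 2 * f z) ^ 2 + (1 + z ^ 2 * f z) * (1 + z ^ 2 * g z)
      + (1 + z ^ 2 * g z) ^ 2) - L.g₂ * z ^ 4) (hf.sub hg)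
    (by have := hf.deriv.continuousAt; have := hg.deriv.continuousAt; fun_prop)
    (by have := hf.continuousAt; have := hg.continuousAt; fun_prop) (by simp) (by norm_num) ?_
  · filter_upwards [hd.filter_mono nhdsWithin_le_nhds, key L, key M] with z h1 h2 h3
    rw [h2.2.1, h3.2.1]
    exact congrArg (· + 1 / z ^ 2) (sub_eq_zero.1 h1)
  · filter_upwards [key L, key M, self_mem_nhdsWithin,
      hf.eventually_analyticAt.filter_mono nhdsWithin_le_nhds,
      hg.eventually_analyticAt.filter_mono nhdsWithin_le_nhds] with z h1 h2 hz h3 h4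
    have hz : z ≠ 0 := hz
    have e1 := L.derivWeierstrassP_sq z h1.1
    have e2 := M.derivWeierstrassP_sq z h2.1
    rw [h1.2.1, h1.2.2] at e1
    rw [h2.2.1, h2.2.2, ← hg2, ← hg3] at e2
    rw [deriv_fun_sub h3.differentiableAt h4.differentiableAt]
    change (deriv f z - 2 / z ^ 3) ^ 2 = 4 * (f z + 1 / z ^ 2) ^ 3 - _ * (f z + _) - _ at e1
    change (deriv g z - 2 / z ^ 3) ^ 2 = 4 * (g z + 1 / z ^ 2) ^ 3 - _ * (g z + _) - _ at e2
    have e3 : z ^ 4 * ((deriv f z - 2 / z ^ 3) ^ 2 - (deriv g z - 2 / z ^ 3) ^ 2) =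
        z ^ 4 * ((4 * (f z + 1 / z ^ 2) ^ 3 - L.g₂ * (f z + 1 / z ^ 2) - L.g₃)
          - (4 * (g z + 1 / z ^ 2) ^ 3 - L.g₂ * (g z + 1 / z ^ 2) - L.g₃)) := by rw [e1, e2]
    field_simp at e3
    apply mul_left_cancel₀ (pow_ne_zero 2 hz)
    linear_combination e3

open PeriodPair in
/-- The period lattice is determined by the invariants `G₄` and `G₆`. -/
theorem lattice_le_of_G_eq {L M : PeriodPair} (h4 : L.G 4 = M.G 4) (h6 : L.G 6 = M.G 6) :
    L.lattice ≤ M.lattice := by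
  set U : Set ℂ := ((L.lattice : Set ℂ) ∪ (M.lattice : Set ℂ))ᶜ
  have hco : ((L.lattice : Set ℂ) ∪ (M.lattice : Set ℂ)).Countable := by
    refine Set.Countable.union ?_ ?_
    · exact Set.countable_coe_iff.1 (L.latticeEquivProd.toEquiv.injective.countable)
    · exact Set.countable_coe_iff.1 (M.latticeEquivProd.toEquiv.injective.countable)
  have hU : IsPreconnected U := (hco.isConnected_compl_of_one_lt_rank (by
    rw [Complex.rank_real_complex]; norm_num)).isPreconnected
  have hUo : IsOpen U := (L.isClosed_lattice.union M.isClosed_lattice).isOpen_compl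
  have hpt : ∀ l : ℂ, ∀ᶠ z in 𝓝[≠] l, z ∈ U := by
    intro l
    filter_upwards [mem_nhdsWithin_of_mem_nhds (L.compl_lattice_sdiff_singleton_mem_nhds l),
      mem_nhdsWithin_of_mem_nhds (M.compl_lattice_sdiff_singleton_mem_nhds l),
      self_mem_nhdsWithin] with z h1 h2 h3
    rintro (h | h)
    · exact h1 ⟨h, h3⟩
    · exact h2 ⟨h, h3⟩
  obtain ⟨z₀, hz₀U, hz₀⟩ : ∃ z₀ ∈ U, ∀ᶠ z in 𝓝 z₀, L.weierstrassP z = M.weierstrassP z := by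
    have h := weierstrassP_eventuallyEq h4 h6
    rw [eventually_nhdsWithin_iff] at h
    have h2 := h.eventually_nhds
    obtain ⟨z, h3, h4, h5⟩ := ((hpt 0).and ((h2.filter_mono nhdsWithin_le_nhds).and
      self_mem_nhdsWithin)).exists
    refine ⟨z, h3, ?_⟩
    filter_upwards [h4, isOpen_ne.mem_nhds h5] with w h6 h7
    exact h6 h7
  have heq : Set.EqOn L.weierstrassP M.weierstrassP U :=
    AnalyticOnNhd.eqOn_of_preconnected_of_eventuallyEq
      (fun z hz => L.analyticOnNhd_weierstrassP z fun h => hz (Or.inl h))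
      (fun z hz => M.analyticOnNhd_weierstrassP z fun h => hz (Or.inr h)) hU hz₀U hz₀
  intro l hl
  by_contra hlM
  -- The two ℘-functions agree off the union of the lattices, so a point of the first lattice
  -- outside the second would be a pole of one and a regular point of the other.
  have h1 := L.order_weierstrassP l hl
  rw [meromorphicOrderAt_congr (f₂ := M.weierstrassP)
    ((hpt l).mono fun z hz => heq hz)] at h1
  have h2 := (M.analyticOnNhd_weierstrassP l hlM).meromorphicOrderAt_nonneg
  rw [h1] at h2
  exact absurd h2 (by decide)

/-- The period pair `(μ z, μ)`. -/
def periodPair (z : ℍ) (μ : ℂ) (hμ : μ ≠ 0) : PeriodPair where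
  ω₁ := μ * z
  ω₂ := μ
  indep := by
    rw [LinearIndependent.pair_iff]
    intro s t h
    have h1 : μ * ((s : ℂ) * z + t) = 0 := by
      simp only [Complex.real_smul] at h
      linear_combination h
    have h2 := (mul_eq_zero.1 h1).resolve_left hμ
    have h3 : s = 0 := by
      have := congrArg Complex.im h2
      simp at this
      exact this.resolve_right z.im_ne_zero
    subst h3
    refine ⟨rfl, ?_⟩
    simpa using h2

/-- The scaling behaviour of the lattice sum turns proportionality of (E₄, E₆) with weights 4 and 6
into equality of the invariants of two suitably scaled lattices. -/
theorem periodPair_G {k : ℕ} (hk : 3 ≤ k) (z : ℍ) (μ : ℂ) (hμ : μ ≠ 0) :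
    (periodPair z μ hμ).G k = (μ ^ k)⁻¹ * (2 * riemannZeta k * ModularForm.E hk z) := by
  have h1 : ModularForm.E hk z = (1 / 2 : ℂ) • eisensteinSeries (N := 1) 0 k z := rfl
  have h2 := tsum_eisSummand_eq_riemannZeta_mul_eisensteinSeries hk z
  rw [h1, smul_eq_mul]
  have h3 : 2 * riemannZeta k * (1 / 2 * eisensteinSeries (N := 1) 0 k z)
    = riemannZeta k * eisensteinSeries (N := 1) 0 k z := by ring
  rw [h3, ← h2, ← tsum_mul_left, PeriodPair.G]
  rw [← ((periodPair z μ hμ).latticeEquivProd.symm.toEquiv).tsum_eq,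
    ← (finTwoArrowEquiv ℤ).tsum_eq]
  refine tsum_congr fun v => ?_
  have h4 : (((periodPair z μ hμ).latticeEquivProd.symm.toEquiv ((finTwoArrowEquiv ℤ) v) :
      (periodPair z μ hμ).lattice) : ℂ) = μ * (v 0 * z + v 1) := by
    have := (periodPair z μ hμ).latticeEquiv_symm_apply (finTwoArrowEquiv ℤ v)
    rw [show (LinearEquiv.toEquiv (periodPair z μ hμ).latticeEquivProd.symm) (finTwoArrowEquiv ℤ v)
      = (periodPair z μ hμ).latticeEquivProd.symm (finTwoArrowEquiv ℤ v) from rfl, this]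
    simp [periodPair]
    ring
  rw [h4, EisensteinSeries.eisSummand, mul_pow, mul_inv, zpow_neg, zpow_natCast]

/-- If `E_k(w) = λ^k E_k(z)` for `k = 4, 6` and `λ ≠ 0`, then `w` is equivalent to `z`. -/
theorem mem_orbit_of_E_eq {z w : ℍ} {l : ℂ} (hl : l ≠ 0)
    (h4 : ModularForm.E₄ w = l ^ 4 * ModularForm.E₄ z)
    (h6 : ModularForm.E₆ w = l ^ 6 * ModularForm.E₆ z) : w ∈ MulAction.orbit SL(2, ℤ) z := by
  set L := periodPair w 1 one_ne_zero
  set M := periodPair z l⁻¹ (inv_ne_zero hl)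
  have e4 : L.G 4 = M.G 4 := by
    rw [periodPair_G (by norm_num : 3 ≤ 4), periodPair_G (by norm_num : 3 ≤ 4), h4]
    simp only [one_pow, inv_one, inv_pow, inv_inv]; ring
  have e6 : L.G 6 = M.G 6 := by
    rw [periodPair_G (by norm_num : 3 ≤ 6), periodPair_G (by norm_num : 3 ≤ 6), h6]
    simp only [one_pow, inv_one, inv_pow, inv_inv]; ring
  have hLM := lattice_le_of_G_eq e4 e6
  have hML := lattice_le_of_G_eq e4.symm e6.symm
  obtain ⟨a, b, hab⟩ := PeriodPair.mem_lattice.1 (hLM L.ω₁_mem_lattice)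
  obtain ⟨c, d, hcd⟩ := PeriodPair.mem_lattice.1 (hLM L.ω₂_mem_lattice)
  obtain ⟨a', b', hab'⟩ := PeriodPair.mem_lattice.1 (hML M.ω₁_mem_lattice)
  obtain ⟨c', d', hcd'⟩ := PeriodPair.mem_lattice.1 (hML M.ω₂_mem_lattice)
  simp only [L, M, periodPair, one_mul, mul_one] at hab hcd hab' hcd'
  set μ := l⁻¹
  have hμ : μ ≠ 0 := inv_ne_zero hl
  have hN : 0 < Complex.normSq μ := Complex.normSq_pos.2 hμ
  -- As c μ z + d μ = 1, the imaginary part of w is that of (a μ z + b μ) times the conjugate of c μ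
  -- z + d μ. This makes the determinant positive; the reverse inclusion gives an integral inverse,
  -- so the determinant is 1.
  have im1 : (w : ℂ).im = Complex.normSq μ * ((a * d - b * c : ℤ) : ℝ) * (z : ℂ).im := by
    have : (w : ℂ) = (a * (μ * z) + b * μ) * (starRingEnd ℂ) (c * (μ * z) + d * μ) := by
      rw [hab, hcd]; simp
    rw [this]
    simp [Complex.normSq_apply]
    ring
  have im2 : Complex.normSq μ * (z : ℂ).im = ((a' * d' - b' * c' : ℤ) : ℝ) * (w : ℂ).im := by
    have : ((μ * z) * (starRingEnd ℂ) μ).im = ((a' * (w : ℂ) + b') * (starRingEnd ℂ) (c' * (w : ℂ) + d')).im := by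
      rw [hab', hcd']
    simp only [map_add, map_mul, map_intCast, Complex.mul_im, Complex.mul_re, Complex.add_re,
      Complex.add_im, Complex.conj_re, Complex.conj_im, Complex.intCast_re, Complex.intCast_im]
      at this
    rw [Complex.normSq_apply]
    push_cast
    linear_combination this
  have hw := w.im_pos
  have hz := z.im_pos
  have hpos : (0 : ℝ) < ((a * d - b * c : ℤ) : ℝ) := by
    by_contra hh
    push Not at hh
    have hw' : (0 : ℝ) < (w : ℂ).im := hw
    have hz' : (0 : ℝ) < (z : ℂ).im := hz
    have : Complex.normSq μ * ((a * d - b * c : ℤ) : ℝ) * (z : ℂ).im ≤ 0 :=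
      mul_nonpos_of_nonpos_of_nonneg (mul_nonpos_of_nonneg_of_nonpos hN.le hh) hz'.le
    rw [im1] at hw'
    linarith
  have hprod : (a * d - b * c) * (a' * d' - b' * c') = 1 := by
    have : (w : ℂ).im * (((a * d - b * c : ℤ) : ℝ) * ((a' * d' - b' * c' : ℤ) : ℝ) - 1) = 0 := by
      linear_combination (-1 : ℝ) * im1 - ((a * d - b * c : ℤ) : ℝ) * im2
    have h := (mul_eq_zero.1 this).resolve_left (ne_of_gt hw)
    have h' : (((a * d - b * c) * (a' * d' - b' * c') : ℤ) : ℝ) = 1 := by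
      rw [Int.cast_mul]; linarith
    exact_mod_cast h'
  have hdet : a * d - b * c = 1 := by
    have hpos' : 0 < a * d - b * c := by exact_mod_cast hpos
    exact (Int.eq_one_or_neg_one_of_mul_eq_one hprod).resolve_right (by omega)
  let γ : SL(2, ℤ) := ⟨!![a, b; c, d], by rw [Matrix.det_fin_two_of, hdet]⟩
  have hne : (c : ℂ) * z + d ≠ 0 := by
    intro h
    apply one_ne_zero (α := ℂ)
    rw [← hcd]; linear_combination μ * h
  refine ⟨γ, UpperHalfPlane.ext ?_⟩
  change ((γ • z : ℍ) : ℂ) = w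
  rw [UpperHalfPlane.specialLinearGroup_apply]
  simp only [γ, algebraMap_int_eq, eq_intCast, Complex.ofReal_intCast, Matrix.of_apply,
    Matrix.cons_val', Matrix.cons_val_zero, Matrix.cons_val_one, Matrix.cons_val_fin_one]
  rw [div_eq_iff hne, ← hab]
  linear_combination (-(a * z + b) : ℂ) * hcd

theorem discriminant_ne_zero' (z : ℍ) : ModularForm.E₄ z ^ 3 - ModularForm.E₆ z ^ 2 ≠ 0 := by
  have := ModularForm.discriminant_ne_zero z
  rw [ModularForm.discriminant_eq_E₄_cube_sub_E₆_sq] at this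
  exact fun h => this (by rw [h]; simp)

/-- The function `E₄³ / E₆²` separates the orbits of `SL(2,ℤ)`. -/
theorem mem_orbit_of_cross_eq {z w : ℍ}
    (h : ModularForm.E₄ z ^ 3 * ModularForm.E₆ w ^ 2 = ModularForm.E₄ w ^ 3 * ModularForm.E₆ z ^ 2) :
    w ∈ MulAction.orbit SL(2, ℤ) z := by
  have hz := discriminant_ne_zero' z
  have hw := discriminant_ne_zero' w
  by_cases hz4 : ModularForm.E₄ z = 0
  · have hz6 : ModularForm.E₆ z ≠ 0 := fun h6 => hz (by rw [hz4, h6]; norm_num)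
    have hw4 : ModularForm.E₄ w = 0 := by
      rw [hz4] at h
      simpa [hz6] using h.symm
    have hw6 : ModularForm.E₆ w ≠ 0 := fun h6 => hw (by rw [hw4, h6]; norm_num)
    obtain ⟨l, hl⟩ := IsAlgClosed.exists_pow_nat_eq (ModularForm.E₆ w / ModularForm.E₆ z)
      (by norm_num : 0 < 6)
    refine mem_orbit_of_E_eq (l := l) ?_ (by simp [hz4, hw4]) (by rw [hl]; field_simp)
    rintro rfl
    exact (div_ne_zero hw6 hz6) (by simpa using hl.symm)
  · have hw4 : ModularForm.E₄ w ≠ 0 := fun h4 => by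
      rw [h4] at h
      have hw6 : ModularForm.E₆ w = 0 := by simpa [hz4] using h
      exact hw (by rw [h4, hw6]; norm_num)
    obtain ⟨l, hl⟩ := IsAlgClosed.exists_pow_nat_eq (ModularForm.E₄ w / ModularForm.E₄ z)
      (by norm_num : 0 < 4)
    have hl0 : l ≠ 0 := by
      rintro rfl
      exact (div_ne_zero hw4 hz4) (by simpa using hl.symm)
    have hl4 : ModularForm.E₄ w = l ^ 4 * ModularForm.E₄ z := by rw [hl]; field_simp
    have h6 : ModularForm.E₆ w ^ 2 = (l ^ 6 * ModularForm.E₆ z) ^ 2 := by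
      apply mul_left_cancel₀ (pow_ne_zero 3 hz4)
      rw [h, hl4]; ring
    -- The fourth root l fixes l⁶ only up to sign; replacing l by I * l keeps l⁴ and changes the
    -- sign of l⁶.
    rcases sq_eq_sq_iff_eq_or_eq_neg.1 h6 with h6 | h6
    · exact mem_orbit_of_E_eq hl0 hl4 h6
    · refine mem_orbit_of_E_eq (l := Complex.I * l) (mul_ne_zero Complex.I_ne_zero hl0) ?_ ?_
      · rw [mul_pow, Complex.I_pow_four, one_mul, hl4]
      · rw [mul_pow, show Complex.I ^ 6 = Complex.I ^ 4 * Complex.I ^ 2 by ring,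
          Complex.I_pow_four, Complex.I_sq, h6]
        ring

open scoped Manifold

/-! ### Behaviour at the cusp -/

theorem tendsto_atImInfty_qExpansion {f : ℍ → ℂ}
    (hper : Function.Periodic (f ∘ ofComplex) (1 : ℝ)) (hhol : MDiff f)
    (hbdd : IsBoundedAtImInfty f) : Tendsto f atImInfty (𝓝 ((qExpansion 1 f).coeff 0)) := by
  have han := analyticAt_cuspFunction_zero one_pos hper hhol hbdd
  have h0 : (qExpansion 1 f).coeff 0 = cuspFunction 1 f 0 := by simp [qExpansion_coeff]
  rw [h0]
  refine (han.continuousAt.tendsto.comp (qParam_tendsto_atImInfty one_pos)).congr fun z => ?_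
  exact eq_cuspFunction z one_ne_zero hper

theorem tendsto_modularForm {k : ℕ} (hk : 3 ≤ k) (hk2 : Even k) :
    Tendsto (ModularForm.E hk) atImInfty (𝓝 1) := by
  have : Fact (IsCusp OnePoint.infty 𝒮ℒ) :=
    ⟨Subgroup.isCusp_of_mem_strictPeriods one_pos one_mem_strictPeriods_SL⟩
  rw [← EisensteinSeries.E_qExpansion_coeff_zero hk hk2]
  exact tendsto_atImInfty_qExpansion
    (SlashInvariantFormClass.periodic_comp_ofComplex _ one_mem_strictPeriods_SL)
    (ModularFormClass.holo _) (ModularFormClass.bdd_at_infty _)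

theorem tendsto_E4 : Tendsto ModularForm.E₄ atImInfty (𝓝 1) := tendsto_modularForm _ (by decide)
theorem tendsto_E6 : Tendsto ModularForm.E₆ atImInfty (𝓝 1) := tendsto_modularForm _ (by decide)

/-- If a holomorphic function has a limit at the cusp, its derivative tends to `0` there. -/
theorem tendsto_deriv_atImInfty {g : ℂ → ℂ} {A : ℝ} {c : ℂ}
    (hg : ∀ z : ℂ, A < z.im → DifferentiableAt ℂ g z)
    (h : Tendsto (fun z : ℍ => g z) atImInfty (𝓝 c)) :
    Tendsto (fun z : ℍ => deriv g z) atImInfty (𝓝 0) := by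
  rw [Metric.tendsto_nhds]
  intro ε hε
  have h1 := (Metric.tendsto_nhds.1 h) (ε / 2) (by positivity)
  obtain ⟨B, hB⟩ := (atImInfty_mem _).1 h1
  refine (atImInfty_mem _).2 ⟨max (max A B) 0 + 2, fun z hz => ?_⟩
  have hzA : A + 2 ≤ z.im := le_trans (by simp) hz
  have hzB : B + 2 ≤ z.im := le_trans (by simp) hz
  have hz0 : 0 + 2 ≤ z.im := le_trans (by simp) hz
  have him : ∀ w : ℂ, w ∈ Metric.closedBall (z : ℂ) 1 → z.im - 1 ≤ w.im := by
    intro w hw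
    have := (Complex.abs_im_le_norm (w - z)).trans (mem_closedBall_iff_norm.1 hw)
    rw [Complex.sub_im, abs_le] at this
    have h3 : (z : ℂ).im = z.im := rfl
    linarith [this.1]
  -- Cauchy's estimate on the unit disc about z, which stays high in the half-plane.
  have hbound := Complex.norm_deriv_le_of_forall_mem_sphere_norm_le (f := fun w => g w - c)
    (c := (z : ℂ)) (R := 1) (C := ε / 2) one_pos ?_ ?_
  · rw [deriv_sub_const_fun] at hbound
    simp only [Set.mem_ofPred_eq, dist_zero_right]
    linarith
  · refine DifferentiableOn.diffContOnCl_ball (U := Metric.closedBall (z : ℂ) 1) (fun w hw => ?_)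
      subset_rfl
    exact ((hg w (by linarith [him w hw])).sub_const c).differentiableWithinAt
  · intro w hw
    have h4 := him w (Metric.sphere_subset_closedBall hw)
    have := hB ⟨w, by linarith⟩ (by change B ≤ w.im; linarith)
    simp only [Set.mem_ofPred_eq, dist_eq_norm] at this
    exact this.le

theorem E2_periodic : Function.Periodic (EisensteinSeries.E2 ∘ ofComplex) (1 : ℝ) := by
  have h : ∀ z : ℍ, EisensteinSeries.E2 ((1 : ℝ) +ᵥ z) = EisensteinSeries.E2 z := by
    intro z
    have := congrFun (EisensteinSeries.E2_slash_action ModularGroup.T) z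
    rw [EisensteinSeries.D2_T, smul_zero, sub_zero, ModularForm.SL_slash_apply,
      UpperHalfPlane.modular_T_smul] at this
    have hd : denom ModularGroup.T z = 1 := by
      rw [ModularGroup.denom_apply]; simp [ModularGroup.T]
    rw [hd, one_zpow, mul_one] at this
    exact this
  intro w
  by_cases hw : 0 < w.im
  · have hw' : 0 < (w + (1 : ℝ)).im := by simpa using hw
    simp only [Function.comp_apply, ofComplex_apply_of_im_pos hw, ofComplex_apply_of_im_pos hw']
    rw [← h ⟨w, hw⟩]
    congr 1
    ext1
    rw [UpperHalfPlane.coe_vadd]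
    exact add_comm _ _
  · have hw' : ¬ 0 < (w + (1 : ℝ)).im := by simpa using hw
    simp only [Function.comp_apply, ofComplex_apply_of_im_nonpos (not_lt.1 hw),
      ofComplex_apply_of_im_nonpos (not_lt.1 hw')]

theorem tendsto_E2 : Tendsto EisensteinSeries.E2 atImInfty (𝓝 1) := by
  have hs := fun z : ℍ => EisensteinSeries.hasSum_qExpansion_E2 (z := z)
  have h1 := tendsto_atImInfty_qExpansion E2_periodic E2_mdifferentiable
    EisensteinSeries.isBoundedAtImInfty_E2
  have han := analyticAt_cuspFunction_zero one_pos E2_periodic E2_mdifferentiable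
    EisensteinSeries.isBoundedAtImInfty_E2
  have h2 := hasFPowerSeriesOnBall_cuspFunction (f := EisensteinSeries.E2) one_pos han
    (c := fun m => if m = 0 then 1 else -24 * ((ArithmeticFunction.sigma 1 m : ℕ) : ℂ)) (fun z => by
      simpa only [Function.Periodic.qParam, Complex.ofReal_one, div_one] using hs z)
  have h3 : (qExpansion 1 EisensteinSeries.E2).coeff 0 = cuspFunction 1 EisensteinSeries.E2 0 := by
    simp [qExpansion_coeff]
  have h4 := h2.hasFPowerSeriesAt.coeff_zero (fun _ => 0)
  rw [h3, ← h4] at h1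
  simpa [FormalMultilinearSeries.ofScalars] using h1

/-! ### Modular forms of small weight -/

/-- All cusps are equivalent to ∞ under SL(2,ℤ), so vanishing there makes f a cusp form, and there
is no nonzero cusp form of level one and weight below 12. -/
theorem eq_zero_of_weight_lt_twelve {k : ℤ} (hk : k < 12) {f : ℍ → ℂ} (hf : MDiff f)
    (hs : ∀ γ : SL(2, ℤ), f ∣[k] γ = f) (h0 : IsZeroAtImInfty f) : f = 0 := by
  let F : CuspForm 𝒮ℒ k :=
    { toFun := f
      slash_action_eq' := fun _ ⟨γ, hγ⟩ => hγ ▸ hs γ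
      holo' := hf
      zero_at_cusps' := fun {c} hc => by
        rw [Subgroup.IsArithmetic.isCusp_iff_isCusp_SL2Z] at hc
        rw [OnePoint.isZeroAt_iff_forall_SL2Z hc]
        intro γ _
        rw [hs γ]
        exact h0 }
  have := rank_zero_iff_forall_zero.1 (CuspForm.rank_eq_zero_of_weight_lt_twelve hk) F
  exact congrArg DFunLike.coe this

/-- `E₄` as a function on the complex plane. -/
def cE4 (z : ℂ) : ℂ := ModularForm.E₄ (ofComplex z)
/-- `E₆` as a function on the complex plane. -/
def cE6 (z : ℂ) : ℂ := ModularForm.E₆ (ofComplex z)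
/-- `E₂` as a function on the complex plane. -/
def cE2 (z : ℂ) : ℂ := EisensteinSeries.E2 (ofComplex z)

@[simp] theorem cE4_coe (z : ℍ) : cE4 z = ModularForm.E₄ z := by rw [cE4, ofComplex_apply]
@[simp] theorem cE6_coe (z : ℍ) : cE6 z = ModularForm.E₆ z := by rw [cE6, ofComplex_apply]
@[simp] theorem cE2_coe (z : ℍ) : cE2 z = EisensteinSeries.E2 z := by rw [cE2, ofComplex_apply]

theorem analyticAt_of_mdiff {f : ℍ → ℂ} (hf : MDiff f) {z : ℂ} (hz : 0 < z.im) :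
    AnalyticAt ℂ (fun w => f (ofComplex w)) z :=
  (UpperHalfPlane.mdifferentiable_iff.1 hf).analyticAt (isOpen_upperHalfPlaneSet.mem_nhds hz)

theorem mdiff_E {k : ℕ} (hk : 3 ≤ k) : MDiff (ModularForm.E hk) := ModularFormClass.holo _

theorem analyticAt_cE4 {z : ℂ} (hz : 0 < z.im) : AnalyticAt ℂ cE4 z :=
  analyticAt_of_mdiff (mdiff_E _) hz
theorem analyticAt_cE6 {z : ℂ} (hz : 0 < z.im) : AnalyticAt ℂ cE6 z :=
  analyticAt_of_mdiff (mdiff_E _) hz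

theorem slash_E {k : ℕ} (hk : 3 ≤ k) (γ : SL(2, ℤ)) :
    (ModularForm.E hk : ℍ → ℂ) ∣[(k : ℤ)] γ = ModularForm.E hk :=
  SlashInvariantFormClass.slash_action_eq (ModularForm.E hk) _ ⟨γ, rfl⟩

open Derivative in
theorem tendsto_normalizedDeriv {f : ℍ → ℂ} (hf : MDiff f) {c : ℂ}
    (h : Tendsto f atImInfty (𝓝 c)) : Tendsto (D f) atImInfty (𝓝 0) := by
  have := tendsto_deriv_atImInfty (g := f ∘ ofComplex) (A := 0) (c := c)
    (fun z hz => (analyticAt_of_mdiff hf hz).differentiableAt)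
    (by simpa [ofComplex_apply] using h)
  have h2 := this.const_mul ((2 * Real.pi * Complex.I)⁻¹ : ℂ)
  rwa [mul_zero] at h2

-- The Serre derivative of E₄ is modular of weight 6 with limit -1/3 at the cusp. Adding E₆/3 gives
-- a cusp form of weight 6, which is zero.
open Derivative in
theorem serreDerivative_E4 :
    serreDerivative 4 ModularForm.E₄ = fun z => -(1 / 3) * ModularForm.E₆ z := by
  have hs := fun γ => serreDerivative_slash_invariant (k := 4) (mdiff_E (by norm_num : 3 ≤ 4))
    (slash_E (by norm_num : 3 ≤ 4) γ)
  have h := eq_zero_of_weight_lt_twelve (k := 6) (by norm_num)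
    (f := serreDerivative 4 ModularForm.E₄ + (1 / 3 : ℂ) • ⇑ModularForm.E₆)
    ((serreDerivative_mdifferentiable _ (mdiff_E _)).add
      ((mdiff_E (by norm_num : 3 ≤ 6)).const_smul (1 / 3 : ℂ)))
    (fun γ => by
      rw [SlashAction.add_slash, ModularForm.SL_smul_slash]
      exact congrArg₂ (· + ·) (hs γ) (congrArg _ (slash_E _ γ))) ?_
  · funext z
    have := congrFun h z
    simp only [Pi.add_apply, Pi.smul_apply, Pi.zero_apply, smul_eq_mul] at this
    linear_combination this
  · have : Tendsto (fun z => D ModularForm.E₄ z - 4 * 12⁻¹ * EisensteinSeries.E2 z * ModularForm.E₄ z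
      + (1 / 3 : ℂ) * ModularForm.E₆ z) atImInfty (𝓝 (0 - 4 * 12⁻¹ * 1 * 1 + 1 / 3 * 1)) :=
      ((tendsto_normalizedDeriv (mdiff_E _) tendsto_E4).sub
        ((tendsto_E2.const_mul _).mul tendsto_E4)).add (tendsto_E6.const_mul _)
    rw [show ((0 : ℂ) - _ + _) = 0 by norm_num] at this
    exact this

-- The same argument in weight 8: the limit at the cusp is -1/2, and adding E₄²/2 gives a cusp form.
open Derivative in
theorem serreDerivative_E6 :
    serreDerivative 6 ModularForm.E₆ = fun z => -(1 / 2) * ModularForm.E₄ z ^ 2 := by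
  have hs := fun γ => serreDerivative_slash_invariant (k := 6) (mdiff_E (by norm_num : 3 ≤ 6))
    (slash_E (by norm_num : 3 ≤ 6) γ)
  have h := eq_zero_of_weight_lt_twelve (k := 8) (by norm_num)
    (f := serreDerivative 6 ModularForm.E₆
      + (1 / 2 : ℂ) • ((ModularForm.E₄ : ℍ → ℂ) * (ModularForm.E₄ : ℍ → ℂ)))
    ((serreDerivative_mdifferentiable _ (mdiff_E _)).add
      (((mdiff_E (by norm_num : 3 ≤ 4)).mul (mdiff_E (by norm_num : 3 ≤ 4))).const_smul
        (1 / 2 : ℂ)))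
    (fun γ => by
      rw [SlashAction.add_slash, ModularForm.SL_smul_slash]
      refine congrArg₂ (· + ·) (hs γ) (congrArg _ ?_)
      have := ModularForm.mul_slash_SL2 4 4 γ ModularForm.E₄ ModularForm.E₄
      exact this.trans (congrArg₂ (· * ·) (slash_E _ γ) (slash_E _ γ))) ?_
  · funext z
    have := congrFun h z
    simp only [Pi.add_apply, Pi.smul_apply, Pi.zero_apply, smul_eq_mul, Pi.mul_apply] at this
    linear_combination this
  · have : Tendsto (fun z => D ModularForm.E₆ z - 6 * 12⁻¹ * EisensteinSeries.E2 z * ModularForm.E₆ z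
      + (1 / 2 : ℂ) * (ModularForm.E₄ z * ModularForm.E₄ z)) atImInfty
      (𝓝 (0 - 6 * 12⁻¹ * 1 * 1 + 1 / 2 * (1 * 1))) :=
      ((tendsto_normalizedDeriv (mdiff_E _) tendsto_E6).sub
        ((tendsto_E2.const_mul _).mul tendsto_E6)).add ((tendsto_E4.mul tendsto_E4).const_mul _)
    rw [show ((0 : ℂ) - _ + _) = 0 by norm_num] at this
    exact this

open Derivative in
/-- Ramanujan's formula for the derivative of `E₄`. -/
theorem hasDerivAt_cE4 {z : ℂ} (hz : 0 < z.im) : HasDerivAt cE4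
    (2 * Real.pi * Complex.I * ((cE2 z * cE4 z - cE6 z) / 3)) z := by
  obtain ⟨w, rfl⟩ : ∃ w : ℍ, (w : ℂ) = z := ⟨⟨z, hz⟩, rfl⟩
  have h : (2 * Real.pi * Complex.I : ℂ)⁻¹ * deriv cE4 w
      - 4 * 12⁻¹ * EisensteinSeries.E2 w * ModularForm.E₄ w = _ :=
    congrFun serreDerivative_E4 w
  refine (analyticAt_cE4 hz).differentiableAt.hasDerivAt.congr_deriv ?_
  have hpi : (2 * Real.pi * Complex.I : ℂ) ≠ 0 := Complex.two_pi_I_ne_zero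
  rw [cE4_coe, cE6_coe, cE2_coe, ← mul_inv_cancel_left₀ hpi (deriv cE4 w)]
  linear_combination (2 * Real.pi * Complex.I : ℂ) * h

open Derivative in
/-- Ramanujan's formula for the derivative of `E₆`. -/
theorem hasDerivAt_cE6 {z : ℂ} (hz : 0 < z.im) : HasDerivAt cE6
    (2 * Real.pi * Complex.I * ((cE2 z * cE6 z - cE4 z ^ 2) / 2)) z := by
  obtain ⟨w, rfl⟩ : ∃ w : ℍ, (w : ℂ) = z := ⟨⟨z, hz⟩, rfl⟩
  have h : (2 * Real.pi * Complex.I : ℂ)⁻¹ * deriv cE6 w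
      - 6 * 12⁻¹ * EisensteinSeries.E2 w * ModularForm.E₆ w = _ :=
    congrFun serreDerivative_E6 w
  refine (analyticAt_cE6 hz).differentiableAt.hasDerivAt.congr_deriv ?_
  have hpi : (2 * Real.pi * Complex.I : ℂ) ≠ 0 := Complex.two_pi_I_ne_zero
  rw [cE4_coe, cE6_coe, cE2_coe, ← mul_inv_cancel_left₀ hpi (deriv cE6 w)]
  linear_combination (2 * Real.pi * Complex.I : ℂ) * h

/-! ### Transformation formulas and zeros -/

theorem E_smul {k : ℕ} (hk : 3 ≤ k) (γ : SL(2, ℤ)) (z : ℍ) :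
    ModularForm.E hk (γ • z) = denom γ z ^ k * ModularForm.E hk z := by
  have h := congrFun (slash_E hk γ) z
  rw [ModularForm.SL_slash_apply] at h
  rw [← h, zpow_neg, zpow_natCast]
  field_simp [denom_ne_zero γ z]

theorem E2_smul (γ : SL(2, ℤ)) (z : ℍ) :
    EisensteinSeries.E2 (γ • z) = denom γ z ^ 2 * EisensteinSeries.E2 z
      + 12 / (2 * Real.pi * Complex.I) * (γ 1 0 : ℂ) * denom γ z := by
  have h := congrFun (EisensteinSeries.E2_slash_action γ) z
  rw [ModularForm.SL_slash_apply] at h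
  have hd := denom_ne_zero γ z
  simp only [Pi.sub_apply, Pi.smul_apply, EisensteinSeries.D2, riemannZeta_two, smul_eq_mul,
    zpow_neg] at h
  rw [mul_inv_eq_iff_eq_mul₀ (zpow_ne_zero _ hd)] at h
  rw [h]
  have hpi : (Real.pi : ℂ) ≠ 0 := Complex.ofReal_ne_zero.2 Real.pi_ne_zero
  have hI := Complex.I_sq
  have h12 : (12 : ℂ) / (2 * Real.pi * Complex.I) = -6 * Complex.I / Real.pi := by
    rw [div_eq_div_iff Complex.two_pi_I_ne_zero hpi]
    linear_combination (12 * Real.pi : ℂ) * hI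
  rw [h12, show ∀ a : ℂ, a ^ (2 : ℤ) = a ^ 2 from fun a => zpow_ofNat a 2]
  field_simp
  ring

theorem S_smul_I : ModularGroup.S • UpperHalfPlane.I = UpperHalfPlane.I := by
  ext1
  rw [UpperHalfPlane.modular_S_smul]
  simp

/-- The involution S fixes i with automorphy factor i, and i⁶ = -1. -/
theorem E6_I : ModularForm.E₆ UpperHalfPlane.I = 0 := by
  have h := E_smul (by norm_num : 3 ≤ 6) ModularGroup.S UpperHalfPlane.I
  rw [S_smul_I, ModularGroup.denom_S] at h
  have h6 : ((UpperHalfPlane.I : ℍ) : ℂ) ^ 6 = -1 := by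
    rw [UpperHalfPlane.coe_I, show Complex.I ^ 6 = Complex.I ^ 4 * Complex.I ^ 2 by ring,
      Complex.I_pow_four, Complex.I_sq, one_mul]
  rw [h6] at h
  linear_combination (1 / 2) * h

/-- The generator of the stabiliser of `ρ`. -/
def gammaRho : SL(2, ℤ) := ⟨!![0, -1; 1, 1], by simp [Matrix.det_fin_two_of]⟩

theorem rho_sq : (rho : ℂ) ^ 2 + rho + 1 = 0 := by
  have h3 : (Real.sqrt 3) ^ 2 = 3 := Real.sq_sqrt (by norm_num)
  apply Complex.ext
  · simp [rho, pow_two]; nlinarith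
  · simp [rho, pow_two]; ring

theorem denom_gammaRho (z : ℍ) : denom gammaRho z = z + 1 := by
  rw [ModularGroup.denom_apply]
  simp [gammaRho]

theorem gammaRho_smul : gammaRho • rho = rho := by
  ext1
  rw [UpperHalfPlane.specialLinearGroup_apply]
  simp only [gammaRho, algebraMap_int_eq, eq_intCast, Complex.ofReal_intCast, Matrix.of_apply,
    Matrix.cons_val', Matrix.cons_val_zero, Matrix.cons_val_one, Matrix.cons_val_fin_one]
  have h := rho_sq
  have h1 : (rho : ℂ) + 1 ≠ 0 := by
    intro h2
    have h3 : (1 : ℂ) = 0 := by linear_combination h - rho * h2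
    exact one_ne_zero h3
  push_cast
  rw [one_mul, div_eq_iff h1]
  linear_combination -h

theorem rho_add_one_pow_three : ((rho : ℂ) + 1) ^ 3 = -1 := by
  linear_combination ((rho : ℂ) + 2) * rho_sq

/-- The automorphy factor ρ + 1 of the stabiliser has cube -1, so its fourth power is -(ρ + 1) ≠ 1.
-/
theorem E4_rho : ModularForm.E₄ rho = 0 := by
  have h := E_smul (by norm_num : 3 ≤ 4) gammaRho rho
  rw [gammaRho_smul, denom_gammaRho, show ((rho : ℂ) + 1) ^ 4 = ((rho : ℂ) + 1) ^ 3 * (rho + 1) by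
    ring, rho_add_one_pow_three] at h
  have h2 : ((rho : ℂ) + 2) * ModularForm.E₄ rho = 0 := by linear_combination h
  refine (mul_eq_zero.1 h2).resolve_left fun h3 => ?_
  have := rho_sq
  have h4 : (3 : ℂ) = 0 := by linear_combination this - (rho - 1) * h3
  norm_num at h4

theorem E4_I_ne : ModularForm.E₄ UpperHalfPlane.I ≠ 0 := fun h =>
  discriminant_ne_zero' UpperHalfPlane.I (by rw [h, E6_I]; norm_num)

/-- If E₄ vanishes at both points, the cross products in `mem_orbit_of_cross_eq` are both zero, so
the points are equivalent. -/
theorem E4_eq_zero_iff {z : ℍ} : ModularForm.E₄ z = 0 ↔ z ∈ MulAction.orbit SL(2, ℤ) rho := by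
  refine ⟨fun h => mem_orbit_of_cross_eq (by rw [h, E4_rho]; ring), ?_⟩
  rintro ⟨γ, rfl⟩
  exact (E_smul _ γ rho).trans (by rw [E4_rho, mul_zero])

theorem E6_eq_zero_iff {z : ℍ} :
    ModularForm.E₆ z = 0 ↔ z ∈ MulAction.orbit SL(2, ℤ) UpperHalfPlane.I := by
  refine ⟨fun h => mem_orbit_of_cross_eq (by rw [h, E6_I]; ring), ?_⟩
  rintro ⟨γ, rfl⟩
  exact (E_smul _ γ _).trans (by rw [E6_I, mul_zero])

/-! ### Möbius changes of the variable -/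

/-- The Möbius transformation `δ ↦ β δ / (1 + e δ)` fixing `0`. -/
def mob (β e δ : ℂ) : ℂ := β * δ / (1 + e * δ)

/-- The equation with coefficients `a₂, a₃` near `z₁` is the pull-back of the equation with
coefficients `b₂, b₃` near `z₀` under `z₁ + δ ↦ z₀ + mob β e δ`, where solutions are transformed
as forms of weight `-2`. -/
def IsPullback (β e : ℂ) (a₂ a₃ : ℂ → ℂ) (z₁ : ℂ) (b₂ b₃ : ℂ → ℂ) (z₀ : ℂ) : Prop :=
  ∀ᶠ δ in 𝓝[≠] (0 : ℂ), a₂ (z₁ + δ) = (β / (1 + e * δ) ^ 2) ^ 2 * b₂ (z₀ + mob β e δ) ∧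
    a₃ (z₁ + δ) = (β / (1 + e * δ) ^ 2) ^ 3 * b₃ (z₀ + mob β e δ)
      - 2 * e * β ^ 2 / (1 + e * δ) ^ 5 * b₂ (z₀ + mob β e δ)

theorem mob_mob {β e δ : ℂ} (hβ : β ≠ 0) (h : 1 + e * δ ≠ 0) :
    mob β⁻¹ (-e / β) (mob β e δ) = δ := by
  have h1 : 1 + -e / β * mob β e δ = (1 + e * δ)⁻¹ := by
    rw [mob]; field_simp; ring
  rw [mob, h1, mob]
  field_simp
  rw [mul_comm δ e, mul_div_cancel_right₀ _ h]

theorem mob_zero (β e : ℂ) : mob β e 0 = 0 := by simp [mob]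

theorem one_add_mob {β e δ : ℂ} (hβ : β ≠ 0) (h : 1 + e * δ ≠ 0) :
    1 + -e / β * mob β e δ = (1 + e * δ)⁻¹ := by
  rw [mob]; field_simp; ring

theorem analyticAt_mob {β e δ : ℂ} (h : 1 + e * δ ≠ 0) : AnalyticAt ℂ (mob β e) δ := by
  unfold mob
  fun_prop (disch := assumption)

theorem eventually_one_add_ne (e : ℂ) : ∀ᶠ δ in 𝓝 (0 : ℂ), 1 + e * δ ≠ 0 :=
  ContinuousAt.eventually_ne (by fun_prop) (by simp)

theorem tendsto_mob {β e : ℂ} (hβ : β ≠ 0) : Tendsto (mob β e) (𝓝[≠] 0) (𝓝[≠] 0) := by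
  refine tendsto_nhdsWithin_iff.2 ⟨?_, ?_⟩
  · have := (analyticAt_mob (β := β) (e := e) (δ := 0) (by simp)).continuousAt.tendsto
    rw [mob_zero] at this
    exact this.mono_left nhdsWithin_le_nhds
  · filter_upwards [(eventually_one_add_ne e).filter_mono nhdsWithin_le_nhds, self_mem_nhdsWithin]
      with δ h1 h2
    exact div_ne_zero (mul_ne_zero hβ h2) h1

/-- The inverse of δ ↦ βδ/(1 + eδ) has the same shape, with parameters β⁻¹ and -e/β. -/
theorem IsPullback.symm {β e : ℂ} (hβ : β ≠ 0) {a₂ a₃ b₂ b₃ : ℂ → ℂ} {z₀ z₁ : ℂ}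
    (h : IsPullback β e a₂ a₃ z₁ b₂ b₃ z₀) :
    IsPullback β⁻¹ (-e / β) b₂ b₃ z₀ a₂ a₃ z₁ := by
  have h1 := (tendsto_mob (e := -e / β) (inv_ne_zero hβ)).eventually h
  filter_upwards [h1, (eventually_one_add_ne (-e / β)).filter_mono nhdsWithin_le_nhds]
    with δ h2 h3
  have e1 : mob β e (mob β⁻¹ (-e / β) δ) = δ := by
    have := mob_mob (β := β⁻¹) (e := -e / β) (δ := δ) (inv_ne_zero hβ) h3
    rwa [inv_inv, show -(-e / β) / β⁻¹ = e by field_simp] at this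
  have e2 : 1 + e * mob β⁻¹ (-e / β) δ = (1 + -e / β * δ)⁻¹ := by
    have := one_add_mob (β := β⁻¹) (e := -e / β) (δ := δ) (inv_ne_zero hβ) h3
    rwa [show -(-e / β) / β⁻¹ = e by field_simp] at this
  rw [e1, e2] at h2
  rw [h2.1, h2.2]
  set s := 1 + -e / β * δ
  constructor
  · field_simp
  · field_simp
    ring

theorem iteratedDeriv_three (f : ℂ → ℂ) (z : ℂ) :
    iteratedDeriv 3 f z = deriv (deriv (deriv f)) z := by
  rw [iteratedDeriv_succ, iteratedDeriv_succ, iteratedDeriv_one]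

theorem hasDerivAt_mob {β e δ : ℂ} (h : 1 + e * δ ≠ 0) :
    HasDerivAt (mob β e) (β / (1 + e * δ) ^ 2) δ := by
  have h1 : HasDerivAt (fun δ => β * δ) β δ := by simpa using (hasDerivAt_id δ).const_mul β
  have h2 : HasDerivAt (fun δ => 1 + e * δ) e δ := by
    simpa using ((hasDerivAt_id δ).const_mul e).const_add 1
  refine (h1.div h2 h).congr_deriv ?_
  congr 1
  ring

/-- The pull-back of a solution. -/
theorem pullback_solution {β e : ℂ} (hβ : β ≠ 0) {y : ℂ → ℂ} {z₀ δ : ℂ} (h : 1 + e * δ ≠ 0)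
    (hy : AnalyticAt ℂ y (z₀ + mob β e δ)) :
    deriv (fun x => (1 + e * x) ^ 2 / β * y (z₀ + mob β e x)) δ
        = 2 * e * (1 + e * δ) / β * y (z₀ + mob β e δ) + deriv y (z₀ + mob β e δ) ∧
      iteratedDeriv 3 (fun x => (1 + e * x) ^ 2 / β * y (z₀ + mob β e x)) δ
        = (β / (1 + e * δ) ^ 2) ^ 2 * iteratedDeriv 3 y (z₀ + mob β e δ) := by
  have hlin : ∀ x, HasDerivAt (fun x => 1 + e * x) e x := fun x => by
    simpa using ((hasDerivAt_id x).const_mul e).const_add 1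
  have hcomp : ∀ {f : ℂ → ℂ} {x : ℂ}, 1 + e * x ≠ 0 → AnalyticAt ℂ f (z₀ + mob β e x) →
      HasDerivAt (fun x => f (z₀ + mob β e x))
        (deriv f (z₀ + mob β e x) * (β / (1 + e * x) ^ 2)) x := fun {f x} hx hf =>
    HasDerivAt.comp x (h₂ := f) hf.differentiableAt.hasDerivAt ((hasDerivAt_mob hx).const_add z₀)
  have hne : ∀ᶠ x in 𝓝 δ, 1 + e * x ≠ 0 := ContinuousAt.eventually_ne (by fun_prop) h
  have hcont : ContinuousAt (fun x => z₀ + mob β e x) δ :=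
    continuousAt_const.add (analyticAt_mob h).continuousAt
  have hana : ∀ᶠ x in 𝓝 δ, AnalyticAt ℂ y (z₀ + mob β e x) :=
    hcont.eventually hy.eventually_analyticAt
  have d1 : ∀ᶠ x in 𝓝 δ, deriv (fun x => (1 + e * x) ^ 2 / β * y (z₀ + mob β e x)) x
      = 2 * e * (1 + e * x) / β * y (z₀ + mob β e x) + deriv y (z₀ + mob β e x) := by
    filter_upwards [hne, hana] with x hx hxy
    have := ((((hlin x).fun_pow 2).div_const β).fun_mul (hcomp hx hxy)).deriv
    rw [this]
    field_simp
    push_cast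
    ring
  have d2 : ∀ᶠ x in 𝓝 δ, deriv (deriv (fun x => (1 + e * x) ^ 2 / β * y (z₀ + mob β e x))) x
      = 2 * e ^ 2 / β * y (z₀ + mob β e x) + 2 * e * (1 + e * x)⁻¹ * deriv y (z₀ + mob β e x)
        + β * ((1 + e * x) ^ 2)⁻¹ * deriv (deriv y) (z₀ + mob β e x) := by
    filter_upwards [hne, hana, d1.eventually_nhds] with x hx hxy hd
    rw [Filter.EventuallyEq.deriv_eq hd]
    have := (((((hlin x).const_mul (2 * e)).div_const β).fun_mul (hcomp hx hxy)).fun_add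
      (hcomp hx hxy.deriv)).deriv
    rw [this]
    field_simp
  -- In the third derivative all lower order terms cancel. This is Bol's identity for Möbius maps:
  -- ∂³ takes weight -2 to weight 4.
  refine ⟨d1.self_of_nhds, ?_⟩
  rw [iteratedDeriv_three, iteratedDeriv_three, Filter.EventuallyEq.deriv_eq d2]
  have hinv1 := (hlin δ).fun_inv h
  have hinv2 := ((hlin δ).fun_pow 2).fun_inv (pow_ne_zero 2 h)
  have := ((((hcomp h hy).const_mul (2 * e ^ 2 / β)).fun_add
    ((hinv1.const_mul (2 * e)).fun_mul (hcomp h hy.deriv))).fun_add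
    ((hinv2.const_mul β).fun_mul (hcomp h hy.deriv.deriv))).deriv
  rw [this]
  field_simp
  push_cast
  ring

/-- Apparentness can be tested after a Möbius change of the variable. -/
theorem IsPullback.isApparentAt {β e : ℂ} (hβ : β ≠ 0) {a₂ a₃ b₂ b₃ : ℂ → ℂ} {z₀ z₁ : ℂ}
    (h : IsPullback β e a₂ a₃ z₁ b₂ b₃ z₀) (ha : IsApparentAt a₂ a₃ z₁) :
    IsApparentAt b₂ b₃ z₀ := by
  obtain ⟨ε, hε, ha⟩ := ha
  set γ := β⁻¹
  set f := -e / β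
  have hγ : γ ≠ 0 := inv_ne_zero hβ
  have hfe : -f / γ = e := by simp only [f, γ]; field_simp
  have hmm : ∀ {δ : ℂ}, 1 + f * δ ≠ 0 → mob β e (mob γ f δ) = δ := fun {δ} hd => by
    have := mob_mob (β := γ) hγ hd
    rwa [hfe, inv_inv] at this
  have hom : ∀ {δ : ℂ}, 1 + f * δ ≠ 0 → 1 + e * mob γ f δ = (1 + f * δ)⁻¹ := fun {δ} hd => by
    have := one_add_mob (β := γ) hγ hd
    rwa [hfe] at this
  have hcm : ContinuousAt (mob γ f) 0 := (analyticAt_mob (by simp)).continuousAt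
  -- On the final ball the denominator stays in the slit plane, so its principal logarithm is
  -- analytic and can be used to correct branches.
  have ev1 : ∀ᶠ δ in 𝓝 (0 : ℂ), 1 + e * mob γ f δ ∈ Complex.slitPlane := by
    have : ContinuousAt (fun δ => 1 + e * mob γ f δ) 0 := by fun_prop
    exact this.eventually (Complex.isOpen_slitPlane.mem_nhds (by simp [mob_zero]))
  have ev2 : ∀ᶠ δ in 𝓝 (0 : ℂ), mob γ f δ ∈ Metric.ball (0 : ℂ) ε :=
    hcm.eventually (by rw [mob_zero]; exact Metric.ball_mem_nhds _ hε)
  have ev3 := eventually_nhdsWithin_iff.1 ((tendsto_mob (e := f) hγ).eventually h)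
  obtain ⟨r, hr, hball⟩ := Metric.eventually_nhds_iff_ball.1
    (((eventually_one_add_ne f).and ev1).and (ev2.and ev3))
  refine ⟨r, hr, fun U hU hUc hUb L hL hexp y hy => ?_⟩
  have hzU : ∀ z ∈ U, z - z₀ ∈ Metric.ball (0 : ℂ) r ∧ z - z₀ ≠ 0 := fun z hz =>
    ⟨by simpa [dist_eq_norm] using (hUb hz).1, sub_ne_zero.2 (hUb hz).2⟩
  let ψ : ℂ → ℂ := fun z => z₁ + mob γ f (z - z₀)
  let φ : ℂ → ℂ := fun w => z₀ + mob β e (w - z₁)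
  have hψU : ∀ z ∈ U, 1 + e * (ψ z - z₁) ≠ 0 ∧ φ (ψ z) = z := fun z hz => by
    obtain ⟨⟨h1, h2⟩, -⟩ := hball _ (hzU z hz).1
    simp only [ψ, φ, add_sub_cancel_left]
    rw [hmm h1]
    exact ⟨Complex.slitPlane_ne_zero h2, by ring⟩
  set V : Set ℂ := ψ '' U
  have hVmem : ∀ w ∈ V, 1 + e * (w - z₁) ≠ 0 ∧ φ w ∈ U ∧ ψ (φ w) = w := by
    rintro _ ⟨z, hz, rfl⟩
    exact ⟨(hψU z hz).1, by rw [(hψU z hz).2]; exact hz, by rw [(hψU z hz).2]⟩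
  have hVeq : V = {w | 1 + e * (w - z₁) ≠ 0} ∩ φ ⁻¹' U := by
    ext w
    refine ⟨fun hw => ⟨(hVmem w hw).1, (hVmem w hw).2.1⟩, fun ⟨h1, h2⟩ => ⟨φ w, h2, ?_⟩⟩
    simp only [ψ, φ, add_sub_cancel_left]
    rw [mob_mob hβ h1]; ring
  have hφan : ∀ w, 1 + e * (w - z₁) ≠ 0 → AnalyticAt ℂ φ w := fun w hw =>
    analyticAt_const.add ((analyticAt_mob hw).fun_comp (f := fun w => w - z₁)
      (analyticAt_id.sub analyticAt_const))
  have hψan : ∀ z ∈ Metric.ball z₀ r, AnalyticAt ℂ ψ z := fun z hz => by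
    have h1 := (hball (z - z₀) (by simpa [dist_eq_norm] using hz)).1.1
    exact analyticAt_const.add ((analyticAt_mob h1).fun_comp (f := fun z => z - z₀)
      (analyticAt_id.sub analyticAt_const))
  have hVo : IsOpen V := by
    rw [hVeq]
    refine ContinuousOn.isOpen_inter_preimage (fun w hw => (hφan w hw).continuousAt.continuousWithinAt)
      ?_ hU
    exact isOpen_ne.preimage (f := fun w => 1 + e * (w - z₁)) (by fun_prop)
  have hVc : IsConnected V := hUc.image ψ fun z hz =>
    (hψan z (hUb hz).1).continuousAt.continuousWithinAt
  have hVb : V ⊆ Metric.ball z₁ ε \ {z₁} := by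
    rintro _ ⟨z, hz, rfl⟩
    obtain ⟨⟨h1, -⟩, h2, -⟩ := hball _ (hzU z hz).1
    refine ⟨by simpa [ψ, dist_eq_norm] using h2, ?_⟩
    simp only [ψ, Set.mem_singleton_iff, add_eq_left]
    exact div_ne_zero (mul_ne_zero hγ (hzU z hz).2) h1
  have hVs : ∀ w ∈ V, 1 + e * (w - z₁) ∈ Complex.slitPlane := by
    rintro _ ⟨z, hz, rfl⟩
    simpa [ψ] using (hball _ (hzU z hz).1).1.2
  -- A branch of log(w - z₁), found from φ w - z₀ = β(w - z₁)/(1 + e(w - z₁)).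
  let M : ℂ → ℂ := fun w => L (φ w) + (Complex.log (1 + e * (w - z₁)) - Complex.log β)
  have hM : ContinuousOn M V := by
    refine ContinuousOn.add (hL.comp (fun w hw => (hφan w (hVmem w hw).1).continuousAt.continuousWithinAt)
      fun w hw => (hVmem w hw).2.1) (ContinuousOn.sub ?_ continuousOn_const)
    exact ContinuousOn.clog (by fun_prop) hVs
  have hMexp : ∀ w ∈ V, Complex.exp (M w) = w - z₁ := by
    intro w hw
    obtain ⟨h1, h2, -⟩ := hVmem w hw
    simp only [M]
    rw [Complex.exp_add, hexp _ h2, Complex.exp_sub, Complex.exp_log h1, Complex.exp_log hβ]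
    simp only [φ, mob, add_sub_cancel_left]
    field_simp
    rw [mul_comm (w - z₁) e, mul_div_cancel_right₀ _ h1]
  let Y : ℂ → ℂ := fun w => (1 + e * (w - z₁)) ^ 2 / β * y (z₀ + mob β e (w - z₁))
  have hyan : ∀ z ∈ U, AnalyticAt ℂ y z := fun z hz => hy.1.analyticAt (hU.mem_nhds hz)
  have hY : IsSolutionOn a₂ a₃ V Y := by
    refine ⟨fun w hw => ?_, fun w hw => ?_⟩
    · obtain ⟨h1, h2, -⟩ := hVmem w hw
      refine DifferentiableAt.differentiableWithinAt (DifferentiableAt.mul (by fun_prop) ?_)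
      exact ((hyan _ h2).comp (hφan w h1)).differentiableAt
    · obtain ⟨h1, h2, h3⟩ := hVmem w hw
      obtain ⟨p1, p2⟩ := pullback_solution (z₀ := z₀) hβ h1 (hyan _ h2)
      have s1 := (deriv_comp_sub_const (x := w)
        (fun x => (1 + e * x) ^ 2 / β * y (z₀ + mob β e x)) z₁).trans p1
      have s3 := (congrFun (iteratedDeriv_comp_sub_const 3
          (fun x => (1 + e * x) ^ 2 / β * y (z₀ + mob β e x)) z₁) w).trans p2
      change deriv Y w = _ at s1
      change iteratedDeriv 3 Y w = _ at s3
      have hsol := hy.2 _ h2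
      have hz := (hzU _ h2)
      obtain ⟨-, -, q⟩ := hball _ hz.1
      have q := q hz.2
      have e3 : mob γ f (φ w - z₀) = w - z₁ := by
        simp only [φ, add_sub_cancel_left]
        exact mob_mob hβ h1
      rw [e3, add_sub_cancel] at q
      rw [s1, s3, q.1, q.2]
      simp only [Y]
      simp only [φ] at hsol
      set s := 1 + e * (w - z₁)
      set Z := z₀ + mob β e (w - z₁)
      have : iteratedDeriv 3 y Z = -(b₂ Z * deriv y Z + b₃ Z * y Z) := by
        linear_combination hsol
      rw [this]
      field_simp
      ring
  obtain ⟨S, H, hH, hYS⟩ := ha V hVo hVc hVb M hM hMexp Y hY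
  -- The exponents are unchanged. The weight factor and the power coming from the difference of the
  -- two branches of the logarithm are analytic on the whole ball and go into the coefficients.
  refine ⟨S, fun κ z => H κ (ψ z) * (β / (1 + e * (ψ z - z₁)) ^ 2)
    * Complex.exp (κ * (Complex.log (1 + e * (ψ z - z₁)) - Complex.log β)), fun κ hκ z hz => ?_,
    fun z hz => ?_⟩
  · have hz' : z - z₀ ∈ Metric.ball (0 : ℂ) r := by simpa [dist_eq_norm] using hz
    obtain ⟨⟨-, h1⟩, h2, -⟩ := hball _ hz'
    have h1' : 1 + e * (ψ z - z₁) ∈ Complex.slitPlane := by simpa [ψ] using h1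
    have hne := Complex.slitPlane_ne_zero h1'
    have hψ := hψan z hz
    have hHan : AnalyticAt ℂ (fun z => H κ (ψ z)) z :=
      (hH κ hκ (ψ z) (by simpa [ψ, dist_eq_norm] using h2)).fun_comp hψ
    have hl : AnalyticAt ℂ (fun z => 1 + e * (ψ z - z₁)) z := by fun_prop
    have hlog : AnalyticAt ℂ (fun z => Complex.log (1 + e * (ψ z - z₁))) z := hl.clog h1'
    have hq : AnalyticAt ℂ (fun z => β / (1 + e * (ψ z - z₁)) ^ 2) z :=
      analyticAt_const.div (hl.pow 2) (pow_ne_zero 2 hne)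
    exact (hHan.mul hq).mul (analyticAt_const.mul (hlog.sub analyticAt_const)).cexp
  · obtain ⟨h1, h2⟩ := hψU z hz
    have h3 := hYS (ψ z) ⟨z, hz, rfl⟩
    have h4 : z₀ + mob β e (ψ z - z₁) = z := h2
    simp only [Y, h4] at h3
    have h5 : y z = β / (1 + e * (ψ z - z₁)) ^ 2 * ((1 + e * (ψ z - z₁)) ^ 2 / β * y z) := by
      field_simp
    rw [h5, h3, Finset.mul_sum]
    refine Finset.sum_congr rfl fun κ _ => ?_
    simp only [M, h2]
    rw [mul_add, Complex.exp_add]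
    ring

/-! ### The canonical coordinate at a point -/

/-- The number `E₂(z₀) / 12`. -/
def slope (z₀ : ℍ) : ℂ := EisensteinSeries.E2 z₀ / 12

/-- The canonical coordinate `x ↦ z₀ + x / (2πi (1 + E₂(z₀) x / 12))`. -/
def coord (z₀ : ℍ) (x : ℂ) : ℂ := z₀ + mob (2 * Real.pi * Complex.I)⁻¹ (slope z₀) x

/-- The expression of a weight `k` function in the canonical coordinate. -/
def localFun (k : ℕ) (f : ℍ → ℂ) (z₀ : ℍ) (x : ℂ) : ℂ :=
  f (ofComplex (coord z₀ x)) / (1 + slope z₀ * x) ^ k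

theorem coord_zero (z₀ : ℍ) : coord z₀ 0 = z₀ := by simp [coord, mob_zero]

/-- The nonholomorphic part of E₂* contributes only -1 to A, so that A = 4π Im(z₀) E₂(z₀)/12 - 1.
The conjugate of z₀ then cancels, x becomes a Möbius coordinate depending on E₂(z₀) alone, and 1 -
(1 + A)w̃ becomes 1 + E₂(z₀)x/12. -/
theorem localSeries_eq (k : ℕ) (f : ℍ → ℂ) (z₀ : ℍ) :
    localSeries k f z₀ = taylor (localFun k f z₀) := by
  refine taylor_congr ?_
  set e := slope z₀ with he
  have hy : ((z₀.im : ℝ) : ℂ) ≠ 0 := Complex.ofReal_ne_zero.2 z₀.im_ne_zero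
  have hpi : (Real.pi : ℂ) ≠ 0 := Complex.ofReal_ne_zero.2 Real.pi_ne_zero
  have hI := Complex.I_ne_zero
  have hconj : (starRingEnd ℂ) (z₀ : ℂ) = z₀ - 2 * Complex.I * z₀.im := by
    apply Complex.ext
    · simp
    · simp; ring
  have hA : (4 * Real.pi * z₀.im / 12 * (EisensteinSeries.E2 z₀
      + 6 / (Real.pi * Complex.I * ((z₀ : ℂ) - (starRingEnd ℂ) (z₀ : ℂ)))) : ℂ)
      = 4 * Real.pi * z₀.im * e - 1 := by
    rw [hconj, he, slope]
    have hII : Complex.I * Complex.I = -1 := Complex.I_mul_I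
    rw [show (z₀ : ℂ) - (z₀ - 2 * Complex.I * z₀.im) = 2 * Complex.I * z₀.im by ring,
      show (Real.pi * Complex.I * (2 * Complex.I * z₀.im) : ℂ)
        = -(2 * Real.pi * z₀.im) by linear_combination (2 * Real.pi * z₀.im : ℂ) * hII]
    field_simp
    ring
  have hne2 : ∀ᶠ x in 𝓝 (0 : ℂ), 1 + e * x + -x / (4 * Real.pi * z₀.im) ≠ 0 :=
    ContinuousAt.eventually_ne (by fun_prop) (by simp)
  filter_upwards [eventually_one_add_ne e, hne2] with x h1 h2
  simp only [hA, localFun]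
  set t : ℂ := -x / (4 * Real.pi * z₀.im) with ht
  have hx : x = -(4 * Real.pi * z₀.im) * t := by rw [ht]; field_simp
  have e1 : 1 - (1 + (4 * Real.pi * z₀.im * e - 1)) * t = 1 + e * x := by
    rw [hx]; ring
  have e2 : 1 - (4 * Real.pi * z₀.im * e - 1) * t = 1 + e * x + t := by rw [hx]; ring
  rw [e1, e2, hconj]
  congr 3
  rw [coord, mob, ← he]
  have h3 : 1 - t / (1 + e * x + t) = (1 + e * x) / (1 + e * x + t) := by
    rw [eq_div_iff h2, sub_mul, div_mul_cancel₀ _ h2]; ring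
  have hII : Complex.I * Complex.I = -1 := Complex.I_mul_I
  have h4 : (2 * Real.pi * Complex.I : ℂ)⁻¹ * x = 2 * Complex.I * z₀.im * t := by
    rw [inv_mul_eq_iff_eq_mul₀ Complex.two_pi_I_ne_zero, hx]
    linear_combination (-(4 * Real.pi * z₀.im * t) : ℂ) * hII
  rw [h3, h4]
  field_simp
  ring

/-! ### Local expansions of modular forms -/

theorem coord_im_pos (z₀ : ℍ) : ∀ᶠ x in 𝓝 (0 : ℂ), 0 < (coord z₀ x).im := by
  have : ContinuousAt (coord z₀) 0 :=
    continuousAt_const.add (analyticAt_mob (by simp)).continuousAt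
  exact this.eventually (p := fun z => 0 < z.im)
    (by rw [coord_zero]; exact isOpen_upperHalfPlaneSet.mem_nhds z₀.im_pos)

theorem analyticAt_coord (z₀ : ℍ) : AnalyticAt ℂ (coord z₀) 0 :=
  analyticAt_const.add (analyticAt_mob (by simp))

theorem analyticAt_localFun (k : ℕ) {f : ℍ → ℂ} {z₀ : ℍ}
    (hf : AnalyticAt ℂ (fun z => f (ofComplex z)) z₀) : AnalyticAt ℂ (localFun k f z₀) 0 := by
  have h1 : AnalyticAt ℂ (fun x => f (ofComplex (coord z₀ x))) 0 :=
    AnalyticAt.fun_comp (g := fun z => f (ofComplex z)) (by rwa [coord_zero]) (analyticAt_coord z₀)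
  exact h1.div (by fun_prop) (by simp)

theorem localFun_zero (k : ℕ) (f : ℍ → ℂ) (z₀ : ℍ) : localFun k f z₀ 0 = f z₀ := by
  simp [localFun, coord_zero]

/-- To first order the canonical coordinate replaces differentiation by the Serre derivative. -/
theorem deriv_localFun (k : ℕ) {f : ℍ → ℂ} {z₀ : ℍ} {d : ℂ}
    (hf : HasDerivAt (fun z => f (ofComplex z)) d z₀) :
    deriv (localFun k f z₀) 0 = (2 * Real.pi * Complex.I)⁻¹ * d - k * slope z₀ * f z₀ := by
  have h0 : HasDerivAt (coord z₀) ((2 * Real.pi * Complex.I)⁻¹) 0 := by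
    have := (hasDerivAt_mob (β := (2 * Real.pi * Complex.I : ℂ)⁻¹) (e := slope z₀) (δ := 0)
      (by simp)).const_add (z₀ : ℂ)
    exact this.congr_deriv (by simp)
  have h1 : HasDerivAt (fun x => f (ofComplex (coord z₀ x))) (d * (2 * Real.pi * Complex.I)⁻¹) 0 :=
    HasDerivAt.comp (h₂ := fun z => f (ofComplex z)) 0 (by rwa [coord_zero]) h0
  have h2 : HasDerivAt (fun x : ℂ => 1 + slope z₀ * x) (slope z₀) 0 := by
    simpa using ((hasDerivAt_id (0 : ℂ)).const_mul (slope z₀)).const_add 1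
  have h3 := (h1.fun_div (h2.fun_pow k) (by simp)).deriv
  have h4 : localFun k f z₀ = fun x => f (ofComplex (coord z₀ x)) / (1 + slope z₀ * x) ^ k := rfl
  rw [h4, h3]
  simp only [mul_zero, add_zero, one_pow, coord_zero, ofComplex_apply]
  ring

/-- The germs of `Ẽ₄` and `Ẽ₆`. -/
def lE4 (z₀ : ℍ) : ℂ → ℂ := localFun 4 ModularForm.E₄ z₀
/-- The germs of `Ẽ₄` and `Ẽ₆`. -/
def lE6 (z₀ : ℍ) : ℂ → ℂ := localFun 6 ModularForm.E₆ z₀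

theorem analyticAt_lE4 (z₀ : ℍ) : AnalyticAt ℂ (lE4 z₀) 0 :=
  analyticAt_localFun 4 (analyticAt_cE4 z₀.im_pos)
theorem analyticAt_lE6 (z₀ : ℍ) : AnalyticAt ℂ (lE6 z₀) 0 :=
  analyticAt_localFun 6 (analyticAt_cE6 z₀.im_pos)

theorem rep_lE4 (z₀ : ℍ) : Rep (lE4 z₀) (e4Series z₀) := by
  rw [e4Series, localSeries_eq]; exact rep_taylor (analyticAt_lE4 z₀)
theorem rep_lE6 (z₀ : ℍ) : Rep (lE6 z₀) (e6Series z₀) := by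
  rw [e6Series, localSeries_eq]; exact rep_taylor (analyticAt_lE6 z₀)

/-- Two germs `u`, `v` at `0` which behave to first order like `E₄`, `E₆` in a local coordinate. -/
structure IsLocalPair (u v : ℂ → ℂ) (τ ν : ℂ) : Prop where
  anU : AnalyticAt ℂ u 0
  anV : AnalyticAt ℂ v 0
  du : deriv u 0 = -τ * v 0 / 3 + 4 * ν * u 0
  dv : deriv v 0 = -τ * u 0 ^ 2 / 2 + 6 * ν * v 0
  τ_ne : τ ≠ 0
  disc : u 0 ^ 3 - v 0 ^ 2 ≠ 0

/-- In Ramanujan's formulas the E₂-terms are exactly cancelled by the canonical coordinate; hence ν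
= 0. -/
theorem isLocalPair_local (z₀ : ℍ) : IsLocalPair (lE4 z₀) (lE6 z₀) 1 0 where
  anU := analyticAt_lE4 z₀
  anV := analyticAt_lE6 z₀
  du := by
    have h := deriv_localFun 4 (f := ModularForm.E₄) (z₀ := z₀) (hasDerivAt_cE4 z₀.im_pos)
    rw [cE4_coe, cE6_coe, cE2_coe, inv_mul_cancel_left₀ Complex.two_pi_I_ne_zero] at h
    rw [lE4, lE6, localFun_zero, localFun_zero, h, slope]
    push_cast; ring
  dv := by
    have h := deriv_localFun 6 (f := ModularForm.E₆) (z₀ := z₀) (hasDerivAt_cE6 z₀.im_pos)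
    rw [cE4_coe, cE6_coe, cE2_coe, inv_mul_cancel_left₀ Complex.two_pi_I_ne_zero] at h
    rw [lE4, lE6, localFun_zero, localFun_zero, h, slope]
    push_cast; ring
  τ_ne := one_ne_zero
  disc := by rw [lE4, lE6, localFun_zero, localFun_zero]; exact discriminant_ne_zero' z₀

/-- The plain displacement z₀ + δ is used for limits of Q and R themselves; here E₂ survives, as ν.
-/
theorem isLocalPair_shift (z₀ : ℍ) : IsLocalPair (fun δ => cE4 (z₀ + δ)) (fun δ => cE6 (z₀ + δ))
    (2 * Real.pi * Complex.I) (2 * Real.pi * Complex.I * slope z₀) where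
  anU := analyticAt_shift (by simpa using analyticAt_cE4 z₀.im_pos)
  anV := analyticAt_shift (by simpa using analyticAt_cE6 z₀.im_pos)
  du := by
    rw [deriv_comp_const_add, add_zero, (hasDerivAt_cE4 z₀.im_pos).deriv, slope, cE2_coe]
    ring
  dv := by
    rw [deriv_comp_const_add, add_zero, (hasDerivAt_cE6 z₀.im_pos).deriv, slope, cE2_coe]
    ring
  τ_ne := Complex.two_pi_I_ne_zero
  disc := by simpa using discriminant_ne_zero' z₀

/-! ### Action of the modular group on local expansions -/

theorem denom_add (γ : SL(2, ℤ)) (z₀ : ℍ) {δ : ℂ} (h : 0 < ((z₀ : ℂ) + δ).im) :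
    denom γ (⟨z₀ + δ, h⟩ : ℍ) = denom γ z₀ + (γ 1 0 : ℂ) * δ := by
  rw [ModularGroup.denom_apply, ModularGroup.denom_apply]
  push_cast; ring

/-- The displacement from the base point is transformed by a Möbius map fixing 0, which puts the
action of γ in the shape required by `IsPullback`. -/
theorem smul_add (γ : SL(2, ℤ)) (z₀ : ℍ) {δ : ℂ} (h : 0 < ((z₀ : ℂ) + δ).im) :
    ((γ • (⟨z₀ + δ, h⟩ : ℍ) : ℍ) : ℂ)
      = (γ • z₀ : ℍ) + mob ((denom γ z₀ ^ 2)⁻¹) ((γ 1 0 : ℂ) / denom γ z₀) δ := by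
  have h0 := denom_ne_zero γ z₀
  have h1 := denom_ne_zero γ (⟨z₀ + δ, h⟩ : ℍ)
  rw [denom_add] at h1
  have hdet : (γ 0 0 : ℂ) * γ 1 1 - γ 0 1 * γ 1 0 = 1 := by
    have := γ.det_coe
    rw [Matrix.det_fin_two] at this
    exact_mod_cast this
  rw [ModularGroup.denom_apply] at h0 h1
  rw [UpperHalfPlane.coe_specialLinearGroup_apply, UpperHalfPlane.coe_specialLinearGroup_apply,
    ModularGroup.denom_apply, mob]
  simp only [algebraMap_int_eq, eq_intCast, Complex.ofReal_intCast] at h0 h1 ⊢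
  set a : ℂ := (γ 0 0 : ℂ)
  set b : ℂ := (γ 0 1 : ℂ)
  set c : ℂ := (γ 1 0 : ℂ)
  set d : ℂ := (γ 1 1 : ℂ)
  set z : ℂ := (z₀ : ℂ)
  have h2 : c * (z + δ) + d ≠ 0 := by
    intro h; apply h1; linear_combination h
  have h3 : 1 + c / (c * z + d) * δ = (c * (z + δ) + d) / (c * z + d) := by
    field_simp; ring
  change (a * (z + δ) + b) / (c * (z + δ) + d) = _
  have h4 : (((c * z + d) ^ 2)⁻¹ * δ) / ((c * (z + δ) + d) / (c * z + d))
      = δ / ((c * z + d) * (c * (z + δ) + d)) := by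
    field_simp
  rw [h3, h4, div_add_div _ _ h0 (mul_ne_zero h0 h2), div_eq_div_iff h2
    (mul_ne_zero h0 (mul_ne_zero h0 h2))]
  linear_combination (c * z + d) * (c * (z + δ) + d) * δ * hdet

/-- If `γ` fixes `z₀`, then weight `k` invariance is an equivariance in the canonical coordinate. -/
theorem localFun_scale {k : ℕ} {f : ℍ → ℂ} {γ : SL(2, ℤ)}
    (hf : ∀ z, f (γ • z) = denom γ z ^ k * f z) {z₀ : ℍ} (hγ : γ • z₀ = z₀) :
    ∀ᶠ x in 𝓝 (0 : ℂ), localFun k f z₀ ((denom γ z₀ ^ 2)⁻¹ * x)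
      = denom γ z₀ ^ k * localFun k f z₀ x := by
  set j := denom γ z₀ with hj
  set c : ℂ := (γ 1 0 : ℂ)
  have hj0 : j ≠ 0 := denom_ne_zero γ z₀
  have hE2 := E2_smul γ z₀
  rw [hγ, ← hj] at hE2
  set s : ℂ := 2 * Real.pi * Complex.I with hs
  have hs0 : s ≠ 0 := Complex.two_pi_I_ne_zero
  -- Quasimodularity of E₂ at the fixed point. It is this relation that makes γ act on the canonical
  -- coordinate by the scalar j⁻².
  have he : slope z₀ = j ^ 2 * slope z₀ + s⁻¹ * c * j := by
    simp only [slope]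
    linear_combination (1 / 12) * hE2
  set e := slope z₀ with hedef
  filter_upwards [coord_im_pos z₀, eventually_one_add_ne e,
    eventually_one_add_ne (e * (j ^ 2)⁻¹)] with x hx h1 h2
  have h3 : j ^ 2 + e * x ≠ 0 := by
    intro h
    apply h2
    have : 1 + e * (j ^ 2)⁻¹ * x = (j ^ 2 + e * x) / j ^ 2 := by field_simp
    rw [this, h, zero_div]
  have h1' : 1 + x * e ≠ 0 := by rwa [mul_comm x]
  have h3' : j ^ 2 + x * e ≠ 0 := by rwa [mul_comm x]
  have hpt : (ofComplex (coord z₀ x)) = (⟨coord z₀ x, hx⟩ : ℍ) := ofComplex_apply_of_im_pos hx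
  have hm : mob s⁻¹ e x = s⁻¹ * x / (1 + e * x) := rfl
  have h4 : 1 + c / j * mob s⁻¹ e x = (j ^ 2 + e * x) / (j ^ 2 * (1 + e * x)) := by
    rw [hm]
    have : c * s⁻¹ * j = e - j ^ 2 * e := by linear_combination -he
    field_simp at this ⊢
    linear_combination x * this
  have hden : denom γ (⟨coord z₀ x, hx⟩ : ℍ) = (j ^ 2 + e * x) / (j * (1 + e * x)) := by
    have := denom_add γ z₀ (δ := mob s⁻¹ e x) hx
    change denom γ (⟨coord z₀ x, hx⟩ : ℍ) = j + c * mob s⁻¹ e x at this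
    rw [this]
    have h5 : j + c * mob s⁻¹ e x = j * (1 + c / j * mob s⁻¹ e x) := by field_simp
    rw [h5, h4]
    field_simp
  have hco : coord z₀ ((j ^ 2)⁻¹ * x) = (γ • (⟨coord z₀ x, hx⟩ : ℍ) : ℍ) := by
    have := smul_add γ z₀ (δ := mob s⁻¹ e x) hx
    change ((γ • (⟨coord z₀ x, hx⟩ : ℍ) : ℍ) : ℂ) = (γ • z₀ : ℍ) + mob (j ^ 2)⁻¹ (c / j) _ at this
    rw [this, hγ, coord]
    congr 1
    change mob s⁻¹ e _ = (j ^ 2)⁻¹ * mob s⁻¹ e x / (1 + c / j * mob s⁻¹ e x)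
    rw [h4, hm, mob]
    have h6 : 1 + e * ((j ^ 2)⁻¹ * x) = (j ^ 2 + e * x) / j ^ 2 := by field_simp
    rw [h6]
    field_simp
  simp only [localFun]
  rw [hco, ofComplex_apply, hf, hden, hpt, ← hedef]
  have h6 : 1 + e * ((j ^ 2)⁻¹ * x) = (j ^ 2 + e * x) / j ^ 2 := by field_simp
  rw [h6]
  rw [div_pow, div_pow, mul_pow]
  have := pow_ne_zero k h3
  have := pow_ne_zero k h1
  have := pow_ne_zero k hj0
  field_simp
  ring

/-! ### Limits of quotients at simple zeros -/

theorem tendsto_pow_mul_div {f g : ℂ → ℂ} (hf : DifferentiableAt ℂ f 0) (hg : ContinuousAt g 0)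
    (h0 : f 0 = 0) (h1 : deriv f 0 ≠ 0) (n : ℕ) :
    Tendsto (fun x => x ^ n * (g x / f x ^ n)) (𝓝[≠] 0) (𝓝 (g 0 / deriv f 0 ^ n)) := by
  have hs := hasDerivAt_iff_tendsto_slope.1 hf.hasDerivAt
  have h2 := (hg.tendsto.mono_left nhdsWithin_le_nhds).div (hs.pow n) (pow_ne_zero n h1)
  refine h2.congr' ?_
  filter_upwards [self_mem_nhdsWithin] with x hx
  have hx : x ≠ 0 := hx
  simp only [Pi.div_apply, slope_def_field, h0, sub_zero, div_pow]
  field_simp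

theorem tendsto_div_of_ne {f g : ℂ → ℂ} (hf : ContinuousAt f 0) (hg : ContinuousAt g 0)
    (h0 : f 0 ≠ 0) (n : ℕ) :
    Tendsto (fun x => x ^ 0 * (g x / f x ^ n)) (𝓝[≠] 0) (𝓝 (g 0 / f 0 ^ n)) := by
  simp only [pow_zero, one_mul]
  exact ((hg.tendsto.div (hf.pow n).tendsto (pow_ne_zero n h0))).mono_left nhdsWithin_le_nhds

theorem tendsto_pow_mul_of_lt {g : ℂ → ℂ} {N M : ℕ} {c : ℂ} (h : N < M)
    (hg : Tendsto (fun x => x ^ N * g x) (𝓝[≠] 0) (𝓝 c)) :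
    Tendsto (fun x => x ^ M * g x) (𝓝[≠] 0) (𝓝 0) := by
  have h1 : Tendsto (fun x : ℂ => x ^ (M - N)) (𝓝[≠] 0) (𝓝 0) := by
    have : Tendsto (fun x : ℂ => x ^ (M - N)) (𝓝 0) (𝓝 (0 ^ (M - N))) :=
      (continuous_pow (M - N)).tendsto 0
    rw [zero_pow (by omega)] at this
    exact this.mono_left nhdsWithin_le_nhds
  have h2 := h1.mul hg
  rw [zero_mul] at h2
  refine h2.congr fun x => ?_
  rw [← mul_assoc, ← pow_add]
  congr 2
  omega

/-! ### Values of the general form, and the types of points. -/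

namespace SingularData

variable {m : ℕ} (D : SingularData m)

section
variable {K : Type*} [Field K] [Algebra ℂ K]

/-- The formula for `Q` with parameters `v`. -/
def qVal (v : FreeParam m → ℂ) (e4 e6 : K) : K :=
  D.qFixed e4 e6 + ∑ j, v (.r1 j) • D.qR1 e4 e6 j

/-- The formula for `R` with parameters `v`. -/
def rVal (v : FreeParam m → ℂ) (e4 e6 : K) : K :=
  D.rFixed e4 e6 + v .sI • rSI e4 e6
    + ∑ j, (v (.s2 j) • D.rS e4 e6 2 j + v (.s1 j) • D.rS e4 e6 1 j)

end

theorem qForm_eq (v : FreeParam m → ℂ) (z : ℍ) :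
    D.qForm v z = D.qVal v (ModularForm.E₄ z) (ModularForm.E₆ z) := rfl
theorem rForm_eq (v : FreeParam m → ℂ) (z : ℍ) :
    D.rForm v z = D.rVal v (ModularForm.E₄ z) (ModularForm.E₆ z) := rfl

/-- The kinds of points, in terms of the values of `E₄` and `E₆`, with the expected exponents. -/
inductive PointType : (Fin 3 → ℚ) → ℂ → ℂ → Prop
  | regular {a b : ℂ} (ha : a ≠ 0) (hb : b ≠ 0) (hF : ∀ j, D.F a b j ≠ 0) : PointType ![0, 1, 2] a b
  | atI {a : ℂ} (ha : a ≠ 0) : PointType D.expI a 0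
  | atRho {b : ℂ} (hb : b ≠ 0) (ht : ∀ j, D.t j ≠ 0) : PointType D.expRho 0 b
  | atPt {a b : ℂ} (j : Fin m) (ha : a ≠ 0) (hb : b ≠ 0) (hj : D.F a b j = 0)
      (hF : ∀ l, l ≠ j → D.F a b l ≠ 0) : PointType (D.expPt j) a b

end SingularData

/-! ### Limits of the individual terms of Q and R at their poles. -/

variable {m : ℕ} {D : SingularData m} {u v : ℂ → ℂ} {τ ν : ℂ}

namespace IsLocalPair

theorem contU (h : IsLocalPair u v τ ν) : ContinuousAt u 0 := h.anU.continuousAt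
theorem contV (h : IsLocalPair u v τ ν) : ContinuousAt v 0 := h.anV.continuousAt

theorem anF (h : IsLocalPair u v τ ν) (j : Fin m) :
    AnalyticAt ℂ (fun x => D.F (u x) (v x) j) 0 := by
  have := h.anU; have := h.anV
  simp only [SingularData.F, smul_eq_mul]
  fun_prop

theorem anΔ (h : IsLocalPair u v τ ν) : AnalyticAt ℂ (fun x => u x ^ 3 - v x ^ 2) 0 := by
  have := h.anU; have := h.anV
  fun_prop

/-- By homogeneity ν enters only through 12ν F_j, which vanishes at a zero of F_j. Together with
`t_sub_one_ne` the formula shows that zeros away from E₄ E₆ = 0 are simple. -/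
theorem deriv_F (h : IsLocalPair u v τ ν) (j : Fin m) (hj : D.F (u 0) (v 0) j = 0) :
    deriv (fun x => D.F (u x) (v x) j) 0 = τ * u 0 ^ 2 * v 0 * (D.t j - 1) := by
  simp only [SingularData.F, smul_eq_mul] at hj ⊢
  have hu := h.anU.differentiableAt.hasDerivAt
  have hv := h.anV.differentiableAt.hasDerivAt
  have := ((hu.fun_pow 3).fun_sub ((hv.fun_pow 2).const_mul (D.t j))).deriv
  rw [this, h.du, h.dv]
  push_cast
  linear_combination (12 * ν) * hj

theorem tendsto_qR1 (h : IsLocalPair u v τ ν) (j : Fin m) (hF : D.F (u 0) (v 0) j ≠ 0) :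
    Tendsto (fun x => x ^ 0 * D.qR1 (u x) (v x) j) (𝓝[≠] 0) (𝓝 (D.qR1 (u 0) (v 0) j)) := by
  have := tendsto_div_of_ne (h.anF j).continuousAt
    (g := fun x => u x * (u x ^ 3 - v x ^ 2)) (h.contU.mul h.anΔ.continuousAt) hF 1
  simpa [SingularData.qR1] using this

theorem tendsto_rS (h : IsLocalPair u v τ ν) (k : ℕ) (j : Fin m) (hF : D.F (u 0) (v 0) j ≠ 0) :
    Tendsto (fun x => x ^ 0 * D.rS (u x) (v x) k j) (𝓝[≠] 0) (𝓝 (D.rS (u 0) (v 0) k j)) :=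
  tendsto_div_of_ne (h.anF j).continuousAt
    (g := fun x => v x * (u x ^ 3 - v x ^ 2) ^ k) (h.contV.mul (h.anΔ.continuousAt.pow k)) hF k

theorem tendsto_rSI (h : IsLocalPair u v τ ν) (hv : v 0 ≠ 0) :
    Tendsto (fun x => x ^ 0 * SingularData.rSI (u x) (v x)) (𝓝[≠] 0)
      (𝓝 (SingularData.rSI (u 0) (v 0))) := by
  have := tendsto_div_of_ne h.contV h.anΔ.continuousAt hv 1
  simpa [SingularData.rSI] using this

theorem t_sub_one_ne (h : IsLocalPair u v τ ν) (j : Fin m) (hj : D.F (u 0) (v 0) j = 0) :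
    D.t j - 1 ≠ 0 := by
  intro ht
  apply h.disc
  simp only [SingularData.F, smul_eq_mul] at hj
  linear_combination hj + v 0 ^ 2 * ht

theorem deriv_F_ne (h : IsLocalPair u v τ ν) (j : Fin m) (hj : D.F (u 0) (v 0) j = 0)
    (hu : u 0 ≠ 0) (hv : v 0 ≠ 0) : deriv (fun x => D.F (u x) (v x) j) 0 ≠ 0 := by
  rw [h.deriv_F j hj]
  exact mul_ne_zero (mul_ne_zero (mul_ne_zero h.τ_ne (pow_ne_zero 2 hu)) hv) (h.t_sub_one_ne j hj)

theorem disc_eq (j : Fin m) (hj : D.F (u 0) (v 0) j = 0) :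
    u 0 ^ 3 - v 0 ^ 2 = (D.t j - 1) * v 0 ^ 2 := by
  simp only [SingularData.F, smul_eq_mul] at hj
  linear_combination hj

theorem tendsto_qR1_self (h : IsLocalPair u v τ ν) (j : Fin m) (hj : D.F (u 0) (v 0) j = 0)
    (hu : u 0 ≠ 0) (hv : v 0 ≠ 0) :
    Tendsto (fun x => x ^ 1 * D.qR1 (u x) (v x) j) (𝓝[≠] 0) (𝓝 (v 0 / (τ * u 0))) := by
  have := tendsto_pow_mul_div (h.anF j).differentiableAt
    (g := fun x => u x * (u x ^ 3 - v x ^ 2)) (h.contU.mul h.anΔ.continuousAt) hj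
    (h.deriv_F_ne j hj hu hv) 1
  have ht := h.t_sub_one_ne j hj
  have hτ := h.τ_ne
  rw [h.deriv_F j hj, disc_eq j hj, show u 0 * ((D.t j - 1) * v 0 ^ 2) /
    (τ * u 0 ^ 2 * v 0 * (D.t j - 1)) ^ 1 = v 0 / (τ * u 0) by field_simp] at this
  simpa only [pow_one, SingularData.qR1] using this

theorem tendsto_rS_self (h : IsLocalPair u v τ ν) (k : ℕ) (j : Fin m)
    (hj : D.F (u 0) (v 0) j = 0) (hu : u 0 ≠ 0) (hv : v 0 ≠ 0) :
    Tendsto (fun x => x ^ k * D.rS (u x) (v x) k j) (𝓝[≠] 0)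
      (𝓝 (v 0 * (v 0 / (τ * u 0 ^ 2)) ^ k)) := by
  have := tendsto_pow_mul_div (h.anF j).differentiableAt
    (g := fun x => v x * (u x ^ 3 - v x ^ 2) ^ k) (h.contV.mul (h.anΔ.continuousAt.pow k)) hj
    (h.deriv_F_ne j hj hu hv) k
  have ht := h.t_sub_one_ne j hj
  have hτ := h.τ_ne
  rw [h.deriv_F j hj, disc_eq j hj, mul_div_assoc, ← div_pow, show (D.t j - 1) * v 0 ^ 2 /
    (τ * u 0 ^ 2 * v 0 * (D.t j - 1)) = v 0 / (τ * u 0 ^ 2) by field_simp] at this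
  exact this

theorem deriv_v_at_zero (h : IsLocalPair u v τ ν) (hv : v 0 = 0) :
    deriv v 0 = -τ * u 0 ^ 2 / 2 := by rw [h.dv, hv]; ring

theorem deriv_u_at_zero (h : IsLocalPair u v τ ν) (hu : u 0 = 0) :
    deriv u 0 = -τ * v 0 / 3 := by rw [h.du, hu]; ring

theorem tendsto_rSI_self (h : IsLocalPair u v τ ν) (hu : u 0 ≠ 0) (hv : v 0 = 0) :
    Tendsto (fun x => x ^ 1 * SingularData.rSI (u x) (v x)) (𝓝[≠] 0) (𝓝 (-2 * u 0 / τ)) := by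
  have hτ := h.τ_ne
  have := tendsto_pow_mul_div h.anV.differentiableAt (g := fun x => u x ^ 3 - v x ^ 2)
    h.anΔ.continuousAt hv (by rw [h.deriv_v_at_zero hv]; field_simp; simp [hτ, hu]) 1
  rw [h.deriv_v_at_zero hv, hv, show (u 0 ^ 3 - 0 ^ 2) / (-τ * u 0 ^ 2 / 2) ^ 1 = -2 * u 0 / τ by
    field_simp; ring] at this
  simpa only [pow_one, SingularData.rSI] using this

/-! ### The terms of highest pole order -/

theorem tendsto_low (h : AnalyticAt ℂ u 0) {N : ℕ} (hN : N ≠ 0) :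
    Tendsto (fun x => x ^ N * u x) (𝓝[≠] 0) (𝓝 0) :=
  tendsto_pow_mul_of_lt (N := 0) (Nat.pos_of_ne_zero hN)
    (by simpa using h.continuousAt.tendsto.mono_left nhdsWithin_le_nhds)

/-- The conditional limit treats a pole term uniformly at all points, so that a sum of such terms
can be evaluated before it is known which of them has a pole. -/
theorem tendsto_div_pow {f g : ℂ → ℂ} (hf : AnalyticAt ℂ f 0) (hg : AnalyticAt ℂ g 0) {n : ℕ}
    (hn : n ≠ 0) {c : ℂ} (h1 : f 0 = 0 → deriv f 0 ≠ 0 ∧ g 0 / deriv f 0 ^ n = c) :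
    Tendsto (fun x => x ^ n * (g x / f x ^ n)) (𝓝[≠] 0) (𝓝 (if f 0 = 0 then c else 0)) := by
  split_ifs with h0
  · rw [← (h1 h0).2]
    exact tendsto_pow_mul_div hf.differentiableAt hg.continuousAt h0 (h1 h0).1 n
  · exact tendsto_pow_mul_of_lt (Nat.pos_of_ne_zero hn)
      (tendsto_div_of_ne hf.continuousAt hg.continuousAt h0 n)

theorem u_ne_of_v (h : IsLocalPair u v τ ν) (hv : v 0 = 0) : u 0 ≠ 0 := fun hu =>
  h.disc (by rw [hu, hv]; ring)

theorem v_ne_of_F (h : IsLocalPair u v τ ν) {j : Fin m} (hj : D.F (u 0) (v 0) j = 0) :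
    v 0 ≠ 0 := by
  intro hv
  apply h.u_ne_of_v hv
  simpa [SingularData.F, hv] using hj

theorem tendsto_qI (h : IsLocalPair u v τ ν) :
    Tendsto (fun x => x ^ 2 * (u x * (u x ^ 3 - v x ^ 2) / v x ^ 2)) (𝓝[≠] 0)
      (𝓝 (if v 0 = 0 then 4 / τ ^ 2 else 0)) := by
  refine tendsto_div_pow h.anV (h.anU.fun_mul h.anΔ) two_ne_zero fun hv => ?_
  have := h.u_ne_of_v hv
  have := h.τ_ne
  rw [h.deriv_v_at_zero hv, hv]
  constructor
  · simp [*]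
  · field_simp; ring

theorem tendsto_rI (h : IsLocalPair u v τ ν) :
    Tendsto (fun x => x ^ 3 * ((u x ^ 3 - v x ^ 2) ^ 2 / v x ^ 3)) (𝓝[≠] 0)
      (𝓝 (if v 0 = 0 then -8 / τ ^ 3 else 0)) := by
  refine tendsto_div_pow h.anV (h.anΔ.fun_pow 2) three_ne_zero fun hv => ?_
  have := h.u_ne_of_v hv
  have := h.τ_ne
  rw [h.deriv_v_at_zero hv, hv]
  constructor
  · simp [*]
  · field_simp; ring

theorem tendsto_qRho (h : IsLocalPair u v τ ν) :
    Tendsto (fun x => x ^ 2 * ((u x ^ 3 - v x ^ 2) / u x ^ 2)) (𝓝[≠] 0)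
      (𝓝 (if u 0 = 0 then -9 / τ ^ 2 else 0)) := by
  refine tendsto_div_pow h.anU h.anΔ two_ne_zero fun hu => ?_
  have : v 0 ≠ 0 := fun hv => h.u_ne_of_v hv hu
  have := h.τ_ne
  rw [h.deriv_u_at_zero hu, hu]
  constructor
  · simp [*]
  · field_simp; ring

theorem tendsto_rRho (h : IsLocalPair u v τ ν) :
    Tendsto (fun x => x ^ 3 * (v x * (u x ^ 3 - v x ^ 2) / u x ^ 3)) (𝓝[≠] 0)
      (𝓝 (if u 0 = 0 then 27 / τ ^ 3 else 0)) := by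
  refine tendsto_div_pow h.anU (h.anV.fun_mul h.anΔ) three_ne_zero fun hu => ?_
  have : v 0 ≠ 0 := fun hv => h.u_ne_of_v hv hu
  have := h.τ_ne
  rw [h.deriv_u_at_zero hu, hu]
  constructor
  · simp [*]
  · field_simp; ring

theorem tendsto_qPt (h : IsLocalPair u v τ ν) (j : Fin m)
    (hu : D.F (u 0) (v 0) j = 0 → u 0 ≠ 0) :
    Tendsto (fun x => x ^ 2 * (u x * (u x ^ 3 - v x ^ 2) ^ 2 / D.F (u x) (v x) j ^ 2)) (𝓝[≠] 0)
      (𝓝 (if D.F (u 0) (v 0) j = 0 then (D.t j * τ ^ 2)⁻¹ else 0)) := by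
  refine tendsto_div_pow (h.anF j) (h.anU.fun_mul (h.anΔ.fun_pow 2)) two_ne_zero fun hj => ?_
  refine ⟨h.deriv_F_ne j hj (hu hj) (h.v_ne_of_F hj), ?_⟩
  have h1 := hu hj
  have h2 := h.v_ne_of_F hj
  have h3 := h.t_sub_one_ne j hj
  have hτ := h.τ_ne
  rw [h.deriv_F j hj, disc_eq j hj]
  simp only [SingularData.F, smul_eq_mul, sub_eq_zero] at hj
  have ht : D.t j ≠ 0 := fun h0 => pow_ne_zero 3 h1 (by rw [hj, h0, zero_mul])
  field_simp
  exact hj.symm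

theorem tendsto_rPt (h : IsLocalPair u v τ ν) (j : Fin m)
    (hu : D.F (u 0) (v 0) j = 0 → u 0 ≠ 0) :
    Tendsto (fun x => x ^ 3 * (v x * (u x ^ 3 - v x ^ 2) ^ 3 / D.F (u x) (v x) j ^ 3)) (𝓝[≠] 0)
      (𝓝 (if D.F (u 0) (v 0) j = 0 then (D.t j ^ 2 * τ ^ 3)⁻¹ else 0)) := by
  refine tendsto_div_pow (h.anF j) (h.anV.fun_mul (h.anΔ.fun_pow 3)) three_ne_zero fun hj => ?_
  refine ⟨h.deriv_F_ne j hj (hu hj) (h.v_ne_of_F hj), ?_⟩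
  have h1 := hu hj
  have h2 := h.v_ne_of_F hj
  have h3 := h.t_sub_one_ne j hj
  have hτ := h.τ_ne
  rw [h.deriv_F j hj, disc_eq j hj]
  simp only [SingularData.F, smul_eq_mul, sub_eq_zero] at hj
  have ht : D.t j ≠ 0 := fun h0 => pow_ne_zero 3 h1 (by rw [hj, h0, zero_mul])
  field_simp
  linear_combination (-u 0 ^ 3 - D.t j * v 0 ^ 2) * hj

theorem tendsto_qFixed (h : IsLocalPair u v τ ν)
    (hu : ∀ j, D.F (u 0) (v 0) j = 0 → u 0 ≠ 0) :
    Tendsto (fun x => x ^ 2 * D.qFixed (u x) (v x)) (𝓝[≠] 0)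
      (𝓝 (D.rI * (if v 0 = 0 then 4 / τ ^ 2 else 0) + D.rRho * (if u 0 = 0 then -9 / τ ^ 2 else 0)
        + ∑ j, D.rPt j * (if D.F (u 0) (v 0) j = 0 then (D.t j * τ ^ 2)⁻¹ else 0))) := by
  have := ((((tendsto_low h.anU two_ne_zero).const_mul D.rInf).add
    (h.tendsto_qI.const_mul D.rI)).add (h.tendsto_qRho.const_mul D.rRho)).add
    (tendsto_finsetSum Finset.univ fun j _ => (h.tendsto_qPt j (hu j)).const_mul (D.rPt j))
  rw [mul_zero, zero_add] at this
  refine this.congr fun x => ?_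
  simp only [SingularData.qFixed, smul_eq_mul, mul_add, Finset.mul_sum]
  simp only [mul_left_comm (x ^ 2)]

theorem tendsto_rFixed (h : IsLocalPair u v τ ν)
    (hu : ∀ j, D.F (u 0) (v 0) j = 0 → u 0 ≠ 0) :
    Tendsto (fun x => x ^ 3 * D.rFixed (u x) (v x)) (𝓝[≠] 0)
      (𝓝 (D.sI * (if v 0 = 0 then -8 / τ ^ 3 else 0) + D.sRho * (if u 0 = 0 then 27 / τ ^ 3 else 0)
        + ∑ j, D.sPt j * (if D.F (u 0) (v 0) j = 0 then (D.t j ^ 2 * τ ^ 3)⁻¹ else 0))) := by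
  have := ((((tendsto_low h.anV three_ne_zero).const_mul D.sInf).add
    (h.tendsto_rI.const_mul D.sI)).add (h.tendsto_rRho.const_mul D.sRho)).add
    (tendsto_finsetSum Finset.univ fun j _ => (h.tendsto_rPt j (hu j)).const_mul (D.sPt j))
  rw [mul_zero, zero_add] at this
  refine this.congr fun x => ?_
  simp only [SingularData.rFixed, smul_eq_mul, mul_add, Finset.mul_sum]
  simp only [mul_left_comm (x ^ 3)]

theorem tendsto_qR1_zero (h : IsLocalPair u v τ ν) (j : Fin m)
    (hu : D.F (u 0) (v 0) j = 0 → u 0 ≠ 0) :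
    Tendsto (fun x => x ^ 2 * D.qR1 (u x) (v x) j) (𝓝[≠] 0) (𝓝 0) := by
  by_cases hj : D.F (u 0) (v 0) j = 0
  · exact tendsto_pow_mul_of_lt one_lt_two (h.tendsto_qR1_self j hj (hu hj) (h.v_ne_of_F hj))
  · exact tendsto_pow_mul_of_lt two_pos (h.tendsto_qR1 j hj)

theorem tendsto_rS_zero (h : IsLocalPair u v τ ν) {k : ℕ} (hk : k < 3) (j : Fin m)
    (hu : D.F (u 0) (v 0) j = 0 → u 0 ≠ 0) :
    Tendsto (fun x => x ^ 3 * D.rS (u x) (v x) k j) (𝓝[≠] 0) (𝓝 0) := by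
  by_cases hj : D.F (u 0) (v 0) j = 0
  · exact tendsto_pow_mul_of_lt hk (h.tendsto_rS_self k j hj (hu hj) (h.v_ne_of_F hj))
  · exact tendsto_pow_mul_of_lt three_pos (h.tendsto_rS k j hj)

theorem tendsto_rSI_zero (h : IsLocalPair u v τ ν) :
    Tendsto (fun x => x ^ 3 * SingularData.rSI (u x) (v x)) (𝓝[≠] 0) (𝓝 0) := by
  by_cases hv : v 0 = 0
  · exact tendsto_pow_mul_of_lt (by norm_num) (h.tendsto_rSI_self (h.u_ne_of_v hv) hv)
  · exact tendsto_pow_mul_of_lt three_pos (h.tendsto_rSI hv)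

end IsLocalPair

/-! ### Leading coefficients of Q and R at each type of point. -/

namespace SingularData.PointType

variable {κ : Fin 3 → ℚ}

theorem u_ne {a b : ℂ} (hP : D.PointType κ a b) (j : Fin m) (hj : D.F a b j = 0) : a ≠ 0 := by
  cases hP with
  | regular ha => exact ha
  | atI ha => exact ha
  | atRho hb ht =>
    exfalso
    simp [SingularData.F, hb, ht j] at hj
  | atPt _ ha => exact ha

/-- At a point of given type at most one term has a double pole, and its fixed parameter was
normalised to produce e₂ - 2. The terms with free parameters have at most simple poles. At a regular
point the exponents 0, 1, 2 have e₂ = 2, in agreement with the limit 0. -/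
theorem tendsto_qVal (h : IsLocalPair u v τ ν) (hP : D.PointType κ (u 0) (v 0))
    (p : FreeParam m → ℂ) :
    Tendsto (fun x => x ^ 2 * D.qVal p (u x) (v x)) (𝓝[≠] 0)
      (𝓝 ((esymmTwo κ - 2) / τ ^ 2)) := by
  have h1 := (h.tendsto_qFixed hP.u_ne).add
    (tendsto_finsetSum Finset.univ fun j _ => (h.tendsto_qR1_zero j (hP.u_ne j)).const_mul (p (.r1 j)))
  simp only [mul_zero, Finset.sum_const_zero, add_zero] at h1
  refine (h1.congr fun x => ?_).trans_eq ?_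
  · simp only [SingularData.qVal, smul_eq_mul, mul_add, Finset.mul_sum]
    simp only [mul_left_comm (x ^ 2)]
  congr 1
  have hτ := h.τ_ne
  have h0 := h.disc
  generalize u 0 = a at *
  generalize v 0 = b at *
  cases hP with
  | regular ha hb hF => simp [ha, hb, hF, esymmTwo]
  | atI ha =>
    simp [ha, SingularData.F, SingularData.rI]
    field_simp
  | atRho hb ht =>
    simp [hb, ht, SingularData.F, SingularData.rRho]
    field_simp
    ring
  | atPt j ha hb hj hF =>
    rw [Finset.sum_eq_single j (fun l _ hl => by simp [hF l hl]) (by simp)]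
    have ht : D.t j ≠ 0 := fun h0 => pow_ne_zero 3 ha (by simpa [SingularData.F, h0] using hj)
    simp [ha, hb, hj, SingularData.rPt]
    field_simp

/-- The same comparison for the triple poles of R, where the terms with free parameters have order
at most 2. -/
theorem tendsto_rVal (h : IsLocalPair u v τ ν) (hP : D.PointType κ (u 0) (v 0))
    (p : FreeParam m → ℂ) :
    Tendsto (fun x => x ^ 3 * D.rVal p (u x) (v x)) (𝓝[≠] 0)
      (𝓝 ((esymmTwo κ - 2 - esymmThree κ) / τ ^ 3)) := by
  have h1 := ((h.tendsto_rFixed hP.u_ne).add (h.tendsto_rSI_zero.const_mul (p .sI))).add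
    (tendsto_finsetSum Finset.univ fun j _ =>
      ((h.tendsto_rS_zero (k := 2) (by norm_num) j (hP.u_ne j)).const_mul (p (.s2 j))).add
      ((h.tendsto_rS_zero (k := 1) (by norm_num) j (hP.u_ne j)).const_mul (p (.s1 j))))
  simp only [mul_zero, Finset.sum_const_zero, add_zero] at h1
  refine (h1.congr fun x => ?_).trans_eq ?_
  · simp only [SingularData.rVal, smul_eq_mul, mul_add, Finset.mul_sum]
    simp only [mul_left_comm (x ^ 3)]
  congr 1
  have hτ := h.τ_ne
  have h0 := h.disc
  generalize u 0 = a at *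
  generalize v 0 = b at *
  cases hP with
  | regular ha hb hF => simp [ha, hb, hF, esymmTwo, esymmThree]
  | atI ha =>
    simp [ha, SingularData.F, SingularData.sI]
    field_simp
    ring
  | atRho hb ht =>
    simp [hb, ht, SingularData.F, SingularData.sRho]
    field_simp
  | atPt j ha hb hj hF =>
    rw [Finset.sum_eq_single j (fun l _ hl => by simp [hF l hl]) (by simp)]
    have ht : D.t j ≠ 0 := fun h0 => pow_ne_zero 3 ha (by simpa [SingularData.F, h0] using hj)
    simp [ha, hb, hj, SingularData.sPt]
    field_simp

end SingularData.PointType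

/-! ### Classification of the points of the upper half-plane -/

namespace SingularData.IsAdmissible

open ModularForm

theorem E4_pt_ne (hD : D.IsAdmissible) (j : Fin m) : E₄ (D.pt j) ≠ 0 := fun h =>
  hD.ne_rho j (E4_eq_zero_iff.1 h)

theorem E6_pt_ne (hD : D.IsAdmissible) (j : Fin m) : E₆ (D.pt j) ≠ 0 := fun h =>
  hD.ne_I j (E6_eq_zero_iff.1 h)

theorem t_ne (hD : D.IsAdmissible) (j : Fin m) : D.t j ≠ 0 :=
  div_ne_zero (pow_ne_zero 3 (hD.E4_pt_ne j)) (pow_ne_zero 2 (hD.E6_pt_ne j))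

/-- A zero of F_j is a point where E₄³/E₆² takes its value at z_j, and this function separates
orbits. -/
theorem F_eq_zero_iff (hD : D.IsAdmissible) (j : Fin m) (z : ℍ) :
    D.F (E₄ z) (E₆ z) j = 0 ↔ z ∈ MulAction.orbit SL(2, ℤ) (D.pt j) := by
  have h6 := hD.E6_pt_ne j
  constructor
  · intro h
    refine mem_orbit_of_cross_eq ?_
    simp only [SingularData.F, SingularData.t, smul_eq_mul] at h
    field_simp at h
    linear_combination -h
  · rintro ⟨γ, rfl⟩
    simp only [SingularData.F, SingularData.t, smul_eq_mul]
    rw [E_smul (by norm_num), E_smul (by norm_num)]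
    field_simp
    ring

theorem mem_singularSet_iff (hD : D.IsAdmissible) (z : ℍ) :
    z ∈ D.singularSet ↔ E₆ z = 0 ∨ E₄ z = 0 ∨ ∃ j, D.F (E₄ z) (E₆ z) j = 0 := by
  simp only [SingularData.singularSet, Set.mem_union, Set.mem_iUnion, hD.F_eq_zero_iff,
    E4_eq_zero_iff, E6_eq_zero_iff, or_assoc]

theorem pointType_pt (hD : D.IsAdmissible) (j : Fin m) {z : ℍ}
    (hz : z ∈ MulAction.orbit SL(2, ℤ) (D.pt j)) : D.PointType (D.expPt j) (E₄ z) (E₆ z) := by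
  refine .atPt j ?_ ?_ ((hD.F_eq_zero_iff j z).2 hz) fun l hl h => ?_
  · intro h
    refine hD.ne_rho j ?_
    rw [← MulAction.orbit_eq_iff.2 (E4_eq_zero_iff.1 h), MulAction.orbit_eq_iff.2 hz]
    exact MulAction.mem_orbit_self _
  · intro h
    refine hD.ne_I j ?_
    rw [← MulAction.orbit_eq_iff.2 (E6_eq_zero_iff.1 h), MulAction.orbit_eq_iff.2 hz]
    exact MulAction.mem_orbit_self _
  · refine hD.inequivalent l j hl ?_
    rw [← MulAction.orbit_eq_iff.2 hz, MulAction.orbit_eq_iff.2 ((hD.F_eq_zero_iff l z).1 h)]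
    exact MulAction.mem_orbit_self _

theorem pointType_I {z : ℍ} (hz : z ∈ MulAction.orbit SL(2, ℤ) UpperHalfPlane.I) :
    D.PointType D.expI (E₄ z) (E₆ z) := by
  have h6 := E6_eq_zero_iff.2 hz
  rw [h6]
  exact .atI fun h => discriminant_ne_zero' z (by rw [h, h6]; ring)

theorem pointType_rho (hD : D.IsAdmissible) {z : ℍ} (hz : z ∈ MulAction.orbit SL(2, ℤ) rho) :
    D.PointType D.expRho (E₄ z) (E₆ z) := by
  have h4 := E4_eq_zero_iff.2 hz
  rw [h4]
  exact .atRho (fun h => discriminant_ne_zero' z (by rw [h, h4]; ring)) hD.t_ne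

theorem pointType_regular (hD : D.IsAdmissible) {z : ℍ} (hz : z ∉ D.singularSet) :
    D.PointType ![0, 1, 2] (E₄ z) (E₆ z) := by
  rw [hD.mem_singularSet_iff] at hz
  push Not at hz
  exact .regular hz.2.1 hz.1 hz.2.2

/-- Every point of the upper half-plane has a type. -/
theorem exists_pointType (hD : D.IsAdmissible) (z : ℍ) :
    ∃ κ, D.PointType κ (E₄ z) (E₆ z) := by
  by_cases hz : z ∈ D.singularSet
  · rcases hz with (hz | hz) | hz
    · exact ⟨_, pointType_I hz⟩
    · exact ⟨_, hD.pointType_rho hz⟩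
    · obtain ⟨j, hj⟩ := Set.mem_iUnion.1 hz
      exact ⟨_, hD.pointType_pt j hj⟩
  · exact ⟨_, hD.pointType_regular hz⟩

end SingularData.IsAdmissible

/-! ### Homogeneity and expansions of the general form -/

namespace SingularData

variable {m : ℕ} (D : SingularData m)

theorem F_homogeneous {l : ℂ} (a b : ℂ) (j : Fin m) :
    D.F (l ^ 4 * a) (l ^ 6 * b) j = l ^ 12 * D.F a b j := by
  simp only [F, smul_eq_mul]; ring

/-- Scaling E₄ and E₆ according to their weights accounts both for the automorphy factor and for the
factor 1 + E₂(z₀)x/12 of the canonical coordinate. -/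
theorem qVal_homogeneous {l : ℂ} (hl : l ≠ 0) (p : FreeParam m → ℂ) (a b : ℂ) :
    D.qVal p (l ^ 4 * a) (l ^ 6 * b) = l ^ 4 * D.qVal p a b := by
  have h1 : (l ^ 4 * a) ^ 3 - (l ^ 6 * b) ^ 2 = l ^ 12 * (a ^ 3 - b ^ 2) := by ring
  simp only [qVal, qFixed, qR1, F_homogeneous, h1, smul_eq_mul, mul_add, Finset.mul_sum]
  congr 1
  · congr 1
    · congr 1
      · congr 1
        · ring
        · field_simp
      · field_simp
    · refine Finset.sum_congr rfl fun j _ => ?_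
      field_simp
  · refine Finset.sum_congr rfl fun j _ => ?_
    field_simp

theorem rVal_homogeneous {l : ℂ} (hl : l ≠ 0) (p : FreeParam m → ℂ) (a b : ℂ) :
    D.rVal p (l ^ 4 * a) (l ^ 6 * b) = l ^ 6 * D.rVal p a b := by
  have h1 : (l ^ 4 * a) ^ 3 - (l ^ 6 * b) ^ 2 = l ^ 12 * (a ^ 3 - b ^ 2) := by ring
  simp only [rVal, rFixed, rS, rSI, F_homogeneous, h1, smul_eq_mul, mul_add, Finset.mul_sum]
  congr 1
  · congr 1
    · congr 1
      · congr 1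
        · congr 1
          · ring
          · field_simp
        · field_simp
      · refine Finset.sum_congr rfl fun j _ => ?_
        field_simp
    · field_simp
  · refine Finset.sum_congr rfl fun j _ => ?_
    field_simp

variable {D}

theorem rep_F {u v : ℂ → ℂ} {U V : ℂ⸨X⸩} (hu : Rep u U) (hv : Rep v V) (j : Fin m) :
    Rep (fun x => D.F (u x) (v x) j) (D.F U V j) :=
  (hu.pow 3).sub ((hv.pow 2).smul _)

theorem rep_qR1 {u v : ℂ → ℂ} {U V : ℂ⸨X⸩} (hu : Rep u U) (hv : Rep v V) (j : Fin m) :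
    Rep (fun x => D.qR1 (u x) (v x) j) (D.qR1 U V j) :=
  (hu.mul ((hu.pow 3).sub (hv.pow 2))).div (rep_F hu hv j)

theorem rep_rS {u v : ℂ → ℂ} {U V : ℂ⸨X⸩} (hu : Rep u U) (hv : Rep v V) (k : ℕ) (j : Fin m) :
    Rep (fun x => D.rS (u x) (v x) k j) (D.rS U V k j) :=
  (hv.mul (((hu.pow 3).sub (hv.pow 2)).pow k)).div ((rep_F hu hv j).pow k)

theorem rep_rSI {u v : ℂ → ℂ} {U V : ℂ⸨X⸩} (hu : Rep u U) (hv : Rep v V) :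
    Rep (fun x => rSI (u x) (v x)) (rSI U V) :=
  ((hu.pow 3).sub (hv.pow 2)).div hv

theorem rep_qFixed {u v : ℂ → ℂ} {U V : ℂ⸨X⸩} (hu : Rep u U) (hv : Rep v V) :
    Rep (fun x => D.qFixed (u x) (v x)) (D.qFixed U V) := by
  have hΔ := (hu.pow 3).sub (hv.pow 2)
  exact (((hu.smul _).add (((hu.mul hΔ).div (hv.pow 2)).smul _)).add
    ((hΔ.div (hu.pow 2)).smul _)).add
    (Rep.sum _ fun j _ => ((hu.mul (hΔ.pow 2)).div ((rep_F hu hv j).pow 2)).smul _)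

theorem rep_rFixed {u v : ℂ → ℂ} {U V : ℂ⸨X⸩} (hu : Rep u U) (hv : Rep v V) :
    Rep (fun x => D.rFixed (u x) (v x)) (D.rFixed U V) := by
  have hΔ := (hu.pow 3).sub (hv.pow 2)
  exact (((hv.smul _).add (((hΔ.pow 2).div (hv.pow 3)).smul _)).add
    (((hv.mul hΔ).div (hu.pow 3)).smul _)).add
    (Rep.sum _ fun j _ => ((hv.mul (hΔ.pow 3)).div ((rep_F hu hv j).pow 3)).smul _)

theorem rep_qVal {u v : ℂ → ℂ} {U V : ℂ⸨X⸩} (hu : Rep u U) (hv : Rep v V)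
    (p : FreeParam m → ℂ) : Rep (fun x => D.qVal p (u x) (v x)) (D.qVal p U V) :=
  (rep_qFixed hu hv).add (Rep.sum _ fun j _ => (rep_qR1 hu hv j).smul _)

theorem rep_rVal {u v : ℂ → ℂ} {U V : ℂ⸨X⸩} (hu : Rep u U) (hv : Rep v V)
    (p : FreeParam m → ℂ) : Rep (fun x => D.rVal p (u x) (v x)) (D.rVal p U V) :=
  ((rep_rFixed hu hv).add ((rep_rSI hu hv).smul _)).add
    (Rep.sum _ fun j _ => ((rep_rS hu hv 2 j).smul _).add ((rep_rS hu hv 1 j).smul _))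

/-- The scalar action in the general form comes from the algebra structure on the Laurent series
field; here it is identified with the coefficientwise one. -/
theorem coeff_smul' (c : ℂ) (S : ℂ⸨X⸩) (n : ℤ) :
    (Algebra.toSMul.smul c S : ℂ⸨X⸩).coeff n = c * S.coeff n := by
  have h : (Algebra.toSMul.smul c S : ℂ⸨X⸩) = algebraMap ℂ ℂ⸨X⸩ c * S := Algebra.smul_def c S
  rw [h, show algebraMap ℂ ℂ⸨X⸩ c = HahnSeries.ofPowerSeries ℤ ℂ (PowerSeries.C c) from rfl,
    HahnSeries.ofPowerSeries_C, HahnSeries.C_mul_eq_smul]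
  rfl

theorem eval_aCoeff (p : FreeParam m → ℂ) (z₀ : ℍ) (n : ℤ) :
    MvPolynomial.eval p (D.aCoeff z₀ n) = (D.qVal p (e4Series z₀) (e6Series z₀)).coeff n := by
  simp only [aCoeff, qVal, map_add, map_sum, map_mul, MvPolynomial.eval_C, MvPolynomial.eval_X,
    HahnSeries.coeff_add, HahnSeries.coeff_sum]
  congr 1
  exact Finset.sum_congr rfl fun j _ => (mul_comm _ _).trans (coeff_smul' _ _ _).symm

theorem eval_rCoeff (p : FreeParam m → ℂ) (z₀ : ℍ) (n : ℤ) :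
    MvPolynomial.eval p (D.rCoeff z₀ n) = (D.rVal p (e4Series z₀) (e6Series z₀)).coeff n := by
  simp only [rCoeff, rVal, map_add, map_sum, map_mul, MvPolynomial.eval_C, MvPolynomial.eval_X,
    HahnSeries.coeff_add, HahnSeries.coeff_sum]
  congr 1
  · congr 1
    exact (mul_comm _ _).trans (coeff_smul' _ _ _).symm
  · refine Finset.sum_congr rfl fun j _ => ?_
    congr 1 <;> exact (mul_comm _ _).trans (coeff_smul' _ _ _).symm

theorem eval_bCoeff (p : FreeParam m → ℂ) (z₀ : ℍ) (n : ℤ) :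
    MvPolynomial.eval p (D.bCoeff z₀ n) = ((n : ℂ) + 1) / 2 * MvPolynomial.eval p (D.aCoeff z₀ (n + 1))
      + MvPolynomial.eval p (D.rCoeff z₀ n) := by
  simp [bCoeff]

end SingularData

/-! ### Frobenius obstructions in general -/

/-- The recursion uses only ring operations and complex scalars, and its case distinction depends
only on f and α. Hence evaluating an obstruction polynomial at parameter values gives the
obstruction of the specialised equation. -/
theorem map_frobeniusCoeff {A B : Type*} [CommRing A] [Algebra ℂ A] [CommRing B] [Algebra ℂ B]
    (φ : A →ₐ[ℂ] B) (a b : ℤ → A) (f : ℂ → ℂ) (α : ℂ) (n : ℕ) :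
    φ (frobeniusCoeff a b f α n) = frobeniusCoeff (φ ∘ a) (φ ∘ b) f α n ∧
    φ (frobeniusObstruction a b f α n) = frobeniusObstruction (φ ∘ a) (φ ∘ b) f α n := by
  have key : ∀ n, (∀ k < n, φ (frobeniusCoeff a b f α k) = frobeniusCoeff (φ ∘ a) (φ ∘ b) f α k) →
      φ (frobeniusObstruction a b f α n) = frobeniusObstruction (φ ∘ a) (φ ∘ b) f α n := by
    intro n h
    simp only [frobeniusObstruction, map_sum]
    refine Finset.sum_congr rfl fun k hk => ?_
    rw [map_mul, h k (Finset.mem_range.1 hk), map_add, map_smul]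
    rfl
  have key2 : ∀ n, φ (frobeniusCoeff a b f α n) = frobeniusCoeff (φ ∘ a) (φ ∘ b) f α n := by
    intro n
    induction n using Nat.strong_induction_on with
    | _ n ih =>
      by_cases hn : n = 0
      · rw [hn, frobeniusCoeff_zero, frobeniusCoeff_zero, map_one]
      by_cases hf : f (α + n) = 0
      · rw [frobeniusCoeff_of_eq_zero _ _ _ _ hn hf, frobeniusCoeff_of_eq_zero _ _ _ _ hn hf,
          map_zero]
      · rw [frobeniusCoeff_of_ne_zero _ _ _ _ hn hf, frobeniusCoeff_of_ne_zero _ _ _ _ hn hf,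
          map_neg, map_smul, key n ih]
  exact ⟨key2 n, key n fun k _ => key2 k⟩

/-- If the coefficients vanish in all degrees except those with `ω^n = 1`, then so do the Frobenius
coefficients and obstructions. -/
theorem frobenius_eq_zero {A : Type*} [CommRing A] [Algebra ℂ A] {a b : ℤ → A} {ω : ℂ}
    (h : ∀ n : ℕ, ω ^ n ≠ 1 → a (n - 2) = 0 ∧ b (n - 3) = 0) (f : ℂ → ℂ) (α : ℂ) (n : ℕ)
    (hn : ω ^ n ≠ 1) : frobeniusCoeff a b f α n = 0 ∧ frobeniusObstruction a b f α n = 0 := by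
  induction n using Nat.strong_induction_on with
  | _ n ih =>
    have h0 : n ≠ 0 := by rintro rfl; exact hn (pow_zero ω)
    have hob : frobeniusObstruction a b f α n = 0 := by
      refine Finset.sum_eq_zero fun k hk => ?_
      have hk := Finset.mem_range.1 hk
      by_cases hk1 : ω ^ k = 1
      · have h1 : ω ^ (n - k) ≠ 1 := by
          intro h2
          apply hn
          rw [← Nat.sub_add_cancel hk.le, pow_add, h2, hk1, one_mul]
        obtain ⟨ha, hb⟩ := h _ h1
        rw [Nat.cast_sub hk.le] at ha hb
        rw [ha, hb, smul_zero, add_zero, zero_mul]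
      · rw [(ih k hk hk1).1, mul_zero]
    refine ⟨?_, hob⟩
    by_cases hf : f (α + n) = 0
    · exact frobeniusCoeff_of_eq_zero _ _ _ _ h0 hf
    · rw [frobeniusCoeff_of_ne_zero _ _ _ _ h0 hf, hob, smul_zero, neg_zero]

namespace SingularData

variable {m : ℕ} {D : SingularData m}

theorem eval_poly (p : FreeParam m → ℂ) (z₀ : ℍ) (κ : Fin 3 → ℚ) (e : ExponentPair) :
    MvPolynomial.eval p (D.poly z₀ κ e) = frobeniusObstruction
      (fun n => MvPolynomial.eval p (D.aCoeff z₀ n)) (fun n => MvPolynomial.eval p (D.bCoeff z₀ n))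
      (ind κ) (κ e.1.1) ⌊κ e.1.2 - κ e.1.1⌋₊ := by
  have := (map_frobeniusCoeff (MvPolynomial.aeval p : MvPolynomial (FreeParam m) ℂ →ₐ[ℂ] ℂ)
    (D.aCoeff z₀) (D.bCoeff z₀) (ind κ) (κ e.1.1) ⌊expDiff κ e⌋₊).2
  exact this

/-! ### Vanishing of coefficients at elliptic points -/

/-- The stabiliser scales x by j⁻² and multiplies Q̃, R̃ by j⁴, j⁶. A nonzero coefficient of Q̃ in
degree n - 2, or of R̃ in degree n - 3, therefore forces j^(2n) = 1. -/
theorem coeff_eq_zero {γ : SL(2, ℤ)} {z₀ : ℍ} (hγ : γ • z₀ = z₀) (n : ℕ)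
    (hn : (denom γ z₀ ^ 2) ^ n ≠ 1) : D.aCoeff z₀ (n - 2) = 0 ∧ D.bCoeff z₀ (n - 3) = 0 := by
  have hj : denom γ z₀ ≠ 0 := denom_ne_zero γ z₀
  have hE4 := localFun_scale (k := 4) (f := ModularForm.E₄)
    (fun z => by simpa using E_smul (k := 4) (by norm_num) γ z) hγ
  have hE6 := localFun_scale (k := 6) (f := ModularForm.E₆)
    (fun z => by simpa using E_smul (k := 6) (by norm_num) γ z) hγ
  set j := denom γ z₀
  have hq : D.aCoeff z₀ (n - 2) = 0 := by
    refine MvPolynomial.funext fun p => ?_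
    rw [map_zero, eval_aCoeff]
    have h1 := (rep_qVal (D := D) (rep_lE4 z₀) (rep_lE6 z₀) p).coeff_scale (c := (j ^ 2)⁻¹)
      (u := j ^ 4) (inv_ne_zero (pow_ne_zero 2 hj)) (by
        filter_upwards [hE4.filter_mono nhdsWithin_le_nhds, hE6.filter_mono nhdsWithin_le_nhds]
          with x h4 h6
        rw [lE4, lE6, h4, h6, D.qVal_homogeneous hj]) (n - 2)
    by_contra hne
    have h2 := mul_right_cancel₀ hne h1
    apply hn
    rw [zpow_sub₀ (inv_ne_zero (pow_ne_zero 2 hj)), inv_zpow, div_eq_iff (by positivity)] at h2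
    simp only [zpow_natCast, zpow_ofNat] at h2
    field_simp at h2
    linear_combination -h2
  have hr : D.rCoeff z₀ (n - 3) = 0 := by
    refine MvPolynomial.funext fun p => ?_
    rw [map_zero, eval_rCoeff]
    have h1 := (rep_rVal (D := D) (rep_lE4 z₀) (rep_lE6 z₀) p).coeff_scale (c := (j ^ 2)⁻¹)
      (u := j ^ 6) (inv_ne_zero (pow_ne_zero 2 hj)) (by
        filter_upwards [hE4.filter_mono nhdsWithin_le_nhds, hE6.filter_mono nhdsWithin_le_nhds]
          with x h4 h6
        rw [lE4, lE6, h4, h6, D.rVal_homogeneous hj]) (n - 3)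
    by_contra hne
    have h2 := mul_right_cancel₀ hne h1
    apply hn
    rw [zpow_sub₀ (inv_ne_zero (pow_ne_zero 2 hj)), inv_zpow, div_eq_iff (by positivity)] at h2
    simp only [zpow_natCast, zpow_ofNat] at h2
    field_simp at h2
    linear_combination -h2
  refine ⟨hq, ?_⟩
  rw [bCoeff, hr, show (n : ℤ) - 3 + 1 = n - 2 by ring, hq, mul_zero, zero_add]

theorem poly_eq_zero {γ : SL(2, ℤ)} {z₀ : ℍ} (hγ : γ • z₀ = z₀) (κ : Fin 3 → ℚ) (e : ExponentPair)
    (hn : (denom γ z₀ ^ 2) ^ ⌊expDiff κ e⌋₊ ≠ 1) : D.poly z₀ κ e = 0 :=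
  (frobenius_eq_zero (fun n hn => coeff_eq_zero hγ n hn) _ _ _ hn).2

/-! ### Local normal form of the equation -/

/-- At a point with the expected exponents, the Laurent coefficients come from analytic germs with
the right indicial polynomial. -/
theorem PointType.exists_germs {κ : Fin 3 → ℚ} {z₀ : ℍ}
    (hP : D.PointType κ (ModularForm.E₄ z₀) (ModularForm.E₆ z₀)) (hmono : StrictMono κ)
    (hint : ∀ i j, ∃ n : ℤ, κ i - κ j = n) (hsum : κ 0 + κ 1 + κ 2 = 3)
    (p : FreeParam m → ℂ) :
    ∃ A B : ℂ → ℂ, IsExponents A B κ ∧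
      (∀ᶠ x in 𝓝[≠] 0, x ^ 2 * D.qVal p (lE4 z₀ x) (lE6 z₀ x) = A x) ∧
      (∀ᶠ x in 𝓝[≠] 0, x ^ 3 * (D.rVal p (lE4 z₀ x) (lE6 z₀ x)
        + 1 / 2 * deriv (fun x => D.qVal p (lE4 z₀ x) (lE6 z₀ x)) x) = B x) ∧
      (∀ n, MvPolynomial.eval p (D.aCoeff z₀ n) = lau A 2 n) ∧
      (∀ n, MvPolynomial.eval p (D.bCoeff z₀ n) = lau B 3 n) := by
  have h := isLocalPair_local z₀
  have hP' : D.PointType κ (lE4 z₀ 0) (lE6 z₀ 0) := by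
    rwa [lE4, lE6, localFun_zero, localFun_zero]
  have hq := hP'.tendsto_qVal h p
  have hr := hP'.tendsto_rVal h p
  rw [one_pow, div_one] at hq hr
  obtain ⟨A, hA, hA0, hA1, hA2⟩ := (rep_qVal (D := D) (rep_lE4 z₀) (rep_lE6 z₀) p).lead hq
  obtain ⟨R, hR, hR0, hR1, hR2⟩ := (rep_rVal (D := D) (rep_lE4 z₀) (rep_lE6 z₀) p).lead hr
  have hA' := hA.deriv
  have htc : ∀ n, tc (fun x => 1 / 2 * (x * deriv A x + -2 * A x) + R x) n
      = 1 / 2 * (n * tc A n + -2 * tc A n) + tc R n := by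
    intro n
    have h1 : tc (fun x => x * deriv A x) n = n * tc A n := by
      have h2 := taylor_pow_mul hA' 1
      simp only [pow_one] at h2
      rw [← coeff_taylor, h2]
      cases n with
      | zero => simp
      | succ n =>
        rw [mul_comm, PowerSeries.coeff_succ_mul_X, coeff_taylor, tc_deriv]
        push_cast; ring
    rw [tc_add (by fun_prop) hR, tc_const_mul, tc_add (by fun_prop) (by fun_prop),
      tc_const_mul, h1]
  -- From Q̃ = A/x² one has x³ · ½Q̃' = ½(xA' - 2A). The value at 0 is -(e₂ - 2) + (e₂ - 2 - e₃) =
  -- -e₃, as the indicial polynomial requires.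
  refine ⟨A, fun x => 1 / 2 * (x * deriv A x + -2 * A x) + R x,
    ⟨hA, by fun_prop, hmono, hint, ?_⟩, hA1, ?_, ?_, ?_⟩
  · intro x
    simp only [zero_mul, zero_add, hA0, hR0, ind, Fin.prod_univ_three, esymmTwo, esymmThree]
    have : (κ 0 : ℂ) + κ 1 + κ 2 = 3 := by exact_mod_cast hsum
    linear_combination x ^ 2 * this
  · have hA1' := eventually_nhdsNE_eventually_nhds_iff.2 hA1
    filter_upwards [hA1', hR1, self_mem_nhdsWithin,
      hA.eventually_analyticAt.filter_mono nhdsWithin_le_nhds] with x h1 h2 hx hAx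
    have hx : x ≠ 0 := hx
    have h3 : (fun x => D.qVal p (lE4 z₀ x) (lE6 z₀ x)) =ᶠ[𝓝 x] fun x => A x / x ^ 2 := by
      filter_upwards [h1, eventually_ne_nhds hx] with y hy hy0
      rw [← hy]; field_simp
    have h4 : HasDerivAt (fun x => A x / x ^ 2) _ x :=
      hAx.differentiableAt.hasDerivAt.fun_div (hasDerivAt_pow 2 x) (pow_ne_zero 2 hx)
    rw [h3.deriv_eq, h4.deriv, ← h2]
    push_cast
    field_simp
    ring
  · intro n
    rw [eval_aCoeff, hA2 n]
    rfl
  · intro n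
    rw [eval_bCoeff, eval_aCoeff, eval_rCoeff, hA2, hR2]
    simp only [lau, Nat.cast_ofNat, show n + 1 + 2 = n + 3 by ring]
    split_ifs with hn
    · obtain ⟨k, hk⟩ := Int.eq_ofNat_of_zero_le hn
      rw [hk, Int.toNat_natCast, htc]
      have : (n : ℂ) + 3 = k := by exact_mod_cast hk
      rw [← this]
      ring
    · simp

theorem PointType.isApparentAt_iff {κ : Fin 3 → ℚ} {z₀ : ℍ}
    (hP : D.PointType κ (ModularForm.E₄ z₀) (ModularForm.E₆ z₀)) (hmono : StrictMono κ)
    (hint : ∀ i j, ∃ n : ℤ, κ i - κ j = n) (hsum : κ 0 + κ 1 + κ 2 = 3)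
    (p : FreeParam m → ℂ) :
    IsApparentAt (fun x => D.qVal p (lE4 z₀ x) (lE6 z₀ x))
      (fun x => D.rVal p (lE4 z₀ x) (lE6 z₀ x)
        + 1 / 2 * deriv (fun x => D.qVal p (lE4 z₀ x) (lE6 z₀ x)) x) 0 ↔
    ∀ e, MvPolynomial.eval p (D.poly z₀ κ e) = 0 := by
  obtain ⟨A, B, h, h2, h3, hA, hB⟩ := hP.exists_germs hmono hint hsum p
  simp only [eval_poly, hA, hB]
  exact ⟨fun hap e => h.obstruction_of_isApparentAt h2 h3 hap e.2,
    fun hz => h.isApparentAt h2 h3 fun i j hij => hz ⟨(i, j), hij⟩⟩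

end SingularData

/-- With κ 1 = κ 0 + n and sum 3, the difference κ 2 - κ 0 equals 3 - 3κ 0 - n, an integer because κ
0 lies in ⅓ℤ. -/
theorem IsExponentTriple.int {κ : Fin 3 → ℚ} (h : IsExponentTriple κ) :
    ∀ i j, ∃ n : ℤ, κ i - κ j = n := by
  obtain ⟨_, h1, h2, n, hn⟩ := h
  obtain ⟨k, hk⟩ := h1 0
  have e1 : κ 1 = κ 0 + n := by linarith
  have e2 : κ 2 = κ 0 + ((3 - k - n : ℤ) : ℚ) := by push_cast; linarith
  intro i j
  fin_cases i <;> fin_cases j <;> simp only [e1, e2, Fin.zero_eta, Fin.mk_one, Fin.reduceFinMk]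
  exacts [⟨0, by simp⟩, ⟨-n, by push_cast; ring⟩, ⟨-(3 - k - n), by push_cast; ring⟩,
    ⟨n, by ring⟩, ⟨0, by simp⟩, ⟨n - (3 - k - n), by push_cast; ring⟩,
    ⟨3 - k - n, by push_cast; ring⟩, ⟨3 - k - n - n, by push_cast; ring⟩, ⟨0, by simp⟩]

/-! ### Pull-backs from weighted transformation laws -/

/-- The normalisation Q₃ = R + ½Q₂' is what makes the equation covariant: differentiating the factor
β²(1 + eδ)⁻⁴ of Q₂ produces exactly the extra term in `IsPullback`. -/
theorem isPullback_of_weights {β e : ℂ} (hβ : β ≠ 0) {q₁ r₁ q₀ r₀ : ℂ → ℂ} {z₁ z₀ : ℂ}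
    (hq : ∀ᶠ δ in 𝓝[≠] (0 : ℂ), q₁ (z₁ + δ) = (β / (1 + e * δ) ^ 2) ^ 2 * q₀ (z₀ + mob β e δ))
    (hr : ∀ᶠ δ in 𝓝[≠] (0 : ℂ), r₁ (z₁ + δ) = (β / (1 + e * δ) ^ 2) ^ 3 * r₀ (z₀ + mob β e δ))
    (hd : ∀ᶠ δ in 𝓝[≠] (0 : ℂ), DifferentiableAt ℂ q₀ (z₀ + δ)) :
    IsPullback β e q₁ (fun x => r₁ x + 1 / 2 * deriv q₁ x) z₁
      q₀ (fun x => r₀ x + 1 / 2 * deriv q₀ x) z₀ := by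
  filter_upwards [eventually_nhdsNE_eventually_nhds_iff.2 hq, hr, (tendsto_mob hβ).eventually hd,
    (eventually_one_add_ne e).filter_mono nhdsWithin_le_nhds] with δ h1 h2 h3 h4
  refine ⟨h1.self_of_nhds, ?_⟩
  have h5 : HasDerivAt (fun x => q₀ (z₀ + mob β e x))
      (deriv q₀ (z₀ + mob β e δ) * (β / (1 + e * δ) ^ 2)) δ :=
    h3.hasDerivAt.comp δ ((hasDerivAt_mob h4).const_add z₀)
  have h6 : HasDerivAt (fun x : ℂ => 1 + e * x) e δ := by
    simpa using ((hasDerivAt_id δ).const_mul e).const_add 1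
  have h7 := (((h6.fun_pow 2).fun_inv (pow_ne_zero 2 h4)).const_mul β).fun_pow 2
  have h9 : (fun x => q₁ (z₁ + x)) =ᶠ[𝓝 δ] fun x =>
      (β * ((1 + e * x) ^ 2)⁻¹) ^ 2 * q₀ (z₀ + mob β e x) := by
    filter_upwards [h1] with x hx
    rw [hx, div_eq_mul_inv]
  rw [h2, ← deriv_comp_const_add, h9.deriv_eq, (h7.fun_mul h5).deriv]
  push_cast
  field_simp
  ring

theorem smul_eq_of_slash {k : ℕ} {f : ℍ → ℂ} (hf : ∀ γ : SL(2, ℤ), f ∣[(k : ℤ)] γ = f)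
    (γ : SL(2, ℤ)) (z : ℍ) : f (γ • z) = denom γ z ^ k * f z := by
  have h := congrFun (hf γ) z
  rw [ModularForm.SL_slash_apply, zpow_neg, zpow_natCast] at h
  rw [← h]
  field_simp [denom_ne_zero γ z]

/-! ### Analyticity of the general form and isolation of the singular points. -/

namespace SingularData

variable {m : ℕ} {D : SingularData m}

theorem analyticAt_F {u v : ℂ → ℂ} {x : ℂ} (hu : AnalyticAt ℂ u x) (hv : AnalyticAt ℂ v x)
    (j : Fin m) : AnalyticAt ℂ (fun x => D.F (u x) (v x) j) x := by
  simp only [F, smul_eq_mul]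
  fun_prop

theorem analyticAt_qVal {u v : ℂ → ℂ} {x : ℂ} (hu : AnalyticAt ℂ u x) (hv : AnalyticAt ℂ v x)
    (h4 : u x ≠ 0) (h6 : v x ≠ 0) (hF : ∀ j, D.F (u x) (v x) j ≠ 0) (p : FreeParam m → ℂ) :
    AnalyticAt ℂ (fun x => D.qVal p (u x) (v x)) x := by
  have hΔ : AnalyticAt ℂ (fun x => u x ^ 3 - v x ^ 2) x := by fun_prop
  have hF' := fun j => analyticAt_F (D := D) hu hv j
  simp only [qVal, qFixed, qR1, smul_eq_mul]
  refine ((((analyticAt_const.fun_mul hu).fun_add (analyticAt_const.fun_mul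
    ((hu.fun_mul hΔ).fun_div (hv.fun_pow 2) (pow_ne_zero 2 h6)))).fun_add
    (analyticAt_const.fun_mul (hΔ.fun_div (hu.fun_pow 2) (pow_ne_zero 2 h4)))).fun_add
    (Finset.analyticAt_fun_sum _ fun j _ => analyticAt_const.fun_mul
      ((hu.fun_mul (hΔ.fun_pow 2)).fun_div ((hF' j).fun_pow 2) (pow_ne_zero 2 (hF j))))).fun_add
    (Finset.analyticAt_fun_sum _ fun j _ => analyticAt_const.fun_mul
      ((hu.fun_mul hΔ).fun_div (hF' j) (hF j)))

theorem analyticAt_rVal {u v : ℂ → ℂ} {x : ℂ} (hu : AnalyticAt ℂ u x) (hv : AnalyticAt ℂ v x)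
    (h4 : u x ≠ 0) (h6 : v x ≠ 0) (hF : ∀ j, D.F (u x) (v x) j ≠ 0) (p : FreeParam m → ℂ) :
    AnalyticAt ℂ (fun x => D.rVal p (u x) (v x)) x := by
  have hΔ : AnalyticAt ℂ (fun x => u x ^ 3 - v x ^ 2) x := by fun_prop
  have hF' := fun j => analyticAt_F (D := D) hu hv j
  have hS : ∀ k j, AnalyticAt ℂ (fun x => v x * (u x ^ 3 - v x ^ 2) ^ k / D.F (u x) (v x) j ^ k) x :=
    fun k j => (hv.fun_mul (hΔ.fun_pow k)).fun_div ((hF' j).fun_pow k) (pow_ne_zero k (hF j))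
  simp only [rVal, rFixed, rS, rSI, smul_eq_mul]
  refine (((((analyticAt_const.fun_mul hv).fun_add (analyticAt_const.fun_mul
    ((hΔ.fun_pow 2).fun_div (hv.fun_pow 3) (pow_ne_zero 3 h6)))).fun_add
    (analyticAt_const.fun_mul ((hv.fun_mul hΔ).fun_div (hu.fun_pow 3) (pow_ne_zero 3 h4)))).fun_add
    (Finset.analyticAt_fun_sum _ fun j _ => analyticAt_const.fun_mul (hS 3 j))).fun_add
    (analyticAt_const.fun_mul (hΔ.fun_div hv h6))).fun_add
    (Finset.analyticAt_fun_sum _ fun j _ =>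
      (analyticAt_const.fun_mul (hS 2 j)).fun_add (analyticAt_const.fun_mul (hS 1 j)))

namespace IsAdmissible

/-- The singular points are isolated. -/
theorem eventually_notMem (hD : D.IsAdmissible) (z₀ : ℍ) : ∀ᶠ δ in 𝓝[≠] (0 : ℂ),
    ∃ h : 0 < ((z₀ : ℂ) + δ).im, (⟨z₀ + δ, h⟩ : ℍ) ∉ D.singularSet := by
  have h := isLocalPair_shift z₀
  obtain ⟨κ, hP⟩ := hD.exists_pointType z₀
  have hne : ∀ {f : ℂ → ℂ}, AnalyticAt ℂ f 0 → (f 0 = 0 → deriv f 0 ≠ 0) →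
      ∀ᶠ δ in 𝓝[≠] (0 : ℂ), f δ ≠ 0 := by
    intro f hf h0
    by_cases hf0 : f 0 = 0
    · exact (hf.differentiableAt.hasDerivAt.eventually_ne (h0 hf0))
    · exact (hf.continuousAt.eventually_ne hf0).filter_mono nhdsWithin_le_nhds
  have hτ := h.τ_ne
  have h4 := hne h.anU fun h0 => by
    rw [h.deriv_u_at_zero h0]
    have := fun hv => h.u_ne_of_v hv h0
    simpa [hτ] using this
  have h6 := hne h.anV fun h0 => by
    rw [h.deriv_v_at_zero h0]
    have := h.u_ne_of_v h0
    simpa [hτ] using this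
  have hF := eventually_all.2 fun j => hne (h.anF (D := D) j) fun h0 =>
    h.deriv_F_ne j h0 (by simpa using hP.u_ne j (by simpa using h0)) (h.v_ne_of_F h0)
  have him : ∀ᶠ δ in 𝓝[≠] (0 : ℂ), 0 < ((z₀ : ℂ) + δ).im := by
    refine Filter.Eventually.filter_mono nhdsWithin_le_nhds ?_
    have : ContinuousAt (fun δ : ℂ => (z₀ : ℂ) + δ) 0 := by fun_prop
    exact this.eventually (p := fun z => 0 < z.im)
      (by simp only [add_zero]; exact isOpen_upperHalfPlaneSet.mem_nhds z₀.im_pos)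
  filter_upwards [h4, h6, hF, him] with δ h1 h2 h3 h4
  refine ⟨h4, ?_⟩
  have e4 : cE4 (z₀ + δ) = ModularForm.E₄ (⟨z₀ + δ, h4⟩ : ℍ) := cE4_coe ⟨z₀ + δ, h4⟩
  have e6 : cE6 (z₀ + δ) = ModularForm.E₆ (⟨z₀ + δ, h4⟩ : ℍ) := cE6_coe ⟨z₀ + δ, h4⟩
  rw [e4] at h1
  rw [e6] at h2
  simp only [e4, e6] at h3
  rw [hD.mem_singularSet_iff]
  push Not
  exact ⟨h2, h1, h3⟩

/-- Near a nonsingular point, the general form is analytic. -/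
theorem analyticAt_of_notMem (hD : D.IsAdmissible) {z : ℍ} (hz : z ∉ D.singularSet)
    (p : FreeParam m → ℂ) :
    AnalyticAt ℂ (fun z => D.qVal p (cE4 z) (cE6 z)) z ∧
    AnalyticAt ℂ (fun z => D.rVal p (cE4 z) (cE6 z)) z := by
  rw [hD.mem_singularSet_iff] at hz
  push Not at hz
  have h4 : cE4 z ≠ 0 := by simpa using hz.2.1
  have h6 : cE6 z ≠ 0 := by simpa using hz.1
  have hF : ∀ j, D.F (cE4 z) (cE6 z) j ≠ 0 := by simpa using hz.2.2
  exact ⟨analyticAt_qVal (analyticAt_cE4 z.im_pos) (analyticAt_cE6 z.im_pos) h4 h6 hF p,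
    analyticAt_rVal (analyticAt_cE4 z.im_pos) (analyticAt_cE6 z.im_pos) h4 h6 hF p⟩

theorem eventually_notMem_nhds (hD : D.IsAdmissible) {z₀ : ℍ} (hz : z₀ ∉ D.singularSet) :
    ∀ᶠ z in 𝓝 (z₀ : ℂ), ∃ h : 0 < z.im, (⟨z, h⟩ : ℍ) ∉ D.singularSet := by
  have h1 := hD.eventually_notMem z₀
  have h2 : ∀ᶠ δ in 𝓝 (0 : ℂ), ∃ h : 0 < ((z₀ : ℂ) + δ).im, (⟨z₀ + δ, h⟩ : ℍ) ∉ D.singularSet := by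
    rw [eventually_nhdsWithin_iff] at h1
    filter_upwards [h1] with δ hδ
    by_cases h0 : δ = 0
    · subst h0
      refine ⟨by simpa using z₀.im_pos, ?_⟩
      convert hz
      simp
    · exact hδ h0
  have h3 : Tendsto (fun z : ℂ => z - z₀) (𝓝 (z₀ : ℂ)) (𝓝 0) := by
    have : ContinuousAt (fun z : ℂ => z - z₀) z₀ := by fun_prop
    simpa [ContinuousAt] using this
  filter_upwards [h3.eventually h2] with z hz
  simpa using hz

end IsAdmissible

/-! ### Covariance of the equation and apparentness at a single point. -/

namespace IsGivenBy

variable {Q R : ℍ → ℂ} {p : FreeParam m → ℂ}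

theorem eventuallyEq (hG : D.IsGivenBy p Q R) (hD : D.IsAdmissible) {z₀ : ℍ}
    (hz : z₀ ∉ D.singularSet) :
    (fun z => Q (ofComplex z)) =ᶠ[𝓝 (z₀ : ℂ)] (fun z => D.qVal p (cE4 z) (cE6 z)) ∧
    (fun z => R (ofComplex z)) =ᶠ[𝓝 (z₀ : ℂ)] (fun z => D.rVal p (cE4 z) (cE6 z)) := by
  have h := hD.eventually_notMem_nhds hz
  constructor
  · filter_upwards [h] with z ⟨h1, h2⟩
    rw [ofComplex_apply_of_im_pos h1, (hG _ h2).1]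
    exact congrArg₂ (D.qVal p) (cE4_coe ⟨z, h1⟩).symm (cE6_coe ⟨z, h1⟩).symm
  · filter_upwards [h] with z ⟨h1, h2⟩
    rw [ofComplex_apply_of_im_pos h1, (hG _ h2).2]
    exact congrArg₂ (D.rVal p) (cE4_coe ⟨z, h1⟩).symm (cE6_coe ⟨z, h1⟩).symm

theorem analyticAt (hG : D.IsGivenBy p Q R) (hD : D.IsAdmissible) {z₀ : ℍ}
    (hz : z₀ ∉ D.singularSet) :
    AnalyticAt ℂ (fun z => Q (ofComplex z)) z₀ ∧ AnalyticAt ℂ (fun z => R (ofComplex z)) z₀ :=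
  ⟨(hD.analyticAt_of_notMem hz p).1.congr (hG.eventuallyEq hD hz).1.symm,
    (hD.analyticAt_of_notMem hz p).2.congr (hG.eventuallyEq hD hz).2.symm⟩

theorem analyticAt_coeffTwo (hG : D.IsGivenBy p Q R) (hD : D.IsAdmissible) {z₀ : ℍ}
    (hz : z₀ ∉ D.singularSet) : AnalyticAt ℂ (coeffTwo Q) z₀ :=
  analyticAt_const.mul (hG.analyticAt hD hz).1

theorem analyticAt_coeffThree (hG : D.IsGivenBy p Q R) (hD : D.IsAdmissible) {z₀ : ℍ}
    (hz : z₀ ∉ D.singularSet) : AnalyticAt ℂ (coeffThree Q R) z₀ :=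
  (analyticAt_const.mul (hG.analyticAt hD hz).2).add
    (analyticAt_const.mul (hG.analyticAt_coeffTwo hD hz).deriv)

theorem eventually_differentiableAt (hG : D.IsGivenBy p Q R) (hD : D.IsAdmissible) (z₀ : ℍ) :
    ∀ᶠ δ in 𝓝[≠] (0 : ℂ), DifferentiableAt ℂ (coeffTwo Q) (z₀ + δ) := by
  filter_upwards [hD.eventually_notMem z₀] with δ ⟨h, h1⟩
  exact (hG.analyticAt_coeffTwo hD h1).differentiableAt

/-- The equation in the canonical coordinate is a pull-back of the original one. -/
theorem isPullback_local (hG : D.IsGivenBy p Q R) (hD : D.IsAdmissible) (z₀ : ℍ) :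
    IsPullback (2 * Real.pi * Complex.I)⁻¹ (slope z₀)
      (fun x => D.qVal p (lE4 z₀ x) (lE6 z₀ x))
      (fun x => D.rVal p (lE4 z₀ x) (lE6 z₀ x)
        + 1 / 2 * deriv (fun x => D.qVal p (lE4 z₀ x) (lE6 z₀ x)) x) 0
      (coeffTwo Q) (coeffThree Q R) z₀ := by
  have hs := Complex.two_pi_I_ne_zero
  have hE := (tendsto_mob (e := slope z₀) (inv_ne_zero hs)).eventually (hD.eventually_notMem z₀)
  have h1 := (eventually_one_add_ne (slope z₀)).filter_mono
    (nhdsWithin_le_nhds (s := ({0}ᶜ : Set ℂ)))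
  refine isPullback_of_weights (inv_ne_zero hs)
    (r₀ := fun z => (2 * Real.pi * Complex.I) ^ 3 * R (ofComplex z)) ?_ ?_
    (hG.eventually_differentiableAt hD z₀)
  · filter_upwards [hE, h1] with x ⟨hx, hx'⟩ h1
    have h2 : ofComplex (coord z₀ x) = ⟨z₀ + mob (2 * Real.pi * Complex.I)⁻¹ (slope z₀) x, hx⟩ :=
      ofComplex_apply_of_im_pos hx
    simp only [zero_add, lE4, lE6, localFun, div_eq_inv_mul, ← inv_pow]
    rw [D.qVal_homogeneous (inv_ne_zero h1), ← D.qForm_eq, coeffTwo]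
    change _ = _ * (_ * Q (ofComplex (coord z₀ x)))
    rw [h2, (hG _ hx').1]
    field_simp
  · filter_upwards [hE, h1] with x ⟨hx, hx'⟩ h1
    have h2 : ofComplex (coord z₀ x) = ⟨z₀ + mob (2 * Real.pi * Complex.I)⁻¹ (slope z₀) x, hx⟩ :=
      ofComplex_apply_of_im_pos hx
    simp only [zero_add, lE4, lE6, localFun, div_eq_inv_mul, ← inv_pow]
    rw [D.rVal_homogeneous (inv_ne_zero h1), ← D.rForm_eq]
    change _ = _ * (_ * R (ofComplex (coord z₀ x)))
    rw [h2, (hG _ hx').2]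
    field_simp

/-- The equation is invariant under the modular group. -/
theorem isPullback_smul (hG : D.IsGivenBy p Q R) (hD : D.IsAdmissible)
    (hQ : IsMeromorphicModularForm 4 Q) (hR : IsMeromorphicModularForm 6 R) (γ : SL(2, ℤ))
    (z₀ : ℍ) :
    IsPullback (denom γ z₀ ^ 2)⁻¹ ((γ 1 0 : ℂ) / denom γ z₀) (coeffTwo Q) (coeffThree Q R) z₀
      (coeffTwo Q) (coeffThree Q R) (γ • z₀ : ℍ) := by
  have hj := denom_ne_zero γ z₀
  refine isPullback_of_weights (inv_ne_zero (pow_ne_zero 2 hj))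
    (q₁ := coeffTwo Q) (r₁ := fun z => (2 * Real.pi * Complex.I) ^ 3 * R (ofComplex z))
    (r₀ := fun z => (2 * Real.pi * Complex.I) ^ 3 * R (ofComplex z)) ?_ ?_
    (hG.eventually_differentiableAt hD _)
  · filter_upwards [hD.eventually_notMem z₀, (eventually_one_add_ne
      ((γ 1 0 : ℂ) / denom γ z₀)).filter_mono nhdsWithin_le_nhds] with x ⟨hx, _⟩ h1
    rw [← smul_add γ z₀ hx, coeffTwo, coeffTwo, ofComplex_apply, ofComplex_apply_of_im_pos hx,
      smul_eq_of_slash hQ.slash_eq, denom_add]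
    rw [show denom γ z₀ + (γ 1 0 : ℂ) * x = denom γ z₀ * (1 + (γ 1 0 : ℂ) / denom γ z₀ * x) by
      field_simp]
    generalize 1 + (γ 1 0 : ℂ) / denom γ z₀ * x = T at *
    field_simp
    ring
  · filter_upwards [hD.eventually_notMem z₀, (eventually_one_add_ne
      ((γ 1 0 : ℂ) / denom γ z₀)).filter_mono nhdsWithin_le_nhds] with x ⟨hx, _⟩ h1
    rw [← smul_add γ z₀ hx, ofComplex_apply, ofComplex_apply_of_im_pos hx,
      smul_eq_of_slash hR.slash_eq, denom_add]
    rw [show denom γ z₀ + (γ 1 0 : ℂ) * x = denom γ z₀ * (1 + (γ 1 0 : ℂ) / denom γ z₀ * x) by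
      field_simp]
    generalize 1 + (γ 1 0 : ℂ) / denom γ z₀ * x = T at *
    field_simp
    ring

theorem isApparentAt_smul (hG : D.IsGivenBy p Q R) (hD : D.IsAdmissible)
    (hQ : IsMeromorphicModularForm 4 Q) (hR : IsMeromorphicModularForm 6 R) {z z₀ : ℍ}
    (hz : z ∈ MulAction.orbit SL(2, ℤ) z₀) (h : IsApparentAt (coeffTwo Q) (coeffThree Q R) z₀) :
    IsApparentAt (coeffTwo Q) (coeffThree Q R) z := by
  obtain ⟨γ, rfl⟩ := hz
  exact (hG.isPullback_smul hD hQ hR γ z₀).isApparentAt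
    (inv_ne_zero (pow_ne_zero 2 (denom_ne_zero γ z₀))) h

theorem isApparentAt_iff (hG : D.IsGivenBy p Q R) (hD : D.IsAdmissible) {κ : Fin 3 → ℚ} {z₀ : ℍ}
    (hP : D.PointType κ (ModularForm.E₄ z₀) (ModularForm.E₆ z₀)) (hκ : IsExponentTriple κ) :
    IsApparentAt (coeffTwo Q) (coeffThree Q R) z₀ ↔
      ∀ e, MvPolynomial.eval p (D.poly z₀ κ e) = 0 := by
  have hs := inv_ne_zero Complex.two_pi_I_ne_zero
  have h := hG.isPullback_local hD z₀
  rw [← hP.isApparentAt_iff hκ.1 hκ.int hκ.2.2.1 p]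
  exact ⟨(h.symm hs).isApparentAt (inv_ne_zero hs), h.isApparentAt hs⟩

end IsGivenBy

/-! ### Regular points -/

theorem coeff_of_regular {z₀ : ℍ} (h4 : ModularForm.E₄ z₀ ≠ 0) (h6 : ModularForm.E₆ z₀ ≠ 0)
    (hF : ∀ j, D.F (ModularForm.E₄ z₀) (ModularForm.E₆ z₀) j ≠ 0) (p : FreeParam m → ℂ) {n : ℤ}
    (hn : n < 0) : MvPolynomial.eval p (D.aCoeff z₀ n) = 0 ∧
      MvPolynomial.eval p (D.bCoeff z₀ n) = 0 := by
  have e4 : lE4 z₀ 0 = ModularForm.E₄ z₀ := localFun_zero _ _ _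
  have e6 : lE6 z₀ 0 = ModularForm.E₆ z₀ := localFun_zero _ _ _
  rw [← e4] at h4
  rw [← e6] at h6
  simp only [← e4, ← e6] at hF
  have key : ∀ {g : ℂ → ℂ} {S : ℂ⸨X⸩}, Rep g S → AnalyticAt ℂ g 0 → ∀ n < 0, S.coeff n = 0 := by
    intro g S h1 h2 n hn
    rw [h1.unique (rep_taylor h2), ofPowerSeries_coeff, if_neg (by omega)]
  have hq := key (rep_qVal (rep_lE4 z₀) (rep_lE6 z₀) p)
    (analyticAt_qVal (analyticAt_lE4 z₀) (analyticAt_lE6 z₀) h4 h6 hF p)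
  have hr := key (rep_rVal (rep_lE4 z₀) (rep_lE6 z₀) p)
    (analyticAt_rVal (analyticAt_lE4 z₀) (analyticAt_lE6 z₀) h4 h6 hF p)
  refine ⟨by rw [eval_aCoeff, hq n hn], ?_⟩
  rw [eval_bCoeff, eval_aCoeff, eval_rCoeff, hr n hn, add_zero]
  -- For n = -1 the coefficient a_0 need not vanish, but its factor (n + 1)/2 does.
  rcases (show n + 1 = 0 ∨ n + 1 < 0 by omega) with h | h
  · have : (n : ℂ) + 1 = 0 := by exact_mod_cast h
    rw [this]; ring
  · rw [hq _ h, mul_zero]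

/-- For the exponents 0, 1, 2 all coefficients occurring have negative index, except a_0 for the
pair 0, 2 with k = 0, where its factor α + k is zero. -/
theorem eval_poly_regular {z₀ : ℍ} (h4 : ModularForm.E₄ z₀ ≠ 0) (h6 : ModularForm.E₆ z₀ ≠ 0)
    (hF : ∀ j, D.F (ModularForm.E₄ z₀) (ModularForm.E₆ z₀) j ≠ 0) (p : FreeParam m → ℂ)
    (e : ExponentPair) : MvPolynomial.eval p (D.poly z₀ ![0, 1, 2] e) = 0 := by
  have hc := fun n hn => coeff_of_regular h4 h6 hF p (n := n) hn
  rw [eval_poly]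
  obtain ⟨⟨i, j⟩, hij⟩ := e
  fin_cases i <;> fin_cases j <;> simp at hij
  · simp [frobeniusObstruction, hc]
  · simp [frobeniusObstruction, hc, Finset.sum_range_succ]
  · have : ⌊(2 : ℚ) - 1⌋₊ = 1 := by norm_num
    simp [frobeniusObstruction, hc, this]

theorem isExponentTriple_regular : IsExponentTriple ![0, 1, 2] := by
  refine ⟨?_, ?_, by simp; norm_num, 1, by norm_num⟩
  · rw [Fin.strictMono_iff_lt_succ]
    intro i
    fin_cases i <;> simp
  · intro k
    fin_cases k
    exacts [⟨0, by norm_num⟩, ⟨3, by norm_num⟩, ⟨6, by norm_num⟩]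

/-! ### Vanishing polynomials -/

namespace IsAdmissible

/-- Here j² = ρ is a primitive cube root of unity, and the exponents are incongruent modulo 3, so
j^(2n) ≠ 1 for every exponent difference n. -/
theorem polyRho_eq_zero (hD : D.IsAdmissible) (e : ExponentPair) : D.polyRho e = 0 := by
  refine poly_eq_zero gammaRho_smul _ _ ?_
  obtain ⟨n, hn, hres⟩ := hD.residues_rho
  have hdist : ∀ i j : Fin 3, i ≠ j → (n i : ZMod 3) ≠ n j := by
    have : ∀ a b c : ZMod 3, ({a, b, c} : Multiset (ZMod 3)) = {0, 1, 2} →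
        a ≠ b ∧ a ≠ c ∧ b ≠ c := by decide
    obtain ⟨h1, h2, h3⟩ := this _ _ _ hres
    intro i j hij
    fin_cases i <;> fin_cases j
    exacts [(hij rfl).elim, h1, h2, h1.symm, (hij rfl).elim, h3, h2.symm, h3.symm, (hij rfl).elim]
  obtain ⟨N, -, hN, hN'⟩ := exists_nat_diff hD.expRho.int hD.expRho.1 e.2
  have hN3 : ¬ 3 ∣ N := by
    rintro ⟨k, rfl⟩
    have h1 : (n e.1.2 : ℂ) = n e.1.1 + (3 * k : ℕ) := by
      rw [hn, hn] at hN'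
      simpa using hN'
    have h2 : n e.1.2 = n e.1.1 + (3 * k : ℕ) := by exact_mod_cast h1
    apply hdist _ _ e.2.ne
    rw [h2]
    push_cast
    rw [show (3 : ZMod 3) = 0 from rfl]
    ring
  rw [expDiff, hN, denom_gammaRho]
  have h1 : ((rho : ℂ) + 1) ^ 2 = rho := by linear_combination rho_sq
  have h3 : (rho : ℂ) ^ 3 = 1 := by linear_combination ((rho : ℂ) - 1) * rho_sq
  rw [h1, ← Nat.div_add_mod N 3, pow_add, pow_mul, h3, one_pow, one_mul]
  have h4 : N % 3 = 1 ∨ N % 3 = 2 := by omega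
  have hsq := rho_sq
  intro h5
  rcases h4 with h4 | h4 <;> rw [h4] at h5
  · rw [pow_one] at h5
    rw [h5] at hsq
    norm_num at hsq
  · have h6 : (rho : ℂ) = -2 := by linear_combination hsq - h5
    rw [h6] at hsq
    norm_num at hsq

/-- Multiplication by 3 preserves the parity of exponent differences, so the residues {0, 0, 1}
leave exactly one even difference. For odd n the factor j² = -1 at i has j^(2n) ≠ 1, and the
obstruction vanishes. -/
theorem exists_pair (hD : D.IsAdmissible) : ∃ p₀ : ExponentPair,
    (∃ n : ℤ, expDiff D.expI p₀ = 2 * n) ∧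
      ∀ p : ExponentPair, p ≠ p₀ → (¬ ∃ n : ℤ, expDiff D.expI p = 2 * n) ∧ D.polyI p = 0 := by
  obtain ⟨n, hn, hres⟩ := hD.parity_I
  have hpair : ∃ p₀ : ExponentPair, (n p₀.1.1 : ZMod 2) = n p₀.1.2 ∧
      ∀ p : ExponentPair, p ≠ p₀ → (n p.1.1 : ZMod 2) ≠ n p.1.2 := by
    have : ∀ f : Fin 3 → ZMod 2, ({f 0, f 1, f 2} : Multiset (ZMod 2)) = {0, 0, 1} →
        ∃ p₀ : ExponentPair, f p₀.1.1 = f p₀.1.2 ∧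
          ∀ p : ExponentPair, p ≠ p₀ → f p.1.1 ≠ f p.1.2 := by decide
    exact this (fun k => (n k : ZMod 2)) hres
  have hev : ∀ p : ExponentPair, ∀ N : ℤ, expDiff D.expI p = N →
      ((n p.1.1 : ZMod 2) = n p.1.2 ↔ Even N) := by
    intro p N hN
    have h1 : 3 * N = n p.1.2 - n p.1.1 := by
      have : (3 * N : ℚ) = n p.1.2 - n p.1.1 := by
        rw [← hn, ← hn, ← hN, expDiff]; ring
      exact_mod_cast this
    rw [eq_comm, ZMod.intCast_eq_intCast_iff_dvd_sub, even_iff_two_dvd]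
    push_cast
    omega
  obtain ⟨p₀, h0, h1⟩ := hpair
  refine ⟨p₀, ?_, fun p hp => ?_⟩
  · obtain ⟨N, hN⟩ := hD.expI.int p₀.1.2 p₀.1.1
    obtain ⟨k, hk⟩ := (hev p₀ N hN).1 h0
    exact ⟨k, by rw [expDiff, hN, hk]; push_cast; ring⟩
  · have hne := h1 p hp
    refine ⟨fun ⟨k, hk⟩ => hne ((hev p (2 * k) (by rw [hk]; push_cast; rfl)).2 (even_two_mul k)), ?_⟩
    obtain ⟨N, -, hN, hN'⟩ := exists_nat_diff hD.expI.int hD.expI.1 p.2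
    have hodd : ¬ Even (N : ℤ) := by
      rw [← hev p N ?_]
      · exact hne
      · have : (D.expI p.1.2 : ℚ) = D.expI p.1.1 + N := by exact_mod_cast hN'
        rw [expDiff, this]
        push_cast; ring
    refine poly_eq_zero S_smul_I _ _ ?_
    rw [expDiff, hN, ModularGroup.denom_S, UpperHalfPlane.coe_I, Complex.I_sq]
    rw [Int.not_even_iff_odd] at hodd
    have : Odd N := by exact_mod_cast hodd
    rw [this.neg_one_pow]
    norm_num

/-- Apparentness throughout the upper half-plane is equivalent to the polynomial system. -/
theorem forall_isApparentAt_iff (hD : D.IsAdmissible) {p₀ : ExponentPair}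
    (hp₀ : ∀ e : ExponentPair, e ≠ p₀ → D.polyI e = 0) {Q R : ℍ → ℂ} {p : FreeParam m → ℂ}
    (hQ : IsMeromorphicModularForm 4 Q) (hR : IsMeromorphicModularForm 6 R)
    (hG : D.IsGivenBy p Q R) :
    (∀ z : ℍ, IsApparentAt (coeffTwo Q) (coeffThree Q R) z) ↔
      ∀ e : EquationIndex m, MvPolynomial.eval p (D.system p₀ e) = 0 := by
  have hI := hG.isApparentAt_iff hD (pointType_I (MulAction.mem_orbit_self _)) hD.expI
  have hpt := fun j => hG.isApparentAt_iff hD (hD.pointType_pt j (MulAction.mem_orbit_self _))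
    (hD.expPt j)
  have hrho := hG.isApparentAt_iff hD (hD.pointType_rho (MulAction.mem_orbit_self _)) hD.expRho
  constructor
  · rintro h (⟨j, e⟩ | _)
    · exact (hpt j).1 (h _) e
    · exact hI.1 (h _) p₀
  · intro h z
    by_cases hz : z ∈ D.singularSet
    · rcases hz with (hz | hz) | hz
      · refine hG.isApparentAt_smul hD hQ hR hz (hI.2 fun e => ?_)
        by_cases he : e = p₀
        · rw [he]
          exact h .atI
        · have := hp₀ e he
          rw [polyI] at this
          rw [this, map_zero]
      · refine hG.isApparentAt_smul hD hQ hR hz (hrho.2 fun e => ?_)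
        have := hD.polyRho_eq_zero e
        rw [polyRho] at this
        rw [this, map_zero]
      · obtain ⟨j, hj⟩ := Set.mem_iUnion.1 hz
        exact hG.isApparentAt_smul hD hQ hR hj ((hpt j).2 fun e => h (.atPt j e))
    -- Regular points are subsumed under the Frobenius criterion, with exponents 0, 1, 2.
    · have hreg := hz
      rw [hD.mem_singularSet_iff] at hreg
      push Not at hreg
      exact (hG.isApparentAt_iff hD (hD.pointType_regular hz) isExponentTriple_regular).2 fun e =>
        eval_poly_regular hreg.2.1 hreg.1 hreg.2.2 p e

end IsAdmissible

end SingularData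

/-! ### Terms of highest degree -/

section Top

variable {σ : Type*}

/-- All monomials of `p` have degree less than `i`. -/
def Low (p : MvPolynomial σ ℂ) (i : ℕ) : Prop := p = 0 ∨ p.totalDegree < i

/-- `p` has degree at most `i`, and `q` is its homogeneous component of degree `i`. -/
def Top (p : MvPolynomial σ ℂ) (i : ℕ) (q : MvPolynomial σ ℂ) : Prop :=
  q.IsHomogeneous i ∧ Low (p - q) i

variable {p p' q q' r : MvPolynomial σ ℂ} {i j : ℕ}

theorem low_zero (i : ℕ) : Low (0 : MvPolynomial σ ℂ) i := .inl rfl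

theorem Low.add (h : Low p i) (h' : Low q i) : Low (p + q) i := by
  rcases h with rfl | h
  · rwa [zero_add]
  rcases h' with rfl | h'
  · rw [add_zero]; exact .inr h
  · exact .inr ((MvPolynomial.totalDegree_add p q).trans_lt (max_lt h h'))

theorem Low.sum {ι : Type*} {s : Finset ι} {f : ι → MvPolynomial σ ℂ} (h : ∀ k ∈ s, Low (f k) i) :
    Low (∑ k ∈ s, f k) i := by
  classical
  induction s using Finset.induction_on with
  | empty => exact low_zero i
  | insert a s ha ih =>
    rw [Finset.sum_insert ha]
    exact (h a (Finset.mem_insert_self a s)).add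
      (ih fun k hk => h k (Finset.mem_insert_of_mem hk))

theorem Low.mul (h : Low p i) (h' : q.totalDegree ≤ j) : Low (p * q) (i + j) := by
  rcases h with rfl | h
  · rw [zero_mul]; exact low_zero _
  · exact .inr ((MvPolynomial.totalDegree_mul p q).trans_lt (by omega))

theorem Low.mono (h : Low p i) (hij : i ≤ j) : Low p j := h.imp_right fun h => h.trans_le hij

theorem low_of_le (h : p.totalDegree ≤ i) : Low p (i + 1) := .inr (by omega)

theorem Low.totalDegree_le (h : Low p i) : p.totalDegree ≤ i := by
  rcases h with rfl | h
  · simp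
  · exact h.le

theorem Top.totalDegree_le (h : Top p i q) : p.totalDegree ≤ i := by
  rw [← sub_add_cancel p q]
  exact (MvPolynomial.totalDegree_add _ _).trans (max_le h.2.totalDegree_le h.1.totalDegree_le)


theorem Top.add_low (h : Top p i q) (h' : Low r i) : Top (p + r) i q :=
  ⟨h.1, by rw [add_sub_right_comm]; exact h.2.add h'⟩

theorem Top.add (h : Top p i q) (h' : Top p' i q') : Top (p + p') i (q + q') :=
  ⟨h.1.add h'.1, by rw [add_sub_add_comm]; exact h.2.add h'.2⟩

theorem Top.sum {ι : Type*} {s : Finset ι} {f g : ι → MvPolynomial σ ℂ}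
    (h : ∀ k ∈ s, Top (f k) i (g k)) : Top (∑ k ∈ s, f k) i (∑ k ∈ s, g k) := by
  refine ⟨MvPolynomial.IsHomogeneous.sum s g i fun k hk => (h k hk).1, ?_⟩
  rw [← Finset.sum_sub_distrib]
  exact Low.sum fun k hk => (h k hk).2

theorem Top.mul (h : Top p i q) (h' : Top p' j q') : Top (p * p') (i + j) (q * q') := by
  refine ⟨h.1.mul h'.1, ?_⟩
  rw [show p * p' - q * q' = (p - q) * p' + (p' - q') * q by ring]
  refine (h.2.mul h'.totalDegree_le).add ?_
  rw [add_comm i]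
  exact h'.2.mul h.1.totalDegree_le

theorem top_C (c : ℂ) : Top (MvPolynomial.C c : MvPolynomial σ ℂ) 0 (MvPolynomial.C c) :=
  ⟨MvPolynomial.isHomogeneous_C σ c, by rw [sub_self]; exact low_zero _⟩

theorem top_X (s : σ) : Top (MvPolynomial.X s : MvPolynomial σ ℂ) 1 (MvPolynomial.X s) :=
  ⟨MvPolynomial.isHomogeneous_X ℂ s, by rw [sub_self]; exact low_zero _⟩

theorem Top.C_mul (h : Top p i q) (c : ℂ) :
    Top (MvPolynomial.C c * p) i (MvPolynomial.C c * q) := by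
  simpa using (top_C c).mul h

theorem low_C (c : ℂ) : Low (MvPolynomial.C c : MvPolynomial σ ℂ) 1 := .inr (by simp)

theorem Top.leadingTerm (h : Top p i q) (hq : q ≠ 0) :
    p.totalDegree = i ∧ leadingTerm p = q := by
  have hq' := h.1.totalDegree hq
  have h1 : p.totalDegree = i := by
    rcases h.2 with h2 | h2
    · rw [sub_eq_zero.1 h2, hq']
    · rw [← add_sub_cancel q p, MvPolynomial.totalDegree_add_eq_left_of_totalDegree_lt
        (by rwa [hq']), hq']
  refine ⟨h1, ?_⟩
  have h3 : MvPolynomial.homogeneousComponent i (p - q) = 0 := by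
    rcases h.2 with h2 | h2
    · rw [h2, map_zero]
    · exact MvPolynomial.homogeneousComponent_eq_zero _ _ h2
  rw [ModularODE.leadingTerm, h1, ← add_sub_cancel q p, map_add, h3, add_zero,
    MvPolynomial.homogeneousComponent_of_mem h.1, if_pos rfl]

/-- A sum in which one term dominates. -/
theorem Top.sum_of_low {n k₀ : ℕ} {f : ℕ → MvPolynomial σ ℂ} (hk : k₀ < n) (h : Top (f k₀) i q)
    (h' : ∀ k < n, k ≠ k₀ → Low (f k) i) : Top (∑ k ∈ Finset.range n, f k) i q := by
  rw [← Finset.add_sum_erase _ _ (Finset.mem_range.2 hk)]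
  refine h.add_low (Low.sum fun k hk => ?_)
  exact h' k (Finset.mem_range.1 (Finset.mem_of_mem_erase hk)) (Finset.ne_of_mem_erase hk)

variable {e g : ℕ → MvPolynomial σ ℂ} {T : ℕ → ℕ → MvPolynomial σ ℂ} {ℓ : ℕ → MvPolynomial σ ℂ}
  {N P : ℕ}

/-- Leading terms of the solution of a linear recursion with coefficients of degree one. -/
theorem top_recursion (he0 : e 0 = 1) (hg : ∀ n, g n = ∑ k ∈ Finset.range n, T n k * e k)
    (hT : ∀ n k, k < n → (T n k).totalDegree ≤ 1) (hℓ : ∀ n, Top (T (n + 1) n) 1 (ℓ (n + 1)))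
    (he : ∀ n, 0 < n → n < N → ∃ c : ℂ, c ≠ 0 ∧ e n = MvPolynomial.C c * g n) (n : ℕ) :
    (n < N → ∃ c : ℂ, c ≠ 0 ∧ Top (e n) n (MvPolynomial.C c * ∏ k ∈ Finset.Icc 1 n, ℓ k)) ∧
    (0 < n → n ≤ N → ∃ c : ℂ, c ≠ 0 ∧
      Top (g n) n (MvPolynomial.C c * ∏ k ∈ Finset.Icc 1 n, ℓ k)) := by
  induction n using Nat.strong_induction_on with
  | _ n ih =>
    have hgn : 0 < n → n ≤ N → ∃ c : ℂ, c ≠ 0 ∧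
        Top (g n) n (MvPolynomial.C c * ∏ k ∈ Finset.Icc 1 n, ℓ k) := by
      intro h0 hN
      obtain ⟨l, rfl⟩ : ∃ l, n = l + 1 := ⟨n - 1, by omega⟩
      obtain ⟨c, hc, htop⟩ := (ih l (by omega)).1 (by omega)
      refine ⟨c, hc, ?_⟩
      rw [hg]
      -- The term T n k * e k has degree at most k + 1, so only k = n - 1 reaches degree n.
      refine Top.sum_of_low (k₀ := l) (by omega) ?_ fun k hk hkl => ?_
      · rw [Finset.prod_Icc_succ_top (by omega), ← mul_assoc, mul_comm _ (ℓ (l + 1)), add_comm l]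
        have := (hℓ l).mul htop
        rwa [add_comm l] at this
      · obtain ⟨c', -, htop'⟩ := (ih k hk).1 (by omega)
        have := (low_of_le (hT _ _ hk)).mul htop'.totalDegree_le
        exact this.mono (by omega)
    refine ⟨fun hN => ?_, hgn⟩
    rcases Nat.eq_zero_or_pos n with rfl | h0
    · refine ⟨1, one_ne_zero, ?_⟩
      rw [he0]
      simpa using top_C (σ := σ) 1
    · obtain ⟨c, hc, htop⟩ := hgn h0 hN.le
      obtain ⟨c', hc', h'⟩ := he n h0 hN
      refine ⟨c' * c, mul_ne_zero hc' hc, ?_⟩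
      rw [h', MvPolynomial.C_mul, mul_assoc]
      exact htop.C_mul c'

/-- Leading terms of the solution of a linear recursion with coefficients of degree one in which
one term is normalised to zero. -/
theorem top_recursion_skip (he0 : e 0 = 1) (hg : ∀ n, g n = ∑ k ∈ Finset.range n, T n k * e k)
    (hT : ∀ n k, k < n → (T n k).totalDegree ≤ 1) (hℓ : ∀ n, Top (T (n + 1) n) 1 (ℓ (n + 1)))
    (hP : 0 < P) (heP : e P = 0)
    (he : ∀ n, 0 < n → n < N → n ≠ P → ∃ c : ℂ, c ≠ 0 ∧ e n = MvPolynomial.C c * g n)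
    (hq : Top (T (P + 1) (P - 1)) 1 q) (n : ℕ) (hPn : P < n) :
    (n < N → ∃ c : ℂ, c ≠ 0 ∧
      Top (e n) (n - 1) (MvPolynomial.C c * q * ∏ k ∈ Finset.Icc 1 n \ {P, P + 1}, ℓ k)) ∧
    (n ≤ N → ∃ c : ℂ, c ≠ 0 ∧
      Top (g n) (n - 1) (MvPolynomial.C c * q * ∏ k ∈ Finset.Icc 1 n \ {P, P + 1}, ℓ k)) := by
  induction n using Nat.strong_induction_on with
  | _ n ih =>
    have hlow : n ≤ N → ∀ k < P, ∃ c : ℂ, c ≠ 0 ∧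
        Top (e k) k (MvPolynomial.C c * ∏ k ∈ Finset.Icc 1 k, ℓ k) := fun hN k hk =>
      (top_recursion (N := P) he0 hg hT hℓ
        (fun n h0 h1 => he n h0 (by omega) (by omega)) k).1 hk
    have hgn : n ≤ N → ∃ c : ℂ, c ≠ 0 ∧
        Top (g n) (n - 1) (MvPolynomial.C c * q * ∏ k ∈ Finset.Icc 1 n \ {P, P + 1}, ℓ k) := by
      intro hN
      rw [hg]
      -- Since e P = 0, the best term in step P + 1 is k = P - 1, of degree P; it supplies the
      -- factor q in place of those with indices P and P + 1. From there each step again adds one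
      -- degree, while terms with k < P are too small to matter.
      by_cases hn : n = P + 1
      · subst hn
        obtain ⟨c, hc, htop⟩ := hlow hN (P - 1) (by omega)
        refine ⟨c, hc, ?_⟩
        have hset : Finset.Icc 1 (P + 1) \ {P, P + 1} = Finset.Icc 1 (P - 1) := by
          ext x; simp; omega
        rw [hset, mul_comm _ q, mul_assoc]
        refine Top.sum_of_low (k₀ := P - 1) (by omega) ?_ fun k hk hkl => ?_
        · have := hq.mul htop
          rwa [show 1 + (P - 1) = P + 1 - 1 by omega] at this
        · by_cases hkP : k = P
          · rw [hkP, heP, mul_zero]; exact low_zero _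
          · obtain ⟨c', -, htop'⟩ := hlow hN k (by omega)
            exact ((low_of_le (hT _ _ hk)).mul htop'.totalDegree_le).mono (by omega)
      · obtain ⟨l, rfl⟩ : ∃ l, n = l + 1 := ⟨n - 1, by omega⟩
        obtain ⟨c, hc, htop⟩ := (ih l (by omega) (by omega)).1 (by omega)
        refine ⟨c, hc, ?_⟩
        have hset : Finset.Icc 1 (l + 1) \ {P, P + 1}
            = insert (l + 1) (Finset.Icc 1 l \ {P, P + 1}) := by
          ext x; simp; omega
        rw [hset, Finset.prod_insert (by simp), mul_left_comm]
        refine Top.sum_of_low (k₀ := l) (by omega) ?_ fun k hk hkl => ?_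
        · have := (hℓ l).mul htop
          rwa [show 1 + (l - 1) = l + 1 - 1 by omega] at this
        · rcases lt_trichotomy k P with hkP | hkP | hkP
          · obtain ⟨c', -, htop'⟩ := hlow hN k hkP
            exact ((low_of_le (hT _ _ hk)).mul htop'.totalDegree_le).mono (by omega)
          · rw [hkP, heP, mul_zero]; exact low_zero _
          · obtain ⟨c', -, htop'⟩ := (ih k (by omega) hkP).1 (by omega)
            exact ((low_of_le (hT _ _ hk)).mul htop'.totalDegree_le).mono (by omega)
    refine ⟨fun hN => ?_, hgn⟩
    obtain ⟨c, hc, htop⟩ := hgn hN.le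
    obtain ⟨c', hc', h'⟩ := he n (by omega) hN (by omega)
    refine ⟨c' * c, mul_ne_zero hc' hc, ?_⟩
    rw [h', MvPolynomial.C_mul, mul_assoc, mul_assoc, ← mul_assoc (MvPolynomial.C c)]
    exact htop.C_mul c'

end Top

/-! ### Linear parts of the coefficients of the Frobenius recursion. -/

theorem Rep.coeff_of_tendsto {g : ℂ → ℂ} {S : ℂ⸨X⸩} (h : Rep g S) {N : ℕ} {c : ℂ}
    (hc : Tendsto (fun x => x ^ N * g x) (𝓝[≠] 0) (𝓝 c)) :
    S.coeff (-N) = c ∧ ∀ n : ℤ, n < -N → S.coeff n = 0 := by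
  obtain ⟨G, -, h0, -, h2⟩ := h.lead hc
  refine ⟨?_, fun n hn => by rw [h2, if_neg (by omega)]⟩
  rw [h2, if_pos (by omega), neg_add_cancel, Int.toNat_zero, tc_zero, h0]

theorem exists_of_ind_eq_zero {κ : Fin 3 → ℚ} (hκ : StrictMono κ) {i : Fin 3} {n : ℕ} (hn : 0 < n)
    (h : ind κ (κ i + n) = 0) : ∃ j, i < j ∧ κ j = κ i + n := by
  obtain ⟨j, hj⟩ := (ind_eq_zero_iff _).1 h
  have h1 : κ j = κ i + n := by exact_mod_cast hj.symm
  refine ⟨j, hκ.lt_iff_lt.1 ?_, h1⟩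
  rw [h1]
  have : (0 : ℚ) < n := by exact_mod_cast hn
  linarith

theorem IsExponentTriple.exists_nat {κ : Fin 3 → ℚ} (hκ : IsExponentTriple κ) (e : ExponentPair) :
    ∃ n : ℕ, 0 < n ∧ ⌊expDiff κ e⌋₊ = n ∧ κ e.1.2 = κ e.1.1 + n := by
  obtain ⟨n, h0, h1, h2⟩ := exists_nat_diff hκ.int hκ.1 e.2
  exact ⟨n, h0, h1, by exact_mod_cast h2⟩

theorem frobeniusCoeff_eq_C_mul {σ : Type*} (a b : ℤ → MvPolynomial σ ℂ) (f : ℂ → ℂ) (α : ℂ)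
    {n : ℕ} (hn : 0 < n) (hf : f (α + n) ≠ 0) : ∃ c : ℂ, c ≠ 0 ∧
    frobeniusCoeff a b f α n = MvPolynomial.C c * frobeniusObstruction a b f α n :=
  ⟨-(f (α + n))⁻¹, neg_ne_zero.2 (inv_ne_zero hf), by
    rw [frobeniusCoeff_of_ne_zero _ _ _ _ hn.ne' hf, MvPolynomial.C_neg, neg_mul,
      MvPolynomial.C_mul']⟩

namespace SingularData

variable {m : ℕ} (D : SingularData m)

/-- The linear part of `a_n`. -/
def aLin (z₀ : ℍ) (n : ℤ) : MvPolynomial (FreeParam m) ℂ :=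
  ∑ j, MvPolynomial.C ((D.qR1 (e4Series z₀) (e6Series z₀) j).coeff n) * MvPolynomial.X (.r1 j)

/-- The linear part of the coefficients of `R̃`. -/
def rLin (z₀ : ℍ) (n : ℤ) : MvPolynomial (FreeParam m) ℂ :=
  MvPolynomial.C ((rSI (e4Series z₀) (e6Series z₀)).coeff n) * MvPolynomial.X .sI
    + ∑ j, (MvPolynomial.C ((D.rS (e4Series z₀) (e6Series z₀) 2 j).coeff n)
        * MvPolynomial.X (.s2 j)
      + MvPolynomial.C ((D.rS (e4Series z₀) (e6Series z₀) 1 j).coeff n) * MvPolynomial.X (.s1 j))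

theorem top_aCoeff (z₀ : ℍ) (n : ℤ) : Top (D.aCoeff z₀ n) 1 (D.aLin z₀ n) := by
  simp only [aCoeff, aLin]
  rw [add_comm]
  exact (Top.sum fun j _ => (top_X _).C_mul _).add_low (low_C _)

theorem top_rCoeff (z₀ : ℍ) (n : ℤ) : Top (D.rCoeff z₀ n) 1 (D.rLin z₀ n) := by
  simp only [rCoeff, rLin]
  rw [add_assoc, add_comm]
  exact (((top_X _).C_mul _).add
    (Top.sum fun j _ => ((top_X _).C_mul _).add ((top_X _).C_mul _))).add_low (low_C _)

/-- The coefficients of the Frobenius recursion. -/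
def recCoeff (z₀ : ℍ) (α : ℂ) (n k : ℕ) : MvPolynomial (FreeParam m) ℂ :=
  (α + (k : ℕ)) • D.aCoeff z₀ ((n : ℤ) - k - 2) + D.bCoeff z₀ ((n : ℤ) - k - 3)

/-- Because b_(l-1) = (l/2) a_l + r_(l-1), the coefficient (α + k)a_l + b_(l-1) equals (α + k + l/2)
a_l + r_(l-1). -/
theorem top_recCoeff (z₀ : ℍ) (α : ℂ) (n k : ℕ) (l : ℤ) (hl : (n : ℤ) - k - 2 = l) :
    Top (D.recCoeff z₀ α n k) 1
      (MvPolynomial.C (α + k + l / 2) * D.aLin z₀ l + D.rLin z₀ (l - 1)) := by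
  have h : D.recCoeff z₀ α n k
      = MvPolynomial.C (α + k + l / 2) * D.aCoeff z₀ l + D.rCoeff z₀ (l - 1) := by
    rw [recCoeff, bCoeff, show (n : ℤ) - k - 3 = l - 1 by omega, hl, sub_add_cancel,
      ← MvPolynomial.C_mul', MvPolynomial.C_add, ← add_assoc, ← add_mul]
    push_cast
    rw [sub_add_cancel]
    simp only [MvPolynomial.C_add]
  rw [h]
  exact ((D.top_aCoeff z₀ l).C_mul _).add (D.top_rCoeff z₀ _)

theorem totalDegree_recCoeff_le (z₀ : ℍ) (α : ℂ) (n k : ℕ) :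
    (D.recCoeff z₀ α n k).totalDegree ≤ 1 :=
  (D.top_recCoeff z₀ α n k _ rfl).totalDegree_le

variable {D}

/-! ### Leading terms at the points `z_j` -/

theorem linearFactor_ne_zero (j : Fin m) (κ : ℚ) (d₁ : ℂ) {d₂ : ℂ} (h : d₂ ≠ 0) (k : ℕ) :
    linearFactor j κ d₁ d₂ k ≠ 0 := by
  classical
  intro h0
  have := congrArg (MvPolynomial.eval (fun s => match s with
    | .s2 _ => (1 : ℂ)
    | _ => 0)) h0
  simp [linearFactor, h] at this

/-- Near z_j only the terms with index j have poles, of order 1 for r_{z_j}^{(1)} and of orders 2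
and 1 for s_{z_j}^{(2)} and s_{z_j}^{(1)}. The subleading coefficient of the s_{z_j}^{(2)} term
gives d₄. -/
theorem IsAdmissible.lin_pt (hD : D.IsAdmissible) (j : Fin m) :
    ∃ d₁ d₂ d₃ d₄ : ℂ, d₁ ≠ 0 ∧ d₂ ≠ 0 ∧ d₃ ≠ 0 ∧
      D.aLin (D.pt j) (-1) = MvPolynomial.C d₁ * MvPolynomial.X (.r1 j) ∧
      D.rLin (D.pt j) (-2) = MvPolynomial.C d₂ * MvPolynomial.X (.s2 j) ∧
      D.rLin (D.pt j) (-1) = MvPolynomial.C d₃ * MvPolynomial.X (.s1 j)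
        + MvPolynomial.C d₄ * MvPolynomial.X (.s2 j) := by
  have h := isLocalPair_local (D.pt j)
  have r4 := rep_lE4 (D.pt j)
  have r6 := rep_lE6 (D.pt j)
  have e4 : lE4 (D.pt j) 0 = ModularForm.E₄ (D.pt j) := localFun_zero _ _ _
  have e6 : lE6 (D.pt j) 0 = ModularForm.E₆ (D.pt j) := localFun_zero _ _ _
  have hu : lE4 (D.pt j) 0 ≠ 0 := by rw [e4]; exact hD.E4_pt_ne j
  have hv : lE6 (D.pt j) 0 ≠ 0 := by rw [e6]; exact hD.E6_pt_ne j
  have hj : D.F (lE4 (D.pt j) 0) (lE6 (D.pt j) 0) j = 0 := by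
    rw [e4, e6, hD.F_eq_zero_iff]; exact MulAction.mem_orbit_self _
  have hF : ∀ l ≠ j, D.F (lE4 (D.pt j) 0) (lE6 (D.pt j) 0) l ≠ 0 := by
    intro l hl
    rw [e4, e6, Ne, hD.F_eq_zero_iff]
    exact hD.inequivalent j l hl.symm
  have hq := (rep_qR1 r4 r6 j).coeff_of_tendsto (h.tendsto_qR1_self j hj hu hv)
  have hq' := fun l hl => ((rep_qR1 r4 r6 l).coeff_of_tendsto (h.tendsto_qR1 l (hF l hl))).2
  have h1 := (rep_rS r4 r6 1 j).coeff_of_tendsto (h.tendsto_rS_self 1 j hj hu hv)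
  have h2 := (rep_rS r4 r6 2 j).coeff_of_tendsto (h.tendsto_rS_self 2 j hj hu hv)
  have hS := fun k l hl => ((rep_rS r4 r6 k l).coeff_of_tendsto (h.tendsto_rS k l (hF l hl))).2
  have hI := ((rep_rSI r4 r6).coeff_of_tendsto (h.tendsto_rSI hv)).2
  simp only [Nat.cast_ofNat, Nat.cast_one, Nat.cast_zero, neg_zero] at hq hq' h1 h2 hS hI
  refine ⟨lE6 (D.pt j) 0 / (1 * lE4 (D.pt j) 0),
    lE6 (D.pt j) 0 * (lE6 (D.pt j) 0 / (1 * lE4 (D.pt j) 0 ^ 2)) ^ 2,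
    lE6 (D.pt j) 0 * (lE6 (D.pt j) 0 / (1 * lE4 (D.pt j) 0 ^ 2)) ^ 1,
    (D.rS (e4Series (D.pt j)) (e6Series (D.pt j)) 2 j).coeff (-1), ?_, ?_, ?_, ?_, ?_, ?_⟩
  · simp [hu, hv]
  · simp [hu, hv]
  · simp [hu, hv]
  · rw [aLin, Finset.sum_eq_single j (fun l _ hl => by rw [hq' l hl _ (by norm_num)]; simp)
      (by simp), hq.1]
  · rw [rLin, hI _ (by norm_num), Finset.sum_eq_single j (fun l _ hl => by
      rw [hS 2 l hl _ (by norm_num), hS 1 l hl _ (by norm_num)]; simp) (by simp), h2.1,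
      h1.2 _ (by norm_num)]
    simp
  · rw [rLin, hI _ (by norm_num), Finset.sum_eq_single j (fun l _ hl => by
      rw [hS 2 l hl _ (by norm_num), hS 1 l hl _ (by norm_num)]; simp) (by simp), h1.1]
    simp [add_comm]

/-- One step of the recursion has l = -1, and κ + n - 1/2 = κ + (n + 1) - 3/2. -/
theorem top_recCoeff_succ {z₀ : ℍ} {j : Fin m} {d₁ d₂ : ℂ}
    (ha : D.aLin z₀ (-1) = MvPolynomial.C d₁ * MvPolynomial.X (.r1 j))
    (hr : D.rLin z₀ (-2) = MvPolynomial.C d₂ * MvPolynomial.X (.s2 j)) (κ : ℚ) (n : ℕ) :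
    Top (D.recCoeff z₀ κ (n + 1) n) 1 (linearFactor j κ d₁ d₂ (n + 1)) := by
  have := D.top_recCoeff z₀ κ (n + 1) n (-1) (by push_cast; ring)
  rw [ha, show (-1 : ℤ) - 1 = -2 by norm_num, hr, ← mul_assoc, ← MvPolynomial.C_mul] at this
  rw [linearFactor]
  convert this using 4
  push_cast; ring

/-- No exponent lies strictly between the two, so every intermediate Frobenius coefficient is a
nonzero multiple of the obstruction in its degree and the plain recursion applies. -/
theorem top_poly_adjacent {z₀ : ℍ} {j : Fin m} {d₁ d₂ : ℂ}
    (ha : D.aLin z₀ (-1) = MvPolynomial.C d₁ * MvPolynomial.X (.r1 j))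
    (hr : D.rLin z₀ (-2) = MvPolynomial.C d₂ * MvPolynomial.X (.s2 j)) {κ : Fin 3 → ℚ}
    (hκ : IsExponentTriple κ) (e : ExponentPair) (he : ∀ k, e.1.1 < k → e.1.2 ≤ k) :
    ∃ c : ℂ, c ≠ 0 ∧ Top (D.poly z₀ κ e) ⌊expDiff κ e⌋₊
      (MvPolynomial.C c * ∏ k ∈ Finset.Icc 1 ⌊expDiff κ e⌋₊, linearFactor j (κ e.1.1) d₁ d₂ k) := by
  obtain ⟨N, hN0, hN, hN'⟩ := hκ.exists_nat e
  rw [poly, hN]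
  refine (top_recursion (N := N) (T := D.recCoeff z₀ (κ e.1.1))
    (g := frobeniusObstruction (D.aCoeff z₀) (D.bCoeff z₀) (ind κ) (κ e.1.1))
    (frobeniusCoeff_zero _ _ _ _) (fun n => rfl)
    (fun n k _ => D.totalDegree_recCoeff_le z₀ _ n k) (top_recCoeff_succ ha hr (κ e.1.1))
    (fun n h0 hn => frobeniusCoeff_eq_C_mul _ _ _ _ h0 fun hf => ?_) N).2 hN0 le_rfl
  obtain ⟨k, hk, hk'⟩ := exists_of_ind_eq_zero hκ.1 h0 hf
  have h1 := hκ.1.monotone (he k hk)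
  rw [hk', hN'] at h1
  have : (N : ℚ) ≤ n := by linarith
  have : N ≤ n := by exact_mod_cast this
  omega

/-- The Frobenius coefficient at the middle exponent, in degree P, is zero by convention. The
two-step coefficient from P - 1 to P + 1 has l = 0, hence a_0 with factor κ 0 + P - 1 = κ 1 - 1,
together with r_(-1). -/
theorem top_poly_pair13 {z₀ : ℍ} {j : Fin m} {d₁ d₂ : ℂ}
    (ha : D.aLin z₀ (-1) = MvPolynomial.C d₁ * MvPolynomial.X (.r1 j))
    (hr : D.rLin z₀ (-2) = MvPolynomial.C d₂ * MvPolynomial.X (.s2 j)) {κ : Fin 3 → ℚ}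
    (hκ : IsExponentTriple κ) :
    ∃ c : ℂ, c ≠ 0 ∧ Top (D.poly z₀ κ pair13) (⌊expDiff κ pair13⌋₊ - 1)
      (MvPolynomial.C c * (MvPolynomial.C ((κ 1 : ℂ) - 1) * D.aLin z₀ 0 + D.rLin z₀ (-1))
        * ∏ k ∈ Finset.Icc 1 ⌊expDiff κ pair13⌋₊ \
            {⌊expDiff κ pair12⌋₊, ⌊expDiff κ pair12⌋₊ + 1}, linearFactor j (κ 0) d₁ d₂ k) := by
  obtain ⟨N, hN0, hN, hN'⟩ := hκ.exists_nat pair13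
  obtain ⟨P, hP0, hP, hP'⟩ := hκ.exists_nat pair12
  rw [poly, hN, hP]
  change κ 2 = κ 0 + N at hN'
  change κ 1 = κ 0 + P at hP'
  have hPN : P < N := by
    have h1 : κ 1 < κ 2 := hκ.1 (by decide)
    rw [hN', hP'] at h1
    have : (P : ℚ) < N := by linarith
    exact_mod_cast this
  have hq : Top (D.recCoeff z₀ (κ 0) (P + 1) (P - 1)) 1
      (MvPolynomial.C ((κ 1 : ℂ) - 1) * D.aLin z₀ 0 + D.rLin z₀ (-1)) := by
    have := D.top_recCoeff z₀ (κ 0) (P + 1) (P - 1) 0 (by omega)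
    rw [zero_sub] at this
    convert this using 4
    rw [hP', Nat.cast_sub (by omega)]
    push_cast; ring
  refine (top_recursion_skip (N := N) (P := P) (T := D.recCoeff z₀ (κ 0))
    (g := frobeniusObstruction (D.aCoeff z₀) (D.bCoeff z₀) (ind κ) (κ 0))
    (frobeniusCoeff_zero _ _ _ _) (fun n => rfl)
    (fun n k _ => D.totalDegree_recCoeff_le z₀ _ n k) (top_recCoeff_succ ha hr (κ 0)) hP0
    (frobeniusCoeff_of_eq_zero _ _ _ _ hP0.ne' ?_)
    (fun n h0 hn hnP => frobeniusCoeff_eq_C_mul _ _ _ _ h0 fun hf => ?_) hq N hPN).2 le_rfl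
  · rw [ind_eq_zero_iff]
    exact ⟨1, by rw [hP']; push_cast; rfl⟩
  · obtain ⟨k, hk, hk'⟩ := exists_of_ind_eq_zero hκ.1 h0 hf
    fin_cases k
    · simp at hk
    · change κ 1 = _ at hk'
      rw [hP'] at hk'
      exact hnP (by exact_mod_cast (add_left_cancel hk').symm)
    · change κ 2 = _ at hk'
      rw [hN'] at hk'
      have : N = n := by exact_mod_cast add_left_cancel hk'
      omega

theorem IsAdmissible.leadingTerm_pt (hD : D.IsAdmissible) (j : Fin m) :
    ((D.polyPt j pair12).totalDegree : ℚ) = expDiff (D.expPt j) pair12 ∧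
    ((D.polyPt j pair23).totalDegree : ℚ) = expDiff (D.expPt j) pair23 ∧
    ((D.polyPt j pair13).totalDegree : ℚ) = expDiff (D.expPt j) pair13 - 1 ∧
    ∃ (d₁ d₂ d₃ d₄ : ℂ) (d' : Fin m → ℂ), d₁ ≠ 0 ∧ d₂ ≠ 0 ∧ d₃ ≠ 0 ∧
      (∃ c : ℂ, c ≠ 0 ∧ leadingTerm (D.polyPt j pair12) =
        MvPolynomial.C c * ∏ k ∈ Finset.Icc 1 ⌊expDiff (D.expPt j) pair12⌋₊,
          linearFactor j (D.expPt j 0) d₁ d₂ k) ∧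
      (∃ c : ℂ, c ≠ 0 ∧ leadingTerm (D.polyPt j pair23) =
        MvPolynomial.C c * ∏ k ∈ Finset.Icc 1 ⌊expDiff (D.expPt j) pair23⌋₊,
          linearFactor j (D.expPt j 1) d₁ d₂ k) ∧
      (∃ c : ℂ, c ≠ 0 ∧ leadingTerm (D.polyPt j pair13) =
        MvPolynomial.C c *
          (MvPolynomial.C d₃ * MvPolynomial.X (.s1 j)
            + MvPolynomial.C d₄ * MvPolynomial.X (.s2 j)
            + ∑ l, MvPolynomial.C (d' l) * MvPolynomial.X (.r1 l)) *
          ∏ k ∈ Finset.Icc 1 ⌊expDiff (D.expPt j) pair13⌋₊ \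
              {⌊expDiff (D.expPt j) pair12⌋₊, ⌊expDiff (D.expPt j) pair12⌋₊ + 1},
            linearFactor j (D.expPt j 0) d₁ d₂ k) := by
  obtain ⟨d₁, d₂, d₃, d₄, h1, h2, h3, ha, hr2, hr1⟩ := hD.lin_pt j
  have hκ := hD.expPt j
  obtain ⟨c12, hc12, h12⟩ := top_poly_adjacent ha hr2 hκ pair12 (by decide)
  obtain ⟨c23, hc23, h23⟩ := top_poly_adjacent ha hr2 hκ pair23 (by decide)
  obtain ⟨c13, hc13, h13⟩ := top_poly_pair13 ha hr2 hκ
  have hform : MvPolynomial.C ((D.expPt j 1 : ℂ) - 1) * D.aLin (D.pt j) 0 + D.rLin (D.pt j) (-1)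
      = MvPolynomial.C d₃ * MvPolynomial.X (.s1 j) + MvPolynomial.C d₄ * MvPolynomial.X (.s2 j)
        + ∑ l, MvPolynomial.C (((D.expPt j 1 : ℂ) - 1)
          * (D.qR1 (e4Series (D.pt j)) (e6Series (D.pt j)) l).coeff 0) * MvPolynomial.X (.r1 l) := by
    rw [hr1, aLin, Finset.mul_sum, add_comm]
    congr 1
    refine Finset.sum_congr rfl fun l _ => ?_
    rw [← mul_assoc, ← MvPolynomial.C_mul]
  have hne : MvPolynomial.C ((D.expPt j 1 : ℂ) - 1) * D.aLin (D.pt j) 0 + D.rLin (D.pt j) (-1)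
      ≠ 0 := by
    intro h0
    rw [hform] at h0
    have := congrArg (MvPolynomial.eval (fun s => match s with
      | .s1 _ => (1 : ℂ)
      | _ => 0)) h0
    simp [h3] at this
  have hC : ∀ {c : ℂ}, c ≠ 0 → (MvPolynomial.C c : MvPolynomial (FreeParam m) ℂ) ≠ 0 := fun hc => by
    simpa using hc
  have hprod : ∀ (s : Finset ℕ) (κ : ℚ), ∏ k ∈ s, linearFactor j κ d₁ d₂ k ≠ 0 := fun s κ =>
    Finset.prod_ne_zero_iff.2 fun k _ => linearFactor_ne_zero j κ d₁ h2 k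
  have l12 := h12.leadingTerm (mul_ne_zero (hC hc12) (hprod _ _))
  have l23 := h23.leadingTerm (mul_ne_zero (hC hc23) (hprod _ _))
  have l13 := h13.leadingTerm (mul_ne_zero (mul_ne_zero (hC hc13) hne) (hprod _ _))
  have hcast : ∀ e : ExponentPair, (⌊expDiff (D.expPt j) e⌋₊ : ℚ) = expDiff (D.expPt j) e := by
    intro e
    obtain ⟨N, -, hN, hN'⟩ := hκ.exists_nat e
    rw [hN, expDiff, hN']; ring
  refine ⟨?_, ?_, ?_, d₁, d₂, d₃, d₄, _, h1, h2, h3, ⟨c12, hc12, l12.2⟩, ⟨c23, hc23, l23.2⟩,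
    c13, hc13, l13.2.trans (by rw [hform])⟩
  · exact (congrArg Nat.cast l12.1).trans (hcast _)
  · exact (congrArg Nat.cast l23.1).trans (hcast _)
  · refine (congrArg Nat.cast l13.1).trans ?_
    obtain ⟨N, hN0, hN, -⟩ := hκ.exists_nat pair13
    rw [hN, Nat.cast_sub (by omega : 1 ≤ N), Nat.cast_one, ← hN, hcast]

/-! ### Leading terms at `i` -/

theorem sum_range_two_mul {A : Type*} [AddCommMonoid A] (f : ℕ → A)
    (hf : ∀ k, f (2 * k + 1) = 0) (n : ℕ) :
    ∑ k ∈ Finset.range (2 * n), f k = ∑ k ∈ Finset.range n, f (2 * k) := by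
  induction n with
  | zero => rfl
  | succ n ih =>
    rw [show 2 * (n + 1) = 2 * n + 1 + 1 by ring, Finset.sum_range_succ, Finset.sum_range_succ, ih,
      hf, add_zero, Finset.sum_range_succ]

/-- E₆ has a simple zero at i, whereas F_l(i) = E₄(i)³ ≠ 0; so only the term with s_i^{(1)} has a
simple pole. -/
theorem lin_I : ∃ d : ℂ, d ≠ 0 ∧
    D.rLin UpperHalfPlane.I (-1) = MvPolynomial.C d * MvPolynomial.X .sI := by
  have h := isLocalPair_local UpperHalfPlane.I
  have r4 := rep_lE4 UpperHalfPlane.I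
  have r6 := rep_lE6 UpperHalfPlane.I
  have e4 : lE4 UpperHalfPlane.I 0 = ModularForm.E₄ UpperHalfPlane.I := localFun_zero _ _ _
  have e6 : lE6 UpperHalfPlane.I 0 = ModularForm.E₆ UpperHalfPlane.I := localFun_zero _ _ _
  have hv : lE6 UpperHalfPlane.I 0 = 0 := by rw [e6]; exact E6_I
  have hu := h.u_ne_of_v hv
  have hF : ∀ l, D.F (lE4 UpperHalfPlane.I 0) (lE6 UpperHalfPlane.I 0) l ≠ 0 := by
    intro l
    rw [hv]
    simp [F, hu]
  have hS := fun k l => ((rep_rS r4 r6 k l).coeff_of_tendsto (h.tendsto_rS k l (hF l))).2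
  have hI := ((rep_rSI r4 r6).coeff_of_tendsto (h.tendsto_rSI_self hu hv)).1
  simp only [Nat.cast_one, Nat.cast_zero, neg_zero] at hS hI
  refine ⟨-2 * lE4 UpperHalfPlane.I 0 / 1, by simp [hu], ?_⟩
  rw [rLin, hI]
  simp [hS]

/-- By the symmetry at i the Frobenius coefficients of odd degree vanish, so the even ones satisfy a
recursion of their own with one-step coefficient of linear part (α + 2(k - 1)) a_0 + r_(-1). Each
double step raises the degree by one, which halves the total. -/
theorem IsAdmissible.leadingTerm_I (hD : D.IsAdmissible) {p₀ : ExponentPair}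
    (hp₀ : ∃ n : ℤ, expDiff D.expI p₀ = 2 * n)
    (huniq : ∀ p : ExponentPair, p ≠ p₀ → ¬ ∃ n : ℤ, expDiff D.expI p = 2 * n) :
    ((D.polyI p₀).totalDegree : ℚ) = expDiff D.expI p₀ / 2 ∧
      ∃ (d : Fin (D.polyI p₀).totalDegree → ℂ)
        (d' : Fin (D.polyI p₀).totalDegree → Fin m → ℂ), (∀ l, d l ≠ 0) ∧
        leadingTerm (D.polyI p₀) =
          ∏ l, (MvPolynomial.C (d l) * MvPolynomial.X .sI
            + ∑ j, MvPolynomial.C (d' l j) * MvPolynomial.X (.r1 j)) := by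
  obtain ⟨d, hd, hr⟩ := lin_I (D := D)
  have hκ := hD.expI
  obtain ⟨N, hN0, hN, hN'⟩ := hκ.exists_nat p₀
  have hexp : expDiff D.expI p₀ = N := by rw [expDiff, hN']; ring
  obtain ⟨M, rfl⟩ : ∃ M, N = 2 * M := by
    obtain ⟨n, hn⟩ := hp₀
    rw [hexp] at hn
    have : (N : ℤ) = 2 * n := by exact_mod_cast hn
    exact ⟨N / 2, by omega⟩
  set α : ℚ := D.expI p₀.1.1 with hα
  set ℓ : ℕ → MvPolynomial (FreeParam m) ℂ := fun k => MvPolynomial.C d * MvPolynomial.X .sI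
    + ∑ j, MvPolynomial.C (((α : ℂ) + 2 * (k - 1 : ℕ))
      * (D.qR1 (e4Series UpperHalfPlane.I) (e6Series UpperHalfPlane.I) j).coeff 0)
        * MvPolynomial.X (.r1 j) with hℓdef
  obtain ⟨c, hc, htop⟩ := (top_recursion (N := M)
    (e := fun k => frobeniusCoeff (D.aCoeff UpperHalfPlane.I) (D.bCoeff UpperHalfPlane.I)
      (ind D.expI) α (2 * k))
    (T := fun n k => D.recCoeff UpperHalfPlane.I α (2 * n) (2 * k)) (ℓ := ℓ)
    (g := fun k => frobeniusObstruction (D.aCoeff UpperHalfPlane.I) (D.bCoeff UpperHalfPlane.I)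
      (ind D.expI) α (2 * k))
    (frobeniusCoeff_zero _ _ _ _) (fun n => by
      refine sum_range_two_mul (fun k => D.recCoeff UpperHalfPlane.I α (2 * n) k *
        frobeniusCoeff (D.aCoeff UpperHalfPlane.I) (D.bCoeff UpperHalfPlane.I)
          (ind D.expI) α k) (fun k => ?_) n
      have := (frobenius_eq_zero (fun n hn => coeff_eq_zero (D := D) S_smul_I n hn) (ind D.expI) α
        (2 * k + 1) (by
          rw [ModularGroup.denom_S, UpperHalfPlane.coe_I, Complex.I_sq, pow_succ, pow_mul]
          norm_num)).1
      rw [this, mul_zero])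
    (fun n k _ => D.totalDegree_recCoeff_le _ _ _ _)
    (fun n => by
      have := D.top_recCoeff UpperHalfPlane.I α (2 * (n + 1)) (2 * n) 0 (by push_cast; ring)
      rw [zero_sub, hr, aLin, Finset.mul_sum] at this
      convert this using 1
      simp only [hℓdef]
      rw [add_comm]
      congr 1
      refine Finset.sum_congr rfl fun j _ => ?_
      rw [← mul_assoc, ← MvPolynomial.C_mul]
      congr 3
      simp)
    -- An exponent at a smaller even distance would give a second pair with even difference.
    (fun n h0 hn => frobeniusCoeff_eq_C_mul _ _ _ _ (by omega) fun hf => by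
      obtain ⟨k, hk, hk'⟩ := exists_of_ind_eq_zero hκ.1 (by omega) hf
      have hne : (⟨(p₀.1.1, k), hk⟩ : ExponentPair) ≠ p₀ := by
        intro h
        have : k = p₀.1.2 := congrArg (fun e : ExponentPair => e.1.2) h
        rw [this, hN'] at hk'
        have : 2 * M = 2 * n := by exact_mod_cast add_left_cancel hk'
        omega
      refine huniq _ hne ⟨n, ?_⟩
      simp only [expDiff, hk']
      push_cast; ring) M).2 (by omega) le_rfl
  -- The product in the statement carries no scalar, so c is distributed over the M factors by means
  -- of an M-th root.
  obtain ⟨r, hr'⟩ := IsAlgClosed.exists_pow_nat_eq c (show 0 < M by omega)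
  have hr0 : r ≠ 0 := by
    rintro rfl
    rw [zero_pow (by omega)] at hr'
    exact hc hr'.symm
  have hℓ0 : ∀ k, ℓ k ≠ 0 := by
    intro k h0
    have := congrArg (MvPolynomial.eval (fun s => match s with
      | .sI => (1 : ℂ)
      | _ => 0)) h0
    simp [hℓdef, hd] at this
  have hlead := htop.leadingTerm (mul_ne_zero (by simpa using hc)
    (Finset.prod_ne_zero_iff.2 fun k _ => hℓ0 k))
  have hP : D.polyI p₀ = frobeniusObstruction (D.aCoeff UpperHalfPlane.I)
      (D.bCoeff UpperHalfPlane.I) (ind D.expI) α (2 * M) := by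
    rw [polyI, poly, hN]; rfl
  rw [← hP] at hlead
  obtain ⟨hdeg, hlead⟩ := hlead
  rw [hlead]
  rw [hdeg]
  refine ⟨by rw [hexp]; push_cast; ring, fun _ => r * d, fun l j => r * (((α : ℂ) + 2 * (l : ℕ))
    * (D.qR1 (e4Series UpperHalfPlane.I) (e6Series UpperHalfPlane.I) j).coeff 0),
    fun _ => mul_ne_zero hr0 hd, ?_⟩
  have h1 : ∏ k ∈ Finset.Icc 1 M, ℓ k = ∏ l : Fin M, ℓ (l + 1) := by
    rw [← Finset.prod_range (fun l => ℓ (l + 1)), ← Finset.Ico_add_one_right_eq_Icc,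
      Finset.prod_Ico_eq_prod_range]
    simp [add_comm]
  rw [h1, ← hr', MvPolynomial.C_pow]
  rw [show (MvPolynomial.C r : MvPolynomial (FreeParam m) ℂ) ^ M
    = ∏ _l : Fin M, MvPolynomial.C r by simp, ← Finset.prod_mul_distrib]
  refine Finset.prod_congr rfl fun l _ => ?_
  simp only [hℓdef, mul_add, Finset.mul_sum, Nat.add_sub_cancel, MvPolynomial.C_mul, mul_assoc]

end SingularData

open scoped Manifold

/-! ### Limits of meromorphic functions -/

theorem tendsto_shift {h : ℂ → ℂ} {z₀ : ℂ} {l : Filter ℂ} :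
    Tendsto (fun δ => h (z₀ + δ)) (𝓝[≠] 0) l ↔ Tendsto h (𝓝[≠] z₀) l := by
  have h1 : Tendsto (fun δ : ℂ => z₀ + δ) (𝓝[≠] 0) (𝓝[≠] z₀) :=
    tendsto_nhdsWithin_iff.2 ⟨(tendsto_add_left_zero z₀).mono_left nhdsWithin_le_nhds, by
      filter_upwards [self_mem_nhdsWithin] with δ hδ
      simpa using hδ⟩
  have h2 : Tendsto (fun z : ℂ => z - z₀) (𝓝[≠] z₀) (𝓝[≠] 0) :=
    tendsto_nhdsWithin_iff.2 ⟨(tendsto_sub_right_zero z₀).mono_left nhdsWithin_le_nhds, by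
      filter_upwards [self_mem_nhdsWithin] with δ hδ
      simpa [sub_eq_zero] using hδ⟩
  exact ⟨fun h3 => by simpa [Function.comp_def] using h3.comp h2, fun h3 => h3.comp h1⟩

theorem exists_analytic_of_tendsto {h : ℂ → ℂ} {z₀ : ℂ} {n : ℕ} {c : ℂ} (hm : MeromorphicAt h z₀)
    (ht : Tendsto (fun δ => δ ^ n * h (z₀ + δ)) (𝓝[≠] 0) (𝓝 c)) :
    ∃ A : ℂ → ℂ, AnalyticAt ℂ A 0 ∧ A 0 = c ∧ ∀ᶠ δ in 𝓝[≠] 0, δ ^ n * h (z₀ + δ) = A δ := by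
  have h1 : MeromorphicAt (fun δ => h (z₀ + δ)) 0 :=
    MeromorphicAt.comp_analyticAt (f := h) (g := fun δ => z₀ + δ) (by simpa using hm) (by fun_prop)
  have h2 : MeromorphicAt (fun δ => δ ^ n * h (z₀ + δ)) 0 :=
    ((by fun_prop : AnalyticAt ℂ (fun δ : ℂ => δ ^ n) 0).meromorphicAt).mul h1
  have h3 := h2.meromorphicOrderAt_nonneg_iff_analyticAt_toMeromorphicNFAt.1
    ((tendsto_nhds_iff_meromorphicOrderAt_nonneg h2).1 ⟨c, ht⟩)
  have h4 := h2.eq_nhdsNE_toMeromorphicNFAt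
  refine ⟨_, h3, ?_, h4⟩
  exact tendsto_nhds_unique (h3.continuousAt.tendsto.mono_left nhdsWithin_le_nhds) (ht.congr' h4)

/-- If the analytic extension of δ^(n+1) h vanishes at 0, division by δ leaves its derivative as
limit. This removes poles one order at a time. -/
theorem exists_tendsto_of_succ {h : ℂ → ℂ} {z₀ : ℂ} {n : ℕ} (hm : MeromorphicAt h z₀)
    (ht : Tendsto (fun δ => δ ^ (n + 1) * h (z₀ + δ)) (𝓝[≠] 0) (𝓝 0)) :
    ∃ c, Tendsto (fun δ => δ ^ n * h (z₀ + δ)) (𝓝[≠] 0) (𝓝 c) := by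
  obtain ⟨A, hA, hA0, h1⟩ := exists_analytic_of_tendsto hm ht
  refine ⟨deriv A 0, (hasDerivAt_iff_tendsto_slope.1 hA.differentiableAt.hasDerivAt).congr' ?_⟩
  filter_upwards [h1, self_mem_nhdsWithin] with δ h2 h3
  have h3 : δ ≠ 0 := h3
  rw [slope_def_field, hA0, ← h2]
  field_simp
  ring

/-- Transport of limits under a fractional linear map. -/
theorem tendsto_of_mob {h : ℂ → ℂ} {j e z₁ z₀ c : ℂ} (hj : j ≠ 0) {k n : ℕ}
    (hh : ∀ᶠ δ in 𝓝[≠] (0 : ℂ), h (z₁ + mob (j ^ 2)⁻¹ e δ) = (j * (1 + e * δ)) ^ k * h (z₀ + δ))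
    (ht : Tendsto (fun δ => δ ^ n * h (z₀ + δ)) (𝓝[≠] 0) (𝓝 c)) :
    Tendsto (fun δ => δ ^ n * h (z₁ + δ)) (𝓝[≠] 0) (𝓝 ((j ^ 2)⁻¹ ^ n * j ^ k * c)) := by
  have hβ : (j ^ 2)⁻¹ ≠ 0 := inv_ne_zero (pow_ne_zero 2 hj)
  have h1 : Tendsto (fun δ : ℂ => ((j ^ 2)⁻¹ / (1 + e * δ)) ^ n * (j * (1 + e * δ)) ^ k) (𝓝[≠] 0)
      (𝓝 ((j ^ 2)⁻¹ ^ n * j ^ k)) := by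
    have : ContinuousAt (fun δ : ℂ => ((j ^ 2)⁻¹ / (1 + e * δ)) ^ n * (j * (1 + e * δ)) ^ k) 0 := by
      have : (1 : ℂ) + e * 0 ≠ 0 := by simp
      fun_prop (disch := assumption)
    simpa [ContinuousAt] using this.tendsto.mono_left (nhdsWithin_le_nhds (s := {0}ᶜ))
  -- Substituting the inverse Möbius map turns the transformed displacement back into δ.
  have h2 := (h1.mul ht).comp (tendsto_mob (e := -e / (j ^ 2)⁻¹) (inv_ne_zero hβ))
  refine h2.congr' ?_
  have h3 := (tendsto_mob (e := -e / (j ^ 2)⁻¹) (inv_ne_zero hβ)).eventually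
    (hh.and ((eventually_one_add_ne e).filter_mono nhdsWithin_le_nhds))
  filter_upwards [h3, (eventually_one_add_ne (-e / (j ^ 2)⁻¹)).filter_mono nhdsWithin_le_nhds]
    with δ ⟨h4, h5⟩ h6
  have h7 := mob_mob (inv_ne_zero hβ) h6
  rw [inv_inv, show -(-e / (j ^ 2)⁻¹) / ((j ^ 2)⁻¹)⁻¹ = e by field_simp] at h7
  rw [Function.comp_apply]
  generalize mob ((j ^ 2)⁻¹)⁻¹ (-e / (j ^ 2)⁻¹) δ = w at *
  rw [h7] at h4
  rw [h4]
  nth_rewrite 1 [← h7]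
  rw [mob, div_pow, div_pow, mul_pow]
  ring

namespace SingularData

variable {m : ℕ} {D : SingularData m}

/-! ### Functions which are modular away from the singular set -/

variable (D) in
/-- `V` is meromorphic, and holomorphic and modular of weight `k` away from the singular set. -/
structure IsForm (k : ℕ) (V : ℍ → ℂ) : Prop where
  mero : MeromorphicOn (fun z => V (ofComplex z)) {z : ℂ | 0 < z.im}
  smul : ∀ (γ : SL(2, ℤ)) (z : ℍ), z ∉ D.singularSet → V (γ • z) = denom γ z ^ k * V z
  analytic : ∀ z : ℍ, z ∉ D.singularSet → AnalyticAt ℂ (fun z => V (ofComplex z)) z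

namespace IsForm

variable {k : ℕ} {V W : ℍ → ℂ}

theorem sub (hV : D.IsForm k V) (hW : D.IsForm k W) : D.IsForm k (fun z => V z - W z) where
  mero := fun z hz => (hV.mero z hz).fun_sub (hW.mero z hz)
  smul := fun γ z hz => by rw [hV.smul γ z hz, hW.smul γ z hz]; ring
  analytic := fun z hz => (hV.analytic z hz).fun_sub (hW.analytic z hz)

theorem eventually_smul (hV : D.IsForm k V) (hD : D.IsAdmissible) (γ : SL(2, ℤ)) (z₀ : ℍ) :
    ∀ᶠ δ in 𝓝[≠] (0 : ℂ), V (ofComplex ((γ • z₀ : ℍ)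
        + mob (denom γ z₀ ^ 2)⁻¹ ((γ 1 0 : ℂ) / denom γ z₀) δ))
      = (denom γ z₀ * (1 + (γ 1 0 : ℂ) / denom γ z₀ * δ)) ^ k * V (ofComplex (z₀ + δ)) := by
  have hj := denom_ne_zero γ z₀
  filter_upwards [hD.eventually_notMem z₀] with δ ⟨h, h1⟩
  rw [← smul_add γ z₀ h, ofComplex_apply, ofComplex_apply_of_im_pos h, hV.smul γ _ h1, denom_add]
  congr 2
  field_simp

/-- Passing to the normal form gives a function which is modular everywhere. -/
theorem exists_normal_form (hV : D.IsForm k V) (hD : D.IsAdmissible) : ∃ W : ℍ → ℂ,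
    MeromorphicNFOn (fun z : ℂ => W (ofComplex z)) {z : ℂ | 0 < z.im} ∧
    (∀ γ : SL(2, ℤ), W ∣[(k : ℤ)] γ = W) ∧ (∀ γ : SL(2, ℤ), ∀ z, W (γ • z) = denom γ z ^ k * W z) ∧
    (∀ z ∉ D.singularSet, W z = V z) ∧
    ∀ z₀ : ℍ, ∀ᶠ δ in 𝓝[≠] (0 : ℂ), W (ofComplex (z₀ + δ)) = V (ofComplex (z₀ + δ)) := by
  set U : Set ℂ := {z : ℂ | 0 < z.im} with hU
  have hUo : IsOpen U := isOpen_upperHalfPlaneSet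
  set G := toMeromorphicNFOn (fun z => V (ofComplex z)) U with hG
  have hGW : ∀ z ∈ U, G ((ofComplex z : ℍ) : ℂ) = G z := fun z hz => by
    rw [ofComplex_apply_of_im_pos hz]
  have hoff : ∀ z ∉ D.singularSet, G (z : ℍ) = V z := by
    intro z hz
    rw [hG, toMeromorphicNFOn_eq_toMeromorphicNFAt hV.mero z.im_pos,
      toMeromorphicNFAt_eq_self.2 (hV.analytic z hz).meromorphicNFAt]
    exact congrArg V (ofComplex_apply z)
  have hNF : MeromorphicNFOn (fun z : ℂ => G (ofComplex z : ℍ)) U := by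
    intro z hz
    refine (meromorphicNFAt_congr (f := G) ?_).1 (meromorphicNFOn_toMeromorphicNFOn _ U hz)
    filter_upwards [hUo.mem_nhds hz] with w hw
    exact (hGW w hw).symm
  have hev : ∀ z₀ : ℍ, ∀ᶠ δ in 𝓝[≠] (0 : ℂ),
      G (ofComplex (z₀ + δ) : ℍ) = V (ofComplex (z₀ + δ)) := by
    intro z₀
    filter_upwards [hD.eventually_notMem z₀] with δ ⟨h, h1⟩
    rw [ofComplex_apply_of_im_pos h]
    exact hoff _ h1
  have hsm : ∀ (γ : SL(2, ℤ)) (z : ℍ), G (γ • z : ℍ) = denom γ z ^ k * G z := by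
    intro γ z
    have hj := denom_ne_zero γ z
    set β := (denom γ z ^ 2)⁻¹ with hβ
    have hβ0 : β ≠ 0 := inv_ne_zero (pow_ne_zero 2 hj)
    set e := (γ 1 0 : ℂ) / denom γ z with he
    have h1 : MeromorphicNFAt (fun δ => G (ofComplex ((γ • z : ℍ) + mob β e δ) : ℍ)) 0 :=
      MeromorphicNFAt.comp_analyticAt (f := fun z : ℂ => G (ofComplex z : ℍ))
        (g := fun δ => ((γ • z : ℍ) : ℂ) + mob β e δ)
        (hNF (by rw [mob_zero, add_zero]; exact (γ • z).im_pos))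
        (analyticAt_const.fun_add (analyticAt_mob (by simp)))
    have h2 : MeromorphicNFAt (fun δ => (denom γ z * (1 + e * δ)) ^ k
        * G (ofComplex (z + δ) : ℍ)) 0 := by
      refine (meromorphicNFAt_mul_iff_right (by fun_prop) (by simp [hj])).2 ?_
      exact MeromorphicNFAt.comp_analyticAt (f := fun z : ℂ => G (ofComplex z : ℍ))
        (g := fun δ => (z : ℂ) + δ) (hNF (by rw [add_zero]; exact z.im_pos)) (by fun_prop)
    -- Two functions in normal form that agree near a point also agree at it; this extends the
    -- transformation law to the singular points.
    have h3 := (h1.eventuallyEq_nhdsNE_iff_eventuallyEq_nhds h2).1 (by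
      filter_upwards [hV.eventually_smul hD γ z, hev z,
        (tendsto_mob (e := e) hβ0).eventually (hev (γ • z))] with δ h4 h5 h6
      rw [h5, ← h4, h6])
    simpa [mob_zero] using h3.self_of_nhds
  refine ⟨fun z => G z, hNF, fun γ => ?_, hsm, hoff, hev⟩
  ext z
  have hj := denom_ne_zero γ z
  rw [ModularForm.SL_slash_apply, hsm, zpow_neg, zpow_natCast]
  field_simp

/-- A form of small weight without poles which vanishes at the cusp is zero. -/
theorem eq_zero (hV : D.IsForm k V) (hD : D.IsAdmissible) (hk : k < 12)
    (hinf : Tendsto V atImInfty (𝓝 0)) (hS : ∀ᶠ z in atImInfty, z ∉ D.singularSet)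
    (hlim : ∀ z₀ : ℍ, (z₀ = UpperHalfPlane.I ∨ z₀ = rho ∨ ∃ j, z₀ = D.pt j) →
      ∃ c, Tendsto (fun δ => V (ofComplex (z₀ + δ))) (𝓝[≠] 0) (𝓝 c)) :
    ∀ z ∉ D.singularSet, V z = 0 := by
  obtain ⟨W, hNF, hslash, hsm, hoff, hev⟩ := hV.exists_normal_form hD
  have hW : D.IsForm k W := by
    refine ⟨hNF.meromorphicOn, fun γ z _ => hsm γ z, fun z hz => ?_⟩
    refine (hNF z.im_pos).meromorphicOrderAt_nonneg_iff_analyticAt.1 ?_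
    refine (tendsto_nhds_iff_meromorphicOrderAt_nonneg (hNF z.im_pos).meromorphicAt).1 ⟨V z, ?_⟩
    rw [← tendsto_shift]
    refine Tendsto.congr' (EventuallyEq.symm (hev z)) ?_
    rw [tendsto_shift (h := fun z => V (ofComplex z))]
    simpa using (hV.analytic z hz).continuousAt.tendsto.mono_left nhdsWithin_le_nhds
  -- Modularity carries a finite limit at a representative to its whole orbit, and a function in
  -- normal form with a finite limit is analytic.
  have hlim' : ∀ z₀ : ℍ, (∃ c, Tendsto (fun δ => V (ofComplex (z₀ + δ))) (𝓝[≠] 0) (𝓝 c)) →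
      ∀ z ∈ MulAction.orbit SL(2, ℤ) z₀, AnalyticAt ℂ (fun z => W (ofComplex z)) (z : ℍ) := by
    rintro z₀ ⟨c, hc⟩ _ ⟨γ, rfl⟩
    have h1 : Tendsto (fun δ => δ ^ 0 * W (ofComplex (z₀ + δ))) (𝓝[≠] 0) (𝓝 c) := by
      simp only [pow_zero, one_mul]
      exact hc.congr' (EventuallyEq.symm (hev z₀))
    have h2 := tendsto_of_mob (h := fun z => W (ofComplex z)) (denom_ne_zero γ z₀)
      (hW.eventually_smul hD γ z₀) h1
    simp only [pow_zero, one_mul] at h2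
    rw [tendsto_shift (h := fun z => W (ofComplex z))] at h2
    have h3 := hNF (γ • z₀).im_pos
    exact h3.meromorphicOrderAt_nonneg_iff_analyticAt.1
      ((tendsto_nhds_iff_meromorphicOrderAt_nonneg h3.meromorphicAt).1 ⟨_, h2⟩)
  have han : ∀ z : ℍ, AnalyticAt ℂ (fun z => W (ofComplex z)) z := by
    intro z
    by_cases hz : z ∈ D.singularSet
    · rcases hz with (hz | hz) | hz
      · exact hlim' _ (hlim _ (.inl rfl)) z hz
      · exact hlim' _ (hlim _ (.inr (.inl rfl))) z hz
      · obtain ⟨j, hj⟩ := Set.mem_iUnion.1 hz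
        exact hlim' _ (hlim _ (.inr (.inr ⟨j, rfl⟩))) z hj
    · exact hW.analytic z hz
  have hWd : MDiff W := UpperHalfPlane.mdifferentiable_iff.2 fun z hz =>
    (han ⟨z, hz⟩).differentiableAt.differentiableWithinAt
  have hW0 := eq_zero_of_weight_lt_twelve (by exact_mod_cast hk) hWd hslash (by
    refine hinf.congr' ?_
    filter_upwards [hS] with z hz
    exact (hoff z hz).symm)
  intro z hz
  rw [← hoff z hz, hW0, Pi.zero_apply]

/-- Modularity forces some leading coefficients at fixed points to vanish. -/
theorem tendsto_of_fixed (hV : D.IsForm k V) (hD : D.IsAdmissible) {γ : SL(2, ℤ)} {z₀ : ℍ}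
    (hγ : γ • z₀ = z₀) {n : ℕ} (hn : denom γ z₀ ^ (2 * n) ≠ denom γ z₀ ^ k)
    (ht : Tendsto (fun δ => δ ^ (n + 1) * V (ofComplex (z₀ + δ))) (𝓝[≠] 0) (𝓝 0)) :
    Tendsto (fun δ => δ ^ n * V (ofComplex (z₀ + δ))) (𝓝[≠] 0) (𝓝 0) := by
  have hj := denom_ne_zero γ z₀
  obtain ⟨c, hc⟩ := exists_tendsto_of_succ (h := fun z => V (ofComplex z)) (hV.mero z₀ z₀.im_pos) ht
  have h1 := tendsto_of_mob (h := fun z => V (ofComplex z)) hj (hV.eventually_smul hD γ z₀) hc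
  rw [hγ] at h1
  -- Transport by the stabiliser multiplies the limit c by j^(k - 2n), so c = 0 unless that factor
  -- is 1.
  have h2 := tendsto_nhds_unique h1 hc
  suffices h : c = 0 by rwa [h] at hc
  by_contra h0
  apply hn
  rw [mul_eq_right₀ h0, inv_pow, inv_mul_eq_one₀ (pow_ne_zero _ (pow_ne_zero _ hj)), ← pow_mul] at h2
  exact h2

end IsForm

end SingularData

theorem tendsto_const_mul_zero {α : Type*} {l : Filter α} {f : α → ℂ} (c : ℂ)
    (h : Tendsto f l (𝓝 0)) : Tendsto (fun x => c * f x) l (𝓝 0) := by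
  simpa using h.const_mul c

/-! ### The behaviour of the general form at the cusp -/

namespace SingularData

variable {m : ℕ} {D : SingularData m}

theorem continuousAt_F (a b : ℂ) (j : Fin m) :
    ContinuousAt (fun p : ℂ × ℂ => D.F p.1 p.2 j) (a, b) := by
  simp only [F, smul_eq_mul]
  fun_prop

theorem continuousAt_qVal {a b : ℂ} (ha : a ≠ 0) (hb : b ≠ 0) (hF : ∀ j, D.F a b j ≠ 0)
    (v : FreeParam m → ℂ) : ContinuousAt (fun p : ℂ × ℂ => D.qVal v p.1 p.2) (a, b) := by
  have hF' := continuousAt_F (D := D) a b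
  have h1 : ContinuousAt (fun p : ℂ × ℂ => p.1) (a, b) := continuousAt_fst
  have h2 : ContinuousAt (fun p : ℂ × ℂ => p.2) (a, b) := continuousAt_snd
  have hΔ : ContinuousAt (fun p : ℂ × ℂ => p.1 ^ 3 - p.2 ^ 2) (a, b) := by fun_prop
  simp only [qVal, qFixed, qR1, smul_eq_mul]
  exact ((((continuousAt_const.mul h1).add (continuousAt_const.mul
    ((h1.mul hΔ).div (h2.pow 2) (pow_ne_zero 2 hb)))).add
    (continuousAt_const.mul (hΔ.div (h1.pow 2) (pow_ne_zero 2 ha)))).add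
    (tendsto_finsetSum _ fun j _ => continuousAt_const.mul
      ((h1.mul (hΔ.pow 2)).div ((hF' j).pow 2) (pow_ne_zero 2 (hF j))))).add
    (tendsto_finsetSum _ fun j _ => continuousAt_const.mul ((h1.mul hΔ).div (hF' j) (hF j)))

theorem continuousAt_rVal {a b : ℂ} (ha : a ≠ 0) (hb : b ≠ 0) (hF : ∀ j, D.F a b j ≠ 0)
    (v : FreeParam m → ℂ) : ContinuousAt (fun p : ℂ × ℂ => D.rVal v p.1 p.2) (a, b) := by
  have hF' := continuousAt_F (D := D) a b
  have h1 : ContinuousAt (fun p : ℂ × ℂ => p.1) (a, b) := continuousAt_fst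
  have h2 : ContinuousAt (fun p : ℂ × ℂ => p.2) (a, b) := continuousAt_snd
  have hΔ : ContinuousAt (fun p : ℂ × ℂ => p.1 ^ 3 - p.2 ^ 2) (a, b) := by fun_prop
  have hS : ∀ k j, ContinuousAt
      (fun p : ℂ × ℂ => p.2 * (p.1 ^ 3 - p.2 ^ 2) ^ k / D.F p.1 p.2 j ^ k) (a, b) :=
    fun k j => (h2.mul (hΔ.pow k)).div ((hF' j).pow k) (pow_ne_zero k (hF j))
  simp only [rVal, rFixed, rS, rSI, smul_eq_mul]
  exact (((((continuousAt_const.mul h2).add (continuousAt_const.mul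
    ((hΔ.pow 2).div (h2.pow 3) (pow_ne_zero 3 hb)))).add
    (continuousAt_const.mul ((h2.mul hΔ).div (h1.pow 3) (pow_ne_zero 3 ha)))).add
    (tendsto_finsetSum _ fun j _ => continuousAt_const.mul (hS 3 j))).add
    (continuousAt_const.mul (hΔ.div h2 hb))).add
    (tendsto_finsetSum _ fun j _ => (continuousAt_const.mul (hS 2 j)).add
      (continuousAt_const.mul (hS 1 j)))

/-- At the cusp E₄ = E₆ = 1 and Δ₀ = 0, so every term but the first vanishes. -/
theorem qVal_one_one (v : FreeParam m → ℂ) : D.qVal v (1 : ℂ) 1 = D.rInf := by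
  simp [qVal, qFixed, qR1]

theorem rVal_one_one (v : FreeParam m → ℂ) : D.rVal v (1 : ℂ) 1 = D.sInf := by
  simp [rVal, rFixed, rS, rSI]

namespace IsAdmissible

/-- The equality t_j = 1 would make Δ₀ vanish at z_j. -/
theorem F_one_one_ne (hD : D.IsAdmissible) (j : Fin m) : D.F (1 : ℂ) 1 j ≠ 0 := by
  intro h
  have h1 : D.t j = 1 := by
    simp only [F, one_pow, smul_eq_mul, mul_one] at h
    linear_combination -h
  have h6 := hD.E6_pt_ne j
  rw [t, div_eq_one_iff_eq (pow_ne_zero 2 h6)] at h1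
  exact discriminant_ne_zero' (D.pt j) (sub_eq_zero.2 h1)

theorem tendsto_qForm (hD : D.IsAdmissible) (v : FreeParam m → ℂ) :
    Tendsto (D.qForm v) atImInfty (𝓝 D.rInf) := by
  rw [← qVal_one_one v]
  have h := (continuousAt_qVal one_ne_zero one_ne_zero hD.F_one_one_ne v).tendsto
  have h1 := tendsto_E4.prodMk_nhds tendsto_E6
  exact (h.comp h1).congr fun z => (qForm_eq D v z).symm

theorem tendsto_rForm (hD : D.IsAdmissible) (v : FreeParam m → ℂ) :
    Tendsto (D.rForm v) atImInfty (𝓝 D.sInf) := by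
  rw [← rVal_one_one v]
  have h := (continuousAt_rVal one_ne_zero one_ne_zero hD.F_one_one_ne v).tendsto
  have h1 := tendsto_E4.prodMk_nhds tendsto_E6
  exact (h.comp h1).congr fun z => (rForm_eq D v z).symm

theorem eventually_notMem_atImInfty (hD : D.IsAdmissible) :
    ∀ᶠ z in atImInfty, z ∉ D.singularSet := by
  have h1 : ∀ᶠ z in atImInfty, ∀ j, D.F (ModularForm.E₄ z) (ModularForm.E₆ z) j ≠ 0 := by
    refine eventually_all.2 fun j => ?_
    exact ((continuousAt_F 1 1 j).tendsto.comp (tendsto_E4.prodMk_nhds tendsto_E6)).eventually_ne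
      (hD.F_one_one_ne j)
  filter_upwards [h1, tendsto_E4.eventually_ne one_ne_zero, tendsto_E6.eventually_ne one_ne_zero]
    with z h2 h3 h4
  rw [hD.mem_singularSet_iff]
  push Not
  exact ⟨h4, h3, h2⟩

/-! ### The general form is modular -/

theorem isForm_qForm (hD : D.IsAdmissible) (v : FreeParam m → ℂ) : D.IsForm 4 (D.qForm v) where
  mero := fun z hz => by
    have h4 := (analyticAt_cE4 hz).meromorphicAt
    have h6 := (analyticAt_cE6 hz).meromorphicAt
    change MeromorphicAt (fun z => D.qVal v (cE4 z) (cE6 z)) z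
    simp only [qVal, qFixed, qR1, F, smul_eq_mul]
    fun_prop
  smul := fun γ z _ => by
    rw [qForm_eq, qForm_eq, ← D.qVal_homogeneous (denom_ne_zero γ z)]
    exact congrArg₂ _ (E_smul _ γ z) (E_smul _ γ z)
  analytic := fun z hz => (hD.analyticAt_of_notMem hz v).1

theorem isForm_rForm (hD : D.IsAdmissible) (v : FreeParam m → ℂ) : D.IsForm 6 (D.rForm v) where
  mero := fun z hz => by
    have h4 := (analyticAt_cE4 hz).meromorphicAt
    have h6 := (analyticAt_cE6 hz).meromorphicAt
    change MeromorphicAt (fun z => D.rVal v (cE4 z) (cE6 z)) z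
    simp only [rVal, rFixed, rS, rSI, F, smul_eq_mul]
    fun_prop
  smul := fun γ z _ => by
    rw [rForm_eq, rForm_eq, ← D.rVal_homogeneous (denom_ne_zero γ z)]
    exact congrArg₂ _ (E_smul _ γ z) (E_smul _ γ z)
  analytic := fun z hz => (hD.analyticAt_of_notMem hz v).2

end IsAdmissible

/-- Passing to the normal form changes V only on the singular set, which does not reach the
neighbourhood of the cusp. The limit there gives boundedness without any power of q. -/
theorem IsForm.exists_isMeromorphicModularForm {k : ℕ} {V : ℍ → ℂ} {c : ℂ} (hV : D.IsForm k V)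
    (hD : D.IsAdmissible) (h : Tendsto V atImInfty (𝓝 c)) :
    ∃ W, IsMeromorphicModularForm k W ∧ ∀ z ∉ D.singularSet, W z = V z := by
  obtain ⟨W, h1, h2, -, h3, -⟩ := hV.exists_normal_form hD
  refine ⟨W, ⟨h1, h2, 0, ?_⟩, h3⟩
  have h4 : Tendsto W atImInfty (𝓝 c) := by
    refine h.congr' ?_
    filter_upwards [hD.eventually_notMem_atImInfty] with z hz
    exact (h3 z hz).symm
  rw [IsBoundedAtImInfty, BoundedAtFilter]
  refine (h4.isBigO_one ℝ).congr_left (fun z => ?_) |>.trans ?_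
  · simp
  · exact Asymptotics.isBigO_of_le _ fun _ => by simp

theorem IsAdmissible.exists_isGivenBy (hD : D.IsAdmissible) (v : FreeParam m → ℂ) :
    ∃ Q R : ℍ → ℂ, IsMeromorphicModularForm 4 Q ∧ IsMeromorphicModularForm 6 R ∧
      D.IsGivenBy v Q R := by
  obtain ⟨Q, h1, h2⟩ :=
    (hD.isForm_qForm v).exists_isMeromorphicModularForm hD (hD.tendsto_qForm v)
  obtain ⟨R, h3, h4⟩ :=
    (hD.isForm_rForm v).exists_isMeromorphicModularForm hD (hD.tendsto_rForm v)
  exact ⟨Q, R, h1, h3, fun z hz => ⟨h2 z hz, h4 z hz⟩⟩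

/-! ### Dependence of the general form on the free parameters -/

theorem qForm_sub (v w : FreeParam m → ℂ) (z : ℍ) : D.qForm v z - D.qForm w z =
    ∑ l, (v (.r1 l) - w (.r1 l)) * D.qR1 (ModularForm.E₄ z) (ModularForm.E₆ z) l := by
  simp only [qForm, sub_mul, Finset.sum_sub_distrib]
  ring

theorem rForm_sub (v w : FreeParam m → ℂ) (z : ℍ) : D.rForm v z - D.rForm w z =
    (v .sI - w .sI) * rSI (ModularForm.E₄ z) (ModularForm.E₆ z)
    + ∑ l, ((v (.s2 l) - w (.s2 l)) * D.rS (ModularForm.E₄ z) (ModularForm.E₆ z) 2 l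
      + (v (.s1 l) - w (.s1 l)) * D.rS (ModularForm.E₄ z) (ModularForm.E₆ z) 1 l) := by
  simp only [rForm, sub_mul, Finset.sum_sub_distrib, Finset.sum_add_distrib]
  ring

theorem IsAdmissible.F_pt_ne (hD : D.IsAdmissible) {j l : Fin m} (h : l ≠ j) :
    D.F (ModularForm.E₄ (D.pt j)) (ModularForm.E₆ (D.pt j)) l ≠ 0 := fun h0 =>
  hD.inequivalent j l h.symm ((hD.F_eq_zero_iff l _).1 h0)

theorem IsAdmissible.F_pt_self (hD : D.IsAdmissible) (j : Fin m) :
    D.F (ModularForm.E₄ (D.pt j)) (ModularForm.E₆ (D.pt j)) j = 0 :=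
  (hD.F_eq_zero_iff j _).2 (MulAction.mem_orbit_self _)

theorem F_I_ne (j : Fin m) :
    D.F (ModularForm.E₄ UpperHalfPlane.I) (ModularForm.E₆ UpperHalfPlane.I) j ≠ 0 := by
  rw [E6_I]
  simpa [F] using E4_I_ne


/-- The limits which determine the free parameters. -/
theorem IsAdmissible.tendsto_qForm_sub (hD : D.IsAdmissible) (v w : FreeParam m → ℂ) (j : Fin m) :
    Tendsto (fun δ => δ ^ 1 * (D.qForm v (ofComplex (D.pt j + δ)) - D.qForm w (ofComplex (D.pt j + δ))))
      (𝓝[≠] 0) (𝓝 ((v (.r1 j) - w (.r1 j)) * (ModularForm.E₆ (D.pt j)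
        / (2 * Real.pi * Complex.I * ModularForm.E₄ (D.pt j))))) := by
  have h := isLocalPair_shift (D.pt j)
  have h1 : ∀ l, Tendsto (fun δ => (v (.r1 l) - w (.r1 l)) * (δ ^ 1 *
      D.qR1 (cE4 (D.pt j + δ)) (cE6 (D.pt j + δ)) l)) (𝓝[≠] 0) (𝓝 (if l = j then
        (v (.r1 j) - w (.r1 j)) * (ModularForm.E₆ (D.pt j)
        / (2 * Real.pi * Complex.I * ModularForm.E₄ (D.pt j))) else 0)) := by
    intro l
    split_ifs with hl
    · subst hl
      refine Tendsto.const_mul _ ?_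
      simpa using h.tendsto_qR1_self (D := D) l (by simpa using hD.F_pt_self l)
        (by simpa using hD.E4_pt_ne l) (by simpa using hD.E6_pt_ne l)
    · exact tendsto_const_mul_zero _ (tendsto_pow_mul_of_lt one_pos
        (h.tendsto_qR1 (D := D) l (by simpa using hD.F_pt_ne hl)))
  have h2 := tendsto_finsetSum Finset.univ fun l _ => h1 l
  rw [Finset.sum_ite_eq' Finset.univ j, if_pos (Finset.mem_univ j)] at h2
  refine h2.congr fun δ => ?_
  rw [qForm_sub, Finset.mul_sum]
  exact Finset.sum_congr rfl fun l _ => mul_left_comm _ _ _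

/-- Among the terms with free parameters only that of s_{z_j}^{(2)} has a double pole at z_j. -/
theorem IsAdmissible.tendsto_rForm_sub_sq (hD : D.IsAdmissible) (v w : FreeParam m → ℂ)
    (j : Fin m) :
    Tendsto (fun δ => δ ^ 2 * (D.rForm v (ofComplex (D.pt j + δ)) - D.rForm w (ofComplex (D.pt j + δ))))
      (𝓝[≠] 0) (𝓝 ((v (.s2 j) - w (.s2 j)) * (ModularForm.E₆ (D.pt j) * (ModularForm.E₆ (D.pt j)
        / (2 * Real.pi * Complex.I * ModularForm.E₄ (D.pt j) ^ 2)) ^ 2))) := by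
  have h := isLocalPair_shift (D.pt j)
  have h0 : Tendsto (fun δ => (v .sI - w .sI) * (δ ^ 2 * rSI (cE4 (D.pt j + δ))
      (cE6 (D.pt j + δ)))) (𝓝[≠] 0) (𝓝 0) := by
    exact tendsto_const_mul_zero _ (tendsto_pow_mul_of_lt two_pos
      (h.tendsto_rSI (by simpa using hD.E6_pt_ne j)))
  have h1 : ∀ l, Tendsto (fun δ =>
      (v (.s2 l) - w (.s2 l)) * (δ ^ 2 * D.rS (cE4 (D.pt j + δ)) (cE6 (D.pt j + δ)) 2 l)
      + (v (.s1 l) - w (.s1 l)) * (δ ^ 2 * D.rS (cE4 (D.pt j + δ)) (cE6 (D.pt j + δ)) 1 l))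
      (𝓝[≠] 0) (𝓝 (if l = j then (v (.s2 j) - w (.s2 j)) * (ModularForm.E₆ (D.pt j)
        * (ModularForm.E₆ (D.pt j) / (2 * Real.pi * Complex.I * ModularForm.E₄ (D.pt j) ^ 2)) ^ 2)
        else 0)) := by
    intro l
    split_ifs with hl
    · subst hl
      have hs := fun k => h.tendsto_rS_self (D := D) k l (by simpa using hD.F_pt_self l)
        (by simpa using hD.E4_pt_ne l) (by simpa using hD.E6_pt_ne l)
      simpa using ((hs 2).const_mul (v (.s2 l) - w (.s2 l))).add
        ((tendsto_pow_mul_of_lt one_lt_two (hs 1)).const_mul (v (.s1 l) - w (.s1 l)))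
    · have hs := fun k => tendsto_pow_mul_of_lt two_pos
        (h.tendsto_rS (D := D) k l (by simpa using hD.F_pt_ne hl))
      simpa using ((hs 2).const_mul (v (.s2 l) - w (.s2 l))).add
        ((hs 1).const_mul (v (.s1 l) - w (.s1 l)))
  have h2 := h0.add (tendsto_finsetSum Finset.univ fun l _ => h1 l)
  rw [zero_add, Finset.sum_ite_eq' Finset.univ j, if_pos (Finset.mem_univ j)] at h2
  refine h2.congr fun δ => ?_
  rw [rForm_sub, mul_add, Finset.mul_sum]
  exact congrArg₂ _ (mul_left_comm _ _ _) (Finset.sum_congr rfl fun l _ => by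
    rw [mul_add]; exact congrArg₂ _ (mul_left_comm _ _ _) (mul_left_comm _ _ _))

/-- The terms with s^{(2)} also contribute to residues, so the simple pole isolates s_{z_j}^{(1)}
only once the s^{(2)} agree. -/
theorem IsAdmissible.tendsto_rForm_sub (hD : D.IsAdmissible) (v w : FreeParam m → ℂ)
    (hvw : ∀ j, v (.s2 j) = w (.s2 j)) (j : Fin m) :
    Tendsto (fun δ => δ ^ 1 * (D.rForm v (ofComplex (D.pt j + δ)) - D.rForm w (ofComplex (D.pt j + δ))))
      (𝓝[≠] 0) (𝓝 ((v (.s1 j) - w (.s1 j)) * (ModularForm.E₆ (D.pt j) * (ModularForm.E₆ (D.pt j)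
        / (2 * Real.pi * Complex.I * ModularForm.E₄ (D.pt j) ^ 2))))) := by
  have h := isLocalPair_shift (D.pt j)
  have h0 : Tendsto (fun δ => (v .sI - w .sI) * (δ ^ 1 * rSI (cE4 (D.pt j + δ))
      (cE6 (D.pt j + δ)))) (𝓝[≠] 0) (𝓝 0) := by
    exact tendsto_const_mul_zero _ (tendsto_pow_mul_of_lt one_pos
      (h.tendsto_rSI (by simpa using hD.E6_pt_ne j)))
  have h1 : ∀ l, Tendsto (fun δ =>
      (v (.s1 l) - w (.s1 l)) * (δ ^ 1 * D.rS (cE4 (D.pt j + δ)) (cE6 (D.pt j + δ)) 1 l))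
      (𝓝[≠] 0) (𝓝 (if l = j then (v (.s1 j) - w (.s1 j)) * (ModularForm.E₆ (D.pt j)
        * (ModularForm.E₆ (D.pt j) / (2 * Real.pi * Complex.I * ModularForm.E₄ (D.pt j) ^ 2)))
        else 0)) := by
    intro l
    split_ifs with hl
    · subst hl
      refine Tendsto.const_mul _ ?_
      simpa using h.tendsto_rS_self (D := D) 1 l (by simpa using hD.F_pt_self l)
        (by simpa using hD.E4_pt_ne l) (by simpa using hD.E6_pt_ne l)
    · exact tendsto_const_mul_zero _ (tendsto_pow_mul_of_lt one_pos
        (h.tendsto_rS (D := D) 1 l (by simpa using hD.F_pt_ne hl)))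
  have h2 := h0.add (tendsto_finsetSum Finset.univ fun l _ => h1 l)
  rw [zero_add, Finset.sum_ite_eq' Finset.univ j, if_pos (Finset.mem_univ j)] at h2
  refine h2.congr fun δ => ?_
  rw [rForm_sub, mul_add, Finset.mul_sum]
  refine congrArg₂ _ (mul_left_comm _ _ _) (Finset.sum_congr rfl fun l _ => ?_)
  rw [hvw l, sub_self, zero_mul, zero_add]
  exact mul_left_comm _ _ _

theorem tendsto_rForm_sub_I (v w : FreeParam m → ℂ) :
    Tendsto (fun δ => δ ^ 1 * (D.rForm v (ofComplex (UpperHalfPlane.I + δ))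
        - D.rForm w (ofComplex (UpperHalfPlane.I + δ)))) (𝓝[≠] 0)
      (𝓝 ((v .sI - w .sI) * (-2 * ModularForm.E₄ UpperHalfPlane.I / (2 * Real.pi * Complex.I)))) := by
  have h := isLocalPair_shift UpperHalfPlane.I
  have h0 := (h.tendsto_rSI_self (by rw [add_zero, cE4_coe]; exact E4_I_ne)
    (by rw [add_zero, cE6_coe]; exact E6_I)).const_mul (v .sI - w .sI)
  rw [add_zero, cE4_coe] at h0
  have h1 : ∀ l, Tendsto (fun δ =>
      (v (.s2 l) - w (.s2 l)) * (δ ^ 1 * D.rS (cE4 (UpperHalfPlane.I + δ))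
        (cE6 (UpperHalfPlane.I + δ)) 2 l)
      + (v (.s1 l) - w (.s1 l)) * (δ ^ 1 * D.rS (cE4 (UpperHalfPlane.I + δ))
        (cE6 (UpperHalfPlane.I + δ)) 1 l)) (𝓝[≠] 0) (𝓝 0) := by
    intro l
    have hs := fun k => tendsto_pow_mul_of_lt one_pos (h.tendsto_rS (D := D) k l
      (by rw [add_zero, cE4_coe, cE6_coe]; exact F_I_ne l))
    have := ((hs 2).const_mul (v (.s2 l) - w (.s2 l))).add
      ((hs 1).const_mul (v (.s1 l) - w (.s1 l)))
    simpa only [mul_zero, add_zero] using this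
  have h2 := h0.add (tendsto_finsetSum Finset.univ fun l _ => h1 l)
  rw [Finset.sum_const_zero, add_zero] at h2
  refine h2.congr fun δ => ?_
  rw [rForm_sub, mul_add, Finset.mul_sum]
  exact congrArg₂ _ (mul_left_comm _ _ _) (Finset.sum_congr rfl fun l _ => by
    rw [mul_add]; exact congrArg₂ _ (mul_left_comm _ _ _) (mul_left_comm _ _ _))

/-- The free parameters are determined by `Q` and `R`. -/
theorem IsGivenBy.unique {Q R : ℍ → ℂ} {v w : FreeParam m → ℂ} (hv : D.IsGivenBy v Q R)
    (hw : D.IsGivenBy w Q R) (hD : D.IsAdmissible) : v = w := by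
  have hz : ∀ z₀ : ℍ, ∀ n : ℕ, Tendsto (fun δ => δ ^ n * (D.qForm v (ofComplex (z₀ + δ))
        - D.qForm w (ofComplex (z₀ + δ)))) (𝓝[≠] 0) (𝓝 0) ∧
      Tendsto (fun δ => δ ^ n * (D.rForm v (ofComplex (z₀ + δ))
        - D.rForm w (ofComplex (z₀ + δ)))) (𝓝[≠] 0) (𝓝 0) := by
    intro z₀ n
    constructor <;>
    · refine tendsto_const_nhds.congr' ?_
      filter_upwards [hD.eventually_notMem z₀] with δ ⟨h, h1⟩
      rw [ofComplex_apply_of_im_pos h]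
      first
        | rw [← (hv _ h1).1, ← (hw _ h1).1, sub_self, mul_zero]
        | rw [← (hv _ h1).2, ← (hw _ h1).2, sub_self, mul_zero]
  have hτ := Complex.two_pi_I_ne_zero
  have key : ∀ a b c : ℂ, c ≠ 0 → (a - b) * c = 0 → a = b := fun a b c hc h =>
    sub_eq_zero.1 ((mul_eq_zero.1 h).resolve_right hc)
  have h4 := hD.E4_pt_ne
  have h6 := hD.E6_pt_ne
  -- The double poles have to be compared before the residues, since
  -- `IsAdmissible.tendsto_rForm_sub` presupposes this equality.
  have hs2 : ∀ j, v (.s2 j) = w (.s2 j) := fun j =>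
    key _ _ _ (mul_ne_zero (h6 j) (pow_ne_zero 2 (div_ne_zero (h6 j)
      (mul_ne_zero hτ (pow_ne_zero 2 (h4 j))))))
      (tendsto_nhds_unique (hD.tendsto_rForm_sub_sq v w j) (hz _ 2).2)
  funext p
  cases p with
  | r1 j =>
    exact key _ _ _ (div_ne_zero (h6 j) (mul_ne_zero hτ (h4 j)))
      (tendsto_nhds_unique (hD.tendsto_qForm_sub v w j) (hz _ 1).1)
  | s2 j => exact hs2 j
  | s1 j =>
    exact key _ _ _ (mul_ne_zero (h6 j) (div_ne_zero (h6 j)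
      (mul_ne_zero hτ (pow_ne_zero 2 (h4 j)))))
      (tendsto_nhds_unique (hD.tendsto_rForm_sub v w hs2 j) (hz _ 1).2)
  | sI =>
    exact key _ _ _ (div_ne_zero (mul_ne_zero (by norm_num) E4_I_ne) hτ)
      (tendsto_nhds_unique (tendsto_rForm_sub_I v w) (hz _ 1).2)

end SingularData

/-! ### Leading coefficients of the equation -/

/-- With A = δ^n h one has δ^(n+1) h' = δA' - nA, and the first term tends to 0. -/
theorem tendsto_deriv_of_tendsto {h : ℂ → ℂ} {z₀ : ℂ} {n : ℕ} {c : ℂ} (hm : MeromorphicAt h z₀)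
    (ht : Tendsto (fun δ => δ ^ n * h (z₀ + δ)) (𝓝[≠] 0) (𝓝 c)) :
    Tendsto (fun δ => δ ^ (n + 1) * deriv h (z₀ + δ)) (𝓝[≠] 0) (𝓝 (-n * c)) := by
  obtain ⟨A, hA, hA0, h1⟩ := exists_analytic_of_tendsto hm ht
  have h2 : Tendsto (fun δ => δ * deriv A δ - n * A δ) (𝓝[≠] 0) (𝓝 (-n * c)) := by
    have : ContinuousAt (fun δ => δ * deriv A δ - n * A δ) 0 :=
      (continuousAt_id.mul hA.deriv.continuousAt).sub (continuousAt_const.mul hA.continuousAt)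
    have h3 := this.tendsto.mono_left (nhdsWithin_le_nhds (s := {0}ᶜ))
    simpa [hA0] using h3
  have h4 : MeromorphicAt (fun δ => h (z₀ + δ)) 0 :=
    MeromorphicAt.comp_analyticAt (f := h) (g := fun δ => z₀ + δ) (by simpa using hm) (by fun_prop)
  refine h2.congr' ?_
  filter_upwards [eventually_nhdsNE_eventually_nhds_iff.2 h1, h4.eventually_analyticAt,
    self_mem_nhdsWithin] with δ h5 h6 h7
  have h7 : δ ≠ 0 := h7
  have h8 : deriv A δ = n * δ ^ (n - 1) * h (z₀ + δ) + δ ^ n * deriv h (z₀ + δ) := by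
    rw [← Filter.EventuallyEq.deriv_eq h5,
      ((hasDerivAt_pow n δ).fun_mul h6.differentiableAt.hasDerivAt).deriv, deriv_comp_const_add]
  rw [h8, ← h5.self_of_nhds]
  rcases n with _ | n
  · simp
  · simp only [Nat.add_sub_cancel]
    ring

section

variable {Q R : ℍ → ℂ} {z₀ : ℂ}

theorem meromorphicAt_coeffTwo (hQ : MeromorphicAt (fun z => Q (ofComplex z)) z₀) :
    MeromorphicAt (coeffTwo Q) z₀ :=
  (MeromorphicAt.const _ _).mul hQ

theorem meromorphicAt_coeffThree (hQ : MeromorphicAt (fun z => Q (ofComplex z)) z₀)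
    (hR : MeromorphicAt (fun z => R (ofComplex z)) z₀) : MeromorphicAt (coeffThree Q R) z₀ :=
  ((MeromorphicAt.const _ _).mul hR).add
    ((MeromorphicAt.const _ _).mul (meromorphicAt_coeffTwo hQ).deriv)

/-- The derivative of a double pole has leading factor -2, so ½Q₂' contributes minus the leading
coefficient of Q₂. -/
theorem tendsto_coeff {a b : ℂ} (hQ : MeromorphicAt (fun z => Q (ofComplex z)) z₀)
    (ha : Tendsto (fun δ => δ ^ 2 * Q (ofComplex (z₀ + δ))) (𝓝[≠] 0) (𝓝 a))
    (hb : Tendsto (fun δ => δ ^ 3 * R (ofComplex (z₀ + δ))) (𝓝[≠] 0) (𝓝 b)) :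
    Tendsto (fun δ => δ ^ 2 * coeffTwo Q (z₀ + δ)) (𝓝[≠] 0)
      (𝓝 ((2 * Real.pi * Complex.I) ^ 2 * a)) ∧
    Tendsto (fun δ => δ ^ 3 * coeffThree Q R (z₀ + δ)) (𝓝[≠] 0)
      (𝓝 ((2 * Real.pi * Complex.I) ^ 3 * b - (2 * Real.pi * Complex.I) ^ 2 * a)) := by
  have h1 : Tendsto (fun δ => δ ^ 2 * coeffTwo Q (z₀ + δ)) (𝓝[≠] 0)
      (𝓝 ((2 * Real.pi * Complex.I) ^ 2 * a)) :=
    (ha.const_mul _).congr fun δ => mul_left_comm _ _ _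
  refine ⟨h1, ?_⟩
  have h2 := (hb.const_mul ((2 * Real.pi * Complex.I) ^ 3)).add
    ((tendsto_deriv_of_tendsto (meromorphicAt_coeffTwo hQ) h1).const_mul (1 / 2))
  refine (h2.congr fun δ => ?_).trans_eq ?_
  · rw [coeffThree]
    ring
  · congr 1
    push_cast
    ring

theorem tendsto_of_coeff {A B : ℂ} (hQ : MeromorphicAt (fun z => Q (ofComplex z)) z₀)
    (hA : Tendsto (fun δ => δ ^ 2 * coeffTwo Q (z₀ + δ)) (𝓝[≠] 0) (𝓝 A))
    (hB : Tendsto (fun δ => δ ^ 3 * coeffThree Q R (z₀ + δ)) (𝓝[≠] 0) (𝓝 B)) :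
    Tendsto (fun δ => δ ^ 2 * Q (ofComplex (z₀ + δ))) (𝓝[≠] 0)
      (𝓝 (A / (2 * Real.pi * Complex.I) ^ 2)) ∧
    Tendsto (fun δ => δ ^ 3 * R (ofComplex (z₀ + δ))) (𝓝[≠] 0)
      (𝓝 ((A + B) / (2 * Real.pi * Complex.I) ^ 3)) := by
  have hτ := Complex.two_pi_I_ne_zero
  constructor
  · refine (hA.div_const _).congr fun δ => ?_
    rw [coeffTwo, mul_left_comm, mul_div_cancel_left₀ _ (pow_ne_zero 2 hτ)]
  · have h2 := ((hB.sub ((tendsto_deriv_of_tendsto (meromorphicAt_coeffTwo hQ) hA).const_mul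
      (1 / 2))).div_const ((2 * Real.pi * Complex.I) ^ 3))
    refine (h2.congr fun δ => ?_).trans_eq ?_
    · rw [div_eq_iff (pow_ne_zero 3 hτ), coeffThree]
      ring
    · congr 1
      push_cast
      ring

theorem tendsto_sub_mul_iff {h : ℂ → ℂ} {n : ℕ} {c : ℂ} :
    Tendsto (fun z => (z - z₀) ^ n * h z) (𝓝[≠] z₀) (𝓝 c) ↔
      Tendsto (fun δ => δ ^ n * h (z₀ + δ)) (𝓝[≠] 0) (𝓝 c) := by
  rw [← tendsto_shift (h := fun z => (z - z₀) ^ n * h z)]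
  simp only [add_sub_cancel_left]

theorem neg_le_meromorphicOrderAt {h : ℂ → ℂ} {n : ℕ} {c : ℂ} (hm : MeromorphicAt h z₀)
    (ht : Tendsto (fun δ => δ ^ n * h (z₀ + δ)) (𝓝[≠] 0) (𝓝 c)) :
    ((-n : ℤ) : WithTop ℤ) ≤ meromorphicOrderAt h z₀ := by
  rw [← tendsto_sub_mul_iff] at ht
  have h1 : MeromorphicAt (fun z => (z - z₀) ^ n) z₀ :=
    (by fun_prop : AnalyticAt ℂ (fun z => (z - z₀) ^ n) z₀).meromorphicAt
  have h2 := (tendsto_nhds_iff_meromorphicOrderAt_nonneg (h1.fun_mul hm)).1 ⟨c, ht⟩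
  have h3 : meromorphicOrderAt (fun z => (z - z₀) ^ n) z₀ = (n : ℤ) := by
    rw [meromorphicOrderAt_eq_int_iff h1]
    exact ⟨fun _ => 1, analyticAt_const, one_ne_zero, by simp⟩
  have h4 := meromorphicOrderAt_mul h1 hm
  change meromorphicOrderAt (fun z => (z - z₀) ^ n * h z) z₀ = _ at h4
  rw [h4, h3] at h2
  cases hq : meromorphicOrderAt h z₀ with
  | top => exact le_top
  | coe q =>
    rw [hq] at h2
    norm_cast at h2 ⊢
    omega

end

theorem HasLocalExponentsAt.tendsto {Q R : ℍ → ℂ} {z₀ : ℂ} {κ : Fin 3 → ℚ}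
    (h : HasLocalExponentsAt (coeffTwo Q) (coeffThree Q R) z₀ κ)
    (hQ : MeromorphicAt (fun z => Q (ofComplex z)) z₀) :
    Tendsto (fun δ => δ ^ 2 * Q (ofComplex (z₀ + δ))) (𝓝[≠] 0)
      (𝓝 ((esymmTwo κ - 2) / (2 * Real.pi * Complex.I) ^ 2)) ∧
    Tendsto (fun δ => δ ^ 3 * R (ofComplex (z₀ + δ))) (𝓝[≠] 0)
      (𝓝 ((esymmTwo κ - 2 - esymmThree κ) / (2 * Real.pi * Complex.I) ^ 3)) := by
  obtain ⟨A, B, hA, hB, h⟩ := h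
  -- The values of the indicial polynomial at 0, 1 and -1 determine A and B.
  have h0 := h 0
  have h1 := h 1
  have h2 := h (-1)
  simp only [Fin.prod_univ_three] at h0 h1 h2
  have eB : B = -esymmThree κ := by rw [esymmThree]; linear_combination h0
  have eA : A = esymmTwo κ - 2 := by
    rw [esymmTwo]
    linear_combination (1 / 2 : ℂ) * (h1 - h2)
  rw [tendsto_sub_mul_iff] at hA hB
  have := tendsto_of_coeff hQ hA hB
  rwa [eA, eB, ← sub_eq_add_neg] at this

theorem hasLocalExponentsAt_of_tendsto {Q R : ℍ → ℂ} {z₀ : ℂ} {κ : Fin 3 → ℚ}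
    (hκ : κ 0 + κ 1 + κ 2 = 3) (hQ : MeromorphicAt (fun z => Q (ofComplex z)) z₀)
    (ha : Tendsto (fun δ => δ ^ 2 * Q (ofComplex (z₀ + δ))) (𝓝[≠] 0)
      (𝓝 ((esymmTwo κ - 2) / (2 * Real.pi * Complex.I) ^ 2)))
    (hb : Tendsto (fun δ => δ ^ 3 * R (ofComplex (z₀ + δ))) (𝓝[≠] 0)
      (𝓝 ((esymmTwo κ - 2 - esymmThree κ) / (2 * Real.pi * Complex.I) ^ 3))) :
    HasLocalExponentsAt (coeffTwo Q) (coeffThree Q R) z₀ κ := by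
  have hτ := Complex.two_pi_I_ne_zero
  have h := tendsto_coeff hQ ha hb
  rw [mul_div_cancel₀ _ (pow_ne_zero 2 hτ), mul_div_cancel₀ _ (pow_ne_zero 3 hτ)] at h
  refine ⟨_, _, tendsto_sub_mul_iff.2 h.1, tendsto_sub_mul_iff.2 h.2, fun x => ?_⟩
  have hs : (κ 0 : ℂ) + κ 1 + κ 2 = 3 := by exact_mod_cast hκ
  simp only [Fin.prod_univ_three, esymmTwo, esymmThree]
  linear_combination x ^ 2 * hs

/-! ### The general form has the prescribed exponents. -/

namespace SingularData

variable {m : ℕ} {D : SingularData m} {Q R : ℍ → ℂ} {v : FreeParam m → ℂ}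

theorem tendsto_forms {κ : Fin 3 → ℚ} {z₀ : ℍ}
    (hP : D.PointType κ (ModularForm.E₄ z₀) (ModularForm.E₆ z₀)) (v : FreeParam m → ℂ) :
    Tendsto (fun δ => δ ^ 2 * D.qForm v (ofComplex (z₀ + δ))) (𝓝[≠] 0)
      (𝓝 ((esymmTwo κ - 2) / (2 * Real.pi * Complex.I) ^ 2)) ∧
    Tendsto (fun δ => δ ^ 3 * D.rForm v (ofComplex (z₀ + δ))) (𝓝[≠] 0)
      (𝓝 ((esymmTwo κ - 2 - esymmThree κ) / (2 * Real.pi * Complex.I) ^ 3)) := by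
  have hP' : D.PointType κ (cE4 (z₀ + 0)) (cE6 (z₀ + 0)) := by
    rwa [add_zero, cE4_coe, cE6_coe]
  exact ⟨PointType.tendsto_qVal (isLocalPair_shift z₀) hP' v,
    PointType.tendsto_rVal (isLocalPair_shift z₀) hP' v⟩

namespace IsGivenBy

theorem tendsto (hG : D.IsGivenBy v Q R) (hD : D.IsAdmissible) {κ : Fin 3 → ℚ} {z₀ : ℍ}
    (hP : D.PointType κ (ModularForm.E₄ z₀) (ModularForm.E₆ z₀)) :
    Tendsto (fun δ => δ ^ 2 * Q (ofComplex (z₀ + δ))) (𝓝[≠] 0)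
      (𝓝 ((esymmTwo κ - 2) / (2 * Real.pi * Complex.I) ^ 2)) ∧
    Tendsto (fun δ => δ ^ 3 * R (ofComplex (z₀ + δ))) (𝓝[≠] 0)
      (𝓝 ((esymmTwo κ - 2 - esymmThree κ) / (2 * Real.pi * Complex.I) ^ 3)) := by
  have h := tendsto_forms hP v
  have hE := hD.eventually_notMem z₀
  constructor
  · refine h.1.congr' ?_
    filter_upwards [hE] with δ ⟨h1, h2⟩
    rw [ofComplex_apply_of_im_pos h1, (hG _ h2).1]
  · refine h.2.congr' ?_
    filter_upwards [hE] with δ ⟨h1, h2⟩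
    rw [ofComplex_apply_of_im_pos h1, (hG _ h2).2]

end IsGivenBy

theorem IsAdmissible.exists_im_gt (hD : D.IsAdmissible) :
    ∃ A : ℝ, ∀ z : ℂ, A < z.im → ∃ w : ℍ, (w : ℂ) = z ∧ w ∉ D.singularSet := by
  obtain ⟨A, hA⟩ := atImInfty_mem _ |>.1 hD.eventually_notMem_atImInfty
  refine ⟨max A 0, fun z hz => ⟨⟨z, (le_max_right _ _).trans_lt hz⟩, rfl, hA _ ?_⟩⟩
  exact ((le_max_left _ _).trans_lt hz).le

/-- The general form has the prescribed exponents. -/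
theorem IsGivenBy.hasPrescribedExponents (hG : D.IsGivenBy v Q R) (hD : D.IsAdmissible)
    (hQ : IsMeromorphicModularForm 4 Q) (hR : IsMeromorphicModularForm 6 R) :
    D.HasPrescribedExponents Q R := by
  have hQm : ∀ z₀ : ℍ, MeromorphicAt (fun z => Q (ofComplex z)) z₀ :=
    fun z₀ => hQ.meromorphic.meromorphicOn z₀ z₀.im_pos
  have hRm : ∀ z₀ : ℍ, MeromorphicAt (fun z => R (ofComplex z)) z₀ :=
    fun z₀ => hR.meromorphic.meromorphicOn z₀ z₀.im_pos
  have hexp : ∀ {κ : Fin 3 → ℚ} {z₀ : ℍ}, κ 0 + κ 1 + κ 2 = 3 →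
      D.PointType κ (ModularForm.E₄ z₀) (ModularForm.E₆ z₀) →
      HasLocalExponentsAt (coeffTwo Q) (coeffThree Q R) z₀ κ := fun hκ hP =>
    hasLocalExponentsAt_of_tendsto hκ (hQm _) (hG.tendsto hD hP).1 (hG.tendsto hD hP).2
  have hτ := Complex.two_pi_I_ne_zero
  have hinf2 : Tendsto (fun z : ℍ => coeffTwo Q z) atImInfty
      (𝓝 ((2 * Real.pi * Complex.I) ^ 2 * D.rInf)) := by
    refine ((hD.tendsto_qForm v).const_mul _).congr' ?_
    filter_upwards [hD.eventually_notMem_atImInfty] with z hz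
    rw [coeffTwo, ofComplex_apply, (hG z hz).1]
  obtain ⟨A, hA⟩ := hD.exists_im_gt
  have hinf3 : Tendsto (fun z : ℍ => coeffThree Q R z) atImInfty
      (𝓝 ((2 * Real.pi * Complex.I) ^ 3 * D.sInf)) := by
    -- The term ½Q₂' tends to 0 at the cusp, so the exponents there depend only on the limits of Q
    -- and R.
    have h1 := tendsto_deriv_atImInfty (g := coeffTwo Q) (A := A) (fun z hz => by
      obtain ⟨w, rfl, hw⟩ := hA z hz
      exact (hG.analyticAt_coeffTwo hD hw).differentiableAt) hinf2
    have h2 := ((hD.tendsto_rForm v).const_mul ((2 * Real.pi * Complex.I) ^ 3)).add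
      (h1.const_mul (1 / 2))
    rw [mul_zero, add_zero] at h2
    refine h2.congr' ?_
    filter_upwards [hD.eventually_notMem_atImInfty] with z hz
    rw [coeffThree, ofComplex_apply, (hG z hz).2]
  have hbd : ∀ {f : ℍ → ℂ} {c : ℂ}, Tendsto f atImInfty (𝓝 c) → IsBoundedAtImInfty f := by
    intro f c h
    rw [IsBoundedAtImInfty, BoundedAtFilter]
    exact (h.isBigO_one ℝ).trans (Asymptotics.isBigO_of_le _ fun _ => by simp)
  refine ⟨fun z => ?_, ⟨hbd hinf2, hbd hinf3⟩,
    fun z hz => ⟨hG.analyticAt_coeffTwo hD hz, hG.analyticAt_coeffThree hD hz⟩,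
    fun j => hexp (hD.expPt j).2.2.1 (hD.pointType_pt j (MulAction.mem_orbit_self _)),
    hexp hD.expI.2.2.1 (IsAdmissible.pointType_I (MulAction.mem_orbit_self _)),
    hexp hD.expRho.2.2.1 (hD.pointType_rho (MulAction.mem_orbit_self _)),
    ⟨_, _, hinf2, hinf3, fun x => ?_⟩⟩
  · obtain ⟨κ, hP⟩ := hD.exists_pointType z
    have h := tendsto_coeff (hQm z) (hG.tendsto hD hP).1 (hG.tendsto hD hP).2
    have h2 := meromorphicAt_coeffTwo (hQm z)
    have h3 := meromorphicAt_coeffThree (hQm z) (hRm z)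
    exact ⟨h2, h3, neg_le_meromorphicOrderAt h2 h.1, neg_le_meromorphicOrderAt h3 h.2⟩
  · have hs : (D.expInf 0 : ℂ) + D.expInf 1 + D.expInf 2 = 0 := by exact_mod_cast hD.expInf.2.2.1
    rw [mul_div_cancel_left₀ _ (pow_ne_zero 2 hτ), mul_div_cancel_left₀ _ (pow_ne_zero 3 hτ)]
    simp only [Fin.prod_univ_three, rInf, sInf, esymmTwo, esymmThree]
    linear_combination x ^ 2 * hs

end SingularData

theorem denom_S_I : denom ModularGroup.S UpperHalfPlane.I = Complex.I := by
  rw [ModularGroup.denom_apply]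
  simp [ModularGroup.S]

namespace SingularData

variable {m : ℕ} {D : SingularData m} {Q R : ℍ → ℂ}

/-! ### Equations with prescribed exponents are of the general form -/

namespace IsForm

variable {V : ℍ → ℂ}

theorem meromorphicAt {k : ℕ} (hV : D.IsForm k V) (z₀ : ℍ) :
    MeromorphicAt (fun z => V (ofComplex z)) z₀ := hV.mero z₀ z₀.im_pos

/-- A pole of order at most one with vanishing residue is removable. -/
theorem exists_tendsto {k : ℕ} (hV : D.IsForm k V) {z₀ : ℍ}
    (h : Tendsto (fun δ => δ ^ 1 * V (ofComplex (z₀ + δ))) (𝓝[≠] 0) (𝓝 0)) :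
    ∃ c, Tendsto (fun δ => V (ofComplex (z₀ + δ))) (𝓝[≠] 0) (𝓝 c) := by
  obtain ⟨c, hc⟩ := exists_tendsto_of_succ (n := 0) (h := fun z => V (ofComplex z))
    (hV.meromorphicAt z₀) h
  exact ⟨c, by simpa using hc⟩

/-- A simple pole in weight 4 at i is excluded because i² ≠ i⁴. -/
theorem tendsto_I_four (hV : D.IsForm 4 V) (hD : D.IsAdmissible)
    (h : Tendsto (fun δ => δ ^ 2 * V (ofComplex (UpperHalfPlane.I + δ))) (𝓝[≠] 0) (𝓝 0)) :
    Tendsto (fun δ => δ ^ 1 * V (ofComplex (UpperHalfPlane.I + δ))) (𝓝[≠] 0) (𝓝 0) := by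
  refine hV.tendsto_of_fixed hD S_smul_I ?_ h
  rw [denom_S_I, mul_one, Complex.I_sq, Complex.I_pow_four]
  norm_num

/-- A double pole in weight 6 at i is excluded because i⁴ ≠ i⁶. A simple pole is allowed, and it
accounts for the parameter s_i^{(1)}. -/
theorem tendsto_I_six (hV : D.IsForm 6 V) (hD : D.IsAdmissible)
    (h : Tendsto (fun δ => δ ^ 3 * V (ofComplex (UpperHalfPlane.I + δ))) (𝓝[≠] 0) (𝓝 0)) :
    Tendsto (fun δ => δ ^ 2 * V (ofComplex (UpperHalfPlane.I + δ))) (𝓝[≠] 0) (𝓝 0) := by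
  refine hV.tendsto_of_fixed hD S_smul_I ?_ h
  rw [denom_S_I, show Complex.I ^ 6 = Complex.I ^ 4 * Complex.I ^ 2 by ring, Complex.I_pow_four,
    Complex.I_sq]
  norm_num

theorem rho_add_one_ne : (rho : ℂ) + 1 ≠ -1 := fun h => by
  have h1 : (rho : ℂ) = -2 := by linear_combination h
  have h2 := rho_sq
  rw [h1] at h2
  norm_num at h2

/-- The factor j = ρ + 1 satisfies j³ = -1 and j ≠ -1, hence j² ≠ j⁴. -/
theorem tendsto_rho_four (hV : D.IsForm 4 V) (hD : D.IsAdmissible)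
    (h : Tendsto (fun δ => δ ^ 2 * V (ofComplex (rho + δ))) (𝓝[≠] 0) (𝓝 0)) :
    Tendsto (fun δ => δ ^ 1 * V (ofComplex (rho + δ))) (𝓝[≠] 0) (𝓝 0) := by
  refine hV.tendsto_of_fixed hD gammaRho_smul ?_ h
  rw [denom_gammaRho]
  intro h1
  have h3 := rho_add_one_pow_three
  apply rho_add_one_ne
  generalize (rho : ℂ) + 1 = j at *
  have hj : j ≠ 0 := by rintro rfl; norm_num at h3
  have h4 : j ^ 2 * (j ^ 2 - 1) = 0 := by linear_combination -h1
  have h5 := (mul_eq_zero.1 h4).resolve_left (pow_ne_zero 2 hj)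
  linear_combination h3 - j * h5

/-- Both j⁴ and j² differ from j⁶ = 1, so the double and the simple pole are excluded and ρ carries
no free parameter. -/
theorem tendsto_rho_six (hV : D.IsForm 6 V) (hD : D.IsAdmissible)
    (h : Tendsto (fun δ => δ ^ 3 * V (ofComplex (rho + δ))) (𝓝[≠] 0) (𝓝 0)) :
    Tendsto (fun δ => δ ^ 1 * V (ofComplex (rho + δ))) (𝓝[≠] 0) (𝓝 0) := by
  have h3 := rho_add_one_pow_three
  have hne := rho_add_one_ne
  refine hV.tendsto_of_fixed hD gammaRho_smul ?_ (hV.tendsto_of_fixed hD gammaRho_smul ?_ h) <;>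
  · rw [denom_gammaRho]
    intro h1
    apply hne
    generalize (rho : ℂ) + 1 = j at *
    first
      | linear_combination h3 - j * (h1 + (j ^ 3 - 1) * h3)
      | linear_combination -(h1 - j * h3 + (j ^ 3 - 1) * h3)

end IsForm

namespace HasPrescribedExponents

theorem isForm_four (H : D.HasPrescribedExponents Q R) (hQ : IsMeromorphicModularForm 4 Q) :
    D.IsForm 4 Q where
  mero := hQ.meromorphic.meromorphicOn
  smul := fun γ z _ => smul_eq_of_slash hQ.slash_eq γ z
  analytic := fun z hz => by
    have hτ := Complex.two_pi_I_ne_zero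
    have h : (fun z => Q (ofComplex z)) =
        fun z => ((2 * Real.pi * Complex.I) ^ 2)⁻¹ * coeffTwo Q z := by
      funext z
      rw [coeffTwo, inv_mul_cancel_left₀ (pow_ne_zero 2 hτ)]
    rw [h]
    exact analyticAt_const.fun_mul (H.regular z hz).1

theorem isForm_six (H : D.HasPrescribedExponents Q R) (hR : IsMeromorphicModularForm 6 R) :
    D.IsForm 6 R where
  mero := hR.meromorphic.meromorphicOn
  smul := fun γ z _ => smul_eq_of_slash hR.slash_eq γ z
  analytic := fun z hz => by
    have hτ := Complex.two_pi_I_ne_zero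
    have h : (fun z => R (ofComplex z)) = fun z => ((2 * Real.pi * Complex.I) ^ 3)⁻¹
        * (coeffThree Q R z - 1 / 2 * deriv (coeffTwo Q) z) := by
      funext z
      rw [coeffThree, add_sub_cancel_right, inv_mul_cancel_left₀ (pow_ne_zero 3 hτ)]
    rw [h]
    exact analyticAt_const.fun_mul ((H.regular z hz).2.fun_sub
      (analyticAt_const.fun_mul (H.regular z hz).1.deriv))

theorem tendsto_atImInfty (H : D.HasPrescribedExponents Q R) (hD : D.IsAdmissible) :
    Tendsto Q atImInfty (𝓝 D.rInf) ∧ Tendsto R atImInfty (𝓝 D.sInf) := by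
  have hτ := Complex.two_pi_I_ne_zero
  obtain ⟨A, B, hA, hB, h⟩ := H.exponents_infty
  have h0 := h 0
  have h1 := h 1
  have h2 := h (-1)
  simp only [Fin.prod_univ_three] at h0 h1 h2
  have eB : B / (2 * Real.pi * Complex.I) ^ 3 = D.sInf := by
    rw [sInf, esymmThree]
    linear_combination h0
  have eA : A / (2 * Real.pi * Complex.I) ^ 2 = D.rInf := by
    rw [rInf, esymmTwo]
    linear_combination (1 / 2 : ℂ) * (h1 - h2)
  obtain ⟨a, ha⟩ := hD.exists_im_gt
  have hd := tendsto_deriv_atImInfty (g := coeffTwo Q) (A := a) (fun z hz => by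
    obtain ⟨w, rfl, hw⟩ := ha z hz
    exact (H.regular w hw).1.differentiableAt) hA
  constructor
  · rw [← eA]
    refine (hA.div_const _).congr fun z => ?_
    rw [coeffTwo, ofComplex_apply, mul_div_cancel_left₀ _ (pow_ne_zero 2 hτ)]
  · rw [← eB]
    have h3 := (hB.sub (hd.const_mul (1 / 2))).div_const ((2 * Real.pi * Complex.I) ^ 3)
    rw [mul_zero, sub_zero] at h3
    refine h3.congr fun z => ?_
    rw [coeffThree, add_sub_cancel_right, ofComplex_apply,
      mul_div_cancel_left₀ _ (pow_ne_zero 3 hτ)]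

theorem tendsto_sub (H : D.HasPrescribedExponents Q R) (hD : D.IsAdmissible)
    (hQ : IsMeromorphicModularForm 4 Q) (v : FreeParam m → ℂ) {z₀ : ℍ}
    (hz : z₀ = UpperHalfPlane.I ∨ z₀ = rho ∨ ∃ j, z₀ = D.pt j) :
    Tendsto (fun δ => δ ^ 2 * (Q (ofComplex (z₀ + δ)) - D.qForm v (ofComplex (z₀ + δ)))) (𝓝[≠] 0)
      (𝓝 0) ∧
    Tendsto (fun δ => δ ^ 3 * (R (ofComplex (z₀ + δ)) - D.rForm v (ofComplex (z₀ + δ)))) (𝓝[≠] 0)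
      (𝓝 0) := by
  have key : ∀ {κ}, D.PointType κ (ModularForm.E₄ z₀) (ModularForm.E₆ z₀) →
      HasLocalExponentsAt (coeffTwo Q) (coeffThree Q R) z₀ κ → _ := fun hP he => by
    have h1 := tendsto_forms hP v
    have h2 := he.tendsto (hQ.meromorphic.meromorphicOn z₀ z₀.im_pos)
    have h3 := h2.1.sub h1.1
    have h4 := h2.2.sub h1.2
    simp only [sub_self, ← mul_sub] at h3 h4
    exact And.intro h3 h4
  rcases hz with rfl | rfl | ⟨j, rfl⟩
  · exact key (IsAdmissible.pointType_I (MulAction.mem_orbit_self _)) H.exponents_I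
  · exact key (hD.pointType_rho (MulAction.mem_orbit_self _)) H.exponents_rho
  · exact key (hD.pointType_pt j (MulAction.mem_orbit_self _)) (H.exponents_pt j)

/-- The prescribed exponents remove the double poles of the difference with the general form, the
stabilisers remove simple poles at i and ρ, and r_j is the residue at z_j of the difference with
zero parameters, suitably normalised. The remaining holomorphic form of weight 4 vanishes at the
cusp. -/
theorem exists_qForm (H : D.HasPrescribedExponents Q R) (hD : D.IsAdmissible)
    (hQ : IsMeromorphicModularForm 4 Q) : ∃ r : Fin m → ℂ, ∀ v : FreeParam m → ℂ,
      (∀ j, v (.r1 j) = r j) → ∀ z ∉ D.singularSet, Q z = D.qForm v z := by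
  have hτ := Complex.two_pi_I_ne_zero
  have hF := fun v => (H.isForm_four hQ).sub (hD.isForm_qForm v)
  have hK : ∀ j, ModularForm.E₆ (D.pt j)
      / (2 * Real.pi * Complex.I * ModularForm.E₄ (D.pt j)) ≠ 0 := fun j =>
    div_ne_zero (hD.E6_pt_ne j) (mul_ne_zero hτ (hD.E4_pt_ne j))
  have h1 := fun j => exists_tendsto_of_succ ((hF 0).meromorphicAt (D.pt j))
    (H.tendsto_sub hD hQ 0 (.inr (.inr ⟨j, rfl⟩))).1
  choose c hc using h1
  refine ⟨fun j => c j / (ModularForm.E₆ (D.pt j)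
    / (2 * Real.pi * Complex.I * ModularForm.E₄ (D.pt j))), fun v hv z hz => sub_eq_zero.1 ?_⟩
  refine (hF v).eq_zero hD (by norm_num) ?_ hD.eventually_notMem_atImInfty ?_ z hz
  · simpa using (H.tendsto_atImInfty hD).1.sub (hD.tendsto_qForm v)
  rintro z₀ (rfl | rfl | ⟨j, rfl⟩)
  · exact (hF v).exists_tendsto
      ((hF v).tendsto_I_four hD (H.tendsto_sub hD hQ v (.inl rfl)).1)
  · exact (hF v).exists_tendsto
      ((hF v).tendsto_rho_four hD (H.tendsto_sub hD hQ v (.inr (.inl rfl))).1)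
  · refine (hF v).exists_tendsto ?_
    have h2 := (hc j).sub (hD.tendsto_qForm_sub v 0 j)
    rw [hv j, Pi.zero_apply, sub_zero, div_mul_cancel₀ _ (hK j), sub_self] at h2
    exact h2.congr fun δ => by ring

/-- The same argument in weight 6, with two rounds at z_j: s^{(2)} cancels the double pole and
s^{(1)} the residue that is left. At i the one admissible simple pole is cancelled by s_i^{(1)}. -/
theorem exists_rForm (H : D.HasPrescribedExponents Q R) (hD : D.IsAdmissible)
    (hQ : IsMeromorphicModularForm 4 Q) (hR : IsMeromorphicModularForm 6 R) :
    ∃ (s s' : Fin m → ℂ) (c : ℂ), ∀ v : FreeParam m → ℂ,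
      (∀ j, v (.s2 j) = s j) → (∀ j, v (.s1 j) = s' j) → v .sI = c →
        ∀ z ∉ D.singularSet, R z = D.rForm v z := by
  have hτ := Complex.two_pi_I_ne_zero
  have hF := fun v => (H.isForm_six hR).sub (hD.isForm_rForm v)
  have hK : ∀ j, ModularForm.E₆ (D.pt j)
      / (2 * Real.pi * Complex.I * ModularForm.E₄ (D.pt j) ^ 2) ≠ 0 := fun j =>
    div_ne_zero (hD.E6_pt_ne j) (mul_ne_zero hτ (pow_ne_zero 2 (hD.E4_pt_ne j)))
  have hK1 := fun j => mul_ne_zero (hD.E6_pt_ne j) (hK j)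
  have hK2 := fun j => mul_ne_zero (hD.E6_pt_ne j) (pow_ne_zero 2 (hK j))
  have hK3 : -2 * ModularForm.E₄ UpperHalfPlane.I / (2 * Real.pi * Complex.I) ≠ 0 :=
    div_ne_zero (mul_ne_zero (by norm_num) E4_I_ne) hτ
  have h1 := fun j => exists_tendsto_of_succ ((hF 0).meromorphicAt (D.pt j))
    (H.tendsto_sub hD hQ 0 (.inr (.inr ⟨j, rfl⟩))).2
  choose c hc using h1
  have h2 : ∀ (v : FreeParam m → ℂ) (j : Fin m), v (.s2 j) = c j / (ModularForm.E₆ (D.pt j) * (ModularForm.E₆ (D.pt j)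
      / (2 * Real.pi * Complex.I * ModularForm.E₄ (D.pt j) ^ 2)) ^ 2) →
      Tendsto (fun δ => δ ^ 2 * (R (ofComplex (D.pt j + δ)) - D.rForm v (ofComplex (D.pt j + δ))))
        (𝓝[≠] 0) (𝓝 0) := by
    intro v j hv
    have h3 := (hc j).sub (hD.tendsto_rForm_sub_sq v 0 j)
    rw [hv, Pi.zero_apply, sub_zero, div_mul_cancel₀ _ (hK2 j), sub_self] at h3
    exact h3.congr fun δ => by ring
  -- The residues at z_j make sense only after the double poles are gone, so they are measured
  -- against parameters w that have the right s^{(2)} and are zero in the other entries.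
  obtain ⟨w, hw, hw1, hwI⟩ : ∃ w : FreeParam m → ℂ, (∀ j, w (.s2 j) = c j / (ModularForm.E₆ (D.pt j) * (ModularForm.E₆ (D.pt j)
      / (2 * Real.pi * Complex.I * ModularForm.E₄ (D.pt j) ^ 2)) ^ 2)) ∧
      (∀ j, w (.s1 j) = 0) ∧ w .sI = 0 :=
    ⟨fun p => match p with | .s2 j => c j / (ModularForm.E₆ (D.pt j) * (ModularForm.E₆ (D.pt j)
      / (2 * Real.pi * Complex.I * ModularForm.E₄ (D.pt j) ^ 2)) ^ 2) | _ => 0, fun _ => rfl, fun _ => rfl, rfl⟩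
  have h3 := fun j => exists_tendsto_of_succ ((hF w).meromorphicAt (D.pt j)) (h2 w j (hw j))
  choose c' hc' using h3
  obtain ⟨b, hb⟩ := exists_tendsto_of_succ ((hF w).meromorphicAt UpperHalfPlane.I)
    ((hF w).tendsto_I_six hD (H.tendsto_sub hD hQ w (.inl rfl)).2)
  refine ⟨fun j => c j / (ModularForm.E₆ (D.pt j) * (ModularForm.E₆ (D.pt j)
      / (2 * Real.pi * Complex.I * ModularForm.E₄ (D.pt j) ^ 2)) ^ 2), fun j => c' j / (ModularForm.E₆ (D.pt j) * (ModularForm.E₆ (D.pt j)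
      / (2 * Real.pi * Complex.I * ModularForm.E₄ (D.pt j) ^ 2))), b / (-2 * ModularForm.E₄ UpperHalfPlane.I / (2 * Real.pi * Complex.I)), fun v hv hv1 hvI z hz => sub_eq_zero.1 ?_⟩
  refine (hF v).eq_zero hD (by norm_num) ?_ hD.eventually_notMem_atImInfty ?_ z hz
  · simpa using (H.tendsto_atImInfty hD).2.sub (hD.tendsto_rForm v)
  rintro z₀ (rfl | rfl | ⟨j, rfl⟩)
  · refine (hF v).exists_tendsto ?_
    have h4 := hb.sub (tendsto_rForm_sub_I (D := D) v w)
    rw [hvI, hwI, sub_zero, div_mul_cancel₀ _ hK3, sub_self] at h4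
    exact h4.congr fun δ => by ring
  · exact (hF v).exists_tendsto
      ((hF v).tendsto_rho_six hD (H.tendsto_sub hD hQ v (.inr (.inl rfl))).2)
  · refine (hF v).exists_tendsto ?_
    have h4 := (hc' j).sub (hD.tendsto_rForm_sub v w (fun l => (hv l).trans (hw l).symm) j)
    rw [hv1 j, hw1 j, sub_zero, div_mul_cancel₀ _ (hK1 j), sub_self] at h4
    exact h4.congr fun δ => by ring

theorem exists_isGivenBy (H : D.HasPrescribedExponents Q R) (hD : D.IsAdmissible)
    (hQ : IsMeromorphicModularForm 4 Q) (hR : IsMeromorphicModularForm 6 R) :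
    ∃ v : FreeParam m → ℂ, D.IsGivenBy v Q R := by
  obtain ⟨r, hr⟩ := H.exists_qForm hD hQ
  obtain ⟨s, s', c, hs⟩ := H.exists_rForm hD hQ hR
  let v : FreeParam m → ℂ := fun p => match p with
    | .r1 j => r j
    | .s2 j => s j
    | .s1 j => s' j
    | .sI => c
  exact ⟨v, fun z hz => ⟨hr v (fun _ => rfl) z hz,
    hs v (fun _ => rfl) (fun _ => rfl) rfl z hz⟩⟩

end HasPrescribedExponents

theorem IsAdmissible.hasPrescribedExponents_iff (hD : D.IsAdmissible)
    (hQ : IsMeromorphicModularForm 4 Q) (hR : IsMeromorphicModularForm 6 R) :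
    D.HasPrescribedExponents Q R ↔ ∃! v : FreeParam m → ℂ, D.IsGivenBy v Q R := by
  constructor
  · intro H
    obtain ⟨v, hv⟩ := H.exists_isGivenBy hD hQ hR
    exact ⟨v, hv, fun w hw => hw.unique hv hD⟩
  · rintro ⟨v, hv, -⟩
    exact hv.hasPrescribedExponents hD hQ hR

end SingularData

/-! ### Counting parameters and equations -/

/-- The free parameters as a sum of index types. -/
def freeParamEquiv (m : ℕ) : FreeParam m ≃ Option (Fin m × Fin 3) where
  toFun
    | .r1 j => some (j, 0)
    | .s2 j => some (j, 1)
    | .s1 j => some (j, 2)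
    | .sI => none
  invFun
    | some (j, 0) => .r1 j
    | some (j, 1) => .s2 j
    | some (j, 2) => .s1 j
    | none => .sI
  left_inv p := by cases p <;> rfl
  right_inv p := by
    rcases p with _ | ⟨j, k⟩
    · rfl
    · fin_cases k <;> rfl

/-- The equations as a sum of index types. -/
def equationIndexEquiv (m : ℕ) : EquationIndex m ≃ Option (Fin m × ExponentPair) where
  toFun
    | .atPt j p => some (j, p)
    | .atI => none
  invFun
    | some (j, p) => .atPt j p
    | none => .atI
  left_inv p := by cases p <;> rfl
  right_inv p := by rcases p with _ | ⟨j, k⟩ <;> rfl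

theorem card_freeParam (m : ℕ) : Nat.card (FreeParam m) = 3 * m + 1 := by
  rw [Nat.card_congr (freeParamEquiv m), Nat.card_eq_fintype_card]
  simp [mul_comm]

theorem card_equationIndex (m : ℕ) : Nat.card (EquationIndex m) = 3 * m + 1 := by
  rw [Nat.card_congr (equationIndexEquiv m), Nat.card_eq_fintype_card, Fintype.card_option,
    Fintype.card_prod, Fintype.card_fin, show Fintype.card ExponentPair = 3 by decide, mul_comm]

end ModularODE

end

/-! ### The main theorem. -/

open ModularODE in
theorem mainTheorem8 (m : ℕ) (D : SingularData m) (hD : D.IsAdmissible) :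
    -- the number of free parameters and the number of equations are both `3m + 1`
    Nat.card (FreeParam m) = 3 * m + 1 ∧ Nat.card (EquationIndex m) = 3 * m + 1 ∧
    -- every choice of the parameters gives meromorphic modular forms `Q`, `R`
    (∀ v : FreeParam m → ℂ, ∃ Q R : ℍ → ℂ,
      IsMeromorphicModularForm 4 Q ∧ IsMeromorphicModularForm 6 R ∧ D.IsGivenBy v Q R) ∧
    -- the pairs with prescribed singular points and exponents are exactly those so obtained
    (∀ Q R : ℍ → ℂ, IsMeromorphicModularForm 4 Q → IsMeromorphicModularForm 6 R →
      (D.HasPrescribedExponents Q R ↔ ∃! v : FreeParam m → ℂ, D.IsGivenBy v Q R)) ∧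
    -- the polynomials at `ρ` vanish identically
    (∀ p : ExponentPair, D.polyRho p = 0) ∧
    -- `p₀` is the unique pair with even exponent difference at `i`
    ∃ p₀ : ExponentPair, (∃ n : ℤ, expDiff D.expI p₀ = 2 * n) ∧
      (∀ p : ExponentPair, p ≠ p₀ → (¬ ∃ n : ℤ, expDiff D.expI p = 2 * n) ∧ D.polyI p = 0) ∧
      -- apparentness throughout the upper half-plane is equivalent to the polynomial system
      (∀ (Q R : ℍ → ℂ) (v : FreeParam m → ℂ),
        IsMeromorphicModularForm 4 Q → IsMeromorphicModularForm 6 R → D.IsGivenBy v Q R →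
        ((∀ z : ℍ, IsApparentAt (coeffTwo Q) (coeffThree Q R) z) ↔
          ∀ e : EquationIndex m, MvPolynomial.eval v (D.system p₀ e) = 0)) ∧
      -- degrees and leading terms at the points `z_j`
      (∀ j : Fin m,
        ((D.system p₀ (.atPt j pair12)).totalDegree : ℚ) = expDiff (D.expPt j) pair12 ∧
        ((D.system p₀ (.atPt j pair23)).totalDegree : ℚ) = expDiff (D.expPt j) pair23 ∧
        ((D.system p₀ (.atPt j pair13)).totalDegree : ℚ) = expDiff (D.expPt j) pair13 - 1 ∧
        ∃ (d₁ d₂ d₃ d₄ : ℂ) (d' : Fin m → ℂ), d₁ ≠ 0 ∧ d₂ ≠ 0 ∧ d₃ ≠ 0 ∧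
          (∃ c : ℂ, c ≠ 0 ∧ leadingTerm (D.system p₀ (.atPt j pair12)) =
            MvPolynomial.C c * ∏ k ∈ Finset.Icc 1 ⌊expDiff (D.expPt j) pair12⌋₊,
              linearFactor j (D.expPt j 0) d₁ d₂ k) ∧
          (∃ c : ℂ, c ≠ 0 ∧ leadingTerm (D.system p₀ (.atPt j pair23)) =
            MvPolynomial.C c * ∏ k ∈ Finset.Icc 1 ⌊expDiff (D.expPt j) pair23⌋₊,
              linearFactor j (D.expPt j 1) d₁ d₂ k) ∧
          (∃ c : ℂ, c ≠ 0 ∧ leadingTerm (D.system p₀ (.atPt j pair13)) =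
            MvPolynomial.C c *
              (MvPolynomial.C d₃ * MvPolynomial.X (.s1 j)
                + MvPolynomial.C d₄ * MvPolynomial.X (.s2 j)
                + ∑ l, MvPolynomial.C (d' l) * MvPolynomial.X (.r1 l)) *
              ∏ k ∈ Finset.Icc 1 ⌊expDiff (D.expPt j) pair13⌋₊ \
                  {⌊expDiff (D.expPt j) pair12⌋₊, ⌊expDiff (D.expPt j) pair12⌋₊ + 1},
                linearFactor j (D.expPt j 0) d₁ d₂ k)) ∧
      -- degree and leading term at `i`
      ((D.system p₀ .atI).totalDegree : ℚ) = expDiff D.expI p₀ / 2 ∧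
      ∃ (d : Fin (D.system p₀ .atI).totalDegree → ℂ)
        (d' : Fin (D.system p₀ .atI).totalDegree → Fin m → ℂ), (∀ l, d l ≠ 0) ∧
        leadingTerm (D.system p₀ .atI) =
          ∏ l, (MvPolynomial.C (d l) * MvPolynomial.X .sI
            + ∑ j, MvPolynomial.C (d' l j) * MvPolynomial.X (.r1 j)) := by
  obtain ⟨p₀, hp₀, huniq⟩ := hD.exists_pair
  exact ⟨card_freeParam m, card_equationIndex m, hD.exists_isGivenBy,
    fun Q R hQ hR => hD.hasPrescribedExponents_iff hQ hR, hD.polyRho_eq_zero, p₀, hp₀, huniq,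
    fun Q R v hQ hR hG => hD.forall_isApparentAt_iff (fun p hp => (huniq p hp).2) hQ hR hG,
    hD.leadingTerm_pt, hD.leadingTerm_I hp₀ fun p hp => (huniq p hp).1⟩
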